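/- **Parameters and notation.** Fix $\log q_1,\log q_2,\log q_3\in\mathbb C$ with sum $0$, put $q_i^{\alpha}=e^{\alpha\log q_i}$, and assume $q_1^aq_2^b=1$ ($a,b\in\mathbb Z$) only for $a=b=0$. Let $s_i=q_i^{1/2}$, $\beta=-\log q_3/\log q_1$, $c_1=-(s_2-s_2^{-1})(s_3-s_3^{-1})$, $\kappa_r=\prod_i(1-q_i^r)$, $g(z,w)=\prod_i(z-q_iw)$, $\delta(x)=\sum_{k\in\mathbb Z}x^k$, $\omega(x)=\frac{(1-q_2x)(1-q_3x)}{(1-x)(1-q_2q_3x)}$, and let $\omega^\pm$ be its expansions at $x^{\pm1}=0$. Currents are written $a(z)=\sum_{k\in\mathbb Z}a_kz^{-k}$. **$\mathcal E_1$.** The quantum toroidal $\mathfrak{gl}_1$ algebra $\mathcal E_1(q_1,q_2,q_3)$ has generators $e_j,f_j,h_r$ ($j\in\mathbb Z$, $r\in\mathbb Z\setminus\{0\}$) and invertible central elements $C,\psi_0$. With $\psi^\pm(z)=\psi_0^{\pm1}\exp(\sum_{r\ge1}\kappa_rh_{\pm r}z^{\mp r})$, its relations are $$[h_r,h_t]=\delta_{r+t,0}\tfrac1r\tfrac{C^r-C^{-r}}{\kappa_r},$$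 $$g(C^{(1\pm1)/2}z,w)\psi^\pm(z)e(w)+g(w,C^{(1\pm1)/2}z)e(w)\psi^\pm(z)=0,$$ $$g(w,C^{(1\mp1)/2}z)\psi^\pm(z)f(w)+g(C^{(1\mp1)/2}z,w)f(w)\psi^\pm(z)=0,$$ $$[e(z),f(w)]=\tfrac1{\kappa_1}\bigl(\delta(Cw/z)\psi^+(w)-\delta(Cz/w)\psi^-(z)\bigr),$$ $$g(z,w)e(z)e(w)+g(w,z)e(w)e(z)=0,\qquad g(w,z)f(z)f(w)+g(z,w)f(w)f(z)=0,$$ and $\mathrm{Sym}_{z_1,z_2,z_3}z_1z_2^2[x(z_1),[x(z_2),x(z_3)]]=0$ for $x=e,f$. Adjoin a central invertible $K$ and let $$k_0^\pm(z)=K^{\pm1}\exp\Bigl(\sum_{r\ge1}\tfrac{\kappa_r}{q_1^{\mp r}-1}h_{\pm r}z^{\mp r}\Bigr),$$ $$k_r^+(z)=(-c_1)^rf(q_1^{r-1}z)\cdots f(z)\,k_0^+(z),\qquad k_r^-(z)=c_1^r\,k_0^-(z)\,e(z)\cdots e(q_1^{r-1}z).$$ The products of $e$'s and of $f$'s here are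 fused currents: multiply $a(z)b(w)$ by the polynomial occurring in its exchange relation, set $w=tz$, and divide by the value of the polynomial. A check denotes the same objects for $\check q_1=q_1^{-1}$, $\check q_2=q_2q_1$, $\check q_3=q_3q_1$ (with $\log\check q_i$ given by the corresponding sums of $\log q_j$, $\check s_i=\check q_i^{1/2}$, $\check\beta=-\log\check q_3/\log\check q_1$). **$\hat{\mathcal A}_{0,0}$.** It is generated by $\mathcal E_1[K]$, $\check{\mathcal E}_1[\check K]$, which commute with each other and satisfy $\psi_0=\check\psi_0$, $C=\check C$, and by the coefficients of currents $X_i^\pm(z)$, $i\in\mathbb Z$, which commute with $C$, subject to (R1)-(R3). (R1) $KX_i^\pm K^{-1}=q_2^{\pm\beta/2}X_i^\pm$, $\check KX^\pm_i\check K^{-1}=\check q_2^{\pm\check\beta/2}X^\pm_i$, and $$\psi^\pm(u)X_i^+(z)\psi^\pm(u)^{-1}=\omega^\pm\bigl(z/(C^{(1\pm1)/2}u)\bigr)X_i^+(z),\qquad \psi^\pm(u)^{-1}X_i^-(z)\psi^\pm(u)=\omega^\pm\bigl(z/(C^{(1\mp1)/2}u)\bigr)X_i^-(z),$$ $$e(u)X_i^+(z)-\omega^-(z/u)X_i^+(z)e(u)=\tfrac1{s_1^{-1}-s_1}\delta(z/u)X^+_{i-1}(q_1z),$$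 $$[f(u),X_i^+(z)]=\tfrac1{s_1^{-1}-s_1}\delta\bigl(q_1^{-1}z/(Cu)\bigr)X^+_{i+1}(q_1^{-1}z)\psi^+(u),$$ $$[X_i^-(z),e(u)]=\tfrac1{s_1^{-1}-s_1}\delta\bigl(z/(Cq_1u)\bigr)\psi^-(u)X^-_{i-1}(q_1^{-1}z),$$ $$X_i^-(z)f(u)-\omega^+(z/u)f(u)X_i^-(z)=\tfrac1{s_1^{-1}-s_1}\delta(z/u)X^-_{i+1}(q_1z);$$ the same relations hold with checks on $\psi^\pm,e,f,C,\omega,s_1$ and on $q_1$ inside the $\delta$'s, with $z$ replaced by $q_1^{\pm i}z$ in the arguments of $\check\omega^\pm$ and $\delta$ in the relations for $X_i^\pm(z)$, and with $X^\pm_{i-1}(z),X^\pm_{i+1}(z)$ (unshifted argument) on the right hand sides. (R2) With $d=j-i$: $X_i^\pm(z)X_i^\pm(w)=-X_i^\pm(w)X_i^\pm(z)$, and for $d\ge1$ $$\gamma_d(z,w)X_i^+(z)X_j^+(w)=(-1)^{d+1}\gamma_d'(w,z)X_j^+(w)X_i^+(z),\quad \gamma_d(w,z)X_i^-(z)X_j^-(w)=(-1)^{d+1}\gamma_d'(z,w)X_j^-(w)X_i^-(z),$$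 $$\gamma_d(z,w)=\prod_{r=1}^{d-1}(z-q_1^rw),\qquad \gamma_d'(w,z)=-q_1^{d(d-1)/2}\,\frac{\prod_{r=0}^{d-1}(w-q_2q_1^{-r}z)(w-q_3q_1^{-r}z)}{\prod_{r=0}^{d}(w-q_1^{-r}z)},$$ where the right hand coefficients are expanded in $|z/w|\ll1$. (R3) $$X_i^+(z)X_j^-(w)+X_j^-(w)X_i^+(z)=\psi_0^{-i}\sum_{r+\check r=i+j}\delta\Bigl(\frac{Cw}{q_1^rz}\Bigr)k_r^+(q_1^{-r}w)\check k^+_{\check r}(\check q_1^{-\check r}q_1^{-j}w)-\psi_0^{-j}\sum_{r+\check r=-i-j}\delta\Bigl(\frac{Cz}{q_1^rw}\Bigr)k_r^-(q_1^{-r}z)\check k^-_{\check r}(\check q_1^{-\check r}q_1^{i}z),$$ with $r,\check r\ge0$. These relations involve infinite sums, which are understood on admissible representations: $\mathbb Z^2$-graded spaces $W=\bigoplus W_{d,\alpha}$ with $\dim W_{d,\alpha}<\infty$ and, for each $\alpha$, $W_{d,\alpha}=0$ for $d\gg0$, where $e_j,f_j,\check e_j,\check f_j$ have bidegree $(j,0)$,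 $h_r,\check h_r$ bidegree $(r,0)$, $X^\pm_{i,k}$ bidegree $(k,\pm1)$, and $C,\psi_0,K,\check C,\check\psi_0,\check K$ bidegree $(0,0)$. Accordingly $\hat{\mathcal A}_{0,0}$ is the completion, in the topology of pointwise convergence on admissible representations, of the algebra of operators on these representations generated by the generators above and the inverses of the invertible ones. **$\mathcal E_{1|1}[K]$.** For parameters $\bar q_1,\bar q_2$ with $\bar s_2=\bar q_2^{1/2}$ let $g_{0,0}=g_{1,1}=1$, $g_{0,1}(z,w)=(z-\bar q_1w)(z-\bar q_1^{-1}w)$, $g_{1,0}(z,w)=(w-\bar q_2z)(w-\bar q_2^{-1}z)$. The algebra is generated by $E_{i,k},F_{i,k},H_{i,r}$ ($i\in\mathbb Z/2$, $k\in\mathbb Z$, $r\in\mathbb Z\setminus\{0\}$) and invertible $\Psi_{i,0}$, $C$, $K$, with $C$ central. With $\Psi_i^\pm(z)=\Psi_{i,0}^{\pm1}\exp(\pm(\bar s_2-\bar s_2^{-1})\sum_{r\ge1}H_{i,\pm r}z^{\mp r})$, its relations are $$[\Psi_i^\pm(z),\Psi_j^\pm(w)]=0,\qquad \tfrac{g_{i,j}(z,C^{-1}w)}{g_{i,j}(z,Cw)}\Psi_i^+(z)\Psi_j^-(w)=\tfrac{g_{j,i}(C^{-1}w,z)}{g_{j,i}(Cw,z)}\Psi_j^-(w)\Psi_i^+(z),$$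 $$g_{i,j}(C^{(1\pm1)/2}z,w)\Psi_i^\pm(z)E_j(w)=g_{j,i}(w,C^{(1\pm1)/2}z)E_j(w)\Psi_i^\pm(z),$$ $$g_{j,i}(w,C^{(1\mp1)/2}z)\Psi_i^\pm(z)F_j(w)=g_{i,j}(C^{(1\mp1)/2}z,w)F_j(w)\Psi_i^\pm(z),$$ $$g_{i,j}(z,w)E_i(z)E_j(w)+g_{j,i}(w,z)E_j(w)E_i(z)=0,\qquad g_{j,i}(w,z)F_i(z)F_j(w)+g_{i,j}(z,w)F_j(w)F_i(z)=0,$$ $$E_i(z)F_j(w)+F_j(w)E_i(z)=-\delta_{i,j}\bigl(\delta(Cw/z)\Psi_i^+(w)-\delta(Cz/w)\Psi_i^-(z)\bigr),$$ $$KE_0K^{-1}=q_2^{-\beta/2}E_0,\quad KF_0K^{-1}=q_2^{\beta/2}F_0,\quad KE_1K^{-1}=q_2^{\beta/2}E_1,\quad KF_1K^{-1}=q_2^{-\beta/2}F_1,\quad K\Psi_i^\pm=\Psi_i^\pm K.$$ The rational functions are expanded in $|w/z|\ll1$. **Proposition.** Let $\bar q_1=q_1^{1/2}$ and $\bar q_2=q_1^{1/2}q_2$,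 with any choice of $\bar s_2$. Then there is a homomorphism of unital algebras $\mathcal E_{1|1}[K]\to\hat{\mathcal A}_{0,0}$ with $C\mapsto C$, $K\mapsto K$ and $$\Psi_1^\pm(z)\mapsto k_0^\pm(z)\check k_0^\pm(z),\qquad \Psi_0^\pm(\bar q_1z)\mapsto\psi_0^{\pm1}\bigl(k_0^\pm(z)\check k_0^\pm(q_1z)\bigr)^{-1},$$ $$E_1(z)\mapsto X_0^+(z),\qquad E_0(\bar q_1z)\mapsto\psi_0^{-1}\bigl(k_0^-(z)\check k_0^-(q_1z)\bigr)^{-1}X_{-1}^-(Cz),$$ $$F_1(z)\mapsto -X_0^-(z),\qquad F_0(\bar q_1z)\mapsto X_1^+(Cz)\,\psi_0\bigl(k_0^+(z)\check k_0^+(q_1z)\bigr)^{-1}.$$ -/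

import Mathlib

namespace QTor

noncomputable section

/-! ### Formal series with coefficients in an algebra

A current `a(z) = ∑_{k ∈ ℤ} a_k z^{-k}` is its coefficient function `k ↦ a_k`.
A formal distribution `∑ D_{m,n} z^{-m} w^{-n}` in two variables is `m ↦ n ↦ D_{m,n}`. -/

section Series

variable {R : Type*} [Ring R] [Algebra ℂ R]

/-- `exp (∑_{r ≥ 1} a_r x^r)` for a power series without constant term, coefficients in `R`. -/
def expSeries (a : PowerSeries R) : PowerSeries R :=
  PowerSeries.mk fun k =>
    ∑ n ∈ Finset.range (k + 1), ((n.factorial : ℂ)⁻¹) • PowerSeries.coeff k (a ^ n)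

/-- The power series `c(t x)`. -/
def scalePS (t : ℂ) (c : PowerSeries R) : PowerSeries R :=
  PowerSeries.mk fun n => t ^ n • PowerSeries.coeff n c

/-- A power series in `z⁻¹` as a current. -/
def posCurrent (c : PowerSeries R) : ℤ → R :=
  fun k => if 0 ≤ k then PowerSeries.coeff k.toNat c else 0

/-- A power series in `z` as a current. -/
def negCurrent (c : PowerSeries R) : ℤ → R :=
  fun k => if k ≤ 0 then PowerSeries.coeff (-k).toNat c else 0

/-- The current `a(t z)`. -/
def scale (t : ℂ) (a : ℤ → R) : ℤ → R := fun k => t ^ (-k) • a k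

/-- The distribution `(a z + b w) D(z,w)`, with `a`, `b` multiplying from the left. -/
def mulLinear (a b : R) (D : ℤ → ℤ → R) : ℤ → ℤ → R :=
  fun m n => a * D (m + 1) n + b * D m (n + 1)

/-- A list `l` of pairs `(α, β)` stands for the polynomial `P(x,y) = ∏ (α x + β y)`;
this is the distribution `P(a z, b w) D(z,w)` (for central `a`, `b`). -/
def mulForms (l : List (ℂ × ℂ)) (a b : R) (D : ℤ → ℤ → R) : ℤ → ℤ → R :=
  l.foldr (fun p D' => mulLinear (p.1 • a) (p.2 • b) D') D

/-- The list that stands for `P(y,x)`. -/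
def swapForms (l : List (ℂ × ℂ)) : List (ℂ × ℂ) := l.map Prod.swap

/-- The value `P(x,y)`. -/
def evalForms (l : List (ℂ × ℂ)) (x y : ℂ) : ℂ := (l.map fun p => p.1 * x + p.2 * y).prod

/-- The distribution `a(z) b(w)`. -/
def prodZW (a b : ℤ → R) : ℤ → ℤ → R := fun m n => a m * b n

/-- The distribution `b(w) a(z)`. -/
def prodWZ (b a : ℤ → R) : ℤ → ℤ → R := fun m n => b n * a m

end Series

/-! ### The quantum toroidal `gl_1` algebra -/

/-- `q_i = exp (log q_i)`; the parameters are given by chosen logarithms. -/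
def q (L : Fin 3 → ℂ) (i : Fin 3) : ℂ := Complex.exp (L i)

/-- `s_i = q_i^{1/2}`. -/
def s (L : Fin 3 → ℂ) (i : Fin 3) : ℂ := Complex.exp (L i / 2)

/-- `β = - log q_3 / log q_1`. -/
def beta (L : Fin 3 → ℂ) : ℂ := -(L 2) / L 0

/-- `q_2^{β/2}`. -/
def q2HalfBeta (L : Fin 3 → ℂ) : ℂ := Complex.exp (beta L / 2 * L 1)

/-- `c_1 = -(s_2 - s_2⁻¹)(s_3 - s_3⁻¹)`. -/
def c1 (L : Fin 3 → ℂ) : ℂ := -((s L 1 - (s L 1)⁻¹) * (s L 2 - (s L 2)⁻¹))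

/-- `κ_r = (1 - q_1^r)(1 - q_2^r)(1 - q_3^r)`. -/
def kappa (L : Fin 3 → ℂ) (r : ℤ) : ℂ := ∏ i, (1 - q L i ^ r)

/-- `g(z,w) = (z - q_1 w)(z - q_2 w)(z - q_3 w)`. -/
def gForms (L : Fin 3 → ℂ) : List (ℂ × ℂ) := [(1, -q L 0), (1, -q L 1), (1, -q L 2)]

/-- The checked parameters for `M = 0`:
`q̌_1 = q_1⁻¹`, `q̌_2 = q_2 q_1`, `q̌_3 = q_3 q_1`, through their logarithms. -/
def check (L : Fin 3 → ℂ) : Fin 3 → ℂ := ![-L 0, L 1 + L 0, L 2 + L 0]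

/-- Images of the generators `e_j`, `f_j`, `h_r`, `C`, `ψ_0` in an algebra
(`h_0` is not a generator; it is put equal to zero below). -/
structure GL1Data (R : Type*) [Ring R] where
  e : ℤ → R
  f : ℤ → R
  h : ℤ → R
  C : Rˣ
  psi0 : Rˣ

namespace GL1Data

variable {R : Type*} [Ring R] [Algebra ℂ R] (L : Fin 3 → ℂ) (T : GL1Data R)

/-- `ψ⁺(z) = ψ_0 exp (∑_{r≥1} κ_r h_r z^{-r})`. -/
def psiP : ℤ → R := posCurrent (PowerSeries.C (T.psi0 : R) *
  expSeries (PowerSeries.mk fun r => if r = 0 then 0 else kappa L r • T.h r))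

/-- `ψ⁻(z) = ψ_0⁻¹ exp (∑_{r≥1} κ_r h_{-r} z^r)`. -/
def psiM : ℤ → R := negCurrent (PowerSeries.C ((T.psi0⁻¹ : Rˣ) : R) *
  expSeries (PowerSeries.mk fun r => if r = 0 then 0 else kappa L r • T.h (-(r : ℤ))))

/-- The set of generators. -/
def gens : Set R :=
  Set.range T.e ∪ Set.range T.f ∪ Set.range T.h ∪ {(T.C : R), (T.psi0 : R)}

/-- The defining relations of the quantum toroidal `gl_1` algebra. -/
structure Relations : Prop where
  h_zero : T.h 0 = 0
  C_central : ∀ x ∈ T.gens, Commute (T.C : R) x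
  psi0_central : ∀ x ∈ T.gens, Commute (T.psi0 : R) x
  h_h : ∀ r t : ℤ, r ≠ 0 → t ≠ 0 → T.h r * T.h t - T.h t * T.h r =
    if r + t = 0 then
      ((r : ℂ)⁻¹ * (kappa L r)⁻¹) • (((T.C ^ r : Rˣ) : R) - ((T.C ^ (-r) : Rˣ) : R))
    else 0
  psiP_e : mulForms (gForms L) (T.C : R) 1 (prodZW (T.psiP L) T.e) +
    mulForms (swapForms (gForms L)) (T.C : R) 1 (prodWZ T.e (T.psiP L)) = 0
  psiM_e : mulForms (gForms L) (1 : R) 1 (prodZW (T.psiM L) T.e) +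
    mulForms (swapForms (gForms L)) (1 : R) 1 (prodWZ T.e (T.psiM L)) = 0
  psiP_f : mulForms (swapForms (gForms L)) (1 : R) 1 (prodZW (T.psiP L) T.f) +
    mulForms (gForms L) (1 : R) 1 (prodWZ T.f (T.psiP L)) = 0
  psiM_f : mulForms (swapForms (gForms L)) (T.C : R) 1 (prodZW (T.psiM L) T.f) +
    mulForms (gForms L) (T.C : R) 1 (prodWZ T.f (T.psiM L)) = 0
  e_f : ∀ m n : ℤ, T.e m * T.f n - T.f n * T.e m =
    (kappa L 1)⁻¹ • (((T.C ^ m : Rˣ) : R) * T.psiP L (m + n) -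
      ((T.C ^ n : Rˣ) : R) * T.psiM L (m + n))
  e_e : mulForms (gForms L) (1 : R) 1 (prodZW T.e T.e) +
    mulForms (swapForms (gForms L)) (1 : R) 1 (prodWZ T.e T.e) = 0
  f_f : mulForms (swapForms (gForms L)) (1 : R) 1 (prodZW T.f T.f) +
    mulForms (gForms L) (1 : R) 1 (prodWZ T.f T.f) = 0
  serre_e : ∀ n : Fin 3 → ℤ, ∑ σ : Equiv.Perm (Fin 3),
    ⁅T.e (n (σ 0) + 1), ⁅T.e (n (σ 1) + 2), T.e (n (σ 2))⁆⁆ = 0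
  serre_f : ∀ n : Fin 3 → ℤ, ∑ σ : Equiv.Perm (Fin 3),
    ⁅T.f (n (σ 0) + 1), ⁅T.f (n (σ 1) + 2), T.f (n (σ 2))⁆⁆ = 0

/-- `k_0⁺(z) = K exp (∑_{r≥1} κ_r / (q_1^{-r} - 1) h_r z^{-r})`, as a power series in `z⁻¹`. -/
def k0P (K : Rˣ) : PowerSeries R := PowerSeries.C (K : R) *
  expSeries (PowerSeries.mk fun r => if r = 0 then 0 else
    (kappa L r / (q L 0 ^ (-(r : ℤ)) - 1)) • T.h r)

/-- `k_0⁻(z) = K⁻¹ exp (∑_{r≥1} κ_r / (q_1^r - 1) h_{-r} z^r)`, as a power series in `z`. -/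
def k0M (K : Rˣ) : PowerSeries R := PowerSeries.C ((K⁻¹ : Rˣ) : R) *
  expSeries (PowerSeries.mk fun r => if r = 0 then 0 else
    (kappa L r / (q L 0 ^ r - 1)) • T.h (-(r : ℤ)))

end GL1Data

/-! ### Locally finite sums of operators and fused currents -/

section Operators

variable {V : Type*} [AddCommGroup V] [Module ℂ V]

open scoped Classical in
/-- The sum `∑_r T_r` of a family of operators such that for each vector `v` only
finitely many `T_r v` are nonzero (and `0` for other families). -/
def locSum {ι : Type*} (T : ι → Module.End ℂ V) : Module.End ℂ V :=
  if h : ∀ v, (Function.support fun r => T r v).Finite then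
    { toFun := fun v => ∑ᶠ r, T r v
      map_add' := fun v w => by
        simp only [map_add]
        exact finsum_add_distrib (h v) (h w)
      map_smul' := fun c v => by
        simp only [map_smul, RingHom.id_apply]
        exact (smul_finsum' c (h v)).symm }
  else 0

/-- The product `a(z) b(z)` in the same variable. -/
def locMul (a b : ℤ → Module.End ℂ V) : ℤ → Module.End ℂ V :=
  fun n => locSum fun k : ℤ => a (n - k) * b k

/-- The fusion `a(x z) b(y z)`: with `P` given by the list `l`, it is
`P(z,w) a(z) b(w)` evaluated at `(x z, y z)` and divided by `P(x z, y z)`. -/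
def fuse (l : List (ℂ × ℂ)) (x y : ℂ) (a b : ℤ → Module.End ℂ V) : ℤ → Module.End ℂ V :=
  fun k => (evalForms l x y)⁻¹ • locSum fun n : ℤ =>
    (x ^ (-(k - l.length - n)) * y ^ (-n)) •
      mulForms l (1 : Module.End ℂ V) 1 (prodZW a b) (k - l.length - n) n

/-- `∏_{a<r} g(q_1^a z, w)`. -/
def fusionForms (L : Fin 3 → ℂ) (r : ℕ) : List (ℂ × ℂ) :=
  (List.range r).flatMap fun a => (gForms L).map fun p => (p.1 * q L 0 ^ a, p.2)

namespace GL1Data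

variable (L : Fin 3 → ℂ) (T : GL1Data (Module.End ℂ V))

/-- `e(z) e(q_1 z) ⋯ e(q_1^{r-1} z)`. -/
def fusedE : ℕ → ℤ → Module.End ℂ V
  | 0 => fun k => if k = 0 then 1 else 0
  | r + 1 => fuse (fusionForms L r) 1 (q L 0 ^ r) (fusedE r) T.e

/-- `f(q_1^{r-1} z) ⋯ f(q_1 z) f(z)`. -/
def fusedF : ℕ → ℤ → Module.End ℂ V
  | 0 => fun k => if k = 0 then 1 else 0
  | r + 1 => fuse (swapForms (fusionForms L r)) (q L 0 ^ r) 1 T.f (fusedF r)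

/-- `k_r⁺(z) = f^{(r)}(z) k_0⁺(z)`, `f^{(r)}(z) = (-c_1)^r f(q_1^{r-1} z) ⋯ f(z)`. -/
def kP (K : (Module.End ℂ V)ˣ) (r : ℕ) : ℤ → Module.End ℂ V :=
  locMul (fun k => (-c1 L) ^ r • T.fusedF L r k) (posCurrent (T.k0P L K))

/-- `k_r⁻(z) = k_0⁻(z) e^{(r)}(z)`, `e^{(r)}(z) = c_1^r e(z) ⋯ e(q_1^{r-1} z)`. -/
def kM (K : (Module.End ℂ V)ˣ) (r : ℕ) : ℤ → Module.End ℂ V :=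
  locMul (negCurrent (T.k0M L K)) (fun k => c1 L ^ r • T.fusedE L r k)

end GL1Data

/-! ### Relations (R1): the `X` currents as vector representations -/

/-- `ω(x) = (1 - q_2 x)(1 - q_3 x) / ((1 - x)(1 - q_2 q_3 x))`, expanded at `x = 0`. -/
def omegaP (L : Fin 3 → ℂ) : PowerSeries ℂ :=
  (1 - PowerSeries.C (q L 1) * PowerSeries.X) * (1 - PowerSeries.C (q L 2) * PowerSeries.X) *
    ((1 - PowerSeries.X) * (1 - PowerSeries.C (q L 1 * q L 2) * PowerSeries.X))⁻¹

/-- `ω(x)` expanded at `x = ∞`, as a power series in `x⁻¹`. -/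
def omegaM (L : Fin 3 → ℂ) : PowerSeries ℂ :=
  (PowerSeries.X - PowerSeries.C (q L 1)) * (PowerSeries.X - PowerSeries.C (q L 2)) *
    ((PowerSeries.X - 1) * (PowerSeries.X - PowerSeries.C (q L 1 * q L 2)))⁻¹

/-- Commutation relations of a toroidal `gl_1` action with a current `X(z) = X⁺_i(z)`:
`ψ^±(u) X(z) = ω^±(p z / (C^{(1±1)/2} u)) X(z) ψ^±(u)`,
`e(u) X(z) - ω⁻(p z / u) X(z) e(u) = (s_1⁻¹ - s_1)⁻¹ δ(p z / u) Y(z)`,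
`f(u) X(z) - X(z) f(u) = (s_1⁻¹ - s_1)⁻¹ δ(q_1⁻¹ p z / (C u)) Y'(z) ψ⁺(u)`. -/
structure LeftVector (L : Fin 3 → ℂ) (T : GL1Data (Module.End ℂ V)) (p : ℂ)
    (X Y Y' : ℤ → Module.End ℂ V) : Prop where
  C_X : ∀ n, Commute (T.C : Module.End ℂ V) (X n)
  psiP_X : ∀ m n : ℤ, T.psiP L m * X n = locSum fun r : ℕ =>
    (PowerSeries.coeff r (omegaP L) * p ^ r) •
      (((T.C ^ (-(r : ℤ)) : (Module.End ℂ V)ˣ) : Module.End ℂ V) *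
        (X (n + r) * T.psiP L (m - r)))
  psiM_X : ∀ m n : ℤ, T.psiM L m * X n = locSum fun r : ℕ =>
    (PowerSeries.coeff r (omegaM L) * p ^ (-(r : ℤ))) • (X (n - r) * T.psiM L (m + r))
  e_X : ∀ m n : ℤ, T.e m * X n - (locSum fun r : ℕ =>
      (PowerSeries.coeff r (omegaM L) * p ^ (-(r : ℤ))) • (X (n - r) * T.e (m + r))) =
    (((s L 0)⁻¹ - s L 0)⁻¹ * p ^ m) • Y (n + m)
  f_X : ∀ m n : ℤ, T.f m * X n - X n * T.f m = ((s L 0)⁻¹ - s L 0)⁻¹ • locSum fun k : ℤ =>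
    ((q L 0)⁻¹ * p) ^ k • (((T.C ^ (-k) : (Module.End ℂ V)ˣ) : Module.End ℂ V) *
      (Y' (n + k) * T.psiP L (m - k)))

/-- Commutation relations of a toroidal `gl_1` action with a current `X(z) = X⁻_i(z)`:
`X(z) ψ^±(u) = ω^±(p z / (C^{(1∓1)/2} u)) ψ^±(u) X(z)`,
`X(z) e(u) - e(u) X(z) = (s_1⁻¹ - s_1)⁻¹ δ(q_1⁻¹ p z / (C u)) ψ⁻(u) Y(z)`,
`X(z) f(u) - ω⁺(p z / u) f(u) X(z) = (s_1⁻¹ - s_1)⁻¹ δ(p z / u) Y'(z)`. -/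
structure RightVector (L : Fin 3 → ℂ) (T : GL1Data (Module.End ℂ V)) (p : ℂ)
    (X Y Y' : ℤ → Module.End ℂ V) : Prop where
  C_X : ∀ n, Commute (T.C : Module.End ℂ V) (X n)
  psiP_X : ∀ m n : ℤ, X n * T.psiP L m = locSum fun r : ℕ =>
    (PowerSeries.coeff r (omegaP L) * p ^ r) • (T.psiP L (m - r) * X (n + r))
  psiM_X : ∀ m n : ℤ, X n * T.psiM L m = locSum fun r : ℕ =>
    (PowerSeries.coeff r (omegaM L) * p ^ (-(r : ℤ))) •
      (((T.C ^ (r : ℤ) : (Module.End ℂ V)ˣ) : Module.End ℂ V) *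
        (T.psiM L (m + r) * X (n - r)))
  e_X : ∀ m n : ℤ, X n * T.e m - T.e m * X n = ((s L 0)⁻¹ - s L 0)⁻¹ • locSum fun k : ℤ =>
    ((q L 0)⁻¹ * p) ^ k • (((T.C ^ (-k) : (Module.End ℂ V)ˣ) : Module.End ℂ V) *
      (T.psiM L (m - k) * Y (n + k)))
  f_X : ∀ m n : ℤ, X n * T.f m - (locSum fun r : ℕ =>
      (PowerSeries.coeff r (omegaP L) * p ^ r) • (T.f (m - r) * X (n + r))) =
    (((s L 0)⁻¹ - s L 0)⁻¹ * p ^ m) • Y' (n + m)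

/-! ### Relations (R2): quadratic relations, for `M = 0` -/

/-- `∏_{r=1}^{d-1} (z - q_1^r w)`, the coefficient `γ_{i,i+d}(z,w)` for `d ≥ 1`. -/
def gammaForms (L : Fin 3 → ℂ) (d : ℕ) : List (ℂ × ℂ) :=
  (List.range (d - 1)).map fun r => (1, -q L 0 ^ (r + 1))

/-- The constant `(-1)^{-1} q_1^{d(d-1)/2}` in `γ_{i+d,i}`. -/
def gammaConst (L : Fin 3 → ℂ) (d : ℕ) : ℂ := -q L 0 ^ (d * (d - 1) / 2)

/-- `∏_{r=0}^{d-1} (1 - q_2 q_1^{-r} x)(1 - q_3 q_1^{-r} x) / ∏_{r=0}^{d} (1 - q_1^{-r} x)`,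
so that `γ_{i+d,i}(w,z)` expanded in `|z/w| ≪ 1` is `gammaConst * w^{d-1}` times
this series at `x = z/w`. -/
def rhoP (L : Fin 3 → ℂ) (d : ℕ) : PowerSeries ℂ :=
  (∏ r ∈ Finset.range d,
    ((1 - PowerSeries.C (q L 1 * (q L 0)⁻¹ ^ r) * PowerSeries.X) *
      (1 - PowerSeries.C (q L 2 * (q L 0)⁻¹ ^ r) * PowerSeries.X))) *
  (∏ r ∈ Finset.range (d + 1), (1 - PowerSeries.C ((q L 0)⁻¹ ^ r) * PowerSeries.X))⁻¹

/-- `∏_{r=0}^{d-1} (x - q_2 q_1^{-r})(x - q_3 q_1^{-r}) / ∏_{r=0}^{d} (x - q_1^{-r})`,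
so that `γ_{i+d,i}(z,w)` expanded in `|z/w| ≪ 1` is `gammaConst * w^{d-1}` times
this series at `x = z/w`. -/
def rhoM (L : Fin 3 → ℂ) (d : ℕ) : PowerSeries ℂ :=
  (∏ r ∈ Finset.range d,
    ((PowerSeries.X - PowerSeries.C (q L 1 * (q L 0)⁻¹ ^ r)) *
      (PowerSeries.X - PowerSeries.C (q L 2 * (q L 0)⁻¹ ^ r)))) *
  (∏ r ∈ Finset.range (d + 1), (PowerSeries.X - PowerSeries.C ((q L 0)⁻¹ ^ r)))⁻¹

/-- `γ_{i,j}(z,w) X⁺_i(z) X⁺_j(w) = (-1)^{i-j-1} γ_{j,i}(w,z) X⁺_j(w) X⁺_i(z)` for `j ≥ i`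
(the relation for `j < i` is the same relation with `(i,z)` and `(j,w)` exchanged). -/
structure QuadraticP (L : Fin 3 → ℂ) (X : ℤ → ℤ → Module.End ℂ V) : Prop where
  diag : ∀ i m n : ℤ, X i m * X i n = -(X i n * X i m)
  offDiag : ∀ (i : ℤ) (d : ℕ), 1 ≤ d → ∀ m n : ℤ,
    mulForms (gammaForms L d) (1 : Module.End ℂ V) 1 (prodZW (X i) (X (i + d))) m n =
      ((-1) ^ (d + 1) * gammaConst L d) • locSum fun t : ℕ =>
        PowerSeries.coeff t (rhoP L d) • (X (i + d) (n + d - 1 - t) * X i (m + t))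

/-- `γ_{i,j}(w,z) X⁻_i(z) X⁻_j(w) = (-1)^{i-j-1} γ_{j,i}(z,w) X⁻_j(w) X⁻_i(z)` for `j ≥ i`. -/
structure QuadraticM (L : Fin 3 → ℂ) (X : ℤ → ℤ → Module.End ℂ V) : Prop where
  diag : ∀ i m n : ℤ, X i m * X i n = -(X i n * X i m)
  offDiag : ∀ (i : ℤ) (d : ℕ), 1 ≤ d → ∀ m n : ℤ,
    mulForms (swapForms (gammaForms L d)) (1 : Module.End ℂ V) 1
        (prodZW (X i) (X (i + d))) m n =
      ((-1) ^ (d + 1) * gammaConst L d) • locSum fun t : ℕ =>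
        PowerSeries.coeff t (rhoM L d) • (X (i + d) (n + d - 1 - t) * X i (m + t))

end Operators

/-! ### The algebra `Â_{0,0}` -/

/-- The generators of `Â_{0,0}` (with the inverses of the invertible ones). -/
inductive AGen : Type
  | e (j : ℤ) | f (j : ℤ) | h (r : ℤ) | C | Cinv | psi0 | psi0inv | K | Kinv
  | e' (j : ℤ) | f' (j : ℤ) | h' (r : ℤ) | C' | C'inv | psi0' | psi0'inv | K' | K'inv
  | Xp (i k : ℤ) | Xm (i k : ℤ)

/-- The operators by which generators act on a graded space (`T'`, `K'` are the checked ones). -/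
structure AData (V : Type) [AddCommGroup V] [Module ℂ V] where
  T : GL1Data (Module.End ℂ V)
  T' : GL1Data (Module.End ℂ V)
  K : (Module.End ℂ V)ˣ
  K' : (Module.End ℂ V)ˣ
  Xp : ℤ → ℤ → Module.End ℂ V
  Xm : ℤ → ℤ → Module.End ℂ V

namespace AData

variable {V : Type} [AddCommGroup V] [Module ℂ V] (L : Fin 3 → ℂ) (D : AData V)

/-- The operator of a generator. -/
def op : AGen → Module.End ℂ V
  | .e j => D.T.e j
  | .f j => D.T.f j
  | .h r => D.T.h r
  | .C => D.T.C
  | .Cinv => (D.T.C⁻¹ : (Module.End ℂ V)ˣ)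
  | .psi0 => D.T.psi0
  | .psi0inv => (D.T.psi0⁻¹ : (Module.End ℂ V)ˣ)
  | .K => D.K
  | .Kinv => (D.K⁻¹ : (Module.End ℂ V)ˣ)
  | .e' j => D.T'.e j
  | .f' j => D.T'.f j
  | .h' r => D.T'.h r
  | .C' => D.T'.C
  | .C'inv => (D.T'.C⁻¹ : (Module.End ℂ V)ˣ)
  | .psi0' => D.T'.psi0
  | .psi0'inv => (D.T'.psi0⁻¹ : (Module.End ℂ V)ˣ)
  | .K' => D.K'
  | .K'inv => (D.K'⁻¹ : (Module.End ℂ V)ˣ)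
  | .Xp i k => D.Xp i k
  | .Xm i k => D.Xm i k

/-- The right hand side of (R3), coefficient of `z^{-m} w^{-n}`, first sum:
`ψ_0^{-i} ∑_{r+ř=i+j} δ(C w / (q_1^r z)) k_r⁺(q_1^{-r} w) ǩ_ř⁺(q̌_1^{-ř} q_1^{-j} w)`. -/
def crossP (i j m n : ℤ) : Module.End ℂ V :=
  if 0 ≤ i + j then
    ((D.T.psi0 ^ (-i) : (Module.End ℂ V)ˣ) : Module.End ℂ V) *
      ∑ r ∈ Finset.HasAntidiagonal.antidiagonal (i + j).toNat,
        (q L 0 ^ r.1)⁻¹ ^ m • (((D.T.C ^ m : (Module.End ℂ V)ˣ) : Module.End ℂ V) *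
          locMul (scale ((q L 0 ^ r.1)⁻¹) (D.T.kP L D.K r.1))
            (scale ((q (check L) 0 ^ r.2)⁻¹ * q L 0 ^ (-j))
              (D.T'.kP (check L) D.K' r.2)) (m + n))
  else 0

/-- The right hand side of (R3), coefficient of `z^{-m} w^{-n}`, second sum (without sign):
`ψ_0^{-j} ∑_{r+ř=-i-j} δ(C z / (q_1^r w)) k_r⁻(q_1^{-r} z) ǩ_ř⁻(q̌_1^{-ř} q_1^i z)`. -/
def crossM (i j m n : ℤ) : Module.End ℂ V :=
  if 0 ≤ -i - j then
    ((D.T.psi0 ^ (-j) : (Module.End ℂ V)ˣ) : Module.End ℂ V) *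
      ∑ r ∈ Finset.HasAntidiagonal.antidiagonal (-i - j).toNat,
        (q L 0 ^ r.1)⁻¹ ^ n • (((D.T.C ^ n : (Module.End ℂ V)ˣ) : Module.End ℂ V) *
          locMul (scale ((q L 0 ^ r.1)⁻¹) (D.T.kM L D.K r.1))
            (scale ((q (check L) 0 ^ r.2)⁻¹ * q L 0 ^ i)
              (D.T'.kM (check L) D.K' r.2)) (m + n))
  else 0

/-- The defining relations of `Â_{0,0}`. -/
structure Relations : Prop where
  rel : D.T.Relations L
  rel' : D.T'.Relations (check L)
  K_central : ∀ x ∈ D.T.gens, Commute (D.K : Module.End ℂ V) x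
  K'_central : ∀ x ∈ D.T'.gens, Commute (D.K' : Module.End ℂ V) x
  commute : ∀ x ∈ D.T.gens ∪ {(D.K : Module.End ℂ V)},
    ∀ y ∈ D.T'.gens ∪ {(D.K' : Module.End ℂ V)}, Commute x y
  psi0_eq : D.T.psi0 = D.T'.psi0
  C_eq : D.T.C = D.T'.C
  K_Xp : ∀ i k : ℤ, (D.K : Module.End ℂ V) * D.Xp i k = q2HalfBeta L • (D.Xp i k * D.K)
  K_Xm : ∀ i k : ℤ, (D.K : Module.End ℂ V) * D.Xm i k = (q2HalfBeta L)⁻¹ • (D.Xm i k * D.K)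
  K'_Xp : ∀ i k : ℤ, (D.K' : Module.End ℂ V) * D.Xp i k =
    q2HalfBeta (check L) • (D.Xp i k * D.K')
  K'_Xm : ∀ i k : ℤ, (D.K' : Module.End ℂ V) * D.Xm i k =
    (q2HalfBeta (check L))⁻¹ • (D.Xm i k * D.K')
  left : ∀ i : ℤ, LeftVector L D.T 1 (D.Xp i)
    (scale (q L 0) (D.Xp (i - 1))) (scale (q L 0)⁻¹ (D.Xp (i + 1)))
  left' : ∀ i : ℤ, LeftVector (check L) D.T' (q L 0 ^ i) (D.Xp i)
    (D.Xp (i - 1)) (D.Xp (i + 1))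
  right : ∀ i : ℤ, RightVector L D.T 1 (D.Xm i)
    (scale (q L 0)⁻¹ (D.Xm (i - 1))) (scale (q L 0) (D.Xm (i + 1)))
  right' : ∀ i : ℤ, RightVector (check L) D.T' (q L 0 ^ (-i)) (D.Xm i)
    (D.Xm (i - 1)) (D.Xm (i + 1))
  quadP : QuadraticP L D.Xp
  quadM : QuadraticM L D.Xm
  cross : ∀ i j m n : ℤ, D.Xp i m * D.Xm j n + D.Xm j n * D.Xp i m =
    D.crossP L i j m n - D.crossM L i j m n

end AData

/-- The degree of a generator. -/
def AGen.deg : AGen → ℤ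
  | .e j | .f j | .h j | .e' j | .f' j | .h' j => j
  | .Xp _ k | .Xm _ k => k
  | _ => 0

/-- The weight of a generator. -/
def AGen.wt : AGen → ℤ
  | .Xp _ _ => 1
  | .Xm _ _ => -1
  | _ => 0

/-- An admissible representation of `Â_{0,0}`: a space graded by degree and weight, with
finite-dimensional homogeneous components and degrees bounded above for each weight, on which
the generators act by homogeneous operators subject to the defining relations. -/
structure AdmRep (L : Fin 3 → ℂ) where
  V : Type
  [addCommGroup : AddCommGroup V]
  [module : Module ℂ V]
  grade : ℤ × ℤ → Submodule ℂ V
  isInternal : DirectSum.IsInternal grade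
  finite : ∀ x, FiniteDimensional ℂ (grade x)
  bounded : ∀ α : ℤ, ∃ d₀ : ℤ, ∀ d > d₀, grade (d, α) = ⊥
  ops : AData V
  homogeneous : ∀ (a : AGen) (d α : ℤ), ∀ v ∈ grade (d, α),
    ops.op a v ∈ grade (d + a.deg, α + a.wt)
  relations : ops.Relations L

attribute [instance] AdmRep.addCommGroup AdmRep.module

/-- Families of operators, one on each admissible representation. -/
abbrev OpFamily (L : Fin 3 → ℂ) : Type 1 := ∀ W : AdmRep L, Module.End ℂ W.V

/-- The algebra of operators on admissible representations generated by the generators of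
`Â_{0,0}` (finite sums of products only). -/
def finiteWords (L : Fin 3 → ℂ) : Subalgebra ℂ (OpFamily L) :=
  Algebra.adjoin ℂ (Set.range fun (a : AGen) (W : AdmRep L) => W.ops.op a)

/-- The algebra `Â_{0,0}`. Its relations, and its elements such as the coefficients of fused
currents, are infinite sums which make sense on admissible representations; accordingly it is
the completion of the algebra generated by the generators in the topology of pointwise
convergence on admissible representations: an element acts on all admissible
representations, and on any finite set of vectors it coincides with a
noncommutative polynomial in the generators. -/
def Ahat (L : Fin 3 → ℂ) : Subalgebra ℂ (OpFamily L) where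
  carrier := {φ | ∀ S : Finset (Σ W : AdmRep L, W.V), ∃ x ∈ finiteWords L,
    ∀ p ∈ S, φ p.1 p.2 = x p.1 p.2}
  mul_mem' := by
    classical
    intro a b ha hb S
    obtain ⟨y, hy, hy'⟩ := hb S
    obtain ⟨x, hx, hx'⟩ := ha (S.image fun p : (Σ W : AdmRep L, W.V) =>
      (⟨p.1, y p.1 p.2⟩ : Σ W : AdmRep L, W.V))
    refine ⟨x * y, mul_mem hx hy, fun p hp => ?_⟩
    have h1 := hx' ⟨p.1, y p.1 p.2⟩ (Finset.mem_image_of_mem _ hp)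
    simp only [Pi.mul_apply, Module.End.mul_apply]
    rw [hy' p hp]
    exact h1
  add_mem' := by
    intro a b ha hb S
    obtain ⟨x, hx, hx'⟩ := ha S
    obtain ⟨y, hy, hy'⟩ := hb S
    refine ⟨x + y, add_mem hx hy, fun p hp => ?_⟩
    simp [hx' p hp, hy' p hp]
  algebraMap_mem' := fun c _ => ⟨algebraMap ℂ _ c, (finiteWords L).algebraMap_mem c,
    fun _ _ => rfl⟩

namespace AdmRep

variable {L : Fin 3 → ℂ} (W : AdmRep L)

/-- The action of `Â_{0,0}` on an admissible representation. -/
def act : Ahat L →ₐ[ℂ] Module.End ℂ W.V :=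
  (Pi.evalAlgHom ℂ (fun W : AdmRep L => Module.End ℂ W.V) W).comp (Ahat L).val

/-- `k_0⁺(z) ǩ_0⁺(t z)` as a power series in `z⁻¹`. -/
def kkP (t : ℂ) : PowerSeries (Module.End ℂ W.V) :=
  W.ops.T.k0P L W.ops.K * scalePS t⁻¹ (W.ops.T'.k0P (check L) W.ops.K')

/-- `k_0⁻(z) ǩ_0⁻(t z)` as a power series in `z`. -/
def kkM (t : ℂ) : PowerSeries (Module.End ℂ W.V) :=
  W.ops.T.k0M L W.ops.K * scalePS t (W.ops.T'.k0M (check L) W.ops.K')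

/-- `X(C z)`. -/
def scaleC (X : ℤ → Module.End ℂ W.V) : ℤ → Module.End ℂ W.V :=
  fun k => ((W.ops.T.C ^ (-k) : (Module.End ℂ W.V)ˣ) : Module.End ℂ W.V) * X k

end AdmRep

/-! ### The quantum toroidal `gl_{1|1}` algebra extended by `K` -/

/-- The generators of `E_{1|1}[K]` (with the inverses of the invertible ones). -/
inductive EGen : Type
  | E (i : ZMod 2) (k : ℤ) | F (i : ZMod 2) (k : ℤ)
  | H (i : ZMod 2) (r : ℤ) (hr : r ≠ 0)
  | psi0 (i : ZMod 2) | psi0inv (i : ZMod 2) | C | Cinv | K | Kinv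

section GL11

variable {R : Type*} [Ring R] [Algebra ℂ R]

/-- `c^m` for an integer `m`, where `c'` is the inverse of `c`. -/
def intPow (c c' : R) (m : ℤ) : R := if 0 ≤ m then c ^ m.toNat else c' ^ (-m).toNat

/-- `g_{i,j}`: `g_{0,0} = g_{1,1} = 1`, `g_{0,1}(z,w) = (z - q̄_1 w)(z - q̄_1⁻¹ w)` and
`g_{1,0}(z,w) = (w - q̄_2 z)(w - q̄_2⁻¹ z)`. -/
def gBar (p1 p2 : ℂ) (i j : ZMod 2) : List (ℂ × ℂ) :=
  if i = j then []
  else if i = 0 then [(1, -p1), (1, -p1⁻¹)]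
  else [(-p2, 1), (-p2⁻¹, 1)]

/-- The coefficients of `∑_{r≥1} H_{i,r} x^r`; here and below `G` assigns to each
generator an element of `R`. -/
def hSeriesP (G : EGen → R) (i : ZMod 2) : PowerSeries R :=
  PowerSeries.mk fun r => if hr : (r : ℤ) ≠ 0 then G (.H i r hr) else 0

/-- The coefficients of `∑_{r≥1} H_{i,-r} x^r`. -/
def hSeriesM (G : EGen → R) (i : ZMod 2) : PowerSeries R :=
  PowerSeries.mk fun r => if hr : (-(r : ℤ)) ≠ 0 then G (.H i (-(r : ℤ)) hr) else 0

/-- `Ψ_i⁺(z) = Ψ_{i,0} exp ((s̄_2 - s̄_2⁻¹) ∑_{r≥1} H_{i,r} z^{-r})`. -/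
def PsiP (s2 : ℂ) (G : EGen → R) (i : ZMod 2) : ℤ → R :=
  posCurrent (PowerSeries.C (G (.psi0 i)) *
    expSeries (PowerSeries.mk fun r =>
      (s2 - s2⁻¹) • PowerSeries.coeff r (hSeriesP G i)))

/-- `Ψ_i⁻(z) = Ψ_{i,0}⁻¹ exp (-(s̄_2 - s̄_2⁻¹) ∑_{r≥1} H_{i,-r} z^r)`. -/
def PsiM (s2 : ℂ) (G : EGen → R) (i : ZMod 2) : ℤ → R :=
  negCurrent (PowerSeries.C (G (.psi0inv i)) *
    expSeries (PowerSeries.mk fun r =>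
      (-(s2 - s2⁻¹)) • PowerSeries.coeff r (hSeriesM G i)))

/-- `Ecur G i` is the current `E_i(z)`. -/
def Ecur (G : EGen → R) (i : ZMod 2) : ℤ → R := fun k => G (.E i k)

/-- `Fcur G i` is the current `F_i(z)`. -/
def Fcur (G : EGen → R) (i : ZMod 2) : ℤ → R := fun k => G (.F i k)

/-- The defining relations of `E_{1|1}[K]`, where `E_i`, `F_i` are odd (so that
`[E_i(z), F_j(w)]` is an anticommutator) and `c = q_2^{β/2}` is the constant in the
relations for `K`. The relation between `Ψ_i⁺(z)` and `Ψ_j⁻(w)`, whose coefficients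
are rational functions expanded in `|w/z| ≪ 1`, is written with cleared denominators. -/
inductive ERel (p1 p2 s2 c : ℂ) (G : EGen → R) : R → R → Prop
  | psi0_inv (i) : ERel p1 p2 s2 c G (G (.psi0 i) * G (.psi0inv i)) 1
  | inv_psi0 (i) : ERel p1 p2 s2 c G (G (.psi0inv i) * G (.psi0 i)) 1
  | C_inv : ERel p1 p2 s2 c G (G .C * G .Cinv) 1
  | inv_C : ERel p1 p2 s2 c G (G .Cinv * G .C) 1
  | K_inv : ERel p1 p2 s2 c G (G .K * G .Kinv) 1
  | inv_K : ERel p1 p2 s2 c G (G .Kinv * G .K) 1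
  | C_central (a : EGen) : ERel p1 p2 s2 c G (G .C * G a) (G a * G .C)
  | PsiP_PsiP (i j) (m n : ℤ) : ERel p1 p2 s2 c G
      (PsiP s2 G i m * PsiP s2 G j n) (PsiP s2 G j n * PsiP s2 G i m)
  | PsiM_PsiM (i j) (m n : ℤ) : ERel p1 p2 s2 c G
      (PsiM s2 G i m * PsiM s2 G j n) (PsiM s2 G j n * PsiM s2 G i m)
  | PsiP_PsiM (i j) (m n : ℤ) : ERel p1 p2 s2 c G
      (mulForms (gBar p1 p2 i j) 1 (G .Cinv) (mulForms (swapForms (gBar p1 p2 j i)) 1 (G .C)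
        (prodZW (PsiP s2 G i) (PsiM s2 G j))) m n)
      (mulForms (swapForms (gBar p1 p2 j i)) 1 (G .Cinv) (mulForms (gBar p1 p2 i j) 1 (G .C)
        (prodWZ (PsiM s2 G j) (PsiP s2 G i))) m n)
  | PsiP_E (i j) (m n : ℤ) : ERel p1 p2 s2 c G
      (mulForms (gBar p1 p2 i j) (G .C) 1 (prodZW (PsiP s2 G i) (Ecur G j)) m n)
      (mulForms (swapForms (gBar p1 p2 j i)) (G .C) 1 (prodWZ (Ecur G j) (PsiP s2 G i)) m n)
  | PsiM_E (i j) (m n : ℤ) : ERel p1 p2 s2 c G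
      (mulForms (gBar p1 p2 i j) 1 1 (prodZW (PsiM s2 G i) (Ecur G j)) m n)
      (mulForms (swapForms (gBar p1 p2 j i)) 1 1 (prodWZ (Ecur G j) (PsiM s2 G i)) m n)
  | PsiP_F (i j) (m n : ℤ) : ERel p1 p2 s2 c G
      (mulForms (swapForms (gBar p1 p2 j i)) 1 1 (prodZW (PsiP s2 G i) (Fcur G j)) m n)
      (mulForms (gBar p1 p2 i j) 1 1 (prodWZ (Fcur G j) (PsiP s2 G i)) m n)
  | PsiM_F (i j) (m n : ℤ) : ERel p1 p2 s2 c G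
      (mulForms (swapForms (gBar p1 p2 j i)) (G .C) 1 (prodZW (PsiM s2 G i) (Fcur G j)) m n)
      (mulForms (gBar p1 p2 i j) (G .C) 1 (prodWZ (Fcur G j) (PsiM s2 G i)) m n)
  | E_E (i j) (m n : ℤ) : ERel p1 p2 s2 c G
      (mulForms (gBar p1 p2 i j) 1 1 (prodZW (Ecur G i) (Ecur G j)) m n +
        mulForms (swapForms (gBar p1 p2 j i)) 1 1 (prodWZ (Ecur G j) (Ecur G i)) m n) 0
  | F_F (i j) (m n : ℤ) : ERel p1 p2 s2 c G
      (mulForms (swapForms (gBar p1 p2 j i)) 1 1 (prodZW (Fcur G i) (Fcur G j)) m n +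
        mulForms (gBar p1 p2 i j) 1 1 (prodWZ (Fcur G j) (Fcur G i)) m n) 0
  | E_F (i j) (m n : ℤ) : ERel p1 p2 s2 c G
      (Ecur G i m * Fcur G j n + Fcur G j n * Ecur G i m)
      (if i = j then
        -(intPow (G .C) (G .Cinv) m * PsiP s2 G i (m + n) -
          intPow (G .C) (G .Cinv) n * PsiM s2 G i (m + n))
      else 0)
  | K_E0 (k : ℤ) : ERel p1 p2 s2 c G (G .K * Ecur G 0 k * G .Kinv) (c⁻¹ • Ecur G 0 k)
  | K_F0 (k : ℤ) : ERel p1 p2 s2 c G (G .K * Fcur G 0 k * G .Kinv) (c • Fcur G 0 k)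
  | K_E1 (k : ℤ) : ERel p1 p2 s2 c G (G .K * Ecur G 1 k * G .Kinv) (c • Ecur G 1 k)
  | K_F1 (k : ℤ) : ERel p1 p2 s2 c G (G .K * Fcur G 1 k * G .Kinv) (c⁻¹ • Fcur G 1 k)
  | K_PsiP (i) (k : ℤ) : ERel p1 p2 s2 c G (G .K * PsiP s2 G i k) (PsiP s2 G i k * G .K)
  | K_PsiM (i) (k : ℤ) : ERel p1 p2 s2 c G (G .K * PsiM s2 G i k) (PsiM s2 G i k * G .K)

end GL11

/-- The algebra `E_{1|1}[K]` with parameters `q̄_1 = p1`, `q̄_2 = p2`, a square root `s2` of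
`q̄_2`, and the constant `c = q_2^{β/2}`, presented by generators and relations. -/
abbrev E11K (p1 p2 s2 c : ℂ) : Type :=
  RingQuot (ERel p1 p2 s2 c (FreeAlgebra.ι ℂ : EGen → FreeAlgebra ℂ EGen))

/-- The generators in `E_{1|1}[K]`. -/
def E11K.gen (p1 p2 s2 c : ℂ) (a : EGen) : E11K p1 p2 s2 c :=
  RingQuot.mkAlgHom ℂ (ERel p1 p2 s2 c (FreeAlgebra.ι ℂ : EGen → FreeAlgebra ℂ EGen))
    (FreeAlgebra.ι ℂ a)

end

end QTor

namespace QTor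

noncomputable section

open Finset

section

/-! ### Exponentials of power series over a noncommutative algebra -/

section ExpSeries

variable {R : Type*} [Ring R]

/-! All relations are checked on one admissible representation at a time. There the images of
`Ψ_i^±` are exponentials in the modes `h_r`, `ȟ_r`, and the images of `E_i`, `F_i` are the currents
`X_0^±`, together with `X_{-1}^-` and `X_1^+` dressed by inverse exponentials. The proof rests on
three points.

Relations with `Ψ`. The logarithms of the `ψ`–`X` exchange relations of (R1) give the commutators of
`h_r`, `ȟ_r` with `X_i^±`. In the logarithm of `k_0^±(z) ǩ_0^±(t z)` the two toroidal algebras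
contribute together one scalar `γ_r(τ)`, where `τ` is the `r`-th power of the ratio of `t` and the
twist of `X_i^±`. Since `q̌_1 = q_1⁻¹`, this scalar is a constant times `1 - τ` (`gammaP_eq`). It
vanishes when the twists agree (`gammaP_one`). When they differ by `q_1^{±1}`, the factor `1 -
q_1^r` cancels the denominator, and what remains is, up to sign and a power of `q̄_1`, the
coefficient of the logarithm of `(1 - q̄_2 x)(1 - q̄_2⁻¹ x) / ((1 - q̄_1 x)(1 - q̄_1⁻¹ x))`, the
exchange function of `E_{1|1}` (`gammaP_q`, `gammaP_q_inv`). The Heisenberg commutators of the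
logarithms have the same scalar (`commutator_kkLog`). These commutators form `ExchangeData`
(`AdmRep.exchangeData`); exponentiating them (`expSeries_conj`, and conversely
`commutator_of_expSeries_conj`) yields all relations that contain a `Ψ`, with denominators cleared.

Relations between `E` and `F`. For `E_1`, `F_1`, relation (R3) at `i = j = 0` has only its `r = ř =
0` terms, which are `Ψ_1^±`. For `E_0`, `F_0` one takes (R3) at `(1, -1)`: the dressing factors
commute with everything in sight, each of them cancels one of the two terms, and the factor that
remains is `Ψ_0^±` (`AdmRep.curE_curF`). `E_0` and `F_1` anticommute because the ratio in (R2) for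
neighbouring indices equals the exchange function of the dressing factor with `X_0^-`, and likewise
for `E_1` and `F_0` (`AdmRep.curE_Xm`, `AdmRep.Xp_curF`). For `E_0`, `E_1`, relation (R3) at `i + j
= -1` gives two delta functions, supported at `z = q̄_1^{±1} w` after rescaling, and both are killed
by `g_{0,1}(z,w)`; what is left of the quadratic relation is the exchange of the dressing factor
with `E_1` (`AdmRep.imE_imE`). The case of `F_0`, `F_1` is dual (`AdmRep.imF_imF`). The constants by
which `K` and `Ǩ` conjugate `X` are inverse to each other, so `KǨ` commutes with every `X_i^±` and
the constant terms of `Ψ_i^±` cause no trouble.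

Passage to the completion. Degrees bounded above for each weight make all occurring sums finite on
every vector. Locally finite sums of elements of `Ahat` stay in `Ahat` (`locSum_mem_Ahat`), so the
images lie there. The homomorphism comes from the presentation, and equality in `Ahat` is tested on
each representation. -/

theorem sum_antidiagonal_assoc {M : Type*} [AddCommMonoid M] (k : ℕ) (f : ℕ → ℕ → ℕ → M) :
    ∑ p ∈ antidiagonal k, ∑ u ∈ antidiagonal p.2, f p.1 u.1 u.2 =
      ∑ p ∈ antidiagonal k, ∑ u ∈ antidiagonal p.1, f u.1 u.2 p.2 := by
  rw [sum_sigma', sum_sigma']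
  refine sum_nbij' (fun x => ⟨(x.1.1 + x.2.1, x.2.2), (x.1.1, x.2.1)⟩)
    (fun x => ⟨(x.2.1, x.2.2 + x.1.2), (x.2.2, x.1.2)⟩) ?_ ?_ ?_ ?_ ?_
  · rintro ⟨⟨a, b⟩, ⟨c, d⟩⟩ h
    simp only [mem_sigma, HasAntidiagonal.mem_antidiagonal, and_true] at h ⊢
    omega
  · rintro ⟨⟨a, b⟩, ⟨c, d⟩⟩ h
    simp only [mem_sigma, HasAntidiagonal.mem_antidiagonal, and_true] at h ⊢
    omega
  · rintro ⟨⟨a, b⟩, ⟨c, d⟩⟩ h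
    simp only [mem_sigma, HasAntidiagonal.mem_antidiagonal] at h
    obtain ⟨-, rfl⟩ := h
    rfl
  · rintro ⟨⟨a, b⟩, ⟨c, d⟩⟩ h
    simp only [mem_sigma, HasAntidiagonal.mem_antidiagonal] at h
    obtain ⟨-, rfl⟩ := h
    rfl
  · rintro ⟨⟨a, b⟩, ⟨c, d⟩⟩ h
    rfl

/-- All coefficients of `a` commute with all coefficients of `b`. -/
def CoeffComm (a b : PowerSeries R) : Prop :=
  ∀ i j, Commute (PowerSeries.coeff i a) (PowerSeries.coeff j b)

namespace CoeffComm

variable {a b c : PowerSeries R}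

theorem symm (h : CoeffComm a b) : CoeffComm b a := fun i j => (h j i).symm

theorem mul_left (ha : CoeffComm a c) (hb : CoeffComm b c) : CoeffComm (a * b) c := by
  intro i j
  rw [PowerSeries.coeff_mul]
  exact Commute.sum_left _ _ _ fun p _ => (ha _ _).mul_left (hb _ _)

theorem one_left : CoeffComm 1 c := by
  intro i j
  rw [PowerSeries.coeff_one]
  split_ifs
  · exact Commute.one_left _
  · exact Commute.zero_left _

theorem pow_left (ha : CoeffComm a c) (n : ℕ) : CoeffComm (a ^ n) c := by
  induction n with
  | zero => simpa using one_left
  | succ n ih => rw [pow_succ]; exact ih.mul_left ha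

theorem add_left (ha : CoeffComm a c) (hb : CoeffComm b c) : CoeffComm (a + b) c := by
  intro i j
  rw [map_add]
  exact (ha i j).add_left (hb i j)

theorem neg_left (ha : CoeffComm a c) : CoeffComm (-a) c := by
  intro i j
  rw [map_neg]
  exact (ha i j).neg_left

theorem commute (h : CoeffComm a b) : Commute a b := by
  ext k
  rw [PowerSeries.coeff_mul, PowerSeries.coeff_mul, ← Nat.sum_antidiagonal_swap]
  exact sum_congr rfl fun p _ => h _ _

end CoeffComm

/-- The Euler derivation `x d/dx`. -/
def euler (a : PowerSeries R) : PowerSeries R :=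
  PowerSeries.mk fun n => (n : R) * PowerSeries.coeff n a

theorem euler_mul (a b : PowerSeries R) : euler (a * b) = euler a * b + a * euler b := by
  ext k
  simp only [euler, PowerSeries.coeff_mk, map_add, PowerSeries.coeff_mul, mul_sum]
  rw [← sum_add_distrib]
  refine sum_congr rfl fun p hp => ?_
  rw [← HasAntidiagonal.mem_antidiagonal.1 hp, Nat.cast_add, add_mul, mul_assoc, ← mul_assoc (_ : R) (p.2 : R),
    ← (Nat.cast_commute p.2 (PowerSeries.coeff p.1 a)).eq, mul_assoc]

theorem euler_one : euler (1 : PowerSeries R) = 0 := by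
  ext k
  rw [euler, PowerSeries.coeff_mk, PowerSeries.coeff_one]
  split_ifs with h <;> simp [h]

theorem euler_add (a b : PowerSeries R) : euler (a + b) = euler a + euler b := by
  ext k
  simp [euler, mul_add]

theorem CoeffComm.euler_left {a b : PowerSeries R} (h : CoeffComm a b) :
    CoeffComm (euler a) b := by
  intro i j
  rw [euler, PowerSeries.coeff_mk]
  exact (Nat.cast_commute _ _).mul_left (h i j)

/-- The Leibniz rule gives `n + 1` terms in which `euler a` stands at different places; commuting
coefficients allow it to be moved to the front in each. -/
theorem euler_pow_succ {a : PowerSeries R} (h : CoeffComm a a) (n : ℕ) :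
    euler (a ^ (n + 1)) = ((n : PowerSeries R) + 1) * (euler a * a ^ n) := by
  induction n with
  | zero => simp
  | succ n ih =>
    rw [pow_succ, euler_mul, ih, mul_assoc, mul_assoc, ← pow_succ,
      ← ((h.pow_left (n + 1)).symm.euler_left.commute).eq]
    push_cast
    noncomm_ring

theorem coeff_pow_eq_zero {a : PowerSeries R} (h0 : PowerSeries.coeff 0 a = 0) {n k : ℕ}
    (h : k < n) : PowerSeries.coeff k (a ^ n) = 0 := by
  induction n generalizing k with
  | zero => omega
  | succ n ih =>
    rw [pow_succ, PowerSeries.coeff_mul]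
    refine sum_eq_zero fun p hp => ?_
    rw [HasAntidiagonal.mem_antidiagonal] at hp
    rcases Nat.lt_or_ge p.1 n with h1 | h1
    · rw [ih h1, zero_mul]
    · have : p.2 = 0 := by omega
      rw [this, h0, mul_zero]

theorem coeff_zero_euler (a : PowerSeries R) : PowerSeries.coeff 0 (euler a) = 0 := by
  simp [euler]

theorem coeff_zero_mul' (a b : PowerSeries R) : PowerSeries.coeff 0 (a * b) =
    PowerSeries.coeff 0 a * PowerSeries.coeff 0 b := by
  simp [PowerSeries.coeff_mul]

variable [Algebra ℂ R]

theorem CoeffComm.exp_left {a c : PowerSeries R} (ha : CoeffComm a c) : CoeffComm (expSeries a) c := by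
  intro i j
  rw [expSeries, PowerSeries.coeff_mk]
  exact Commute.sum_left _ _ _ fun n _ => (ha.pow_left n i j).smul_left _

/-- Without a constant term, `a ^ n` starts in degree `n`. Hence the cutoff in the definition of
`expSeries` loses nothing and may be replaced by any larger one, in particular by one common to
several coefficients. -/
theorem coeff_expSeries_of_lt {a : PowerSeries R} (h0 : PowerSeries.coeff 0 a = 0) {k N : ℕ}
    (h : k < N) : PowerSeries.coeff k (expSeries a) =
      ∑ n ∈ range N, ((n.factorial : ℂ)⁻¹) • PowerSeries.coeff k (a ^ n) := by
  rw [expSeries, PowerSeries.coeff_mk]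
  refine sum_subset (range_subset_range.2 h) fun n _ hn => ?_
  rw [coeff_pow_eq_zero h0 (by simpa using hn), smul_zero]

theorem coeff_zero_expSeries (a : PowerSeries R) : PowerSeries.coeff 0 (expSeries a) = 1 := by
  simp [expSeries]

theorem euler_expSeries {a : PowerSeries R} (h0 : PowerSeries.coeff 0 a = 0)
    (h : CoeffComm a a) : euler (expSeries a) = euler a * expSeries a := by
  ext k
  rw [PowerSeries.coeff_mul]
  -- The zeroth coefficient of `euler a` vanishes, so only `p.2 < k` matters and one cutoff, `range
  -- k`, serves all terms of the convolution.
  have h1 : ∀ p ∈ antidiagonal k,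
      PowerSeries.coeff p.1 (euler a) * PowerSeries.coeff p.2 (expSeries a) =
      ∑ n ∈ range k, ((n.factorial : ℂ)⁻¹) •
        (PowerSeries.coeff p.1 (euler a) * PowerSeries.coeff p.2 (a ^ n)) := by
    intro p hp
    rw [HasAntidiagonal.mem_antidiagonal] at hp
    rcases Nat.eq_zero_or_pos p.1 with h1 | h1
    · simp [h1, euler]
    · rw [coeff_expSeries_of_lt h0 (show p.2 < k by omega), mul_sum]
      exact sum_congr rfl fun n _ => by rw [mul_smul_comm]
  rw [sum_congr rfl h1, sum_comm]
  have h2 : ∀ n : ℕ, PowerSeries.coeff k (euler (a ^ (n + 1))) = ((n : ℂ) + 1) •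
      ∑ p ∈ antidiagonal k, PowerSeries.coeff p.1 (euler a) * PowerSeries.coeff p.2 (a ^ n) := by
    intro n
    rw [euler_pow_succ h, ← PowerSeries.coeff_mul]
    have : ((n : PowerSeries R) + 1) = PowerSeries.C ((n : R) + 1) := by simp
    rw [this, PowerSeries.coeff_C_mul, Algebra.smul_def]
    simp
  rw [euler, PowerSeries.coeff_mk, coeff_expSeries_of_lt h0 (Nat.lt_succ_self k),
    sum_range_succ', mul_add, mul_sum]
  have h3 : (k : R) * ((Nat.factorial 0 : ℂ)⁻¹ • PowerSeries.coeff k (a ^ 0)) = 0 := by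
    rw [pow_zero, PowerSeries.coeff_one]
    split_ifs with h <;> simp [h]
  rw [h3, add_zero]
  refine sum_congr rfl fun n _ => ?_
  rw [← smul_sum, mul_smul_comm]
  have h4 := h2 n
  rw [euler, PowerSeries.coeff_mk] at h4
  rw [h4, smul_smul]
  congr 1
  rw [Nat.factorial_succ]
  push_cast
  have : (n : ℂ) + 1 ≠ 0 := by exact_mod_cast Nat.succ_ne_zero n
  have : (n.factorial : ℂ) ≠ 0 := by exact_mod_cast n.factorial_ne_zero
  field_simp

theorem natCast_mul_cancel {k : ℕ} (hk : k ≠ 0) {x y : R} (h : (k : R) * x = (k : R) * y) :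
    x = y := by
  have h1 : ∀ z : R, z = ((k : ℂ)⁻¹) • ((k : R) * z) := by
    intro z
    rw [← nsmul_eq_mul, ← Nat.cast_smul_eq_nsmul ℂ, smul_smul, inv_mul_cancel₀
      (by exact_mod_cast hk), one_smul]
  rw [h1 x, h, ← h1 y]

/-- As `D` has no constant term, the equation reads `k y_k = ∑_{i ≥ 1} D_i y_{k-i}`, a recursion
that determines `y` from `y_0`. Division by `k` is possible over `ℂ`. -/
theorem eq_of_euler_eq {D y z : PowerSeries R} (hD : PowerSeries.coeff 0 D = 0)
    (hy : euler y = D * y) (hz : euler z = D * z)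
    (h0 : PowerSeries.coeff 0 y = PowerSeries.coeff 0 z) : y = z := by
  ext k
  induction k using Nat.strong_induction_on with
  | _ k ih =>
    rcases Nat.eq_zero_or_pos k with rfl | hk
    · exact h0
    · refine natCast_mul_cancel hk.ne' ?_
      have h1 := congrArg (PowerSeries.coeff k) hy
      have h2 := congrArg (PowerSeries.coeff k) hz
      rw [euler, PowerSeries.coeff_mk, PowerSeries.coeff_mul] at h1 h2
      rw [h1, h2]
      refine sum_congr rfl fun p hp => ?_
      rw [HasAntidiagonal.mem_antidiagonal] at hp
      rcases Nat.eq_zero_or_pos p.1 with h3 | h3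
      · rw [h3, hD, zero_mul, zero_mul]
      · rw [ih p.2 (by omega)]

theorem expSeries_unique {a y : PowerSeries R} (h0 : PowerSeries.coeff 0 a = 0)
    (h : CoeffComm a a) (hy : euler y = euler a * y) (hy0 : PowerSeries.coeff 0 y = 1) :
    expSeries a = y :=
  eq_of_euler_eq (coeff_zero_euler a) (euler_expSeries h0 h) hy
    ((coeff_zero_expSeries a).trans hy0.symm)

/-- The product solves the differential equation that characterizes the exponential of the sum;
commutation of `a` with `b` is needed to bring `euler b` past `expSeries a`. -/
theorem expSeries_add {a b : PowerSeries R} (ha0 : PowerSeries.coeff 0 a = 0)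
    (hb0 : PowerSeries.coeff 0 b = 0) (ha : CoeffComm a a) (hb : CoeffComm b b)
    (hab : CoeffComm a b) : expSeries (a + b) = expSeries a * expSeries b := by
  refine expSeries_unique (by rw [map_add, ha0, hb0, add_zero]) ?_ ?_ ?_
  · exact (ha.add_left hab.symm).symm.add_left (hab.add_left hb).symm |>.symm
  · rw [euler_mul, euler_expSeries ha0 ha, euler_expSeries hb0 hb, euler_add, add_mul, mul_assoc,
      ← mul_assoc (expSeries a), hab.exp_left.symm.euler_left.symm.commute.eq, mul_assoc]
  · rw [coeff_zero_mul', coeff_zero_expSeries, coeff_zero_expSeries, mul_one]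

theorem expSeries_zero : expSeries (0 : PowerSeries R) = 1 := by
  refine expSeries_unique (by simp) (fun i j => by simp) ?_ (by simp)
  rw [euler_one]
  ext k
  simp [euler]

theorem expSeries_mul_neg {a : PowerSeries R} (ha0 : PowerSeries.coeff 0 a = 0)
    (ha : CoeffComm a a) : expSeries a * expSeries (-a) = 1 := by
  rw [← expSeries_add ha0 (by rw [map_neg, ha0, neg_zero]) ha ha.neg_left.symm.neg_left.symm ha.neg_left.symm,
    add_neg_cancel, expSeries_zero]

theorem expSeries_neg_mul {a : PowerSeries R} (ha0 : PowerSeries.coeff 0 a = 0)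
    (ha : CoeffComm a a) : expSeries (-a) * expSeries a = 1 := by
  rw [← expSeries_add (by rw [map_neg, ha0, neg_zero]) ha0 ha.neg_left.symm.neg_left.symm ha ha.neg_left,
    neg_add_cancel, expSeries_zero]

/-- `∑_{r ≥ 1} (a^r / r) x^r = - log (1 - a x)`. -/
def negLog (a : R) : PowerSeries R :=
  PowerSeries.mk fun r => ((r : ℂ)⁻¹) • a ^ r

/-- The coefficient at `r = 0` is `0⁻¹ • 1`, which is zero by the convention `0⁻¹ = 0`; so the sum
in `negLog` really starts at `r = 1`. -/
theorem coeff_zero_negLog (a : R) : PowerSeries.coeff 0 (negLog a) = 0 := by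
  simp [negLog]

theorem coeffComm_negLog {a b : R} (h : Commute a b) : CoeffComm (negLog a) (negLog b) := by
  intro i j
  simp only [negLog, PowerSeries.coeff_mk]
  exact ((h.pow_pow i j).smul_left _).smul_right _

theorem coeff_euler_negLog_succ (a : R) (k : ℕ) :
    PowerSeries.coeff (k + 1) (euler (negLog a)) = a ^ (k + 1) := by
  rw [euler, PowerSeries.coeff_mk, negLog, PowerSeries.coeff_mk, ← nsmul_eq_mul,
    ← Nat.cast_smul_eq_nsmul ℂ, smul_smul, mul_inv_cancel₀ (by exact_mod_cast k.succ_ne_zero),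
    one_smul]

/-- The Euler derivative of `negLog a` is the geometric series `∑_{r ≥ 1} a^r x^r`, whose product
with `1 - a x` telescopes to `a x`. So `1 - a x` solves the equation of the exponential. -/
theorem expSeries_neg_negLog (a : R) :
    expSeries (-negLog a) = 1 - PowerSeries.C a * PowerSeries.X := by
  have hc : CoeffComm (-negLog a) (-negLog a) :=
    (coeffComm_negLog (Commute.refl a)).neg_left.symm.neg_left
  refine expSeries_unique (by rw [map_neg, coeff_zero_negLog, neg_zero]) hc ?_ (by simp)
  have h1 : euler (-negLog a) = -euler (negLog a) := by
    ext k
    simp [euler]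
  rw [h1, mul_sub, mul_one]
  ext k
  rcases k with _ | k
  · simp [euler, ← mul_assoc]
  · rw [map_sub, ← mul_assoc, PowerSeries.coeff_succ_mul_X, PowerSeries.coeff_mul_C, map_neg,
      map_neg, coeff_euler_negLog_succ]
    rcases k with _ | k
    · simp [euler, PowerSeries.coeff_X]
    · rw [coeff_euler_negLog_succ]
      simp [euler, PowerSeries.coeff_X, pow_succ, PowerSeries.coeff_one]

end ExpSeries

end

section

/-! ### Rescaling the variable, and substituting a central multiple of it -/

section Substitutions

variable {R : Type*} [Ring R] [Algebra ℂ R]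

theorem map_expSeries {S : Type*} [Ring S] [Algebra ℂ S] (f : R →ₐ[ℂ] S) (a : PowerSeries R) :
    PowerSeries.map (f : R →+* S) (expSeries a) =
      expSeries (PowerSeries.map (f : R →+* S) a) := by
  ext k
  simp [expSeries, ← map_pow]

theorem scalePS_one (t : ℂ) : scalePS t (1 : PowerSeries R) = 1 := by
  ext k
  rw [scalePS, PowerSeries.coeff_mk, PowerSeries.coeff_one]
  split_ifs with h <;> simp [h]

theorem scalePS_mul (t : ℂ) (a b : PowerSeries R) :
    scalePS t (a * b) = scalePS t a * scalePS t b := by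
  ext k
  simp only [scalePS, PowerSeries.coeff_mk, PowerSeries.coeff_mul, smul_sum]
  refine sum_congr rfl fun p hp => ?_
  rw [← HasAntidiagonal.mem_antidiagonal.1 hp, smul_mul_smul_comm, pow_add]

theorem scalePS_pow (t : ℂ) (a : PowerSeries R) (n : ℕ) :
    scalePS t (a ^ n) = scalePS t a ^ n := by
  induction n with
  | zero => simp [scalePS_one]
  | succ n ih => rw [pow_succ, pow_succ, scalePS_mul, ih]

theorem scalePS_expSeries (t : ℂ) (a : PowerSeries R) :
    scalePS t (expSeries a) = expSeries (scalePS t a) := by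
  ext k
  simp only [expSeries, ← scalePS_pow]
  simp only [scalePS, PowerSeries.coeff_mk, smul_sum]
  exact sum_congr rfl fun n _ => smul_comm _ _ _

theorem scalePS_C (t : ℂ) (a : R) : scalePS t (PowerSeries.C a) = PowerSeries.C a := by
  ext k
  rw [scalePS, PowerSeries.coeff_mk, PowerSeries.coeff_C]
  split_ifs with h <;> simp [h]

/-- The power series `c(u x)` for an element `u` of an algebra. -/
def substMul (u : R) (c : PowerSeries ℂ) : PowerSeries R :=
  PowerSeries.mk fun n => PowerSeries.coeff n c • u ^ n

theorem substMul_one (u : R) : substMul u 1 = 1 := by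
  ext k
  rw [substMul, PowerSeries.coeff_mk, PowerSeries.coeff_one, PowerSeries.coeff_one]
  split_ifs with h <;> simp [h]

theorem substMul_mul (u : R) (a b : PowerSeries ℂ) :
    substMul u (a * b) = substMul u a * substMul u b := by
  ext k
  simp only [substMul, PowerSeries.coeff_mk, PowerSeries.coeff_mul, sum_smul]
  refine sum_congr rfl fun p hp => ?_
  rw [← HasAntidiagonal.mem_antidiagonal.1 hp, smul_mul_smul_comm, pow_add]

theorem substMul_pow (u : R) (a : PowerSeries ℂ) (n : ℕ) :
    substMul u (a ^ n) = substMul u a ^ n := by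
  induction n with
  | zero => simp [substMul_one]
  | succ n ih => rw [pow_succ, pow_succ, substMul_mul, ih]

theorem substMul_expSeries (u : R) (a : PowerSeries ℂ) :
    substMul u (expSeries a) = expSeries (substMul u a) := by
  ext k
  simp only [expSeries, ← substMul_pow]
  simp only [substMul, PowerSeries.coeff_mk, sum_smul]
  exact sum_congr rfl fun n _ => by rw [smul_eq_mul, mul_smul]

theorem coeffComm_substMul {u v : R} (h : Commute u v) (a b : PowerSeries ℂ) :
    CoeffComm (substMul u a) (substMul v b) := by
  intro i j
  simp only [substMul, PowerSeries.coeff_mk]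
  exact ((h.pow_pow i j).smul_left _).smul_right _

/-- `1 - T x + x^2`. -/
def quadSeries (T : ℂ) : PowerSeries ℂ :=
  1 - PowerSeries.C T * PowerSeries.X + PowerSeries.X ^ 2

end Substitutions

/-! ### Power series in `w / z` acting on two-variable coefficient families -/

section Action

variable {R : Type*} [Ring R]

/-- The action of a power series in `x = w / z` on `∑_{k ≥ 0, n} F_{k,n} z^{-k} w^{-n}`. -/
def act (d : PowerSeries R) (F : ℕ → ℤ → R) : ℕ → ℤ → R := fun k n =>
  ∑ p ∈ antidiagonal k, PowerSeries.coeff p.1 d * F p.2 (n + p.1)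

/-- Coefficients act by left multiplication only, so this is associativity of convolution and needs
no commutation between the series and the family. -/
theorem act_mul (d e : PowerSeries R) (F : ℕ → ℤ → R) : act (d * e) F = act d (act e F) := by
  ext k n
  simp only [act, mul_sum, PowerSeries.coeff_mul, sum_mul]
  have h := sum_antidiagonal_assoc k fun a b c =>
    PowerSeries.coeff a d * (PowerSeries.coeff b e * F c (n + a + b))
  rw [h]
  refine sum_congr rfl fun p _ => sum_congr rfl fun u hu => ?_
  rw [← HasAntidiagonal.mem_antidiagonal.1 hu, mul_assoc, Nat.cast_add, add_assoc]

theorem act_one (F : ℕ → ℤ → R) : act 1 F = F := by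
  ext k n
  rw [act, sum_eq_single (0, k)]
  · simp
  · rintro ⟨a, b⟩ h1 h2
    rw [PowerSeries.coeff_one, if_neg, zero_mul]
    rintro rfl
    apply h2
    simpa using h1
  · simp

/-- The coefficients of `P B(w)`, for a power series `P` in `z⁻¹`. -/
def seriesCur (P : PowerSeries R) (B : ℤ → R) : ℕ → ℤ → R := fun k n =>
  PowerSeries.coeff k P * B n

/-- The coefficients of `B(w) P`, for a power series `P` in `z⁻¹`. -/
def curSeries (B : ℤ → R) (P : PowerSeries R) : ℕ → ℤ → R := fun k n =>
  B n * PowerSeries.coeff k P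

/-- A constant factor may be put into the exponential on both sides of a conjugation. -/
theorem conj_C_mul {p : R} {P c : PowerSeries R} {B : ℤ → R} (hB : ∀ n, Commute p (B n))
    (hc : ∀ n, Commute p (PowerSeries.coeff n c)) (h : seriesCur P B = act c (curSeries B P)) :
    seriesCur (PowerSeries.C p * P) B = act c (curSeries B (PowerSeries.C p * P)) := by
  ext k n
  have h1 := congrFun (congrFun h k) n
  simp only [seriesCur, curSeries, act, PowerSeries.coeff_C_mul] at h1 ⊢
  rw [mul_assoc, h1, mul_sum]
  refine sum_congr rfl fun q _ => ?_
  rw [← mul_assoc p, (hc _).eq, mul_assoc, ← mul_assoc p, (hB _).eq]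
  simp only [mul_assoc]

/-- Used to remove the factor `ψ_0^{±1}` of `ψ^±` before logarithms are taken. -/
theorem conj_of_C_mul {p : Rˣ} {P c : PowerSeries R} {B : ℤ → R} (hB : ∀ n, Commute (p : R) (B n))
    (hc : ∀ n, Commute (p : R) (PowerSeries.coeff n c))
    (h : seriesCur (PowerSeries.C (p : R) * P) B =
      act c (curSeries B (PowerSeries.C (p : R) * P))) :
    seriesCur P B = act c (curSeries B P) := by
  have h1 := conj_C_mul (p := ((p⁻¹ : Rˣ) : R)) (fun n => (hB n).units_inv_left)
    (fun n => (hc n).units_inv_left) h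
  have h2 : PowerSeries.C ((p⁻¹ : Rˣ) : R) * (PowerSeries.C (p : R) * P) = P := by
    rw [← mul_assoc, ← map_mul, Units.inv_mul, map_one, one_mul]
  rwa [h2] at h1

end Action

/-! ### Exchange relations of exponentials versus commutators of logarithms -/

section Conjugation

variable {R : Type*} [Ring R] [Algebra ℂ R] {a l : PowerSeries R} {B : ℤ → R}

theorem coeff_expSeries_recursion (ha0 : PowerSeries.coeff 0 a = 0) (ha : CoeffComm a a) (k : ℕ) :
    (k : R) * PowerSeries.coeff k (expSeries a) = ∑ p ∈ antidiagonal k,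
      (p.1 : R) * PowerSeries.coeff p.1 a * PowerSeries.coeff p.2 (expSeries a) := by
  have h := congrArg (PowerSeries.coeff k) (euler_expSeries ha0 ha)
  rw [PowerSeries.coeff_mul] at h
  simpa only [euler, PowerSeries.coeff_mk] using h

/-- For any `D` with `[a_r, B_n] = l_r B_{n+r} + D_{r,n}`: the distribution
`exp (l) B(w) exp (a)` satisfies the recursion of `exp (a) B(w)` up to terms with `D`. -/
theorem act_recursion (D : ℕ → ℤ → R) (ha0 : PowerSeries.coeff 0 a = 0) (ha : CoeffComm a a)
    (hl0 : PowerSeries.coeff 0 l = 0) (hl : CoeffComm l l) (hal : CoeffComm a l)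
    (h : ∀ r n, PowerSeries.coeff r a * B n =
      B n * PowerSeries.coeff r a + PowerSeries.coeff r l * B (n + r) + D r n) (k : ℕ) (n : ℤ) :
    ∑ p ∈ antidiagonal k, (p.1 : R) * PowerSeries.coeff p.1 a *
        act (expSeries l) (curSeries B (expSeries a)) p.2 n =
      (k : R) * act (expSeries l) (curSeries B (expSeries a)) k n +
      ∑ p ∈ antidiagonal k, ∑ u ∈ antidiagonal p.2, (p.1 : R) *
        (PowerSeries.coeff u.1 (expSeries l) * D p.1 (n + u.1) *
          PowerSeries.coeff u.2 (expSeries a)) := by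
  have hcomm : ∀ i j, Commute (PowerSeries.coeff i a) (PowerSeries.coeff j (expSeries l)) :=
    hal.symm.exp_left.symm
  have key : ∑ p ∈ antidiagonal k, (p.1 : R) * PowerSeries.coeff p.1 a *
        act (expSeries l) (curSeries B (expSeries a)) p.2 n =
      ∑ p ∈ antidiagonal k, ∑ u ∈ antidiagonal p.2,
        (PowerSeries.coeff u.1 (expSeries l) * B (n + u.1) *
          ((p.1 : R) * PowerSeries.coeff p.1 a * PowerSeries.coeff u.2 (expSeries a)) +
        (p.1 : R) * PowerSeries.coeff p.1 l * PowerSeries.coeff u.1 (expSeries l) *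
          B (n + p.1 + u.1) * PowerSeries.coeff u.2 (expSeries a) +
        (p.1 : R) * (PowerSeries.coeff u.1 (expSeries l) * D p.1 (n + u.1) *
          PowerSeries.coeff u.2 (expSeries a))) := by
    refine sum_congr rfl fun p _ => ?_
    rw [act, mul_sum]
    refine sum_congr rfl fun u _ => ?_
    -- The coefficient of `a` passes `exp (l)` freely, and its commutator with `B` produces three
    -- terms: it continues to `exp (a)`, or is replaced by a coefficient of `l`, or by `D`.
    have e1 : PowerSeries.coeff p.1 a * (PowerSeries.coeff u.1 (expSeries l) *
        (B (n + u.1) * PowerSeries.coeff u.2 (expSeries a))) =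
        PowerSeries.coeff u.1 (expSeries l) * B (n + u.1) *
          (PowerSeries.coeff p.1 a * PowerSeries.coeff u.2 (expSeries a)) +
        PowerSeries.coeff p.1 l * PowerSeries.coeff u.1 (expSeries l) *
        B (n + p.1 + u.1) * PowerSeries.coeff u.2 (expSeries a) +
        PowerSeries.coeff u.1 (expSeries l) * D p.1 (n + u.1) *
          PowerSeries.coeff u.2 (expSeries a) := by
      rw [← mul_assoc, (hcomm p.1 u.1).eq, mul_assoc, ← mul_assoc _ (B _), h, add_mul, add_mul,
        mul_add, mul_add, (hl.symm.exp_left.symm p.1 u.1).eq, add_right_comm n]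
      simp only [mul_assoc]
    rw [curSeries, mul_assoc, e1, mul_add, mul_add]
    congr 2
    · rw [← mul_assoc, (Nat.cast_commute p.1 (_ : R)).eq, mul_assoc, ← mul_assoc (p.1 : R)]
    · simp only [mul_assoc]
  rw [key]
  simp only [sum_add_distrib]
  congr 1
  rw [act, mul_sum]
  -- The weight `k` splits into the indices of `exp (l)` and `exp (a)`, and each part is rewritten
  -- by the Euler recursion of its own exponential. The two resulting triple sums match those of
  -- `key` after reassociation.
  have h1 : ∀ p ∈ antidiagonal k, (k : R) * (PowerSeries.coeff p.1 (expSeries l) *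
        curSeries B (expSeries a) p.2 (n + p.1)) =
      ∑ u ∈ antidiagonal p.2, (PowerSeries.coeff p.1 (expSeries l) * B (n + p.1) *
        ((u.1 : R) * PowerSeries.coeff u.1 a * PowerSeries.coeff u.2 (expSeries a))) +
      ∑ u ∈ antidiagonal p.1, (u.1 : R) * PowerSeries.coeff u.1 l *
        PowerSeries.coeff u.2 (expSeries l) * B (n + u.1 + u.2) *
          PowerSeries.coeff p.2 (expSeries a) := by
    intro p hp
    have h2 : ∑ u ∈ antidiagonal p.1, (u.1 : R) * PowerSeries.coeff u.1 l *
        PowerSeries.coeff u.2 (expSeries l) * B (n + u.1 + u.2) *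
          PowerSeries.coeff p.2 (expSeries a) = (p.1 : R) * (PowerSeries.coeff p.1 (expSeries l) *
        curSeries B (expSeries a) p.2 (n + p.1)) := by
      rw [curSeries, ← mul_assoc, ← mul_assoc, coeff_expSeries_recursion hl0 hl, sum_mul, sum_mul]
      refine sum_congr rfl fun u hu => ?_
      rw [← HasAntidiagonal.mem_antidiagonal.1 hu, Nat.cast_add, add_assoc]
    rw [h2, ← mul_sum, ← coeff_expSeries_recursion ha0 ha,
      ← HasAntidiagonal.mem_antidiagonal.1 hp, Nat.cast_add, add_comm, add_mul,
      add_comm, ← mul_assoc _ (p.2 : R), ← (Nat.cast_commute p.2 (_ : R)).eq, curSeries]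
    simp only [mul_assoc]
    exact add_comm _ _
  rw [sum_congr rfl h1, sum_add_distrib]
  congr 1
  · rw [sum_antidiagonal_assoc k fun x y z =>
        PowerSeries.coeff y (expSeries l) * B (n + y) *
          ((x : R) * PowerSeries.coeff x a * PowerSeries.coeff z (expSeries a)),
      sum_antidiagonal_assoc k fun x y z =>
        PowerSeries.coeff x (expSeries l) * B (n + x) *
          ((y : R) * PowerSeries.coeff y a * PowerSeries.coeff z (expSeries a))]
    exact sum_congr rfl fun p _ => (Nat.sum_antidiagonal_swap
      (f := fun u : ℕ × ℕ => PowerSeries.coeff u.1 (expSeries l) * B (n + u.1) *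
        ((u.2 : R) * PowerSeries.coeff u.2 a * PowerSeries.coeff p.2 (expSeries a))))
  · rw [sum_antidiagonal_assoc k fun x y z => (x : R) * PowerSeries.coeff x l *
      PowerSeries.coeff y (expSeries l) * B (n + x + y) * PowerSeries.coeff z (expSeries a)]

/-- If `[a_r, B(w)] = l_r w^r B(w)`, then `exp (a) B(w) = exp (l) B(w) exp (a)`. -/
theorem expSeries_conj (ha0 : PowerSeries.coeff 0 a = 0) (ha : CoeffComm a a)
    (hl0 : PowerSeries.coeff 0 l = 0) (hl : CoeffComm l l) (hal : CoeffComm a l)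
    (h : ∀ r n, PowerSeries.coeff r a * B n =
      B n * PowerSeries.coeff r a + PowerSeries.coeff r l * B (n + r)) :
    seriesCur (expSeries a) B = act (expSeries l) (curSeries B (expSeries a)) := by
  ext k n
  induction k using Nat.strong_induction_on generalizing n with
  | _ k ih =>
    rcases Nat.eq_zero_or_pos k with rfl | hk
    · simp [seriesCur, curSeries, act, expSeries]
    refine natCast_mul_cancel hk.ne' ?_
    -- With zero defect both sides obey the recursion `k F_k = ∑_p p a_p F_{k-p}`, in which only `p
    -- ≥ 1` contributes; the induction hypothesis therefore covers every term on the right.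
    have h1 := act_recursion (B := B) (fun _ _ => 0) ha0 ha hl0 hl hal (fun r n => by rw [h, add_zero]) k n
    simp only [mul_zero, zero_mul, sum_const_zero, add_zero] at h1
    rw [← h1, seriesCur, ← mul_assoc, coeff_expSeries_recursion ha0 ha, sum_mul]
    refine sum_congr rfl fun p hp => ?_
    rw [HasAntidiagonal.mem_antidiagonal] at hp
    rcases Nat.eq_zero_or_pos p.1 with h2 | h2
    · simp [h2]
    · rw [← ih p.2 (by omega), seriesCur, mul_assoc]

/-- The converse of `expSeries_conj`. -/
theorem commutator_of_expSeries_conj (ha0 : PowerSeries.coeff 0 a = 0) (ha : CoeffComm a a)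
    (hl0 : PowerSeries.coeff 0 l = 0) (hl : CoeffComm l l) (hal : CoeffComm a l)
    (h : seriesCur (expSeries a) B = act (expSeries l) (curSeries B (expSeries a))) (k : ℕ)
    (n : ℤ) : PowerSeries.coeff k a * B n =
      B n * PowerSeries.coeff k a + PowerSeries.coeff k l * B (n + k) := by
  set D : ℕ → ℤ → R := fun r n => PowerSeries.coeff r a * B n -
    (B n * PowerSeries.coeff r a + PowerSeries.coeff r l * B (n + r)) with hD
  suffices H : D k n = 0 from sub_eq_zero.1 H
  induction k using Nat.strong_induction_on generalizing n with
  | _ k ih =>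
    rcases Nat.eq_zero_or_pos k with rfl | hk
    · simp only [hD, ha0, hl0, zero_mul, mul_zero, add_zero, sub_zero]
    have h1 := act_recursion (B := B) D ha0 ha hl0 hl hal
      (fun r n => by simp only [hD]; rw [add_sub_cancel]) k n
    rw [← h] at h1
    have h2 : ∑ p ∈ antidiagonal k, (p.1 : R) * PowerSeries.coeff p.1 a *
        seriesCur (expSeries a) B p.2 n = (k : R) * seriesCur (expSeries a) B k n := by
      rw [seriesCur, ← mul_assoc, coeff_expSeries_recursion ha0 ha, sum_mul]
      exact sum_congr rfl fun p _ => by rw [seriesCur, mul_assoc (_ * _)]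
    -- By hypothesis the exchanged distribution satisfies the exact recursion, so the sum of the
    -- `D`-terms is zero. Those with first index below `k` vanish by induction, and the last one is
    -- `k · D k n`.
    rw [h2, left_eq_add, sum_eq_single (k, 0)] at h1
    · refine natCast_mul_cancel hk.ne' ?_
      simpa [coeff_zero_expSeries, expSeries] using h1
    · rintro ⟨i, j⟩ hp hne
      rw [HasAntidiagonal.mem_antidiagonal] at hp
      refine sum_eq_zero fun u _ => ?_
      have : i ≠ k := by
        rintro rfl
        exact hne (by simpa using hp)
      dsimp only at hp ⊢
      rw [ih i (by omega)]
      simp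
    · simp

end Conjugation

end

section

/-! ### One-sided currents as two-variable distributions -/

section Distributions

variable {R : Type*} [Ring R]

/-- A family of coefficients of `z^{-k} w^{-n}`, `k ≥ 0`, as a distribution. -/
def posDist (F : ℕ → ℤ → R) : ℤ → ℤ → R := fun m n => if 0 ≤ m then F m.toNat n else 0

/-- A family of coefficients of `z^k w^n`, `k ≥ 0`, as a distribution. -/
def negDist (F : ℕ → ℤ → R) : ℤ → ℤ → R := fun m n => if m ≤ 0 then F (-m).toNat (-n) else 0

theorem prodZW_posCurrent (P : PowerSeries R) (B : ℤ → R) :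
    prodZW (posCurrent P) B = posDist (seriesCur P B) := by
  ext m n
  simp only [prodZW, posCurrent, posDist, seriesCur]
  split_ifs <;> simp

theorem prodWZ_posCurrent (P : PowerSeries R) (B : ℤ → R) :
    prodWZ B (posCurrent P) = posDist (curSeries B P) := by
  ext m n
  simp only [prodWZ, posCurrent, posDist, curSeries]
  split_ifs <;> simp

theorem prodZW_negCurrent (P : PowerSeries R) (B : ℤ → R) :
    prodZW (negCurrent P) B = negDist (seriesCur P fun n => B (-n)) := by
  ext m n
  simp only [prodZW, negCurrent, negDist, seriesCur, neg_neg]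
  split_ifs <;> simp

theorem prodWZ_negCurrent (P : PowerSeries R) (B : ℤ → R) :
    prodWZ B (negCurrent P) = negDist (curSeries (fun n => B (-n)) P) := by
  ext m n
  simp only [prodWZ, negCurrent, negDist, curSeries, neg_neg]
  split_ifs <;> simp

theorem commute_posCurrent {P : PowerSeries R} {x : R}
    (h : ∀ k, Commute (PowerSeries.coeff k P) x) (n : ℤ) : Commute (posCurrent P n) x := by
  rw [posCurrent]
  split_ifs
  · exact h _
  · exact Commute.zero_left _

theorem commute_negCurrent {P : PowerSeries R} {x : R}
    (h : ∀ k, Commute (PowerSeries.coeff k P) x) (n : ℤ) : Commute (negCurrent P n) x := by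
  rw [negCurrent]
  split_ifs
  · exact h _
  · exact Commute.zero_left _

theorem negCurrent_eq (P : PowerSeries R) (n : ℤ) : negCurrent P n = posCurrent P (-n) := by
  simp only [negCurrent, posCurrent, Left.nonneg_neg_iff]

theorem prodZW_eq_prodWZ {a b : ℤ → R} (h : ∀ m n, Commute (a m) (b n)) :
    prodZW a b = prodWZ b a := by
  ext m n
  exact (h m n).eq

end Distributions

/-! ### The polynomials `g_{i,j}` and their exchange function -/

section QuadraticForms

variable {R : Type*} [Ring R] [Algebra ℂ R]

/-- The distribution `(a^2 z^2 - T a b z w + b^2 w^2) D(z,w)`. -/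
def quadDist (T : ℂ) (a b : R) (D : ℤ → ℤ → R) : ℤ → ℤ → R := fun m n =>
  a * (a * D (m + 2) n) - T • (a * (b * D (m + 1) (n + 1))) + b * (b * D m (n + 2))

theorem mulForms_pair {x₁ y₁ x₂ y₂ : ℂ} {a b : R} (hab : Commute a b) (D : ℤ → ℤ → R) (m n : ℤ) :
    mulForms [(x₁, y₁), (x₂, y₂)] a b D m n = (x₁ * x₂) • (a * (a * D (m + 2) n)) +
      (x₁ * y₂ + y₁ * x₂) • (a * (b * D (m + 1) (n + 1))) + (y₁ * y₂) • (b * (b * D m (n + 2))) := by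
  simp only [mulForms, List.foldr_cons, List.foldr_nil, mulLinear, smul_mul_assoc, mul_add,
    mul_smul_comm, smul_smul, add_smul, add_assoc, one_add_one_eq_two]
  rw [← mul_assoc b a, ← hab.eq, mul_assoc a b]
  rw [mul_comm x₂ x₁, mul_comm y₂ x₁, mul_comm y₂ y₁, mul_comm y₁ x₂]

/-- `q̄_1 + q̄_1⁻¹` for `i = 0`, and `q̄_2 + q̄_2⁻¹` for `i = 1`. -/
def gTrace (p1 p2 : ℂ) (i : ZMod 2) : ℂ := if i = 0 then p1 + p1⁻¹ else p2 + p2⁻¹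

/-- The two roots are inverse to each other, so the product is `x² - T x y + y²` and depends only on
the trace `T`. It is symmetric in `x` and `y`, and therefore the swapped list below gives the same
distribution. -/
theorem mulForms_gBar {p1 p2 : ℂ} (h1 : p1 ≠ 0) (h2 : p2 ≠ 0) {i j : ZMod 2} (hij : i ≠ j)
    {a b : R} (hab : Commute a b) (D : ℤ → ℤ → R) :
    mulForms (gBar p1 p2 i j) a b D = quadDist (gTrace p1 p2 i) a b D := by
  ext m n
  rw [gBar, if_neg hij]
  by_cases hi : i = 0
  · rw [if_pos hi, mulForms_pair hab, quadDist, gTrace, if_pos hi]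
    have : (1 : ℂ) * -p1⁻¹ + -p1 * 1 = -(p1 + p1⁻¹) := by ring
    rw [this, neg_smul, ← sub_eq_add_neg, neg_mul_neg, mul_inv_cancel₀ h1, mul_one, one_smul,
      one_smul]
  · rw [if_neg hi, mulForms_pair hab, quadDist, gTrace, if_neg hi]
    have : -p2 * 1 + 1 * -p2⁻¹ = -(p2 + p2⁻¹) := by ring
    rw [this, neg_smul, ← sub_eq_add_neg, neg_mul_neg, mul_inv_cancel₀ h2, mul_one, one_smul,
      one_smul]

theorem mulForms_swap_gBar {p1 p2 : ℂ} (h1 : p1 ≠ 0) (h2 : p2 ≠ 0) {i j : ZMod 2} (hij : i ≠ j)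
    {a b : R} (hab : Commute a b) (D : ℤ → ℤ → R) :
    mulForms (swapForms (gBar p1 p2 i j)) a b D = quadDist (gTrace p1 p2 i) a b D := by
  ext m n
  rw [gBar, if_neg hij]
  by_cases hi : i = 0
  · rw [if_pos hi, swapForms, List.map_cons, List.map_cons, List.map_nil, Prod.swap_prod_mk,
      Prod.swap_prod_mk, mulForms_pair hab, quadDist, gTrace, if_pos hi]
    have : -p1 * 1 + 1 * -p1⁻¹ = -(p1 + p1⁻¹) := by ring
    rw [this, neg_smul, ← sub_eq_add_neg, neg_mul_neg, mul_inv_cancel₀ h1, mul_one, one_smul,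
      one_smul]
  · rw [if_neg hi, swapForms, List.map_cons, List.map_cons, List.map_nil, Prod.swap_prod_mk,
      Prod.swap_prod_mk, mulForms_pair hab, quadDist, gTrace, if_neg hi]
    have : (1 : ℂ) * -p2⁻¹ + -p2 * 1 = -(p2 + p2⁻¹) := by ring
    rw [this, neg_smul, ← sub_eq_add_neg, neg_mul_neg, mul_inv_cancel₀ h2, mul_one, one_smul,
      one_smul]

theorem mulForms_gBar_self (p1 p2 : ℂ) (i : ZMod 2) (a b : R) (D : ℤ → ℤ → R) :
    mulForms (gBar p1 p2 i i) a b D = D := by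
  simp [gBar, mulForms]

theorem mulForms_swap_gBar_self (p1 p2 : ℂ) (i : ZMod 2) (a b : R) (D : ℤ → ℤ → R) :
    mulForms (swapForms (gBar p1 p2 i i)) a b D = D := by
  simp [gBar, mulForms, swapForms]

theorem coeff_quadSeries (T : ℂ) (k : ℕ) : PowerSeries.coeff k (quadSeries T) =
    if k = 0 then 1 else if k = 1 then -T else if k = 2 then 1 else 0 := by
  rcases k with _ | _ | _ | k
  · simp [quadSeries]
  · simp [quadSeries, PowerSeries.coeff_X_pow, PowerSeries.coeff_one]
  · simp [quadSeries, PowerSeries.coeff_X_pow, PowerSeries.coeff_one]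
  · simp [quadSeries, PowerSeries.coeff_X_pow, PowerSeries.coeff_one]

theorem act_quadSeries_zero (T : ℂ) (u : R) (F : ℕ → ℤ → R) (n : ℤ) :
    act (substMul u (quadSeries T)) F 0 n = F 0 n := by
  simp [act, substMul, quadSeries]

theorem act_quadSeries_one (T : ℂ) (u : R) (F : ℕ → ℤ → R) (n : ℤ) :
    act (substMul u (quadSeries T)) F 1 n = F 1 n - T • (u * F 0 (n + 1)) := by
  simp [act, substMul, coeff_quadSeries, Nat.antidiagonal_succ, sub_eq_add_neg]

theorem act_quadSeries_add_two (T : ℂ) (u : R) (F : ℕ → ℤ → R) (k : ℕ) (n : ℤ) :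
    act (substMul u (quadSeries T)) F (k + 2) n =
      F (k + 2) n - T • (u * F (k + 1) (n + 1)) + u * (u * F k (n + 2)) := by
  rw [act, Nat.sum_antidiagonal_succ, Nat.sum_antidiagonal_succ, sum_eq_single (0, k)]
  · simp [substMul, coeff_quadSeries, sub_eq_add_neg, add_assoc, pow_two, mul_assoc]
  · rintro ⟨i, j⟩ hp hne
    rw [HasAntidiagonal.mem_antidiagonal] at hp
    have : i ≠ 0 := by
      rintro rfl
      exact hne (by simpa using hp)
    simp [substMul, coeff_quadSeries, this]
  · simp

/-- `z² - T u z w + u² w² = z² (1 - T x + x²)` at `x = u w / z`, and the factor `z²` moves the first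
index by two. -/
theorem quadDist_posDist (T : ℂ) (u : R) (F : ℕ → ℤ → R) (m n : ℤ) :
    quadDist T 1 u (posDist F) m n = posDist (act (substMul u (quadSeries T)) F) (m + 2) n := by
  rcases lt_or_ge (m + 2) 0 with h | h
  · simp [quadDist, posDist, show ¬ 0 ≤ m + 2 by omega, show ¬ 0 ≤ m + 1 by omega,
      show ¬ 0 ≤ m by omega]
  · obtain ⟨k, hk⟩ := Int.eq_ofNat_of_zero_le h
    obtain rfl : m = k - 2 := by omega
    -- For `k = 0, 1` some of the three terms lie outside the support of `posDist`, which
    -- corresponds to the truncated low-order formulas for `act`.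
    rcases k with _ | _ | k
    · simp [quadDist, posDist, act_quadSeries_zero]
    · simp [quadDist, posDist, act_quadSeries_one]
    · have e1 : ((k + 1 + 1 : ℕ) : ℤ) - 2 = k := by push_cast; ring
      simp only [quadDist, posDist, e1, one_mul]
      rw [if_pos (by omega), if_pos (by omega), if_pos (by omega),
        show ((k : ℤ) + 2).toNat = k + 2 by omega, show ((k : ℤ) + 1).toNat = k + 1 by omega,
        Int.toNat_natCast, act_quadSeries_add_two, if_pos (by omega)]

theorem quadDist_posDist_unit (T : ℂ) (c : Rˣ) (F : ℕ → ℤ → R) (m n : ℤ) :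
    quadDist T (c : R) 1 (posDist F) m n = (c : R) * (c : R) *
      posDist (act (substMul ((c⁻¹ : Rˣ) : R) (quadSeries T)) F) (m + 2) n := by
  rw [← quadDist_posDist]
  simp only [quadDist, mul_add, mul_sub, one_mul, mul_smul_comm, mul_assoc, Units.mul_inv_cancel_left]

/-- Here `w²` is factored out, with `x = u z / w`; thus the shift by two is in the second index. -/
theorem quadDist_negDist (T : ℂ) (u : R) (F : ℕ → ℤ → R) (m n : ℤ) :
    quadDist T u 1 (negDist F) m n = negDist (act (substMul u (quadSeries T)) F) m (n + 2) := by
  rcases lt_or_ge 0 m with h | h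
  · simp [quadDist, negDist, show ¬ m + 2 ≤ 0 by omega, show ¬ m + 1 ≤ 0 by omega,
      show ¬ m ≤ 0 by omega]
  · obtain ⟨k, hk⟩ := Int.eq_ofNat_of_zero_le (show 0 ≤ -m by omega)
    obtain rfl : m = -k := by omega
    rcases k with _ | _ | k
    · simp [quadDist, negDist, act_quadSeries_zero]
    · simp [quadDist, negDist, act_quadSeries_one]
      rw [sub_eq_add_neg, add_comm, show -2 + -n + 1 = -1 + -n by ring]
    · simp only [quadDist, negDist, one_mul]
      rw [if_pos (by omega), if_pos (by omega), if_pos (by omega),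
        show (-(-((k + 1 + 1 : ℕ) : ℤ) + 2)).toNat = k by omega,
        show (-(-((k + 1 + 1 : ℕ) : ℤ) + 1)).toNat = k + 1 by omega,
        show (-(-((k + 1 + 1 : ℕ) : ℤ))).toNat = k + 2 by omega, act_quadSeries_add_two,
        show -(n + 2) + 2 = -n by ring, show -(n + 2) + 1 = -(n + 1) by ring, if_pos (by omega)]
      abel

/-- `∑_{r ≥ 1} (q̄_1^r + q̄_1^{-r} - q̄_2^r - q̄_2^{-r}) x^r / r`. -/
def barSeries (p1 p2 : ℂ) : PowerSeries ℂ :=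
  negLog p1 + negLog p1⁻¹ + (-negLog p2 + -negLog p2⁻¹)

theorem coeffComm_of_comm (a b : PowerSeries ℂ) : CoeffComm a b := fun _ _ => mul_comm _ _

theorem coeff_zero_barSeries (p1 p2 : ℂ) : PowerSeries.coeff 0 (barSeries p1 p2) = 0 := by
  simp only [barSeries, map_add, map_neg, coeff_zero_negLog, neg_zero, add_zero]

theorem quadSeries_eq {p : ℂ} (hp : p ≠ 0) :
    quadSeries (p + p⁻¹) = expSeries (-negLog p) * expSeries (-negLog p⁻¹) := by
  rw [expSeries_neg_negLog, expSeries_neg_negLog, quadSeries]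
  have : PowerSeries.C p * PowerSeries.C p⁻¹ = 1 := by
    rw [← map_mul, mul_inv_cancel₀ hp, map_one]
  rw [map_add]
  linear_combination (-PowerSeries.X ^ 2) * this

/-- `exp (barSeries)` is the quotient of `(1 - q̄_2 x)(1 - q̄_2⁻¹ x)` by `(1 - q̄_1 x)(1 - q̄_1⁻¹
x)`. This identity turns an exponential exchange function into a relation with cleared denominators.
-/
theorem quadSeries_mul_exp {p1 p2 : ℂ} (h1 : p1 ≠ 0) (h2 : p2 ≠ 0) :
    quadSeries (p1 + p1⁻¹) * expSeries (barSeries p1 p2) = quadSeries (p2 + p2⁻¹) := by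
  rw [barSeries, expSeries_add, expSeries_add, expSeries_add, quadSeries_eq h1, quadSeries_eq h2]
  · have e1 := expSeries_neg_mul (coeff_zero_negLog p1) (coeffComm_of_comm _ _)
    have e2 := expSeries_neg_mul (coeff_zero_negLog p1⁻¹) (coeffComm_of_comm _ _)
    linear_combination (expSeries (-negLog p2) * expSeries (-negLog p2⁻¹) *
      expSeries (-negLog p1⁻¹) * expSeries (negLog p1⁻¹)) * e1 +
      (expSeries (-negLog p2) * expSeries (-negLog p2⁻¹)) * e2
  all_goals first
    | exact coeffComm_of_comm _ _
    | simp only [map_add, map_neg, coeff_zero_negLog, neg_zero, add_zero]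

theorem quadSeries_mul_exp_neg {p1 p2 : ℂ} (h1 : p1 ≠ 0) (h2 : p2 ≠ 0) :
    quadSeries (p2 + p2⁻¹) * expSeries (-barSeries p1 p2) = quadSeries (p1 + p1⁻¹) := by
  rw [← quadSeries_mul_exp h1 h2, mul_assoc, expSeries_mul_neg (coeff_zero_barSeries _ _)
    (coeffComm_of_comm _ _), mul_one]

end QuadraticForms

end

section

/-! ### Exchange relations with cleared denominators -/

section Exchange

variable {R : Type*} [Ring R] [Algebra ℂ R]

theorem coeff_substMul (u : R) (c : PowerSeries ℂ) (n : ℕ) :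
    PowerSeries.coeff n (substMul u c) = PowerSeries.coeff n c • u ^ n := by
  rw [substMul, PowerSeries.coeff_mk]

theorem substMul_neg (u : R) (c : PowerSeries ℂ) : substMul u (-c) = -substMul u c := by
  ext k
  simp [coeff_substMul]

theorem commute_substMul {x u : R} (h : Commute x u) (c : PowerSeries ℂ) (n : ℕ) :
    Commute x (PowerSeries.coeff n (substMul u c)) := by
  rw [coeff_substMul]
  exact (h.pow_right n).smul_right _

theorem coeffComm_substMul_right {a : PowerSeries R} {u : R}
    (h : ∀ n, Commute (PowerSeries.coeff n a) u) (c : PowerSeries ℂ) :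
    CoeffComm a (substMul u c) := fun i j => commute_substMul (h i) c j

/-- The exchange relation of the exponential of `a` with a current `B(w)`, with
denominators cleared. -/
theorem act_quadSeries_conj {T T' : ℂ} {s : PowerSeries ℂ} (hs0 : PowerSeries.coeff 0 s = 0)
    (hq : quadSeries T * expSeries s = quadSeries T') {a : PowerSeries R} {p u : R} {B : ℤ → R}
    (ha0 : PowerSeries.coeff 0 a = 0) (ha : CoeffComm a a)
    (hau : ∀ n, Commute (PowerSeries.coeff n a) u) (hpu : Commute p u) (hpB : ∀ n, Commute p (B n))
    (h : ∀ r n, PowerSeries.coeff r a * B n =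
      B n * PowerSeries.coeff r a + PowerSeries.coeff r (substMul u s) * B (n + r)) :
    act (substMul u (quadSeries T)) (seriesCur (PowerSeries.C p * expSeries a) B) =
      act (substMul u (quadSeries T')) (curSeries B (PowerSeries.C p * expSeries a)) := by
  have h1 := expSeries_conj ha0 ha (by simp [substMul, hs0, - PowerSeries.coeff_zero_eq_constantCoeff])
    (coeffComm_substMul (Commute.refl u) s s) (coeffComm_substMul_right hau s) h
  rw [← substMul_expSeries] at h1
  rw [conj_C_mul hpB (commute_substMul hpu _) h1, ← act_mul, ← substMul_mul, hq]

/-- On both sides `c² z²` is pulled out of the quadratic form, which leaves series in `c⁻¹ w / z`;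
the exponential factor then converts one quadratic series into the other. -/
theorem quadDist_exchange_pos {T T' : ℂ} {s : PowerSeries ℂ} (hs0 : PowerSeries.coeff 0 s = 0)
    (hq : quadSeries T * expSeries s = quadSeries T') {a : PowerSeries R} {p : R} {c : Rˣ}
    {B : ℤ → R} (ha0 : PowerSeries.coeff 0 a = 0) (ha : CoeffComm a a)
    (hac : ∀ n, Commute (PowerSeries.coeff n a) (c : R)) (hpc : Commute p (c : R))
    (hpB : ∀ n, Commute p (B n))
    (h : ∀ r n, PowerSeries.coeff r a * B n = B n * PowerSeries.coeff r a +
      PowerSeries.coeff r (substMul ((c⁻¹ : Rˣ) : R) s) * B (n + r)) :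
    quadDist T (c : R) 1 (prodZW (posCurrent (PowerSeries.C p * expSeries a)) B) =
      quadDist T' (c : R) 1 (prodWZ B (posCurrent (PowerSeries.C p * expSeries a))) := by
  ext m n
  rw [prodZW_posCurrent, prodWZ_posCurrent, quadDist_posDist_unit, quadDist_posDist_unit,
    act_quadSeries_conj hs0 hq ha0 ha (fun n => (hac n).units_inv_right) hpc.units_inv_right hpB h]

theorem quadDist_exchange_neg {T T' : ℂ} {s : PowerSeries ℂ} (hs0 : PowerSeries.coeff 0 s = 0)
    (hq : quadSeries T * expSeries s = quadSeries T') {a : PowerSeries R} {p u : R}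
    {B : ℤ → R} (ha0 : PowerSeries.coeff 0 a = 0) (ha : CoeffComm a a)
    (hau : ∀ n, Commute (PowerSeries.coeff n a) u) (hpu : Commute p u)
    (hpB : ∀ n, Commute p (B n))
    (h : ∀ (r : ℕ) n, PowerSeries.coeff r a * B n = B n * PowerSeries.coeff r a +
      PowerSeries.coeff r (substMul u s) * B (n - r)) :
    quadDist T u 1 (prodZW (negCurrent (PowerSeries.C p * expSeries a)) B) =
      quadDist T' u 1 (prodWZ B (negCurrent (PowerSeries.C p * expSeries a))) := by
  ext m n
  rw [prodZW_negCurrent, prodWZ_negCurrent, quadDist_negDist, quadDist_negDist,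
    act_quadSeries_conj hs0 hq ha0 ha hau hpu (fun n => hpB (-n))]
  intro r n
  rw [h, neg_add, sub_eq_add_neg]

/-- `B` commutes with `exp (a)` if it commutes with all coefficients of `a`. -/
theorem commute_expSeries {a : PowerSeries R} {p x : R}
    (h : ∀ r, Commute (PowerSeries.coeff r a) x) (hp : Commute p x) (k : ℕ) :
    Commute (PowerSeries.coeff k (PowerSeries.C p * expSeries a)) x := by
  have h1 : CoeffComm a (PowerSeries.C x) := by
    intro i j
    rw [PowerSeries.coeff_C]
    split_ifs
    · exact h i
    · exact Commute.zero_right _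
  have h2 := h1.exp_left k 0
  rw [PowerSeries.coeff_C, if_pos rfl] at h2
  rw [PowerSeries.coeff_C_mul]
  exact hp.mul_left h2

/-- The commutator of `exp (a)` with an element that has a central commutator with `a`. -/
theorem commutator_expSeries {a : PowerSeries R} {x l : R} {r : ℕ} (hr : r ≠ 0)
    (ha0 : PowerSeries.coeff 0 a = 0) (hl : ∀ t, Commute l (PowerSeries.coeff t a))
    (h : ∀ t, x * PowerSeries.coeff t a = PowerSeries.coeff t a * x + if t = r then l else 0) :
    PowerSeries.C x * expSeries a = expSeries a * PowerSeries.C x +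
      PowerSeries.C l * (PowerSeries.X ^ r * expSeries a) := by
  have h1 : PowerSeries.C x * a = a * PowerSeries.C x + PowerSeries.C l * PowerSeries.X ^ r := by
    ext t
    rw [map_add, PowerSeries.coeff_C_mul, PowerSeries.coeff_mul_C, h, PowerSeries.coeff_C_mul,
      PowerSeries.coeff_X_pow, mul_ite, mul_one, mul_zero]
  have hla : Commute (PowerSeries.C l * PowerSeries.X ^ r) a := by
    refine Commute.mul_left ?_ (PowerSeries.commute_X_pow _ _).symm
    ext t
    rw [PowerSeries.coeff_C_mul, PowerSeries.coeff_mul_C, (hl t).eq]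
  -- Since the commutator `l x^r` commutes with `a`, commuting with `C x` acts on powers of `a` like
  -- a derivation with constant value.
  have h2 : ∀ n : ℕ, PowerSeries.C x * a ^ (n + 1) = a ^ (n + 1) * PowerSeries.C x +
      ((n : PowerSeries R) + 1) * (PowerSeries.C l * (PowerSeries.X ^ r * a ^ n)) := by
    intro n
    induction n with
    | zero => simp [h1]
    | succ n ih =>
      rw [pow_succ a (n + 1), ← mul_assoc, ih, add_mul, mul_assoc, h1, mul_add, ← mul_assoc,
        ← (hla.pow_right (n + 1)).eq]
      push_cast
      simp only [mul_assoc, pow_succ a n]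
      noncomm_ring
  ext k
  have h3 : ∀ n : ℕ, x * PowerSeries.coeff k (a ^ (n + 1)) =
      PowerSeries.coeff k (a ^ (n + 1)) * x +
        ((n : ℂ) + 1) • (l * PowerSeries.coeff k (PowerSeries.X ^ r * a ^ n)) := by
    intro n
    have := congrArg (PowerSeries.coeff k) (h2 n)
    have e : ((n : PowerSeries R) + 1) = PowerSeries.C ((n : R) + 1) := by simp
    rw [PowerSeries.coeff_C_mul, map_add, PowerSeries.coeff_mul_C, e, PowerSeries.coeff_C_mul,
      PowerSeries.coeff_C_mul] at this
    rw [this, Algebra.smul_def]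
    simp
  -- As `r ≥ 1`, only coefficients of `expSeries a` below degree `k` enter, so `range k` suffices.
  -- This is the range left over after the `n = 0` term is split off on the other side.
  have h4 : PowerSeries.coeff k (PowerSeries.X ^ r * expSeries a) = ∑ n ∈ range k,
      ((n.factorial : ℂ)⁻¹) • PowerSeries.coeff k (PowerSeries.X ^ r * a ^ n) := by
    simp only [PowerSeries.coeff_X_pow_mul']
    split_ifs with hk
    · exact coeff_expSeries_of_lt ha0 (by omega)
    · simp
  rw [map_add, PowerSeries.coeff_C_mul, PowerSeries.coeff_mul_C, PowerSeries.coeff_C_mul, h4,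
    coeff_expSeries_of_lt ha0 (Nat.lt_succ_self k), sum_range_succ', mul_add, add_mul, mul_sum,
    sum_mul, mul_sum]
  have h5 : x * ((Nat.factorial 0 : ℂ)⁻¹ • PowerSeries.coeff k (a ^ 0)) =
      ((Nat.factorial 0 : ℂ)⁻¹ • PowerSeries.coeff k (a ^ 0)) * x := by
    rw [pow_zero, PowerSeries.coeff_one]
    split_ifs <;> simp
  rw [h5, add_right_comm, ← sum_add_distrib]
  congr 1
  refine sum_congr rfl fun n _ => ?_
  rw [mul_smul_comm, h3, smul_add, smul_mul_assoc, smul_smul, mul_smul_comm]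
  congr 2
  rw [Nat.factorial_succ]
  push_cast
  have : (n : ℂ) + 1 ≠ 0 := by exact_mod_cast Nat.succ_ne_zero n
  have : (n.factorial : ℂ) ≠ 0 := by exact_mod_cast n.factorial_ne_zero
  field_simp

/-- Multiplication of the generating series by `x^r` becomes the shift of the current by `r`; for `n
< r` the shifted coefficient is zero, in agreement with the vanishing of `posCurrent` at negative
indices. -/
theorem commutator_posCurrent_exp {a : PowerSeries R} {p x l : R} {r : ℕ} (hr : r ≠ 0)
    (ha0 : PowerSeries.coeff 0 a = 0) (hl : ∀ t, Commute l (PowerSeries.coeff t a))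
    (hxp : Commute x p) (hlp : Commute l p)
    (h : ∀ t, x * PowerSeries.coeff t a = PowerSeries.coeff t a * x + if t = r then l else 0)
    (n : ℤ) : x * posCurrent (PowerSeries.C p * expSeries a) n =
      posCurrent (PowerSeries.C p * expSeries a) n * x +
        l * posCurrent (PowerSeries.C p * expSeries a) (n - r) := by
  have h1 := congrArg (PowerSeries.coeff n.toNat) (commutator_expSeries hr ha0 hl h)
  rw [PowerSeries.coeff_C_mul, map_add, PowerSeries.coeff_mul_C, PowerSeries.coeff_C_mul,
    PowerSeries.coeff_X_pow_mul'] at h1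
  simp only [posCurrent, PowerSeries.coeff_C_mul]
  rcases lt_or_ge n 0 with hn | hn
  · simp [show ¬ 0 ≤ n by omega, show ¬ (r : ℤ) ≤ n by omega]
  · rw [if_pos hn, ← mul_assoc, hxp.eq, mul_assoc, h1, mul_add, mul_assoc]
    congr 1
    rw [← mul_assoc, ← hlp.eq, mul_assoc]
    by_cases h2 : 0 ≤ n - r
    · rw [if_pos h2, if_pos (by omega), show (n - r).toNat = n.toNat - r by omega]
    · rw [if_neg h2, if_neg (by omega), mul_zero]

theorem commutator_negCurrent_exp {a : PowerSeries R} {p x l : R} {r : ℕ} (hr : r ≠ 0)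
    (ha0 : PowerSeries.coeff 0 a = 0) (hl : ∀ t, Commute l (PowerSeries.coeff t a))
    (hxp : Commute x p) (hlp : Commute l p)
    (h : ∀ t, x * PowerSeries.coeff t a = PowerSeries.coeff t a * x + if t = r then l else 0)
    (n : ℤ) : x * negCurrent (PowerSeries.C p * expSeries a) n =
      negCurrent (PowerSeries.C p * expSeries a) n * x +
        l * negCurrent (PowerSeries.C p * expSeries a) (n + r) := by
  simp only [negCurrent_eq]
  rw [commutator_posCurrent_exp hr ha0 hl hxp hlp h, neg_add, sub_eq_add_neg]

/-- The exchange relation between `exp (a)` and a current, for two quadratic factors. -/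
theorem quadDist_quadDist_exchange {T T' : ℂ} {s : PowerSeries ℂ}
    (hs0 : PowerSeries.coeff 0 s = 0) (hq : quadSeries T * expSeries s = quadSeries T')
    {a : PowerSeries R} {p : R} {c : Rˣ} {B : ℤ → R} (ha0 : PowerSeries.coeff 0 a = 0)
    (ha : CoeffComm a a) (hac : ∀ n, Commute (PowerSeries.coeff n a) (c : R))
    (hpc : Commute p (c : R)) (hpB : ∀ n, Commute p (B n))
    (h : ∀ r n, PowerSeries.coeff r a * B n = B n * PowerSeries.coeff r a +
      (PowerSeries.coeff r (substMul ((c⁻¹ : Rˣ) : R) s) -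
        PowerSeries.coeff r (substMul (c : R) s)) * B (n + r)) :
    quadDist T 1 ((c⁻¹ : Rˣ) : R) (quadDist T' 1 (c : R)
        (prodZW (posCurrent (PowerSeries.C p * expSeries a)) B)) =
      quadDist T' 1 ((c⁻¹ : Rˣ) : R) (quadDist T 1 (c : R)
        (prodWZ B (posCurrent (PowerSeries.C p * expSeries a)))) := by
  have hcc : Commute (c : R) ((c⁻¹ : Rˣ) : R) := (Commute.refl _).units_inv_right
  have hac' : ∀ n, Commute (PowerSeries.coeff n a) ((c⁻¹ : Rˣ) : R) :=
    fun n => (hac n).units_inv_right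
  have h0 : ∀ u : R, PowerSeries.coeff 0 (substMul u s) = 0 := fun u => by
    rw [coeff_substMul, hs0, zero_smul]
  have h0' : PowerSeries.coeff 0 (-substMul (c : R) s) = 0 := by rw [map_neg, h0, neg_zero]
  -- The commutator has one part at `c⁻¹` and one at `c`, so the exchange function is the product of
  -- `exp (s)(c⁻¹ x)` and `exp (-s)(c x)`.
  set l := substMul ((c⁻¹ : Rˣ) : R) s + -substMul (c : R) s with hl
  have hll : ∀ b : PowerSeries R, CoeffComm (substMul ((c⁻¹ : Rˣ) : R) s) b →
      CoeffComm (substMul (c : R) s) b → CoeffComm l b := fun b h1 h2 => h1.add_left h2.neg_left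
  have h1 : CoeffComm (substMul ((c⁻¹ : Rˣ) : R) s) (substMul ((c⁻¹ : Rˣ) : R) s) :=
    coeffComm_substMul (Commute.refl _) s s
  have h2 : CoeffComm (substMul (c : R) s) (substMul (c : R) s) :=
    coeffComm_substMul (Commute.refl _) s s
  have h3 : CoeffComm (substMul (c : R) s) (substMul ((c⁻¹ : Rˣ) : R) s) :=
    coeffComm_substMul hcc s s
  have hlc : CoeffComm l l :=
    hll l (hll _ h1 h3).symm (hll _ h3.symm h2).symm
  have hal : CoeffComm a l :=
    (hll a (coeffComm_substMul_right hac' s).symm (coeffComm_substMul_right hac s).symm).symm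
  have key := expSeries_conj (l := l) (B := B) ha0 ha (by rw [hl, map_add, h0, h0', add_zero]) hlc hal
    (fun r n => by rw [h, hl, map_add, map_neg, sub_eq_add_neg])
  have e1 : expSeries l = substMul ((c⁻¹ : Rˣ) : R) (expSeries s) *
      substMul (c : R) (expSeries (-s)) := by
    rw [hl, expSeries_add (h0 _) h0' h1 h2.neg_left.symm.neg_left h3.symm.symm.neg_left.symm,
      substMul_expSeries, substMul_expSeries, substMul_neg]
  have hpl : ∀ n, Commute p (PowerSeries.coeff n (expSeries l)) := by
    intro n
    rw [e1, PowerSeries.coeff_mul]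
    exact Commute.sum_right _ _ _ fun q _ =>
      (commute_substMul hpc.units_inv_right _ _).mul_right (commute_substMul hpc _ _)
  have key2 := conj_C_mul hpB hpl key
  have hq' : quadSeries T' * expSeries (-s) = quadSeries T := by
    rw [← hq, mul_assoc, expSeries_mul_neg hs0 (coeffComm_of_comm _ _), mul_one]
  have hT : ∀ (T T' : ℂ) (F : ℕ → ℤ → R), quadDist T 1 ((c⁻¹ : Rˣ) : R)
      (quadDist T' 1 (c : R) (posDist F)) = fun m n =>
      posDist (act (substMul ((c⁻¹ : Rˣ) : R) (quadSeries T) *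
        substMul (c : R) (quadSeries T')) F) (m + 2 + 2) n := by
    intro T T' F
    have : quadDist T' 1 (c : R) (posDist F) = fun m n =>
        posDist (act (substMul (c : R) (quadSeries T')) F) (m + 2) n := by
      ext m n
      rw [quadDist_posDist]
    rw [this]
    ext m n
    rw [act_mul, ← quadDist_posDist]
    simp only [quadDist]
    rw [show m + 1 + 2 = m + 2 + 1 by ring]
  rw [prodZW_posCurrent, prodWZ_posCurrent, hT, hT, key2, ← act_mul, e1]
  -- The factors at `c` and at `c⁻¹` commute, so each quadratic series can be placed beside its own
  -- exponential: at `c⁻¹` the form with `T` becomes that with `T'`, and at `c` the reverse.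
  have e2 : Commute (substMul (c : R) (quadSeries T')) (substMul ((c⁻¹ : Rˣ) : R) (expSeries s)) :=
    (coeffComm_substMul hcc _ _).commute
  rw [mul_assoc (substMul _ _), ← mul_assoc (substMul (c : R) _), e2.eq, mul_assoc, ← substMul_mul,
    ← mul_assoc, ← substMul_mul, hq, hq']

end Exchange

end

section

/-! ### Calculus of locally finite sums of operators -/

section LocallyFinite

variable {V : Type*} [AddCommGroup V] [Module ℂ V] {ι κ : Type*}

/-- Only finitely many members of the family are nonzero on a given vector. -/
def LocFin (T : ι → Module.End ℂ V) : Prop := ∀ v, (Function.support fun r => T r v).Finite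

/-- For other families `locSum` is zero by convention, so local finiteness has to be established
before a sum can be evaluated. -/
theorem locSum_apply {T : ι → Module.End ℂ V} (h : LocFin T) (v : V) :
    locSum T v = ∑ᶠ r, T r v := by
  have h' : ∀ v, (Function.support fun r => T r v).Finite := h
  rw [locSum, dif_pos h']
  rfl

theorem LocFin.mul_left {T : ι → Module.End ℂ V} (h : LocFin T) (a : Module.End ℂ V) :
    LocFin fun r => a * T r := fun v => (h v).subset fun r hr h0 => hr (by
      simp only [Module.End.mul_apply, h0, map_zero])

theorem LocFin.mul_right {T : ι → Module.End ℂ V} (h : LocFin T) (a : Module.End ℂ V) :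
    LocFin fun r => T r * a := fun v => h (a v)

theorem LocFin.add {T T' : ι → Module.End ℂ V} (h : LocFin T) (h' : LocFin T') :
    LocFin fun r => T r + T' r := fun v => ((h v).union (h' v)).subset
      (Function.support_add (fun r => T r v) fun r => T' r v)

theorem LocFin.smul {T : ι → Module.End ℂ V} (h : LocFin T) (c : ℂ) :
    LocFin fun r => c • T r := fun v => (h v).subset fun r hr h0 => hr (by
      simp only [LinearMap.smul_apply, h0, smul_zero])

theorem LocFin.comp {T : ι → Module.End ℂ V} (h : LocFin T) {e : κ → ι}
    (he : Function.Injective e) : LocFin fun r => T (e r) := fun v =>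
  (h v).preimage he.injOn

theorem mul_locSum {T : ι → Module.End ℂ V} (h : LocFin T) (a : Module.End ℂ V) :
    a * locSum T = locSum fun r => a * T r := by
  ext v
  rw [Module.End.mul_apply, locSum_apply h, locSum_apply (h.mul_left a)]
  exact AddMonoidHom.map_finsum a.toAddMonoidHom (h v)

theorem locSum_mul {T : ι → Module.End ℂ V} (h : LocFin T) (a : Module.End ℂ V) :
    locSum T * a = locSum fun r => T r * a := by
  ext v
  rw [Module.End.mul_apply, locSum_apply h, locSum_apply (h.mul_right a)]
  rfl

theorem locSum_add {T T' : ι → Module.End ℂ V} (h : LocFin T) (h' : LocFin T') :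
    (locSum fun r => T r + T' r) = locSum T + locSum T' := by
  ext v
  rw [LinearMap.add_apply, locSum_apply h, locSum_apply h', locSum_apply (h.add h')]
  exact finsum_add_distrib (h v) (h' v)

theorem locSum_smul {T : ι → Module.End ℂ V} (h : LocFin T) (c : ℂ) :
    (locSum fun r => c • T r) = c • locSum T := by
  ext v
  rw [LinearMap.smul_apply, locSum_apply h, locSum_apply (h.smul c)]
  exact (smul_finsum' c (h v)).symm

theorem locSum_zero : locSum (fun _ : ι => (0 : Module.End ℂ V)) = 0 := by
  ext v
  rw [locSum_apply (fun v => by simp)]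
  simp

theorem locSum_comp_equiv {T : ι → Module.End ℂ V} (h : LocFin T) (e : κ ≃ ι) :
    (locSum fun r => T (e r)) = locSum T := by
  ext v
  rw [locSum_apply h, locSum_apply (h.comp e.injective)]
  exact finsum_comp_equiv e (f := fun r => T r v)

theorem locSum_eq_sum {T : ι → Module.End ℂ V} {S : Finset ι} (h : ∀ r, r ∉ S → T r = 0) :
    locSum T = ∑ r ∈ S, T r := by
  have h1 : ∀ v, (Function.support fun r => T r v) ⊆ S := fun v r hr => by
    by_contra h2
    exact hr (by simp only [h r h2, LinearMap.zero_apply])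
  ext v
  rw [locSum_apply (fun v => S.finite_toSet.subset (h1 v)),
    finsum_eq_sum_of_support_subset _ (h1 v), LinearMap.sum_apply]

theorem LocFin.fst {T : ι × κ → Module.End ℂ V} (h : LocFin T) (i : ι) :
    LocFin fun j => T (i, j) := h.comp (Prod.mk_right_injective i)

theorem LocFin.locSum_snd {T : ι × κ → Module.End ℂ V} (h : LocFin T) :
    LocFin fun i => locSum fun j => T (i, j) := by
  intro v
  refine ((h v).image Prod.fst).subset fun i hi => ?_
  by_contra h1
  refine hi ?_
  dsimp only
  rw [locSum_apply (h.fst i)]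
  refine finsum_eq_zero_of_forall_eq_zero fun j => ?_
  by_contra h2
  exact h1 ⟨(i, j), h2, rfl⟩

theorem locSum_prod {T : ι × κ → Module.End ℂ V} (h : LocFin T) :
    locSum T = locSum fun i => locSum fun j => T (i, j) := by
  ext v
  rw [locSum_apply h, locSum_apply h.locSum_snd, finsum_curry (fun p => T p v) (h v)]
  exact finsum_congr fun i => (locSum_apply (h.fst i) v).symm

/-- `b(z) v` is bounded in powers of `z⁻¹`, for each vector `v`. -/
def IsField (b : ℤ → Module.End ℂ V) : Prop := ∀ v, ∃ N : ℤ, ∀ k > N, b k v = 0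

theorem IsField.mul_left {b : ℤ → Module.End ℂ V} (h : IsField b)
    (a : ℤ → Module.End ℂ V) : IsField fun n => a n * b n := fun v => by
  obtain ⟨N, hN⟩ := h v
  exact ⟨N, fun k hk => by simp [hN k hk]⟩

/-- The summands of `a(z) b(z)`. -/
def LocFinMul (a b : ℤ → Module.End ℂ V) : Prop := ∀ n : ℤ, LocFin fun k : ℤ => a (n - k) * b k

/-- A series in `z` forces `k ≥ n`, and the field property bounds `k` from above on a given vector;
a finite interval remains. -/
theorem IsField.locFinMul_neg {b : ℤ → Module.End ℂ V} (h : IsField b)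
    (P : PowerSeries (Module.End ℂ V)) : LocFinMul (negCurrent P) b := by
  intro n v
  obtain ⟨N, hN⟩ := h v
  refine (Set.finite_Icc n N).subset fun k hk => ?_
  by_contra h1
  apply hk
  rcases lt_or_ge N k with h2 | h2
  · simp [hN k h2]
  · have : ¬ (n - k ≤ 0) := fun h3 => h1 ⟨by omega, h2⟩
    simp only [negCurrent, if_neg this, zero_mul, LinearMap.zero_apply]

/-- Here the right factor provides both bounds: it has no negative modes and its high modes kill the
vector. Nothing is required of the left factor. -/
theorem IsField.locFinMul_pos {b : ℤ → Module.End ℂ V} (h : IsField b)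
    (hb : ∀ k < 0, b k = 0) (a : ℤ → Module.End ℂ V) : LocFinMul a b := by
  intro n v
  obtain ⟨N, hN⟩ := h v
  refine (Set.finite_Icc 0 N).subset fun k hk => ?_
  by_contra h1
  apply hk
  rcases lt_or_ge N k with h2 | h2
  · simp [hN k h2]
  · have : k < 0 := by
      by_contra h3
      exact h1 ⟨by omega, h2⟩
    simp [hb k this]

/-- An element with given commutators with `a(z)` and `b(z)` has the sum of these as its
commutator with `a(z) b(z)`. -/
theorem commutator_locMul {a b : ℤ → Module.End ℂ V} (h : LocFinMul a b) {x l l' : Module.End ℂ V}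
    {r : ℤ} (ha : ∀ n, x * a n = a n * x + l * a (n + r))
    (hb : ∀ n, x * b n = b n * x + l' * b (n + r)) (hl : ∀ n, Commute l' (a n)) (n : ℤ) :
    x * locMul a b n = locMul a b n * x + (l + l') * locMul a b (n + r) := by
  have h1 : locMul a b (n + r) = locSum fun k => a (n - k) * b (k + r) := by
    rw [locMul, ← locSum_comp_equiv (h (n + r)) (Equiv.addRight r)]
    simp only [Equiv.coe_addRight, add_sub_add_right_eq_sub]
  have h1f : LocFin fun k => a (n - k) * b (k + r) := by
    have := (h (n + r)).comp (Equiv.addRight r).injective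
    simpa only [Equiv.coe_addRight, add_sub_add_right_eq_sub] using this
  have h2 : locMul a b (n + r) = locSum fun k => a (n - k + r) * b k := by
    rw [locMul]
    simp only [add_sub_right_comm]
  have h2f : LocFin fun k => a (n - k + r) * b k := by
    have := h (n + r)
    simpa only [add_sub_right_comm] using this
  have h3 : l' * locMul a b (n + r) = locSum fun k => l' * (a (n - k) * b (k + r)) := by
    rw [h1, mul_locSum h1f]
  rw [add_mul, h3, h2, mul_locSum h2f, locMul, mul_locSum (h n), locSum_mul (h n), ← locSum_add,
    ← locSum_add]
  · congr 1
    ext1 k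
    rw [← mul_assoc, ha, add_mul, mul_assoc, hb, mul_add, ← mul_assoc (a (n - k)) l', ← (hl _).eq]
    simp only [mul_assoc]
    abel
  · exact (h n).mul_right x
  · exact (h2f.mul_left l).add (h1f.mul_left l')
  · exact h2f.mul_left l
  · exact h1f.mul_left l'

theorem commute_locMul {a b : ℤ → Module.End ℂ V} (h : LocFinMul a b) {x : Module.End ℂ V}
    (ha : ∀ n, Commute x (a n)) (hb : ∀ n, Commute x (b n)) (n : ℤ) :
    Commute x (locMul a b n) := by
  rw [commute_iff_eq, locMul, mul_locSum (h n), locSum_mul (h n)]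
  congr 1
  ext1 k
  exact ((ha _).mul_right (hb _)).eq

end LocallyFinite

/-! ### The logarithm of the structure function `ω` -/

section VectorCommutators

variable {V : Type*} [AddCommGroup V] [Module ℂ V] (L : Fin 3 → ℂ)

/-- `∑_{r ≥ 1} (1 - q_2^r)(1 - q_3^r) x^r / r`, when `q_1 q_2 q_3 = 1`. -/
def omegaLogP : PowerSeries ℂ :=
  (negLog 1 + negLog (q L 1 * q L 2)) + (-negLog (q L 1) + -negLog (q L 2))

/-- `∑_{r ≥ 1} (1 - q_2^{-r})(1 - q_3^{-r}) x^r / r`. -/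
def omegaLogM : PowerSeries ℂ :=
  (negLog 1 + negLog ((q L 1)⁻¹ * (q L 2)⁻¹)) + (-negLog (q L 1)⁻¹ + -negLog (q L 2)⁻¹)

/-- Each `exp (negLog a)` is inverse to `1 - a x`. The three rational functions that occur, `ω⁺`,
`ω⁻` and the ratio in (R2) for neighbouring indices, are all reduced to this identity. -/
theorem exp_sum_negLog (a b c d : ℂ) :
    expSeries ((negLog a + negLog b) + (-negLog c + -negLog d)) *
      ((1 - PowerSeries.C a * PowerSeries.X) * (1 - PowerSeries.C b * PowerSeries.X)) =
      (1 - PowerSeries.C c * PowerSeries.X) * (1 - PowerSeries.C d * PowerSeries.X) := by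
  rw [expSeries_add, expSeries_add, expSeries_add, ← expSeries_neg_negLog a,
    ← expSeries_neg_negLog b, expSeries_neg_negLog c, expSeries_neg_negLog d]
  · have e1 := expSeries_mul_neg (coeff_zero_negLog a) (coeffComm_of_comm _ _)
    have e2 := expSeries_mul_neg (coeff_zero_negLog b) (coeffComm_of_comm _ _)
    linear_combination ((1 - PowerSeries.C c * PowerSeries.X) *
      (1 - PowerSeries.C d * PowerSeries.X) * expSeries (negLog b) * expSeries (-negLog b)) * e1 +
      ((1 - PowerSeries.C c * PowerSeries.X) * (1 - PowerSeries.C d * PowerSeries.X)) * e2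
  all_goals first
    | exact coeffComm_of_comm _ _
    | simp only [map_add, map_neg, coeff_zero_negLog, neg_zero, add_zero]

theorem omegaP_eq : omegaP L = expSeries (omegaLogP L) := by
  rw [omegaP, eq_comm, PowerSeries.eq_mul_inv_iff_mul_eq (by simp)]
  have h := exp_sum_negLog 1 (q L 1 * q L 2) (q L 1) (q L 2)
  rwa [map_one, one_mul] at h

theorem q_ne_zero (i : Fin 3) : q L i ≠ 0 := Complex.exp_ne_zero _

/-- Factoring out the constants, `x - A = -A (1 - A⁻¹ x)`, brings the expansion at infinity to the
form of `exp_sum_negLog` with inverse parameters; the constants of numerator and denominator cancel.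
-/
theorem omegaM_eq : omegaM L = expSeries (omegaLogM L) := by
  have h1 := q_ne_zero L 1
  have h2 := q_ne_zero L 2
  rw [omegaM, eq_comm, PowerSeries.eq_mul_inv_iff_mul_eq (by simp [h1, h2])]
  have h := exp_sum_negLog 1 ((q L 1)⁻¹ * (q L 2)⁻¹) (q L 1)⁻¹ (q L 2)⁻¹
  rw [map_one, one_mul, map_mul] at h
  have e1 : PowerSeries.C (q L 1) * PowerSeries.C (q L 1)⁻¹ = 1 := by
    rw [← map_mul, mul_inv_cancel₀ h1, map_one]
  have e2 : PowerSeries.C (q L 2) * PowerSeries.C (q L 2)⁻¹ = 1 := by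
    rw [← map_mul, mul_inv_cancel₀ h2, map_one]
  change expSeries (omegaLogM L) * _ = _ at h
  rw [map_mul]
  set A := PowerSeries.C (q L 1)
  set B := PowerSeries.C (q L 2)
  set A' := PowerSeries.C (q L 1)⁻¹
  set B' := PowerSeries.C (q L 2)⁻¹
  set X : PowerSeries ℂ := PowerSeries.X
  have k1 : X - A = -A * (1 - A' * X) := by linear_combination (-X) * e1
  have k2 : X - B = -B * (1 - B' * X) := by linear_combination (-X) * e2
  have k3 : X - A * B = -(A * B) * (1 - A' * B' * X) := by
    linear_combination (-X) * (B * B') * e1 - X * e2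
  rw [k1, k2, k3]
  linear_combination (A * B) * h

theorem coeff_zero_omegaLogP : PowerSeries.coeff 0 (omegaLogP L) = 0 := by
  simp only [omegaLogP, map_add, map_neg, coeff_zero_negLog, neg_zero, add_zero]

theorem coeff_zero_omegaLogM : PowerSeries.coeff 0 (omegaLogM L) = 0 := by
  simp only [omegaLogM, map_add, map_neg, coeff_zero_negLog, neg_zero, add_zero]

end VectorCommutators

end

section

/-! ### Logarithms of `ψ^±` -/

namespace GL1Data

section Logarithms

variable {R : Type*} [Ring R] [Algebra ℂ R] (L : Fin 3 → ℂ) (T : GL1Data R)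

/-- `log (ψ_0⁻¹ ψ⁺(z))`. -/
def psiLogP : PowerSeries R :=
  PowerSeries.mk fun r => if r = 0 then 0 else kappa L r • T.h r

/-- `log (ψ_0 ψ⁻(z))`. -/
def psiLogM : PowerSeries R :=
  PowerSeries.mk fun r => if r = 0 then 0 else kappa L r • T.h (-(r : ℤ))

theorem coeff_zero_psiLogP : PowerSeries.coeff 0 (T.psiLogP L) = 0 := by
  rw [psiLogP, PowerSeries.coeff_mk, if_pos rfl]

theorem coeff_zero_psiLogM : PowerSeries.coeff 0 (T.psiLogM L) = 0 := by
  rw [psiLogM, PowerSeries.coeff_mk, if_pos rfl]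

variable {L T}

theorem h_mem_gens {S : Type*} [Ring S] {T : GL1Data S} (r : ℤ) : T.h r ∈ T.gens := Or.inl (Or.inr ⟨r, rfl⟩)

theorem commute_psiLogP {x : R} (h : ∀ y ∈ T.gens, Commute x y) (k : ℕ) :
    Commute x (PowerSeries.coeff k (T.psiLogP L)) := by
  rw [psiLogP, PowerSeries.coeff_mk]
  split_ifs
  · exact Commute.zero_right _
  · exact (h _ (h_mem_gens _)).smul_right _

theorem commute_psiLogM {x : R} (h : ∀ y ∈ T.gens, Commute x y) (k : ℕ) :
    Commute x (PowerSeries.coeff k (T.psiLogM L)) := by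
  rw [psiLogM, PowerSeries.coeff_mk]
  split_ifs
  · exact Commute.zero_right _
  · exact (h _ (h_mem_gens _)).smul_right _

theorem Relations.commute_h (hT : T.Relations L) {r t : ℤ} (h : r + t ≠ 0) :
    Commute (T.h r) (T.h t) := by
  rcases eq_or_ne r 0 with rfl | hr
  · rw [hT.h_zero]
    exact Commute.zero_left _
  rcases eq_or_ne t 0 with rfl | ht
  · rw [hT.h_zero]
    exact Commute.zero_right _
  exact sub_eq_zero.1 ((hT.h_h r t hr ht).trans (if_neg h))

theorem Relations.coeffComm_psiLogP (hT : T.Relations L) :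
    CoeffComm (T.psiLogP L) (T.psiLogP L) := by
  intro i j
  simp only [psiLogP, PowerSeries.coeff_mk]
  split_ifs with h1 h2
  · exact Commute.zero_left _
  · exact Commute.zero_left _
  · exact Commute.zero_right _
  · exact ((hT.commute_h (by omega)).smul_left _).smul_right _

theorem Relations.coeffComm_psiLogM (hT : T.Relations L) :
    CoeffComm (T.psiLogM L) (T.psiLogM L) := by
  intro i j
  simp only [psiLogM, PowerSeries.coeff_mk]
  split_ifs with h1 h2
  · exact Commute.zero_left _
  · exact Commute.zero_left _
  · exact Commute.zero_right _
  · exact ((hT.commute_h (by omega)).smul_left _).smul_right _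

end Logarithms

end GL1Data

/-! ### Commutators of the Heisenberg modes with vector currents -/

section VectorCommutators

variable {V : Type*} [AddCommGroup V] [Module ℂ V] {L : Fin 3 → ℂ}
  {T : GL1Data (Module.End ℂ V)} {p : ℂ} {X Y Y' : ℤ → Module.End ℂ V}

theorem locSum_nat {S : ℕ → Module.End ℂ V} {k : ℕ} (h : ∀ r > k, S r = 0) :
    locSum S = ∑ u ∈ antidiagonal k, S u.1 := by
  rw [Nat.sum_antidiagonal_eq_sum_range_succ_mk]
  exact locSum_eq_sum fun r hr => h r (by simpa using hr)

theorem units_zpow_neg_natCast (c : (Module.End ℂ V)ˣ) (r : ℕ) :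
    ((c ^ (-(r : ℤ)) : (Module.End ℂ V)ˣ) : Module.End ℂ V) =
      ((c⁻¹ : (Module.End ℂ V)ˣ) : Module.End ℂ V) ^ r := by
  rw [zpow_neg, zpow_natCast, ← inv_pow, Units.val_pow_eq_pow_val]

/-- `ψ⁺` has no negative modes, so the infinite sum over `r` stops at `r = k` and becomes a finite
convolution. The argument `p / C` of `ω⁺` appears as the substituted element. -/
theorem LeftVector.conj_psiP (h : LeftVector L T p X Y Y') :
    seriesCur (PowerSeries.C (T.psi0 : Module.End ℂ V) * expSeries (T.psiLogP L)) X =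
      act (substMul (p • ((T.C⁻¹ : (Module.End ℂ V)ˣ) : Module.End ℂ V)) (omegaP L))
        (curSeries X (PowerSeries.C (T.psi0 : Module.End ℂ V) * expSeries (T.psiLogP L))) := by
  ext1 k
  ext1 n
  have h1 := h.psiP_X k n
  have h2 : ∀ m, T.psiP L m =
    posCurrent (PowerSeries.C (T.psi0 : Module.End ℂ V) * expSeries (T.psiLogP L)) m :=
    fun _ => rfl
  simp only [h2] at h1
  generalize PowerSeries.C (T.psi0 : Module.End ℂ V) * expSeries (T.psiLogP L) = P at h1 ⊢
  rw [locSum_nat (k := k)] at h1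
  · rw [posCurrent, if_pos (by omega), Int.toNat_natCast] at h1
    rw [seriesCur, h1, act]
    refine sum_congr rfl fun u hu => ?_
    rw [← HasAntidiagonal.mem_antidiagonal.1 hu, posCurrent, if_pos (by omega), coeff_substMul,
      curSeries, smul_pow, smul_smul, smul_mul_assoc, units_zpow_neg_natCast,
      show (((u.1 + u.2 : ℕ) : ℤ) - u.1).toNat = u.2 by omega]
  · intro r hr
    rw [posCurrent, if_neg (by omega), mul_zero, mul_zero, smul_zero]

/-- Both indices are reflected, so that `ψ⁻`, a series in positive powers, can be treated by the
same one-sided formalism. -/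
theorem LeftVector.conj_psiM (h : LeftVector L T p X Y Y') :
    seriesCur (PowerSeries.C ((T.psi0⁻¹ : (Module.End ℂ V)ˣ) : Module.End ℂ V) *
        expSeries (T.psiLogM L)) (fun n => X (-n)) =
      act (substMul (p⁻¹ • (1 : Module.End ℂ V)) (omegaM L))
        (curSeries (fun n => X (-n)) (PowerSeries.C ((T.psi0⁻¹ : (Module.End ℂ V)ˣ) :
          Module.End ℂ V) * expSeries (T.psiLogM L))) := by
  ext1 k
  ext1 n
  have h1 := h.psiM_X (-k) (-n)
  have h2 : ∀ m, T.psiM L m =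
    negCurrent (PowerSeries.C ((T.psi0⁻¹ : (Module.End ℂ V)ˣ) : Module.End ℂ V) *
      expSeries (T.psiLogM L)) m := fun _ => rfl
  simp only [h2] at h1
  generalize PowerSeries.C ((T.psi0⁻¹ : (Module.End ℂ V)ˣ) : Module.End ℂ V) *
    expSeries (T.psiLogM L) = P at h1 ⊢
  rw [locSum_nat (k := k)] at h1
  · rw [negCurrent, if_pos (by omega), neg_neg, Int.toNat_natCast] at h1
    rw [seriesCur, h1, act]
    refine sum_congr rfl fun u hu => ?_
    rw [← HasAntidiagonal.mem_antidiagonal.1 hu, negCurrent, if_pos (by omega), coeff_substMul,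
      curSeries, smul_pow, smul_smul, smul_mul_assoc, one_pow, one_mul, zpow_neg, zpow_natCast,
      inv_pow, show (-(-((u.1 + u.2 : ℕ) : ℤ) + u.1)).toNat = u.2 by omega, neg_add,
      sub_eq_add_neg]
  · intro r hr
    rw [negCurrent, if_neg (by omega), mul_zero, smul_zero]

/-- In this relation `X` stands to the left of `ψ`, so `ω` acts on `seriesCur`; `act_inverse` later
brings it to the form of the `X⁺` case, at the cost of the sign of the logarithm. -/
theorem RightVector.conj_psiP (h : RightVector L T p X Y Y') :
    curSeries X (PowerSeries.C (T.psi0 : Module.End ℂ V) * expSeries (T.psiLogP L)) =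
      act (substMul (p • (1 : Module.End ℂ V)) (omegaP L))
        (seriesCur (PowerSeries.C (T.psi0 : Module.End ℂ V) * expSeries (T.psiLogP L)) X) := by
  ext1 k
  ext1 n
  have h1 := h.psiP_X k n
  have h2 : ∀ m, T.psiP L m =
    posCurrent (PowerSeries.C (T.psi0 : Module.End ℂ V) * expSeries (T.psiLogP L)) m :=
    fun _ => rfl
  simp only [h2] at h1
  generalize PowerSeries.C (T.psi0 : Module.End ℂ V) * expSeries (T.psiLogP L) = P at h1 ⊢
  rw [locSum_nat (k := k)] at h1
  · rw [posCurrent, if_pos (by omega), Int.toNat_natCast] at h1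
    rw [curSeries, h1, act]
    refine sum_congr rfl fun u hu => ?_
    rw [← HasAntidiagonal.mem_antidiagonal.1 hu, posCurrent, if_pos (by omega), coeff_substMul,
      seriesCur, smul_pow, smul_smul, smul_mul_assoc, one_pow, one_mul,
      show (((u.1 + u.2 : ℕ) : ℤ) - u.1).toNat = u.2 by omega]
  · intro r hr
    rw [posCurrent, if_neg (by omega), zero_mul, smul_zero]

theorem RightVector.conj_psiM (h : RightVector L T p X Y Y') :
    curSeries (fun n => X (-n)) (PowerSeries.C ((T.psi0⁻¹ : (Module.End ℂ V)ˣ) :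
        Module.End ℂ V) * expSeries (T.psiLogM L)) =
      act (substMul (p⁻¹ • (T.C : Module.End ℂ V)) (omegaM L))
        (seriesCur (PowerSeries.C ((T.psi0⁻¹ : (Module.End ℂ V)ˣ) : Module.End ℂ V) *
          expSeries (T.psiLogM L)) (fun n => X (-n))) := by
  ext1 k
  ext1 n
  have h1 := h.psiM_X (-k) (-n)
  have h2 : ∀ m, T.psiM L m =
    negCurrent (PowerSeries.C ((T.psi0⁻¹ : (Module.End ℂ V)ˣ) : Module.End ℂ V) *
      expSeries (T.psiLogM L)) m := fun _ => rfl
  simp only [h2] at h1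
  generalize PowerSeries.C ((T.psi0⁻¹ : (Module.End ℂ V)ˣ) : Module.End ℂ V) *
    expSeries (T.psiLogM L) = P at h1 ⊢
  rw [locSum_nat (k := k)] at h1
  · rw [negCurrent, if_pos (by omega), neg_neg, Int.toNat_natCast] at h1
    rw [curSeries, h1, act]
    refine sum_congr rfl fun u hu => ?_
    rw [← HasAntidiagonal.mem_antidiagonal.1 hu, negCurrent, if_pos (by omega), coeff_substMul,
      seriesCur, smul_pow, smul_smul, smul_mul_assoc, zpow_neg, zpow_natCast, zpow_natCast,
      inv_pow, show (-(-((u.1 + u.2 : ℕ) : ℤ) + u.1)).toNat = u.2 by omega, neg_add,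
      sub_eq_add_neg, Units.val_pow_eq_pow_val]
  · intro r hr
    rw [negCurrent, if_neg (by omega), zero_mul, mul_zero, smul_zero]

/-- The commutators of the coefficients of `a` with a current, from the exchange relation of
`p exp (a)`. -/
theorem commutator_of_conj {a : PowerSeries (Module.End ℂ V)} {c : (Module.End ℂ V)ˣ}
    {u : Module.End ℂ V} {l : PowerSeries ℂ} {B : ℤ → Module.End ℂ V}
    (ha0 : PowerSeries.coeff 0 a = 0) (ha : CoeffComm a a) (hl0 : PowerSeries.coeff 0 l = 0)
    (hau : ∀ n, Commute u (PowerSeries.coeff n a)) (hcu : Commute (c : Module.End ℂ V) u)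
    (h : seriesCur (PowerSeries.C (c : Module.End ℂ V) * expSeries a) B =
      act (substMul u (expSeries l))
        (curSeries B (PowerSeries.C (c : Module.End ℂ V) * expSeries a))) :
    (∀ n, Commute (c : Module.End ℂ V) (B n)) ∧ ∀ k n, PowerSeries.coeff k a * B n =
      B n * PowerSeries.coeff k a + PowerSeries.coeff k (substMul u l) * B (n + k) := by
  -- The lowest coefficient of the exchange relation shows that the constant term commutes with the
  -- current. This is how commutation of `ψ_0` with `X` is obtained, which is not among the assumed
  -- relations.
  have hc : ∀ n, Commute (c : Module.End ℂ V) (B n) := by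
    intro n
    have := congrFun (congrFun h 0) n
    rw [commute_iff_eq]
    simpa [seriesCur, curSeries, act, substMul, expSeries] using this
  refine ⟨hc, ?_⟩
  have h1 := conj_of_C_mul hc (commute_substMul hcu _) h
  rw [substMul_expSeries] at h1
  refine commutator_of_expSeries_conj ha0 ha ?_ (coeffComm_substMul (Commute.refl u) l l)
    (coeffComm_substMul_right (fun n => (hau n).symm) l) h1
  rw [coeff_substMul, hl0, zero_smul]

theorem act_inverse {u : Module.End ℂ V} {l : PowerSeries ℂ} (hl0 : PowerSeries.coeff 0 l = 0)
    {F F' : ℕ → ℤ → Module.End ℂ V} (h : F = act (substMul u (expSeries l)) F') :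
    F' = act (substMul u (expSeries (-l))) F := by
  rw [h, ← act_mul, ← substMul_mul, expSeries_neg_mul hl0 (coeffComm_of_comm _ _), substMul_one,
    act_one]

theorem LeftVector.commutator_P (h : LeftVector L T p X Y Y') (hT : T.Relations L) :
    (∀ n, Commute (T.psi0 : Module.End ℂ V) (X n)) ∧
    ∀ (k : ℕ) (n : ℤ), PowerSeries.coeff k (T.psiLogP L) * X n =
      X n * PowerSeries.coeff k (T.psiLogP L) + PowerSeries.coeff k (substMul
        (p • ((T.C⁻¹ : (Module.End ℂ V)ˣ) : Module.End ℂ V)) (omegaLogP L)) * X (n + k) := by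
  have hC : ∀ x ∈ T.gens, Commute ((T.C⁻¹ : (Module.End ℂ V)ˣ) : Module.End ℂ V) x :=
    fun x hx => (hT.C_central x hx).units_inv_left
  have h1 := h.conj_psiP
  rw [omegaP_eq] at h1
  exact commutator_of_conj (T.coeff_zero_psiLogP L) hT.coeffComm_psiLogP (coeff_zero_omegaLogP L)
    (fun n => (GL1Data.commute_psiLogP hC n).smul_left p)
    ((hC _ (Or.inr (Or.inr rfl))).symm.smul_right p) h1

theorem LeftVector.commutator_M (h : LeftVector L T p X Y Y') (hT : T.Relations L) (k : ℕ)
    (n : ℤ) : PowerSeries.coeff k (T.psiLogM L) * X n =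
      X n * PowerSeries.coeff k (T.psiLogM L) + PowerSeries.coeff k (substMul
        (p⁻¹ • (1 : Module.End ℂ V)) (omegaLogM L)) * X (n - k) := by
  have h1 := h.conj_psiM
  rw [omegaM_eq] at h1
  have h2 := (commutator_of_conj (T.coeff_zero_psiLogM L) hT.coeffComm_psiLogM
    (coeff_zero_omegaLogM L) (fun n => (Commute.one_left _).smul_left _)
    ((Commute.one_right _).smul_right _) h1).2 k (-n)
  rwa [neg_neg, neg_add, neg_neg, ← sub_eq_add_neg] at h2

theorem RightVector.commutator_P (h : RightVector L T p X Y Y') (hT : T.Relations L) :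
    (∀ n, Commute (T.psi0 : Module.End ℂ V) (X n)) ∧
    ∀ (k : ℕ) (n : ℤ), PowerSeries.coeff k (T.psiLogP L) * X n =
      X n * PowerSeries.coeff k (T.psiLogP L) + PowerSeries.coeff k (substMul
        (p • (1 : Module.End ℂ V)) (-omegaLogP L)) * X (n + k) := by
  have h1 := h.conj_psiP
  rw [omegaP_eq] at h1
  exact commutator_of_conj (T.coeff_zero_psiLogP L) hT.coeffComm_psiLogP
    (by rw [map_neg, coeff_zero_omegaLogP, neg_zero]) (fun n => (Commute.one_left _).smul_left _)
    ((Commute.one_right _).smul_right _) (act_inverse (coeff_zero_omegaLogP L) h1)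

theorem RightVector.commutator_M (h : RightVector L T p X Y Y') (hT : T.Relations L) (k : ℕ)
    (n : ℤ) : PowerSeries.coeff k (T.psiLogM L) * X n =
      X n * PowerSeries.coeff k (T.psiLogM L) + PowerSeries.coeff k (substMul
        (p⁻¹ • (T.C : Module.End ℂ V)) (-omegaLogM L)) * X (n - k) := by
  have h1 := h.conj_psiM
  rw [omegaM_eq] at h1
  have h2 := (commutator_of_conj (T.coeff_zero_psiLogM L) hT.coeffComm_psiLogM
    (by rw [map_neg, coeff_zero_omegaLogM, neg_zero])
    (fun n => (GL1Data.commute_psiLogM hT.C_central n).smul_left _)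
    ((hT.C_central _ (Or.inr (Or.inr rfl))).symm.units_inv_left.smul_right _)
    (act_inverse (coeff_zero_omegaLogM L) h1)).2 k (-n)
  rwa [neg_neg, neg_add, neg_neg, ← sub_eq_add_neg] at h2

end VectorCommutators

end

section

/-! ### The scalar `γ_r(τ)` and the parameters -/

section Scalars

variable (L : Fin 3 → ℂ)

/-- The coefficient in the commutator of the logarithm of `k_0⁺ ǩ_0⁺` with a vector current. -/
def gammaP (r : ℕ) (τ : ℂ) : ℂ :=
  (q L 0 ^ (-(r : ℤ)) - 1)⁻¹ * PowerSeries.coeff r (omegaLogP L) +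
    τ * (q (check L) 0 ^ (-(r : ℤ)) - 1)⁻¹ * PowerSeries.coeff r (omegaLogP (check L))

/-- The coefficient in the commutator of the logarithm of `k_0⁻ ǩ_0⁻` with a vector current. -/
def gammaM (r : ℕ) (τ : ℂ) : ℂ :=
  (q L 0 ^ r - 1)⁻¹ * PowerSeries.coeff r (omegaLogM L) +
    τ * (q (check L) 0 ^ r - 1)⁻¹ * PowerSeries.coeff r (omegaLogM (check L))

theorem q_check_zero : q (check L) 0 = (q L 0)⁻¹ := by
  simp [q, check, Complex.exp_neg]

theorem q_check_one : q (check L) 1 = q L 1 * q L 0 := by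
  simp [q, check, Complex.exp_add]

theorem q_check_two : q (check L) 2 = q L 2 * q L 0 := by
  simp [q, check, Complex.exp_add]

variable {L}

theorem q_prod (hsum : L 0 + L 1 + L 2 = 0) : q L 0 * q L 1 * q L 2 = 1 := by
  rw [q, q, q, ← Complex.exp_add, ← Complex.exp_add, hsum, Complex.exp_zero]

theorem s_sq : s L 0 ^ 2 = q L 0 := by
  rw [s, q, ← Complex.exp_nat_mul]
  congr 1
  push_cast
  ring

theorem s_ne_zero : s L 0 ≠ 0 := Complex.exp_ne_zero _

theorem check_sum (hsum : L 0 + L 1 + L 2 = 0) :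
    check L 0 + check L 1 + check L 2 = 0 := by
  simp only [check, Matrix.cons_val]
  linear_combination hsum

/-- In terms of the unchecked parameters the monomial is `q_1^{b-a} q_2^b`, an invertible change of
exponents. -/
theorem check_generic (hgen : ∀ a b : ℤ, q L 0 ^ a * q L 1 ^ b = 1 → a = 0 ∧ b = 0) (a b : ℤ)
    (h : q (check L) 0 ^ a * q (check L) 1 ^ b = 1) : a = 0 ∧ b = 0 := by
  have h0 := q_ne_zero L 0
  rw [q_check_zero, q_check_one, mul_zpow, inv_zpow', mul_left_comm, mul_comm, mul_comm _ (q L 0 ^ b),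
    ← zpow_add₀ h0] at h
  obtain ⟨h1, h2⟩ := hgen _ _ h
  omega

theorem q_zero_pow_ne_one (hgen : ∀ a b : ℤ, q L 0 ^ a * q L 1 ^ b = 1 → a = 0 ∧ b = 0) {r : ℕ}
    (hr : r ≠ 0) : q L 0 ^ r ≠ 1 := by
  intro h
  have := (hgen r 0 (by simpa using h)).1
  omega

theorem kappa_ne_zero (hsum : L 0 + L 1 + L 2 = 0)
    (hgen : ∀ a b : ℤ, q L 0 ^ a * q L 1 ^ b = 1 → a = 0 ∧ b = 0) {r : ℤ} (hr : r ≠ 0) :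
    kappa L r ≠ 0 := by
  have h2 : q L 2 = (q L 0)⁻¹ * (q L 1)⁻¹ := by
    have h0 := q_ne_zero L 0
    have h1 := q_ne_zero L 1
    have := q_prod hsum
    field_simp
    linear_combination this
  rw [kappa, Fin.prod_univ_three]
  refine mul_ne_zero (mul_ne_zero ?_ ?_) ?_ <;> rw [sub_ne_zero] <;> intro h
  · exact hr (hgen r 0 (by simpa using h.symm)).1
  · exact hr (hgen 0 r (by simpa using h.symm)).2
  · have := (hgen (-r) (-r) (by rw [h, h2, mul_zpow, inv_zpow', inv_zpow'])).1
    omega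

theorem coeff_omegaLogP (r : ℕ) : PowerSeries.coeff r (omegaLogP L) =
    (r : ℂ)⁻¹ * (1 + (q L 1 * q L 2) ^ r - q L 1 ^ r - q L 2 ^ r) := by
  simp only [omegaLogP, negLog, map_add, map_neg, PowerSeries.coeff_mk, smul_eq_mul, one_pow]
  ring

theorem coeff_omegaLogM (r : ℕ) : PowerSeries.coeff r (omegaLogM L) =
    (r : ℂ)⁻¹ * (1 + ((q L 1)⁻¹ * (q L 2)⁻¹) ^ r - (q L 1)⁻¹ ^ r - (q L 2)⁻¹ ^ r) := by
  simp only [omegaLogM, negLog, map_add, map_neg, PowerSeries.coeff_mk, smul_eq_mul, one_pow]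
  ring

theorem coeff_barSeries (p1 p2 : ℂ) (r : ℕ) : PowerSeries.coeff r (barSeries p1 p2) =
    (r : ℂ)⁻¹ * (p1 ^ r + p1⁻¹ ^ r - p2 ^ r - p2⁻¹ ^ r) := by
  simp only [barSeries, negLog, map_add, map_neg, PowerSeries.coeff_mk, smul_eq_mul]
  ring

theorem gammaP_zero (τ : ℂ) : gammaP L 0 τ = 0 := by
  rw [gammaP, coeff_zero_omegaLogP, coeff_zero_omegaLogP]
  ring

theorem gammaM_zero (τ : ℂ) : gammaM L 0 τ = 0 := by
  rw [gammaM, coeff_zero_omegaLogM, coeff_zero_omegaLogM]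
  ring

/-- Since `q_1 q_2 q_3 = 1`, passing to checked parameters multiplies `(1 - q_2^r)(1 - q_3^r)` by
`q_1^r`, while `(q_1^{-r} - 1)⁻¹ = q_1^r (1 - q_1^r)⁻¹` is replaced by `-(1 - q_1^r)⁻¹`. The two
contributions are thus opposite apart from `τ`, whence the factor `1 - τ`. -/
theorem gammaP_eq (hsum : L 0 + L 1 + L 2 = 0)
    (hgen : ∀ a b : ℤ, q L 0 ^ a * q L 1 ^ b = 1 → a = 0 ∧ b = 0) {r : ℕ} (hr : r ≠ 0) (τ : ℂ) :
    gammaP L r τ = (r : ℂ)⁻¹ * ((1 - q L 0 ^ r)⁻¹ * (1 + q L 0 ^ r - q L 0 ^ r *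
        (q L 1 ^ r + (q L 0 ^ r)⁻¹ * (q L 1 ^ r)⁻¹)) * (1 - τ)) := by
  have h0 : q L 0 ^ r ≠ 0 := pow_ne_zero _ (q_ne_zero L 0)
  have h1 : q L 1 ^ r ≠ 0 := pow_ne_zero _ (q_ne_zero L 1)
  have ha := q_zero_pow_ne_one hgen hr
  have ha' : 1 - q L 0 ^ r ≠ 0 := sub_ne_zero.2 ha.symm
  have ha'' : q L 0 ^ r - 1 ≠ 0 := sub_ne_zero.2 ha
  have h2 : q L 2 ^ r = (q L 0 ^ r)⁻¹ * (q L 1 ^ r)⁻¹ := by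
    have := congrArg (· ^ r) (q_prod hsum)
    simp only [mul_pow, one_pow] at this
    field_simp
    linear_combination this
  rw [gammaP, coeff_omegaLogP, coeff_omegaLogP, q_check_zero, q_check_one, q_check_two,
    zpow_neg, zpow_neg, zpow_natCast, zpow_natCast, inv_pow, inv_inv]
  simp only [mul_pow, h2]
  generalize q L 0 ^ r = a at *
  generalize q L 1 ^ r = b at *
  have e1 : (a⁻¹ - 1)⁻¹ = a * (1 - a)⁻¹ := by field_simp
  have e2 : (a - 1)⁻¹ = -(1 - a)⁻¹ := by rw [← inv_neg, neg_sub]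
  rw [e1, e2]
  generalize (1 - a)⁻¹ = A
  field_simp
  ring

/-- Inverting the parameters multiplies `(1 - q_2^r)(1 - q_3^r)` by `q_1^r`, and the prefactor is
now `(q_1^r - 1)⁻¹ = -(1 - q_1^r)⁻¹`; in total only the sign changes. One scalar therefore controls
`Ψ⁺` and `Ψ⁻`. -/
theorem gammaM_eq (hsum : L 0 + L 1 + L 2 = 0)
    (hgen : ∀ a b : ℤ, q L 0 ^ a * q L 1 ^ b = 1 → a = 0 ∧ b = 0) (r : ℕ) (τ : ℂ) :
    gammaM L r τ = -gammaP L r τ := by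
  rcases eq_or_ne r 0 with rfl | hr
  · rw [gammaP_zero, gammaM_zero, neg_zero]
  rw [gammaP_eq hsum hgen hr]
  have h0 : q L 0 ^ r ≠ 0 := pow_ne_zero _ (q_ne_zero L 0)
  have h1 : q L 1 ^ r ≠ 0 := pow_ne_zero _ (q_ne_zero L 1)
  have ha := q_zero_pow_ne_one hgen hr
  have ha' : 1 - q L 0 ^ r ≠ 0 := sub_ne_zero.2 ha.symm
  have h2 : q L 2 ^ r = (q L 0 ^ r)⁻¹ * (q L 1 ^ r)⁻¹ := by
    have := congrArg (· ^ r) (q_prod hsum)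
    simp only [mul_pow, one_pow] at this
    field_simp
    linear_combination this
  rw [gammaM, coeff_omegaLogM, coeff_omegaLogM, q_check_zero, q_check_one, q_check_two]
  simp only [mul_pow, inv_pow, h2]
  generalize q L 0 ^ r = a at *
  generalize q L 1 ^ r = b at *
  have e1 : (a⁻¹ - 1)⁻¹ = a * (1 - a)⁻¹ := by field_simp
  have e2 : (a - 1)⁻¹ = -(1 - a)⁻¹ := by rw [← inv_neg, neg_sub]
  rw [e1, e2]
  generalize (1 - a)⁻¹ = A
  field_simp
  ring

/-- The cancellation between the two toroidal algebras: `k_0 ǩ_0` commutes with a vector current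
whose twist matches its own. -/
theorem gammaP_one (hsum : L 0 + L 1 + L 2 = 0)
    (hgen : ∀ a b : ℤ, q L 0 ^ a * q L 1 ^ b = 1 → a = 0 ∧ b = 0) (r : ℕ) :
    gammaP L r 1 = 0 := by
  rcases eq_or_ne r 0 with rfl | hr
  · exact gammaP_zero _
  · rw [gammaP_eq hsum hgen hr, sub_self, mul_zero, mul_zero]

/-- Now `1 - τ` cancels the denominator `1 - q_1^r`, and the remaining `1 + q_1^r - (q_1 q_2)^r -
q_2^{-r}` is symmetric under inversion of `q̄_1` and of `q̄_2` once `s_1^r` is taken out. This is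
where `q̄_1 = s_1` and `q̄_2 = s_1 q_2` come from. -/
theorem gammaP_q (hsum : L 0 + L 1 + L 2 = 0)
    (hgen : ∀ a b : ℤ, q L 0 ^ a * q L 1 ^ b = 1 → a = 0 ∧ b = 0) (r : ℕ) :
    gammaP L r (q L 0 ^ r) =
      s L 0 ^ r * PowerSeries.coeff r (barSeries (s L 0) (s L 0 * q L 1)) := by
  rcases eq_or_ne r 0 with rfl | hr
  · rw [gammaP_zero, coeff_zero_barSeries, mul_zero]
  rw [gammaP_eq hsum hgen hr, coeff_barSeries]
  have ha' : 1 - q L 0 ^ r ≠ 0 := sub_ne_zero.2 (q_zero_pow_ne_one hgen hr).symm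
  have h1 : q L 1 ^ r ≠ 0 := pow_ne_zero _ (q_ne_zero L 1)
  have h2 : s L 0 ^ r ≠ 0 := pow_ne_zero _ s_ne_zero
  have h3 : q L 0 ^ r = (s L 0 ^ r) ^ 2 := by rw [← s_sq, pow_right_comm]
  rw [mul_assoc _ _ (1 - q L 0 ^ r), mul_comm _ (1 - q L 0 ^ r), inv_mul_cancel_left₀ ha', h3]
  simp only [inv_pow, mul_pow]
  generalize s L 0 ^ r = P at *
  field_simp
  ring

/-- Follows from the previous case, because `1 - q_1^{-r} = -q_1^{-r} (1 - q_1^r)`. -/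
theorem gammaP_q_inv (hsum : L 0 + L 1 + L 2 = 0)
    (hgen : ∀ a b : ℤ, q L 0 ^ a * q L 1 ^ b = 1 → a = 0 ∧ b = 0) (r : ℕ) :
    gammaP L r ((q L 0)⁻¹ ^ r) =
      -((s L 0)⁻¹ ^ r * PowerSeries.coeff r (barSeries (s L 0) (s L 0 * q L 1))) := by
  rcases eq_or_ne r 0 with rfl | hr
  · rw [gammaP_zero, coeff_zero_barSeries, mul_zero, neg_zero]
  have h0 : q L 0 ^ r ≠ 0 := pow_ne_zero _ (q_ne_zero L 0)
  have h1 := gammaP_q hsum hgen r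
  have h2 : s L 0 ^ r ≠ 0 := pow_ne_zero _ s_ne_zero
  have h3 : q L 0 ^ r = (s L 0 ^ r) ^ 2 := by rw [← s_sq, pow_right_comm]
  rw [gammaP_eq hsum hgen hr] at h1 ⊢
  have h4 : (1 : ℂ) - (q L 0)⁻¹ ^ r = -(q L 0 ^ r)⁻¹ * (1 - q L 0 ^ r) := by
    rw [inv_pow]
    field_simp
    ring
  have h5 : (s L 0)⁻¹ ^ r = (q L 0 ^ r)⁻¹ * s L 0 ^ r := by
    rw [h3, inv_pow]
    field_simp
  rw [h4, h5]
  linear_combination (-(q L 0 ^ r)⁻¹) * h1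

end Scalars

end

section

/-! ### The logarithms of `k_0^±(z) ǩ_0^±(t z)` and their Heisenberg relations -/

section KKLogarithms

variable {R : Type*} [Ring R] [Algebra ℂ R] (L : Fin 3 → ℂ) (T T' : GL1Data R)

/-- The logarithm of `k_0⁺(z) ǩ_0⁺(t z)`, without its constant term. -/
def kkLogP (t : ℂ) : PowerSeries R := PowerSeries.mk fun r =>
  (q L 0 ^ (-(r : ℤ)) - 1)⁻¹ • PowerSeries.coeff r (T.psiLogP L) +
    (t⁻¹ ^ r * (q (check L) 0 ^ (-(r : ℤ)) - 1)⁻¹) • PowerSeries.coeff r (T'.psiLogP (check L))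

/-- The logarithm of `k_0⁻(z) ǩ_0⁻(t z)`, without its constant term. -/
def kkLogM (t : ℂ) : PowerSeries R := PowerSeries.mk fun r =>
  (q L 0 ^ r - 1)⁻¹ • PowerSeries.coeff r (T.psiLogM L) +
    (t ^ r * (q (check L) 0 ^ r - 1)⁻¹) • PowerSeries.coeff r (T'.psiLogM (check L))

theorem coeff_zero_kkLogP (t : ℂ) : PowerSeries.coeff 0 (kkLogP L T T' t) = 0 := by
  rw [kkLogP, PowerSeries.coeff_mk, GL1Data.coeff_zero_psiLogP, GL1Data.coeff_zero_psiLogP,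
    smul_zero, smul_zero, add_zero]

theorem coeff_zero_kkLogM (t : ℂ) : PowerSeries.coeff 0 (kkLogM L T T' t) = 0 := by
  rw [kkLogM, PowerSeries.coeff_mk, GL1Data.coeff_zero_psiLogM, GL1Data.coeff_zero_psiLogM,
    smul_zero, smul_zero, add_zero]

variable {L T T'}

theorem commute_kkLogP {x : R} (h : ∀ y ∈ T.gens, Commute x y) (h' : ∀ y ∈ T'.gens, Commute x y)
    (t : ℂ) (k : ℕ) : Commute x (PowerSeries.coeff k (kkLogP L T T' t)) := by
  rw [kkLogP, PowerSeries.coeff_mk]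
  exact ((GL1Data.commute_psiLogP h k).smul_right _).add_right
    ((GL1Data.commute_psiLogP h' k).smul_right _)

theorem commute_kkLogM {x : R} (h : ∀ y ∈ T.gens, Commute x y) (h' : ∀ y ∈ T'.gens, Commute x y)
    (t : ℂ) (k : ℕ) : Commute x (PowerSeries.coeff k (kkLogM L T T' t)) := by
  rw [kkLogM, PowerSeries.coeff_mk]
  exact ((GL1Data.commute_psiLogM h k).smul_right _).add_right
    ((GL1Data.commute_psiLogM h' k).smul_right _)

theorem coeffComm_kkLogP (hT : T.Relations L) (hT' : T'.Relations (check L))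
    (h : ∀ x ∈ T.gens, ∀ y ∈ T'.gens, Commute x y) (t t' : ℂ) :
    CoeffComm (kkLogP L T T' t) (kkLogP L T T' t') := by
  intro i j
  have h1 := hT.coeffComm_psiLogP i j
  have h2 := hT'.coeffComm_psiLogP i j
  have h3 : ∀ i j, Commute (PowerSeries.coeff i (T.psiLogP L))
      (PowerSeries.coeff j (T'.psiLogP (check L))) := fun i j =>
    GL1Data.commute_psiLogP (fun y hy => (GL1Data.commute_psiLogP
      (fun x hx => (h x hx y hy).symm) i).symm) j
  rw [kkLogP, kkLogP, PowerSeries.coeff_mk, PowerSeries.coeff_mk]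
  exact ((h1.smul_right _).add_right ((h3 _ _).smul_right _)).smul_left _ |>.add_left
    ((((h3 _ _).symm.smul_right _).add_right (h2.smul_right _)).smul_left _)

theorem coeffComm_kkLogM (hT : T.Relations L) (hT' : T'.Relations (check L))
    (h : ∀ x ∈ T.gens, ∀ y ∈ T'.gens, Commute x y) (t t' : ℂ) :
    CoeffComm (kkLogM L T T' t) (kkLogM L T T' t') := by
  intro i j
  have h1 := hT.coeffComm_psiLogM i j
  have h2 := hT'.coeffComm_psiLogM i j
  have h3 : ∀ i j, Commute (PowerSeries.coeff i (T.psiLogM L))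
      (PowerSeries.coeff j (T'.psiLogM (check L))) := fun i j =>
    GL1Data.commute_psiLogM (fun y hy => (GL1Data.commute_psiLogM
      (fun x hx => (h x hx y hy).symm) i).symm) j
  rw [kkLogM, kkLogM, PowerSeries.coeff_mk, PowerSeries.coeff_mk]
  exact ((h1.smul_right _).add_right ((h3 _ _).smul_right _)).smul_left _ |>.add_left
    ((((h3 _ _).symm.smul_right _).add_right (h2.smul_right _)).smul_left _)

theorem C_mul_expSeries_mul {x y : R} {a b : PowerSeries R} (ha0 : PowerSeries.coeff 0 a = 0)
    (hb0 : PowerSeries.coeff 0 b = 0) (ha : CoeffComm a a) (hb : CoeffComm b b)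
    (hab : CoeffComm a b) (hy : ∀ k, Commute y (PowerSeries.coeff k a)) :
    (PowerSeries.C x * expSeries a) * (PowerSeries.C y * expSeries b) =
      PowerSeries.C (x * y) * expSeries (a + b) := by
  have h : Commute (PowerSeries.C y) (expSeries a) := by
    have h1 : CoeffComm a (PowerSeries.C y) := by
      intro i j
      rw [PowerSeries.coeff_C]
      split_ifs
      · exact (hy i).symm
      · exact Commute.zero_right _
    exact h1.exp_left.symm.commute
  rw [expSeries_add ha0 hb0 ha hb hab, map_mul, mul_assoc, ← mul_assoc (expSeries a), ← h.eq]
  simp only [mul_assoc]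

theorem kkLogP_eq (t : ℂ) : kkLogP L T T' t =
    (PowerSeries.mk fun r => if r = 0 then 0 else (kappa L r / (q L 0 ^ (-(r : ℤ)) - 1)) • T.h r) +
    scalePS t⁻¹ (PowerSeries.mk fun r => if r = 0 then 0 else
      (kappa (check L) r / (q (check L) 0 ^ (-(r : ℤ)) - 1)) • T'.h r) := by
  ext r
  simp only [kkLogP, scalePS, GL1Data.psiLogP, PowerSeries.coeff_mk, map_add]
  split_ifs with h
  · simp
  · rw [smul_smul, smul_smul, smul_smul, div_eq_inv_mul, div_eq_inv_mul, mul_assoc]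

theorem kkLogM_eq (t : ℂ) : kkLogM L T T' t =
    (PowerSeries.mk fun r => if r = 0 then 0 else
      (kappa L r / (q L 0 ^ r - 1)) • T.h (-(r : ℤ))) +
    scalePS t (PowerSeries.mk fun r => if r = 0 then 0 else
      (kappa (check L) r / (q (check L) 0 ^ r - 1)) • T'.h (-(r : ℤ))) := by
  ext r
  simp only [kkLogM, scalePS, GL1Data.psiLogM, PowerSeries.coeff_mk, map_add]
  split_ifs with h
  · simp
  · rw [smul_smul, smul_smul, smul_smul, div_eq_inv_mul, div_eq_inv_mul, mul_assoc]

/-- Modes of one sign commute, within each toroidal algebra and between the two, so the two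
exponents can be added; `K'` passes the first exponential. -/
theorem k0P_mul_k0P (hT : T.Relations L) (hT' : T'.Relations (check L))
    (h : ∀ x ∈ T.gens, ∀ y ∈ T'.gens, Commute x y) (K K' : Rˣ)
    (hK' : ∀ x ∈ T.gens, Commute x (K' : R)) (t : ℂ) :
    T.k0P L K * scalePS t⁻¹ (T'.k0P (check L) K') =
      PowerSeries.C ((K * K' : Rˣ) : R) * expSeries (kkLogP L T T' t) := by
  have hc := coeffComm_kkLogP hT hT' h t t
  rw [kkLogP_eq, GL1Data.k0P, GL1Data.k0P, scalePS_mul, scalePS_C, scalePS_expSeries,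
    C_mul_expSeries_mul, Units.val_mul]
  · simp
  · simp [scalePS]
  · intro i j
    simp only [PowerSeries.coeff_mk]
    split_ifs with h1 h2
    · exact Commute.zero_left _
    · exact Commute.zero_left _
    · exact Commute.zero_right _
    · exact ((hT.commute_h (by omega)).smul_left _).smul_right _
  · intro i j
    simp only [scalePS, PowerSeries.coeff_mk]
    refine Commute.smul_left (Commute.smul_right ?_ _) _
    split_ifs with h1 h2
    · exact Commute.zero_left _
    · exact Commute.zero_left _
    · exact Commute.zero_right _
    · exact ((hT'.commute_h (by omega)).smul_left _).smul_right _
  · intro i j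
    simp only [scalePS, PowerSeries.coeff_mk]
    refine Commute.smul_right ?_ _
    split_ifs with h1 h2
    · exact Commute.zero_left _
    · exact Commute.zero_left _
    · exact Commute.zero_right _
    · exact ((h _ (GL1Data.h_mem_gens _) _ (GL1Data.h_mem_gens _)).smul_left _).smul_right _
  · intro k
    simp only [PowerSeries.coeff_mk]
    split_ifs with h1
    · exact Commute.zero_right _
    · exact ((hK' _ (GL1Data.h_mem_gens _)).symm).smul_right _

theorem k0M_mul_k0M (hT : T.Relations L) (hT' : T'.Relations (check L))
    (h : ∀ x ∈ T.gens, ∀ y ∈ T'.gens, Commute x y) (K K' : Rˣ) (hKK' : Commute K K')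
    (hK' : ∀ x ∈ T.gens, Commute x (K' : R)) (t : ℂ) :
    T.k0M L K * scalePS t (T'.k0M (check L) K') =
      PowerSeries.C (((K * K')⁻¹ : Rˣ) : R) * expSeries (kkLogM L T T' t) := by
  rw [kkLogM_eq, GL1Data.k0M, GL1Data.k0M, scalePS_mul, scalePS_C, scalePS_expSeries,
    C_mul_expSeries_mul, hKK'.eq, mul_inv_rev, Units.val_mul]
  · simp
  · simp [scalePS]
  · intro i j
    simp only [PowerSeries.coeff_mk]
    split_ifs with h1 h2
    · exact Commute.zero_left _
    · exact Commute.zero_left _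
    · exact Commute.zero_right _
    · exact ((hT.commute_h (by omega)).smul_left _).smul_right _
  · intro i j
    simp only [scalePS, PowerSeries.coeff_mk]
    refine Commute.smul_left (Commute.smul_right ?_ _) _
    split_ifs with h1 h2
    · exact Commute.zero_left _
    · exact Commute.zero_left _
    · exact Commute.zero_right _
    · exact ((hT'.commute_h (by omega)).smul_left _).smul_right _
  · intro i j
    simp only [scalePS, PowerSeries.coeff_mk]
    refine Commute.smul_right ?_ _
    split_ifs with h1 h2
    · exact Commute.zero_left _
    · exact Commute.zero_left _
    · exact Commute.zero_right _
    · exact ((h _ (GL1Data.h_mem_gens _) _ (GL1Data.h_mem_gens _)).smul_left _).smul_right _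
  · intro k
    simp only [PowerSeries.coeff_mk]
    split_ifs with h1
    · exact Commute.zero_right _
    · exact ((hK' _ (GL1Data.h_mem_gens _)).symm.units_inv_left).smul_right _

/-- The commutators of the coefficients of `log ψ⁺` and `log ψ⁻`. -/
theorem GL1Data.Relations.commutator_psiLog (hsum : L 0 + L 1 + L 2 = 0)
    (hgen : ∀ a b : ℤ, q L 0 ^ a * q L 1 ^ b = 1 → a = 0 ∧ b = 0) (hT : T.Relations L) (r t : ℕ) :
    PowerSeries.coeff r (T.psiLogP L) * PowerSeries.coeff t (T.psiLogM L) =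
      PowerSeries.coeff t (T.psiLogM L) * PowerSeries.coeff r (T.psiLogP L) +
        if t = r then ((r : ℂ)⁻¹ * kappa L r) •
          ((T.C : R) ^ r - ((T.C⁻¹ : Rˣ) : R) ^ r) else 0 := by
  simp only [GL1Data.psiLogP, GL1Data.psiLogM, PowerSeries.coeff_mk]
  rcases eq_or_ne r 0 with rfl | hr
  · simp
  rcases eq_or_ne t 0 with rfl | ht
  · simp [hr.symm]
  rw [if_neg hr, if_neg ht]
  have h1 := hT.h_h r (-t) (by omega) (by omega)
  rw [sub_eq_iff_eq_add, add_comm] at h1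
  rw [smul_mul_smul_comm, smul_mul_smul_comm, h1, smul_add, mul_comm (kappa L t)]
  congr 1
  by_cases h2 : t = r
  · rw [if_pos h2, if_pos (by omega), smul_smul, h2, zpow_neg, zpow_natCast, ← inv_pow,
      Units.val_pow_eq_pow_val, Units.val_pow_eq_pow_val]
    have := kappa_ne_zero hsum hgen (r := r) (by omega)
    congr 1
    push_cast
    field_simp
  · rw [if_neg h2, if_neg (by omega), smul_zero]

/-- The factor `1 - q_1^r` of `κ_r` cancels one of the two denominators, and the rest of `κ_r / r`
is the coefficient of `log ω⁺`. So the Heisenberg constant is the one met in the commutator with a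
vector current. -/
theorem inv_mul_inv_mul_kappa
    (hgen : ∀ a b : ℤ, q L 0 ^ a * q L 1 ^ b = 1 → a = 0 ∧ b = 0) (r : ℕ) :
    (q L 0 ^ (-(r : ℤ)) - 1)⁻¹ * (q L 0 ^ r - 1)⁻¹ * ((r : ℂ)⁻¹ * kappa L r) =
      -((q L 0 ^ (-(r : ℤ)) - 1)⁻¹ * PowerSeries.coeff r (omegaLogP L)) := by
  rcases eq_or_ne r 0 with rfl | hr
  · simp
  rw [coeff_omegaLogP, kappa, Fin.prod_univ_three, zpow_natCast, zpow_natCast, zpow_natCast]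
  have ha : q L 0 ^ r - 1 ≠ 0 := sub_ne_zero.2 (q_zero_pow_ne_one hgen hr)
  have h1 : (q L 0 ^ r - 1)⁻¹ * (1 - q L 0 ^ r) = -1 := by
    rw [← neg_sub (q L 0 ^ r), mul_neg, inv_mul_cancel₀ ha]
  rw [mul_pow]
  linear_combination ((q L 0 ^ (-(r : ℤ)) - 1)⁻¹ * (r : ℂ)⁻¹ * (1 - q L 1 ^ r) *
    (1 - q L 2 ^ r)) * h1

/-- The two algebras commute, so only their own Heisenberg brackets contribute, and by
`inv_mul_inv_mul_kappa` they add up to the same scalar `γ_r`, with `t⁻¹ t'` in the role of the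
relative twist. -/
theorem commutator_kkLog (hsum : L 0 + L 1 + L 2 = 0)
    (hgen : ∀ a b : ℤ, q L 0 ^ a * q L 1 ^ b = 1 → a = 0 ∧ b = 0) (hT : T.Relations L)
    (hT' : T'.Relations (check L)) (h : ∀ x ∈ T.gens, ∀ y ∈ T'.gens, Commute x y)
    (hC : T.C = T'.C) (t t' : ℂ) (r k : ℕ) :
    PowerSeries.coeff r (kkLogP L T T' t) * PowerSeries.coeff k (kkLogM L T T' t') =
      PowerSeries.coeff k (kkLogM L T T' t') * PowerSeries.coeff r (kkLogP L T T' t) +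
        if k = r then -(gammaP L r ((t⁻¹ * t') ^ r) •
          ((T.C : R) ^ r - ((T.C⁻¹ : Rˣ) : R) ^ r)) else 0 := by
  have h1 := hT.commutator_psiLog hsum hgen r k
  have h2 := hT'.commutator_psiLog (check_sum hsum) (check_generic hgen) r k
  have h3 : Commute (PowerSeries.coeff r (T.psiLogP L))
      (PowerSeries.coeff k (T'.psiLogM (check L))) :=
    GL1Data.commute_psiLogM (fun y hy => (GL1Data.commute_psiLogP
      (fun x hx => (h x hx y hy).symm) r).symm) k
  have h4 : Commute (PowerSeries.coeff k (T.psiLogM L))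
      (PowerSeries.coeff r (T'.psiLogP (check L))) :=
    GL1Data.commute_psiLogP (fun y hy => (GL1Data.commute_psiLogM
      (fun x hx => (h x hx y hy).symm) k).symm) r
  simp only [kkLogP, kkLogM, PowerSeries.coeff_mk]
  rw [add_mul, mul_add, mul_add, add_mul, mul_add, mul_add]
  simp only [smul_mul_smul_comm]
  rw [h1, h2, h3.eq, h4.eq]
  by_cases hk : k = r
  · subst hk
    simp only [if_true]
    rw [← hC]
    generalize (T.C : R) ^ k - ((T.C⁻¹ : Rˣ) : R) ^ k = Z
    have e1 := inv_mul_inv_mul_kappa hgen k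
    have e2 := inv_mul_inv_mul_kappa (check_generic hgen) k
    have e3 : -(gammaP L k ((t⁻¹ * t') ^ k) • Z) =
        ((q L 0 ^ (-(k : ℤ)) - 1)⁻¹ * (q L 0 ^ k - 1)⁻¹ * ((k : ℂ)⁻¹ * kappa L k)) • Z +
        ((t⁻¹ ^ k * (q (check L) 0 ^ (-(k : ℤ)) - 1)⁻¹ * (t' ^ k * (q (check L) 0 ^ k - 1)⁻¹)) *
          ((k : ℂ)⁻¹ * kappa (check L) k)) • Z := by
      rw [← neg_smul, ← add_smul]
      congr 1
      rw [gammaP, mul_pow]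
      linear_combination -e1 - (t⁻¹ ^ k * t' ^ k) * e2
    rw [e3, smul_add, smul_add, smul_smul, smul_smul]
    simp only [mul_comm, mul_left_comm, mul_assoc]
    abel
  · simp only [if_neg hk, add_zero]
    simp only [mul_comm, mul_left_comm, mul_assoc]
    abel

end KKLogarithms

/-! ### Commutators of these logarithms with a current that is a vector for both algebras -/

section Commutators

variable {V : Type*} [AddCommGroup V] [Module ℂ V] {L : Fin 3 → ℂ}
  {T T' : GL1Data (Module.End ℂ V)} {p' : ℂ} {X Y Y' Z Z' : ℤ → Module.End ℂ V}

/-- The two commutators simply add. The unchecked twist is normalized to `1`, so `τ` multiplies only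
the checked summand of `γ_r`, as in its definition. -/
theorem commutator_kkLogP_left (hT : T.Relations L) (hT' : T'.Relations (check L))
    (hC : T.C = T'.C) (h : LeftVector L T 1 X Y Y') (h' : LeftVector (check L) T' p' X Z Z')
    (t : ℂ) (r : ℕ) (n : ℤ) : PowerSeries.coeff r (kkLogP L T T' t) * X n =
      X n * PowerSeries.coeff r (kkLogP L T T' t) +
        (gammaP L r ((t⁻¹ * p') ^ r) • ((T.C⁻¹ : (Module.End ℂ V)ˣ) : Module.End ℂ V) ^ r) *
          X (n + r) := by
  have h1 := (h.commutator_P hT).2 r n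
  have h2 := (h'.commutator_P hT').2 r n
  simp only [kkLogP, PowerSeries.coeff_mk]
  rw [add_mul, mul_add, smul_mul_assoc, smul_mul_assoc, h1, h2, ← hC, coeff_substMul,
    coeff_substMul, gammaP, smul_pow, smul_pow, one_pow, one_smul, mul_pow]
  simp only [smul_add, mul_smul_comm, smul_mul_assoc, smul_smul, add_smul, add_mul]
  rw [show t⁻¹ ^ r * p' ^ r * (q (check L) 0 ^ (-(r : ℤ)) - 1)⁻¹ *
    PowerSeries.coeff r (omegaLogP (check L)) = t⁻¹ ^ r * (q (check L) 0 ^ (-(r : ℤ)) - 1)⁻¹ *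
      (PowerSeries.coeff r (omegaLogP (check L)) * p' ^ r) by ring]
  abel

theorem commutator_kkLogM_left (hT : T.Relations L) (hT' : T'.Relations (check L))
    (h : LeftVector L T 1 X Y Y') (h' : LeftVector (check L) T' p' X Z Z')
    (t : ℂ) (r : ℕ) (n : ℤ) : PowerSeries.coeff r (kkLogM L T T' t) * X n =
      X n * PowerSeries.coeff r (kkLogM L T T' t) +
        gammaM L r ((t * p'⁻¹) ^ r) • X (n - r) := by
  have h1 := h.commutator_M hT r n
  have h2 := h'.commutator_M hT' r n
  simp only [kkLogM, PowerSeries.coeff_mk]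
  rw [add_mul, mul_add, smul_mul_assoc, smul_mul_assoc, h1, h2, coeff_substMul,
    coeff_substMul, gammaM, smul_pow, smul_pow, one_pow, inv_one, one_pow, one_smul,
    mul_pow]
  simp only [smul_add, mul_smul_comm, smul_mul_assoc, smul_smul, add_smul, one_mul]
  rw [show t ^ r * p'⁻¹ ^ r * (q (check L) 0 ^ r - 1)⁻¹ *
    PowerSeries.coeff r (omegaLogM (check L)) = t ^ r * (q (check L) 0 ^ r - 1)⁻¹ *
      (PowerSeries.coeff r (omegaLogM (check L)) * p'⁻¹ ^ r) by ring]
  abel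

theorem commutator_kkLogP_right (hT : T.Relations L) (hT' : T'.Relations (check L))
    (h : RightVector L T 1 X Y Y') (h' : RightVector (check L) T' p' X Z Z')
    (t : ℂ) (r : ℕ) (n : ℤ) : PowerSeries.coeff r (kkLogP L T T' t) * X n =
      X n * PowerSeries.coeff r (kkLogP L T T' t) +
        (-gammaP L r ((t⁻¹ * p') ^ r)) • X (n + r) := by
  have h1 := (h.commutator_P hT).2 r n
  have h2 := (h'.commutator_P hT').2 r n
  simp only [kkLogP, PowerSeries.coeff_mk]
  rw [add_mul, mul_add, smul_mul_assoc, smul_mul_assoc, h1, h2, coeff_substMul,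
    coeff_substMul, gammaP, smul_pow, smul_pow, one_pow, one_pow, one_smul, mul_pow, map_neg,
    map_neg, neg_add]
  simp only [smul_add, mul_smul_comm, smul_mul_assoc, smul_smul, add_smul, one_mul]
  rw [show -(t⁻¹ ^ r * p' ^ r * (q (check L) 0 ^ (-(r : ℤ)) - 1)⁻¹ *
    PowerSeries.coeff r (omegaLogP (check L))) = t⁻¹ ^ r * (q (check L) 0 ^ (-(r : ℤ)) - 1)⁻¹ *
      (-PowerSeries.coeff r (omegaLogP (check L)) * p' ^ r) by ring, mul_neg]
  abel

theorem commutator_kkLogM_right (hT : T.Relations L) (hT' : T'.Relations (check L))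
    (hC : T.C = T'.C) (h : RightVector L T 1 X Y Y') (h' : RightVector (check L) T' p' X Z Z')
    (t : ℂ) (r : ℕ) (n : ℤ) : PowerSeries.coeff r (kkLogM L T T' t) * X n =
      X n * PowerSeries.coeff r (kkLogM L T T' t) +
        ((-gammaM L r ((t * p'⁻¹) ^ r)) • (T.C : Module.End ℂ V) ^ r) * X (n - r) := by
  have h1 := h.commutator_M hT r n
  have h2 := h'.commutator_M hT' r n
  simp only [kkLogM, PowerSeries.coeff_mk]
  rw [add_mul, mul_add, smul_mul_assoc, smul_mul_assoc, h1, h2, ← hC, coeff_substMul,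
    coeff_substMul, gammaM, smul_pow, smul_pow, inv_one, one_pow, one_smul, mul_pow, map_neg,
    map_neg, neg_add]
  simp only [smul_add, mul_smul_comm, smul_mul_assoc, smul_smul, add_smul, add_mul]
  rw [show -(t ^ r * p'⁻¹ ^ r * (q (check L) 0 ^ r - 1)⁻¹ *
    PowerSeries.coeff r (omegaLogM (check L))) = t ^ r * (q (check L) 0 ^ r - 1)⁻¹ *
      (-PowerSeries.coeff r (omegaLogM (check L)) * p'⁻¹ ^ r) by ring, mul_neg]
  abel

end Commutators

end

section

/-! ### From commutators to the relations of `E_{1|1}` that contain `Ψ` -/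

section Presentation

variable {R : Type*} [Ring R] [Algebra ℂ R]

/-- The logarithm of the exchange function of `Ψ_i^±` and `E_j`. -/
def exchangeLog (p1 p2 : ℂ) (i j : ZMod 2) : PowerSeries ℂ :=
  if i = j then 0 else if i = 0 then barSeries p1 p2 else -barSeries p1 p2

theorem coeff_zero_exchangeLog (p1 p2 : ℂ) (i j : ZMod 2) :
    PowerSeries.coeff 0 (exchangeLog p1 p2 i j) = 0 := by
  rw [exchangeLog]
  split_ifs
  · rw [map_zero]
  · exact coeff_zero_barSeries _ _
  · rw [map_neg, coeff_zero_barSeries, neg_zero]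

theorem zmod_two_cases (i : ZMod 2) : i = 0 ∨ i = 1 := by
  revert i
  decide

theorem quadSeries_mul_exchange {p1 p2 : ℂ} (h1 : p1 ≠ 0) (h2 : p2 ≠ 0) {i j : ZMod 2}
    (hij : i ≠ j) : quadSeries (gTrace p1 p2 i) * expSeries (exchangeLog p1 p2 i j) =
      quadSeries (gTrace p1 p2 j) := by
  rw [exchangeLog, if_neg hij]
  rcases zmod_two_cases i with rfl | rfl <;> rcases zmod_two_cases j with rfl | rfl
  · exact absurd rfl hij
  · simpa [gTrace] using quadSeries_mul_exp h1 h2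
  · simpa [gTrace] using quadSeries_mul_exp_neg h1 h2
  · exact absurd rfl hij

/-- The commutators that give the relations of `E_{1|1}` that involve the currents
`Ψ_i⁺(z) = κ_i exp (A_i)` and `Ψ_i⁻(z) = κ_i⁻¹ exp (A'_i)`. -/
structure ExchangeData (p1 p2 : ℂ) (c : Rˣ) (κ : ZMod 2 → Rˣ) (A A' : ZMod 2 → PowerSeries R)
    (E F : ZMod 2 → ℤ → R) : Prop where
  A_zero : ∀ i, PowerSeries.coeff 0 (A i) = 0
  A'_zero : ∀ i, PowerSeries.coeff 0 (A' i) = 0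
  c_κ : ∀ i, Commute (c : R) (κ i)
  c_A : ∀ i k, Commute (c : R) (PowerSeries.coeff k (A i))
  c_A' : ∀ i k, Commute (c : R) (PowerSeries.coeff k (A' i))
  c_E : ∀ i k, Commute (c : R) (E i k)
  c_F : ∀ i k, Commute (c : R) (F i k)
  κ_κ : ∀ i j, Commute (κ i : R) (κ j)
  κ_A : ∀ i j k, Commute (κ i : R) (PowerSeries.coeff k (A j))
  κ_A' : ∀ i j k, Commute (κ i : R) (PowerSeries.coeff k (A' j))
  κ_E : ∀ i j k, Commute (κ i : R) (E j k)
  κ_F : ∀ i j k, Commute (κ i : R) (F j k)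
  A_A : ∀ i j, CoeffComm (A i) (A j)
  A'_A' : ∀ i j, CoeffComm (A' i) (A' j)
  A_A' : ∀ i j r k, PowerSeries.coeff r (A i) * PowerSeries.coeff k (A' j) =
    PowerSeries.coeff k (A' j) * PowerSeries.coeff r (A i) + if k = r then
      PowerSeries.coeff r (substMul ((c⁻¹ : Rˣ) : R) (exchangeLog p1 p2 i j)) -
        PowerSeries.coeff r (substMul (c : R) (exchangeLog p1 p2 i j)) else 0
  A_E : ∀ i j r n, PowerSeries.coeff r (A i) * E j n = E j n * PowerSeries.coeff r (A i) +
    PowerSeries.coeff r (substMul ((c⁻¹ : Rˣ) : R) (exchangeLog p1 p2 i j)) * E j (n + r)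
  A'_E : ∀ i j (r : ℕ) n, PowerSeries.coeff r (A' i) * E j n =
    E j n * PowerSeries.coeff r (A' i) +
      PowerSeries.coeff r (substMul (1 : R) (exchangeLog p1 p2 i j)) * E j (n - r)
  A_F : ∀ i j r n, PowerSeries.coeff r (A i) * F j n = F j n * PowerSeries.coeff r (A i) +
    PowerSeries.coeff r (substMul (1 : R) (exchangeLog p1 p2 j i)) * F j (n + r)
  A'_F : ∀ i j (r : ℕ) n, PowerSeries.coeff r (A' i) * F j n =
    F j n * PowerSeries.coeff r (A' i) +
      PowerSeries.coeff r (substMul (c : R) (exchangeLog p1 p2 j i)) * F j (n - r)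

/-- The current `κ exp (a)`, in powers of `z⁻¹`. -/
def expP (κ : Rˣ) (a : PowerSeries R) : ℤ → R :=
  posCurrent (PowerSeries.C (κ : R) * expSeries a)

/-- The current `κ⁻¹ exp (a)`, in powers of `z`. -/
def expM (κ : Rˣ) (a : PowerSeries R) : ℤ → R :=
  negCurrent (PowerSeries.C ((κ⁻¹ : Rˣ) : R) * expSeries a)

theorem commute_expP {x : R} {κ : Rˣ} {a : PowerSeries R} (hκ : Commute (κ : R) x)
    (ha : ∀ k, Commute (PowerSeries.coeff k a) x) (n : ℤ) : Commute (expP κ a n) x :=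
  commute_posCurrent (commute_expSeries ha hκ) n

theorem commute_expM {x : R} {κ : Rˣ} {a : PowerSeries R} (hκ : Commute (κ : R) x)
    (ha : ∀ k, Commute (PowerSeries.coeff k a) x) (n : ℤ) : Commute (expM κ a n) x :=
  commute_negCurrent (commute_expSeries ha hκ.units_inv_left) n

theorem exchangeLog_self (p1 p2 : ℂ) (i : ZMod 2) : exchangeLog p1 p2 i i = 0 := if_pos rfl

theorem coeff_substMul_zero (u : R) (k : ℕ) : PowerSeries.coeff k (substMul u 0) = 0 := by
  rw [coeff_substMul, map_zero, zero_smul]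

namespace ExchangeData

variable {p1 p2 : ℂ} {c : Rˣ} {κ : ZMod 2 → Rˣ} {A A' : ZMod 2 → PowerSeries R}
  {E F : ZMod 2 → ℤ → R}

theorem psiP_psiP (h : ExchangeData p1 p2 c κ A A' E F) (i j : ZMod 2) (m n : ℤ) :
    expP (κ i) (A i) m * expP (κ j) (A j) n = expP (κ j) (A j) n * expP (κ i) (A i) m :=
  (commute_expP (commute_expP (h.κ_κ j i) (fun k => (h.κ_A i j k).symm) n).symm
    (fun k => (commute_expP (h.κ_A j i k) (fun l => h.A_A j i l k) n).symm) m).eq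

theorem psiM_psiM (h : ExchangeData p1 p2 c κ A A' E F) (i j : ZMod 2) (m n : ℤ) :
    expM (κ i) (A' i) m * expM (κ j) (A' j) n = expM (κ j) (A' j) n * expM (κ i) (A' i) m :=
  (commute_expM (commute_expM (h.κ_κ j i) (fun k => (h.κ_A' i j k).symm) n).symm
    (fun k => (commute_expM (h.κ_A' j i k) (fun l => h.A'_A' j i l k) n).symm) m).eq

theorem psiP_E (h : ExchangeData p1 p2 c κ A A' E F) (h1 : p1 ≠ 0) (h2 : p2 ≠ 0) (i j : ZMod 2) :
    mulForms (gBar p1 p2 i j) (c : R) 1 (prodZW (expP (κ i) (A i)) (E j)) =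
      mulForms (swapForms (gBar p1 p2 j i)) (c : R) 1 (prodWZ (E j) (expP (κ i) (A i))) := by
  rcases eq_or_ne i j with rfl | hij
  · rw [mulForms_gBar_self, mulForms_swap_gBar_self]
    refine prodZW_eq_prodWZ fun m n => commute_expP (h.κ_E i i n) (fun k => ?_) m
    rw [commute_iff_eq, h.A_E, exchangeLog_self, coeff_substMul_zero, zero_mul, add_zero]
  · rw [mulForms_gBar h1 h2 hij (Commute.one_right _),
      mulForms_swap_gBar h1 h2 hij.symm (Commute.one_right _)]
    exact quadDist_exchange_pos (coeff_zero_exchangeLog _ _ _ _)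
      (quadSeries_mul_exchange h1 h2 hij) (h.A_zero i) (h.A_A i i) (fun n => (h.c_A i n).symm)
      (h.c_κ i).symm (h.κ_E i j) (h.A_E i j)

theorem psiM_E (h : ExchangeData p1 p2 c κ A A' E F) (h1 : p1 ≠ 0) (h2 : p2 ≠ 0) (i j : ZMod 2) :
    mulForms (gBar p1 p2 i j) (1 : R) 1 (prodZW (expM (κ i) (A' i)) (E j)) =
      mulForms (swapForms (gBar p1 p2 j i)) (1 : R) 1 (prodWZ (E j) (expM (κ i) (A' i))) := by
  rcases eq_or_ne i j with rfl | hij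
  · rw [mulForms_gBar_self, mulForms_swap_gBar_self]
    refine prodZW_eq_prodWZ fun m n => commute_expM (h.κ_E i i n) (fun k => ?_) m
    rw [commute_iff_eq, h.A'_E, exchangeLog_self, coeff_substMul_zero, zero_mul, add_zero]
  · rw [mulForms_gBar h1 h2 hij (Commute.one_right _),
      mulForms_swap_gBar h1 h2 hij.symm (Commute.one_right _)]
    exact quadDist_exchange_neg (coeff_zero_exchangeLog _ _ _ _)
      (quadSeries_mul_exchange h1 h2 hij) (h.A'_zero i) (h.A'_A' i i)
      (fun n => Commute.one_right _) (Commute.one_right _)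
      (fun n => (h.κ_E i j n).units_inv_left) (h.A'_E i j)

theorem psiP_F (h : ExchangeData p1 p2 c κ A A' E F) (h1 : p1 ≠ 0) (h2 : p2 ≠ 0) (i j : ZMod 2) :
    mulForms (swapForms (gBar p1 p2 j i)) (1 : R) 1 (prodZW (expP (κ i) (A i)) (F j)) =
      mulForms (gBar p1 p2 i j) (1 : R) 1 (prodWZ (F j) (expP (κ i) (A i))) := by
  rcases eq_or_ne i j with rfl | hij
  · rw [mulForms_gBar_self, mulForms_swap_gBar_self]
    refine prodZW_eq_prodWZ fun m n => commute_expP (h.κ_F i i n) (fun k => ?_) m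
    rw [commute_iff_eq, h.A_F, exchangeLog_self, coeff_substMul_zero, zero_mul, add_zero]
  · rw [mulForms_gBar h1 h2 hij (Commute.one_right _),
      mulForms_swap_gBar h1 h2 hij.symm (Commute.one_right _)]
    have h3 := quadDist_exchange_pos (c := (1 : Rˣ)) (coeff_zero_exchangeLog _ _ _ _)
      (quadSeries_mul_exchange h1 h2 hij.symm) (h.A_zero i) (h.A_A i i)
      (fun n => Commute.one_right _) (Commute.one_right _) (h.κ_F i j)
      (by rw [inv_one, Units.val_one]; exact h.A_F i j)
    rwa [Units.val_one] at h3

theorem psiM_F (h : ExchangeData p1 p2 c κ A A' E F) (h1 : p1 ≠ 0) (h2 : p2 ≠ 0) (i j : ZMod 2) :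
    mulForms (swapForms (gBar p1 p2 j i)) (c : R) 1 (prodZW (expM (κ i) (A' i)) (F j)) =
      mulForms (gBar p1 p2 i j) (c : R) 1 (prodWZ (F j) (expM (κ i) (A' i))) := by
  rcases eq_or_ne i j with rfl | hij
  · rw [mulForms_gBar_self, mulForms_swap_gBar_self]
    refine prodZW_eq_prodWZ fun m n => commute_expM (h.κ_F i i n) (fun k => ?_) m
    rw [commute_iff_eq, h.A'_F, exchangeLog_self, coeff_substMul_zero, zero_mul, add_zero]
  · rw [mulForms_gBar h1 h2 hij (Commute.one_right _),
      mulForms_swap_gBar h1 h2 hij.symm (Commute.one_right _)]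
    exact quadDist_exchange_neg (coeff_zero_exchangeLog _ _ _ _)
      (quadSeries_mul_exchange h1 h2 hij.symm) (h.A'_zero i) (h.A'_A' i i)
      (fun n => (h.c_A' i n).symm) (h.c_κ i).symm.units_inv_left
      (fun n => (h.κ_F i j n).units_inv_left) (h.A'_F i j)

/-- The coefficients of `A i` and `A' j` have central commutators, so `Ψ_j⁻` behaves under `A i`
like a vector current. This allows the `Ψ⁺`–`Ψ⁻` relation to be treated like an exchange with a
current. -/
theorem A_psiM (h : ExchangeData p1 p2 c κ A A' E F) (i j : ZMod 2) (r : ℕ) (n : ℤ) :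
    PowerSeries.coeff r (A i) * expM (κ j) (A' j) n =
      expM (κ j) (A' j) n * PowerSeries.coeff r (A i) +
        (PowerSeries.coeff r (substMul ((c⁻¹ : Rˣ) : R) (exchangeLog p1 p2 i j)) -
          PowerSeries.coeff r (substMul (c : R) (exchangeLog p1 p2 i j))) *
            expM (κ j) (A' j) (n + r) := by
  have hl : ∀ x : R, Commute (c : R) x → Commute
      (PowerSeries.coeff r (substMul ((c⁻¹ : Rˣ) : R) (exchangeLog p1 p2 i j)) -
        PowerSeries.coeff r (substMul (c : R) (exchangeLog p1 p2 i j))) x := fun x hx =>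
    ((commute_substMul hx.symm.units_inv_right _ r).symm).sub_left
      (commute_substMul hx.symm _ r).symm
  rcases eq_or_ne r 0 with rfl | hr
  · simp only [h.A_zero, coeff_substMul, coeff_zero_exchangeLog, zero_smul, zero_mul, mul_zero,
      sub_zero, add_zero]
  · exact commutator_negCurrent_exp hr (h.A'_zero j) (fun t => hl _ (h.c_A' j t))
      (h.κ_A j i r).symm.units_inv_right (hl _ (h.c_κ j).units_inv_right)
      (fun t => h.A_A' i j r t) n

theorem psiP_psiM (h : ExchangeData p1 p2 c κ A A' E F) (h1 : p1 ≠ 0) (h2 : p2 ≠ 0)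
    (i j : ZMod 2) : mulForms (gBar p1 p2 i j) 1 ((c⁻¹ : Rˣ) : R)
        (mulForms (swapForms (gBar p1 p2 j i)) 1 (c : R)
          (prodZW (expP (κ i) (A i)) (expM (κ j) (A' j)))) =
      mulForms (swapForms (gBar p1 p2 j i)) 1 ((c⁻¹ : Rˣ) : R) (mulForms (gBar p1 p2 i j) 1 (c : R)
        (prodWZ (expM (κ j) (A' j)) (expP (κ i) (A i)))) := by
  have hκ : ∀ n, Commute (κ i : R) (expM (κ j) (A' j) n) := fun n =>
    (commute_expM (h.κ_κ j i) (fun k => (h.κ_A' i j k).symm) n).symm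
  rcases eq_or_ne i j with rfl | hij
  · simp only [mulForms_gBar_self, mulForms_swap_gBar_self]
    refine prodZW_eq_prodWZ fun m n => commute_expP (hκ n) (fun k => ?_) m
    rw [commute_iff_eq, h.A_psiM, exchangeLog_self, coeff_substMul_zero, coeff_substMul_zero,
      sub_zero, zero_mul, add_zero]
  · have e1 := fun (u : R) D => mulForms_gBar h1 h2 hij (Commute.one_left u) D
    have e2 := fun (u : R) D => mulForms_swap_gBar h1 h2 hij.symm (Commute.one_left u) D
    rw [e1, e2, e2, e1]
    exact quadDist_quadDist_exchange (coeff_zero_exchangeLog _ _ _ _)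
      (quadSeries_mul_exchange h1 h2 hij) (h.A_zero i) (h.A_A i i) (fun n => (h.c_A i n).symm)
      (h.c_κ i).symm hκ (h.A_psiM i j)

end ExchangeData

end Presentation

end

section

/-! ### Verification of the presentation from commutators and anticommutators -/

section Presentation

theorem intPow_units {R : Type*} [Ring R] (u : Rˣ) (m : ℤ) :
    intPow (u : R) ((u⁻¹ : Rˣ) : R) m = ((u ^ m : Rˣ) : R) := by
  rw [intPow]
  split_ifs with h
  · obtain ⟨k, rfl⟩ := Int.eq_ofNat_of_zero_le h
    rw [Int.toNat_natCast, zpow_natCast, Units.val_pow_eq_pow_val]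
  · obtain ⟨k, hk⟩ := Int.eq_ofNat_of_zero_le (show 0 ≤ -m by omega)
    obtain rfl : m = -k := by omega
    rw [neg_neg, Int.toNat_natCast, zpow_neg, zpow_natCast, ← inv_pow, Units.val_pow_eq_pow_val]

variable {R : Type*} [Ring R] [Algebra ℂ R]

theorem quadDist_swap (T : ℂ) (D : ℤ → ℤ → R) (m n : ℤ) :
    quadDist T 1 1 (fun m n => D n m) m n = quadDist T 1 1 D n m := by
  simp only [quadDist, one_mul]
  abel

/-- The images of the generators of `E_{1|1}[K]`, given those of `E_i(z)` and `F_i(z)` and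
the logarithms of `Ψ_i^±(z)`. -/
def genMap (s2 : ℂ) (c K : Rˣ) (κ : ZMod 2 → Rˣ) (A A' : ZMod 2 → PowerSeries R)
    (E F : ZMod 2 → ℤ → R) : EGen → R
  | .E i k => E i k
  | .F i k => F i k
  | .H i r _ => (s2 - s2⁻¹)⁻¹ • (if 0 < r then PowerSeries.coeff r.toNat (A i)
      else -PowerSeries.coeff (-r).toNat (A' i))
  | .psi0 i => κ i
  | .psi0inv i => ((κ i)⁻¹ : Rˣ)
  | .C => c
  | .Cinv => (c⁻¹ : Rˣ)
  | .K => K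
  | .Kinv => (K⁻¹ : Rˣ)

variable {s2 : ℂ} {c K : Rˣ} {κ : ZMod 2 → Rˣ} {A A' : ZMod 2 → PowerSeries R}
  {E F : ZMod 2 → ℤ → R}

/-- The image of `H_{i,r}` carries the inverse of the constant in the exponent of `Ψ_i`, hence the
condition on `s2`; the opposite sign in `Ψ_i⁻` is absorbed by the sign for `r < 0` in `genMap`. -/
theorem PsiP_genMap (hs : s2 - s2⁻¹ ≠ 0) {i : ZMod 2} (hA : PowerSeries.coeff 0 (A i) = 0) :
    PsiP s2 (genMap s2 c K κ A A' E F) i = expP (κ i) (A i) := by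
  rw [PsiP, expP]
  congr 3
  ext r
  rw [PowerSeries.coeff_mk, hSeriesP, PowerSeries.coeff_mk]
  split_ifs with hr
  · rw [genMap, if_pos (by omega), smul_smul, mul_inv_cancel₀ hs, one_smul, Int.toNat_natCast]
  · rw [smul_zero, show r = 0 by omega, hA]

theorem PsiM_genMap (hs : s2 - s2⁻¹ ≠ 0) {i : ZMod 2} (hA' : PowerSeries.coeff 0 (A' i) = 0) :
    PsiM s2 (genMap s2 c K κ A A' E F) i = expM (κ i) (A' i) := by
  rw [PsiM, expM]
  congr 3
  ext r
  rw [PowerSeries.coeff_mk, hSeriesM, PowerSeries.coeff_mk]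
  split_ifs with hr
  · rw [genMap, if_neg (by omega), neg_smul, smul_smul, mul_inv_cancel₀ hs, one_smul, neg_neg,
      neg_neg, Int.toNat_natCast]
  · rw [smul_zero, show r = 0 by omega, hA']

/-- The relations of `E_{1|1}[K]` hold for `genMap`. -/
theorem eq_of_ERel {p1 p2 b : ℂ} (h1 : p1 ≠ 0) (h2 : p2 ≠ 0) (hs : s2 - s2⁻¹ ≠ 0)
    (h : ExchangeData p1 p2 c κ A A' E F)
    (hc_K : Commute (c : R) K)
    (hK_κ : ∀ i, Commute (K : R) (κ i))
    (hK_A : ∀ i k, Commute (K : R) (PowerSeries.coeff k (A i)))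
    (hK_A' : ∀ i k, Commute (K : R) (PowerSeries.coeff k (A' i)))
    (hEE : ∀ i m n, E i m * E i n + E i n * E i m = 0)
    (hFF : ∀ i m n, F i m * F i n + F i n * F i m = 0)
    (hEE' : ∀ m n, quadDist (gTrace p1 p2 0) 1 1 (prodZW (E 0) (E 1)) m n +
      quadDist (gTrace p1 p2 1) 1 1 (prodWZ (E 1) (E 0)) m n = 0)
    (hFF' : ∀ m n, quadDist (gTrace p1 p2 1) 1 1 (prodZW (F 0) (F 1)) m n +
      quadDist (gTrace p1 p2 0) 1 1 (prodWZ (F 1) (F 0)) m n = 0)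
    (hEF : ∀ i m n, E i m * F i n + F i n * E i m = -(((c ^ m : Rˣ) : R) * expP (κ i) (A i) (m + n) -
      ((c ^ n : Rˣ) : R) * expM (κ i) (A' i) (m + n)))
    (hEF' : ∀ i j m n, i ≠ j → E i m * F j n + F j n * E i m = 0)
    (hK_E0 : ∀ k, (K : R) * E 0 k = b⁻¹ • (E 0 k * K))
    (hK_F0 : ∀ k, (K : R) * F 0 k = b • (F 0 k * K))
    (hK_E1 : ∀ k, (K : R) * E 1 k = b • (E 1 k * K))
    (hK_F1 : ∀ k, (K : R) * F 1 k = b⁻¹ • (F 1 k * K))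
    {x y : R} (hxy : ERel p1 p2 s2 b (genMap s2 c K κ A A' E F) x y) : x = y := by
  have eP := fun i => PsiP_genMap (s2 := s2) (c := c) (K := K) (κ := κ) (A' := A') (E := E)
    (F := F) hs (h.A_zero i)
  have eM := fun i => PsiM_genMap (s2 := s2) (c := c) (K := K) (κ := κ) (A := A) (E := E)
    (F := F) hs (h.A'_zero i)
  have eE : ∀ i, Ecur (genMap s2 c K κ A A' E F) i = E i := fun i => rfl
  have eF : ∀ i, Fcur (genMap s2 c K κ A A' E F) i = F i := fun i => rfl
  have eC : genMap s2 c K κ A A' E F .C = c := rfl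
  have eC' : genMap s2 c K κ A A' E F .Cinv = (c⁻¹ : Rˣ) := rfl
  have eK : genMap s2 c K κ A A' E F .K = K := rfl
  have eK' : genMap s2 c K κ A A' E F .Kinv = (K⁻¹ : Rˣ) := rfl
  have conjK : ∀ (t : ℂ) (z : R), (K : R) * z = t • (z * K) →
      (K : R) * z * ((K⁻¹ : Rˣ) : R) = t • z := fun t z hz => by
    rw [hz, smul_mul_assoc, Units.mul_inv_cancel_right]
  cases hxy with
  | psi0_inv i => exact (κ i).mul_inv
  | inv_psi0 i => exact (κ i).inv_mul
  | C_inv => exact c.mul_inv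
  | inv_C => exact c.inv_mul
  | K_inv => exact K.mul_inv
  | inv_K => exact K.inv_mul
  | C_central a =>
    rw [eC]
    refine Commute.eq ?_
    cases a with
    | E i k => exact h.c_E i k
    | F i k => exact h.c_F i k
    | H i r hr =>
      rw [genMap]
      refine Commute.smul_right ?_ _
      split_ifs
      · exact h.c_A i _
      · exact (h.c_A' i _).neg_right
    | psi0 i => exact h.c_κ i
    | psi0inv i => exact (h.c_κ i).units_inv_right
    | C => exact Commute.refl _
    | Cinv => exact (Commute.refl (c : R)).units_inv_right
    | K => exact hc_K
    | Kinv => exact hc_K.units_inv_right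
  | PsiP_PsiP i j m n => rw [eP, eP]; exact h.psiP_psiP i j m n
  | PsiM_PsiM i j m n => rw [eM, eM]; exact h.psiM_psiM i j m n
  | PsiP_PsiM i j m n =>
    rw [eP, eM, eC, eC']
    exact congrFun (congrFun (h.psiP_psiM h1 h2 i j) m) n
  | PsiP_E i j m n =>
    rw [eP, eE, eC]
    exact congrFun (congrFun (h.psiP_E h1 h2 i j) m) n
  | PsiM_E i j m n =>
    rw [eM, eE]
    exact congrFun (congrFun (h.psiM_E h1 h2 i j) m) n
  | PsiP_F i j m n =>
    rw [eP, eF]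
    exact congrFun (congrFun (h.psiP_F h1 h2 i j) m) n
  | PsiM_F i j m n =>
    rw [eM, eF, eC]
    exact congrFun (congrFun (h.psiM_F h1 h2 i j) m) n
  | E_E i j m n =>
    rw [eE, eE]
    rcases eq_or_ne i j with rfl | hij
    · rw [mulForms_gBar_self, mulForms_swap_gBar_self]
      exact hEE i m n
    · rw [mulForms_gBar h1 h2 hij (Commute.one_right _),
        mulForms_swap_gBar h1 h2 hij.symm (Commute.one_right _)]
      rcases zmod_two_cases i with rfl | rfl <;> rcases zmod_two_cases j with rfl | rfl
      · exact absurd rfl hij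
      · exact hEE' m n
      -- For `(i, j) = (1, 0)` the relation is the one for `(0, 1)` with `z` and `w` interchanged,
      -- since the quadratic forms are symmetric.
      · rw [add_comm]
        have h3 := hEE' n m
        rw [← quadDist_swap _ (prodZW (E 0) (E 1)), ← quadDist_swap _ (prodWZ (E 1) (E 0))] at h3
        exact h3
      · exact absurd rfl hij
  | F_F i j m n =>
    rw [eF, eF]
    rcases eq_or_ne i j with rfl | hij
    · rw [mulForms_gBar_self, mulForms_swap_gBar_self]
      exact hFF i m n
    · rw [mulForms_gBar h1 h2 hij (Commute.one_right _),
        mulForms_swap_gBar h1 h2 hij.symm (Commute.one_right _)]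
      rcases zmod_two_cases i with rfl | rfl <;> rcases zmod_two_cases j with rfl | rfl
      · exact absurd rfl hij
      · exact hFF' m n
      · rw [add_comm]
        have h3 := hFF' n m
        rw [← quadDist_swap _ (prodZW (F 0) (F 1)), ← quadDist_swap _ (prodWZ (F 1) (F 0))] at h3
        exact h3
      · exact absurd rfl hij
  | E_F i j m n =>
    rw [eE, eF, eP, eM, eC, eC', intPow_units, intPow_units]
    split_ifs with hij
    · rw [← hij]
      exact hEF i m n
    · exact hEF' i j m n hij
  | K_E0 k => exact conjK _ _ (hK_E0 k)
  | K_F0 k => exact conjK _ _ (hK_F0 k)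
  | K_E1 k => exact conjK _ _ (hK_E1 k)
  | K_F1 k => exact conjK _ _ (hK_F1 k)
  | K_PsiP i k =>
    rw [eP, eK]
    exact (commute_expP (hK_κ i).symm (fun r => (hK_A i r).symm) k).eq.symm
  | K_PsiM i k =>
    rw [eM, eK]
    exact (commute_expM (hK_κ i).symm (fun r => (hK_A' i r).symm) k).eq.symm

end Presentation

/-! ### Compatibility of the relations with algebra homomorphisms -/

section Naturality

variable {R S : Type*} [Ring R] [Algebra ℂ R] [Ring S] [Algebra ℂ S] (f : R →ₐ[ℂ] S)

theorem map_posCurrent (P : PowerSeries R) (k : ℤ) :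
    f (posCurrent P k) = posCurrent (PowerSeries.map (f : R →+* S) P) k := by
  simp only [posCurrent]
  split_ifs <;> simp

theorem map_negCurrent (P : PowerSeries R) (k : ℤ) :
    f (negCurrent P k) = negCurrent (PowerSeries.map (f : R →+* S) P) k := by
  simp only [negCurrent]
  split_ifs <;> simp

theorem map_mulForms (l : List (ℂ × ℂ)) (a b : R) (D : ℤ → ℤ → R) (m n : ℤ) :
    f (mulForms l a b D m n) = mulForms l (f a) (f b) (fun m n => f (D m n)) m n := by
  induction l generalizing m n with
  | nil => rfl
  | cons p l ih =>
    change f (mulLinear _ _ (mulForms l a b D) m n) =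
      mulLinear _ _ (mulForms l (f a) (f b) fun m n => f (D m n)) m n
    simp only [mulLinear, map_add, map_mul, map_smul, ih]

theorem map_PsiP (s2 : ℂ) (G : EGen → R) (i : ZMod 2) (k : ℤ) :
    f (PsiP s2 G i k) = PsiP s2 (fun a => f (G a)) i k := by
  rw [PsiP, map_posCurrent, map_mul, map_expSeries, PsiP, PowerSeries.map_C]
  congr 4
  ext r
  simp only [PowerSeries.coeff_map, PowerSeries.coeff_mk, hSeriesP, RingHom.coe_coe, map_smul]
  split_ifs <;> simp

theorem map_PsiM (s2 : ℂ) (G : EGen → R) (i : ZMod 2) (k : ℤ) :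
    f (PsiM s2 G i k) = PsiM s2 (fun a => f (G a)) i k := by
  rw [PsiM, map_negCurrent, map_mul, map_expSeries, PsiM, PowerSeries.map_C]
  congr 4
  ext r
  simp only [PowerSeries.coeff_map, PowerSeries.coeff_mk, hSeriesM, RingHom.coe_coe, map_smul]
  split_ifs <;> simp

theorem map_intPow (c c' : R) (m : ℤ) : f (intPow c c' m) = intPow (f c) (f c') m := by
  simp only [intPow]
  split_ifs <;> simp

/-- The relations are given by universal formulas in the generators. This transports a relation of
the free algebra to the operators on each representation, the only place where it has to be
verified. -/
theorem ERel.map {p1 p2 s2 c : ℂ} {G : EGen → R} {x y : R} (h : ERel p1 p2 s2 c G x y) :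
    ERel p1 p2 s2 c (fun a => f (G a)) (f x) (f y) := by
  have eP := map_PsiP f s2 G
  have eM := map_PsiM f s2 G
  cases h with
  | psi0_inv i => rw [map_mul, map_one]; exact .psi0_inv i
  | inv_psi0 i => rw [map_mul, map_one]; exact .inv_psi0 i
  | C_inv => rw [map_mul, map_one]; exact .C_inv
  | inv_C => rw [map_mul, map_one]; exact .inv_C
  | K_inv => rw [map_mul, map_one]; exact .K_inv
  | inv_K => rw [map_mul, map_one]; exact .inv_K
  | C_central a => rw [map_mul, map_mul]; exact .C_central a
  | PsiP_PsiP i j m n => rw [map_mul, map_mul, eP, eP]; exact .PsiP_PsiP i j m n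
  | PsiM_PsiM i j m n => rw [map_mul, map_mul, eM, eM]; exact .PsiM_PsiM i j m n
  | PsiP_PsiM i j m n =>
    simp only [map_mulForms, map_one, prodZW, prodWZ, map_mul, eP, eM]
    exact .PsiP_PsiM (G := fun a => f (G a)) i j m n
  | PsiP_E i j m n =>
    simp only [map_mulForms, map_one, prodZW, prodWZ, map_mul, eP]
    exact .PsiP_E (G := fun a => f (G a)) i j m n
  | PsiM_E i j m n =>
    simp only [map_mulForms, map_one, prodZW, prodWZ, map_mul, eM]
    exact .PsiM_E (G := fun a => f (G a)) i j m n
  | PsiP_F i j m n =>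
    simp only [map_mulForms, map_one, prodZW, prodWZ, map_mul, eP]
    exact .PsiP_F (G := fun a => f (G a)) i j m n
  | PsiM_F i j m n =>
    simp only [map_mulForms, map_one, prodZW, prodWZ, map_mul, eM]
    exact .PsiM_F (G := fun a => f (G a)) i j m n
  | E_E i j m n =>
    simp only [map_add, map_zero, map_mulForms, map_one, prodZW, prodWZ, map_mul]
    exact .E_E (G := fun a => f (G a)) i j m n
  | F_F i j m n =>
    simp only [map_add, map_zero, map_mulForms, map_one, prodZW, prodWZ, map_mul]
    exact .F_F (G := fun a => f (G a)) i j m n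
  | E_F i j m n =>
    have := ERel.E_F (p1 := p1) (p2 := p2) (s2 := s2) (c := c) (G := fun a => f (G a)) i j m n
    rw [map_add, map_mul, map_mul, apply_ite f, map_neg, map_sub, map_mul, map_mul, map_zero,
      map_intPow, map_intPow, eP, eM]
    exact this
  | K_E0 k => rw [map_mul, map_mul, map_smul]; exact .K_E0 (G := fun a => f (G a)) k
  | K_F0 k => rw [map_mul, map_mul, map_smul]; exact .K_F0 (G := fun a => f (G a)) k
  | K_E1 k => rw [map_mul, map_mul, map_smul]; exact .K_E1 (G := fun a => f (G a)) k
  | K_F1 k => rw [map_mul, map_mul, map_smul]; exact .K_F1 (G := fun a => f (G a)) k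
  | K_PsiP i k => rw [map_mul, map_mul, eP]; exact .K_PsiP i k
  | K_PsiM i k => rw [map_mul, map_mul, eM]; exact .K_PsiM i k

end Naturality

end

section

/-! ### Gradings, fields and central elements on an admissible representation -/

namespace AdmRep

variable {L : Fin 3 → ℂ} (W : AdmRep L)

/-- Operators of bidegree `(d, w)`. -/
def Homogeneous (d w : ℤ) (T : Module.End ℂ W.V) : Prop :=
  ∀ d' α, ∀ v ∈ W.grade (d', α), T v ∈ W.grade (d' + d, α + w)

variable {W}

theorem Homogeneous.mul {d d' w w' : ℤ} {T T' : Module.End ℂ W.V} (h : W.Homogeneous d w T)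
    (h' : W.Homogeneous d' w' T') : W.Homogeneous (d + d') (w + w') (T * T') := by
  intro e α v hv
  have := h _ _ _ (h' _ _ _ hv)
  rwa [show e + (d + d') = e + d' + d by ring, show α + (w + w') = α + w' + w by ring]

theorem Homogeneous.add {d w : ℤ} {T T' : Module.End ℂ W.V} (h : W.Homogeneous d w T)
    (h' : W.Homogeneous d w T') : W.Homogeneous d w (T + T') := fun e α v hv =>
  (W.grade _).add_mem (h e α v hv) (h' e α v hv)

theorem Homogeneous.smul {d w : ℤ} {T : Module.End ℂ W.V} (h : W.Homogeneous d w T) (c : ℂ) :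
    W.Homogeneous d w (c • T) := fun e α v hv =>
  (W.grade _).smul_mem c (h e α v hv)

theorem homogeneous_zero (d w : ℤ) : W.Homogeneous d w 0 := fun _ _ _ _ =>
  (W.grade _).zero_mem

theorem homogeneous_one : W.Homogeneous 0 0 1 := fun e α v hv => by simpa using hv

theorem homogeneous_sum {ι : Type*} {d w : ℤ} {T : ι → Module.End ℂ W.V} {S : Finset ι}
    (h : ∀ i ∈ S, W.Homogeneous d w (T i)) : W.Homogeneous d w (∑ i ∈ S, T i) := by
  classical
  induction S using Finset.induction_on with
  | empty => simpa using homogeneous_zero d w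
  | insert a S ha ih =>
    rw [sum_insert ha]
    exact (h a (mem_insert_self a S)).add (ih fun i hi => h i (mem_insert_of_mem hi))

/-- A vector is a finite sum of homogeneous ones. On each of them the `k`-th mode raises the degree
by `k` within a fixed weight space, where degrees are bounded above. -/
theorem isField_of_homogeneous {w : ℤ} {b : ℤ → Module.End ℂ W.V}
    (h : ∀ k, W.Homogeneous k w (b k)) : IsField b := by
  intro v
  have hv : v ∈ ⨆ x, W.grade x := by
    rw [W.isInternal.submodule_iSup_eq_top]
    trivial
  induction hv using Submodule.iSup_induction' with
  | mem x u hu =>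
    obtain ⟨d, α⟩ := x
    obtain ⟨d₀, h₀⟩ := W.bounded (α + w)
    refine ⟨d₀ - d, fun k hk => ?_⟩
    have h1 := h k d α u hu
    rwa [h₀ (d + k) (by omega), Submodule.mem_bot] at h1
  | zero => exact ⟨0, fun k _ => map_zero _⟩
  | add u u' _ _ hu hu' =>
    obtain ⟨N, hN⟩ := hu
    obtain ⟨N', hN'⟩ := hu'
    refine ⟨max N N', fun k hk => ?_⟩
    rw [map_add, hN k (lt_of_le_of_lt (le_max_left _ _) hk),
      hN' k (lt_of_le_of_lt (le_max_right _ _) hk), add_zero]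

/-- Power series whose coefficients have their index as degree. -/
def HomogeneousSeries (W : AdmRep L) (P : PowerSeries (Module.End ℂ W.V)) : Prop :=
  ∀ k : ℕ, W.Homogeneous k 0 (PowerSeries.coeff k P)

theorem HomogeneousSeries.mul {P Q : PowerSeries (Module.End ℂ W.V)}
    (hP : W.HomogeneousSeries P) (hQ : W.HomogeneousSeries Q) : W.HomogeneousSeries (P * Q) := by
  intro k
  rw [PowerSeries.coeff_mul]
  refine homogeneous_sum fun p hp => ?_
  have := (hP p.1).mul (hQ p.2)
  rwa [← Nat.cast_add, HasAntidiagonal.mem_antidiagonal.1 hp, add_zero] at this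

theorem homogeneousSeries_C {x : Module.End ℂ W.V} (hx : W.Homogeneous 0 0 x) :
    W.HomogeneousSeries (PowerSeries.C x) := by
  intro k
  rw [PowerSeries.coeff_C]
  split_ifs with h
  · rwa [h, Nat.cast_zero]
  · exact homogeneous_zero _ _

theorem HomogeneousSeries.exp {P : PowerSeries (Module.End ℂ W.V)} (hP : W.HomogeneousSeries P) :
    W.HomogeneousSeries (expSeries P) := by
  have h1 : ∀ n, W.HomogeneousSeries (P ^ n) := by
    intro n
    induction n with
    | zero =>
      rw [pow_zero, ← map_one (PowerSeries.C (R := Module.End ℂ W.V))]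
      exact homogeneousSeries_C homogeneous_one
    | succ n ih => rw [pow_succ]; exact ih.mul hP
  intro k
  rw [expSeries, PowerSeries.coeff_mk]
  exact homogeneous_sum fun n _ => (h1 n k).smul _

theorem HomogeneousSeries.isField {P : PowerSeries (Module.End ℂ W.V)}
    (hP : W.HomogeneousSeries P) : IsField (posCurrent P) := by
  refine isField_of_homogeneous (w := 0) fun k => ?_
  rw [posCurrent]
  split_ifs with h
  · have := hP k.toNat
    rwa [Int.toNat_of_nonneg h] at this
  · exact homogeneous_zero _ _

theorem isField_Xp (i : ℤ) : IsField (W.ops.Xp i) :=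
  isField_of_homogeneous (w := 1) fun k => W.homogeneous (.Xp i k)

theorem isField_Xm (i : ℤ) : IsField (W.ops.Xm i) :=
  isField_of_homogeneous (w := -1) fun k => W.homogeneous (.Xm i k)

theorem isField_scaleC {X : ℤ → Module.End ℂ W.V} (h : IsField X) : IsField (W.scaleC X) :=
  h.mul_left _

theorem homogeneousSeries_kkLogP (t : ℂ) :
    W.HomogeneousSeries (kkLogP L W.ops.T W.ops.T' t) := by
  intro k
  simp only [kkLogP, GL1Data.psiLogP, PowerSeries.coeff_mk]
  split_ifs
  · simpa using homogeneous_zero _ _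
  · have h1 : W.Homogeneous k 0 (W.ops.T.h k) := W.homogeneous (.h k)
    have h2 : W.Homogeneous k 0 (W.ops.T'.h k) := W.homogeneous (.h' k)
    exact ((h1.smul _).smul _).add ((h2.smul _).smul _)

variable (W)

theorem T_rel : W.ops.T.Relations L := W.relations.rel

theorem T'_rel : W.ops.T'.Relations (check L) := W.relations.rel'

theorem T_T' : ∀ x ∈ W.ops.T.gens, ∀ y ∈ W.ops.T'.gens, Commute x y := fun x hx y hy =>
  W.relations.commute x (Or.inl hx) y (Or.inl hy)

theorem C_mem : (W.ops.T.C : Module.End ℂ W.V) ∈ W.ops.T.gens := Or.inr (Or.inl rfl)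

theorem psi0_mem : (W.ops.T.psi0 : Module.End ℂ W.V) ∈ W.ops.T.gens := Or.inr (Or.inr rfl)

theorem C_T : ∀ x ∈ W.ops.T.gens, Commute (W.ops.T.C : Module.End ℂ W.V) x := W.T_rel.C_central

theorem C_T' : ∀ x ∈ W.ops.T'.gens, Commute (W.ops.T.C : Module.End ℂ W.V) x := by
  rw [W.relations.C_eq]
  exact W.T'_rel.C_central

theorem psi0_T : ∀ x ∈ W.ops.T.gens, Commute (W.ops.T.psi0 : Module.End ℂ W.V) x :=
  W.T_rel.psi0_central

theorem psi0_T' : ∀ x ∈ W.ops.T'.gens, Commute (W.ops.T.psi0 : Module.End ℂ W.V) x := by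
  rw [W.relations.psi0_eq]
  exact W.T'_rel.psi0_central

theorem K_T' : ∀ x ∈ W.ops.T'.gens, Commute (W.ops.K : Module.End ℂ W.V) x := fun x hx =>
  W.relations.commute _ (Or.inr rfl) x (Or.inl hx)

theorem K'_T : ∀ x ∈ W.ops.T.gens, Commute (W.ops.K' : Module.End ℂ W.V) x := fun x hx =>
  (W.relations.commute x (Or.inl hx) _ (Or.inr rfl)).symm

theorem K_K' : Commute (W.ops.K : Module.End ℂ W.V) W.ops.K' :=
  W.relations.commute _ (Or.inr rfl) _ (Or.inr rfl)

/-- The product of `K` and `Ǩ`. -/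
def KK : (Module.End ℂ W.V)ˣ := W.ops.K * W.ops.K'

theorem KK_T : ∀ x ∈ W.ops.T.gens, Commute (W.KK : Module.End ℂ W.V) x := fun x hx => by
  rw [KK, Units.val_mul]
  exact (W.relations.K_central x hx).mul_left (W.K'_T x hx)

theorem KK_T' : ∀ x ∈ W.ops.T'.gens, Commute (W.KK : Module.End ℂ W.V) x := fun x hx => by
  rw [KK, Units.val_mul]
  exact (W.K_T' x hx).mul_left (W.relations.K'_central x hx)

theorem K_KK : Commute (W.ops.K : Module.End ℂ W.V) W.KK := by
  rw [KK, Units.val_mul]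
  exact (Commute.refl _).mul_right W.K_K'

theorem C_Xp (i n : ℤ) : Commute (W.ops.T.C : Module.End ℂ W.V) (W.ops.Xp i n) :=
  (W.relations.left i).C_X n

theorem C_Xm (i n : ℤ) : Commute (W.ops.T.C : Module.End ℂ W.V) (W.ops.Xm i n) :=
  (W.relations.right i).C_X n

theorem psi0_Xp (i n : ℤ) : Commute (W.ops.T.psi0 : Module.End ℂ W.V) (W.ops.Xp i n) :=
  ((W.relations.left i).commutator_P W.T_rel).1 n

theorem psi0_Xm (i n : ℤ) : Commute (W.ops.T.psi0 : Module.End ℂ W.V) (W.ops.Xm i n) :=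
  ((W.relations.right i).commutator_P W.T_rel).1 n

/-- With vanishing sum of logarithms, `β = (log q_1 + log q_2) / log q_1` and `β̌ = -log q_2 / log
q_1`, so `β log q_2` and `β̌ log q̌_2` are opposite. -/
theorem _root_.QTor.q2HalfBeta_mul_check (hL : L 0 ≠ 0) (hsum : L 0 + L 1 + L 2 = 0) :
    q2HalfBeta L * q2HalfBeta (check L) = 1 := by
  rw [q2HalfBeta, q2HalfBeta, ← Complex.exp_add, ← Complex.exp_zero]
  congr 1
  have h2 : L 2 = -L 0 - L 1 := by linear_combination hsum
  simp only [beta, check, Matrix.cons_val, h2]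
  field_simp
  ring

variable {W}

/-- The constants of `K` and `Ǩ` cancel. This is what makes the constant terms of all `Ψ_i^±`
commute with the images of `E_j` and `F_j`. -/
theorem KK_Xp (hL : L 0 ≠ 0) (hsum : L 0 + L 1 + L 2 = 0) (i n : ℤ) :
    Commute (W.KK : Module.End ℂ W.V) (W.ops.Xp i n) := by
  rw [commute_iff_eq, KK, Units.val_mul, mul_assoc, W.relations.K'_Xp, mul_smul_comm, ← mul_assoc,
    W.relations.K_Xp, smul_mul_assoc, smul_smul, mul_comm (q2HalfBeta (check L)),
    q2HalfBeta_mul_check hL hsum, one_smul, mul_assoc]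

theorem KK_Xm (hL : L 0 ≠ 0) (hsum : L 0 + L 1 + L 2 = 0) (i n : ℤ) :
    Commute (W.KK : Module.End ℂ W.V) (W.ops.Xm i n) := by
  rw [commute_iff_eq, KK, Units.val_mul, mul_assoc, W.relations.K'_Xm, mul_smul_comm, ← mul_assoc,
    W.relations.K_Xm, smul_mul_assoc, smul_smul, ← mul_inv, mul_comm (q2HalfBeta (check L)),
    q2HalfBeta_mul_check hL hsum, inv_one, one_smul, mul_assoc]

end AdmRep

end

section

/-- The function on `ℤ/2` with given values. -/
def pair {α : Type*} (x₀ x₁ : α) (i : ZMod 2) : α := if i = 0 then x₀ else x₁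

theorem pair_zero {α : Type*} (x₀ x₁ : α) : pair x₀ x₁ 0 = x₀ := if_pos rfl

theorem pair_one {α : Type*} (x₀ x₁ : α) : pair x₀ x₁ 1 = x₁ := if_neg (by decide)

theorem forall_zmod_two {P : ZMod 2 → Prop} (h₀ : P 0) (h₁ : P 1) (i : ZMod 2) : P i := by
  rcases zmod_two_cases i with rfl | rfl
  exacts [h₀, h₁]

/-- The conditions on the parameters. -/
structure Generic (L : Fin 3 → ℂ) : Prop where
  sum : L 0 + L 1 + L 2 = 0
  gen : ∀ a b : ℤ, q L 0 ^ a * q L 1 ^ b = 1 → a = 0 ∧ b = 0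

/-- Needed because `log q_1` is the denominator of `β`; the genericity condition excludes `q_1 = 1`.
-/
theorem Generic.ne_zero {L : Fin 3 → ℂ} (h : Generic L) : L 0 ≠ 0 := fun h0 => by
  have := h.gen 1 0
  simp [q, h0] at this

/-! ### The dressed currents `E_0`, `F_0` and their commutators with the logarithms -/

namespace AdmRep

variable {L : Fin 3 → ℂ} (W : AdmRep L)

/-- The logarithm of `k_0⁺(z) ǩ_0⁺(t z)`. -/
abbrev logP (t : ℂ) : PowerSeries (Module.End ℂ W.V) := kkLogP L W.ops.T W.ops.T' t

/-- The logarithm of `k_0⁻(z) ǩ_0⁻(t z)`. -/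
abbrev logM (t : ℂ) : PowerSeries (Module.End ℂ W.V) := kkLogM L W.ops.T W.ops.T' t

theorem kkP_eq (t : ℂ) : W.kkP t = PowerSeries.C (W.KK : Module.End ℂ W.V) * expSeries (W.logP t) :=
  k0P_mul_k0P W.T_rel W.T'_rel W.T_T' _ _ (fun x hx => (W.K'_T x hx).symm) t

theorem kkM_eq (t : ℂ) : W.kkM t = PowerSeries.C ((W.KK⁻¹ : (Module.End ℂ W.V)ˣ) : Module.End ℂ W.V) *
    expSeries (W.logM t) :=
  k0M_mul_k0M W.T_rel W.T'_rel W.T_T' _ _ W.K_K'.units_of_val (fun x hx => (W.K'_T x hx).symm) t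

/-- The current `(k_0⁺(z) ǩ_0⁺(q_1 z))⁻¹`. -/
def invP : ℤ → Module.End ℂ W.V := expP W.KK⁻¹ (-W.logP (q L 0))

/-- The current `(k_0⁻(z) ǩ_0⁻(q_1 z))⁻¹`. -/
def invM : ℤ → Module.End ℂ W.V := expM W.KK⁻¹ (-W.logM (q L 0))

/-- The image of `E_0(q̄_1 z)`. -/
def curE : ℤ → Module.End ℂ W.V := fun n =>
  ((W.ops.T.psi0⁻¹ : (Module.End ℂ W.V)ˣ) : Module.End ℂ W.V) *
    locMul W.invM (W.scaleC (W.ops.Xm (-1))) n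

/-- The image of `F_0(q̄_1 z)`. -/
def curF : ℤ → Module.End ℂ W.V :=
  locMul (W.scaleC (W.ops.Xp 1)) (fun n => W.ops.T.psi0 * W.invP n)

section Commutators

theorem logP_logP (t t' : ℂ) : CoeffComm (W.logP t) (W.logP t') :=
  coeffComm_kkLogP W.T_rel W.T'_rel W.T_T' t t'

theorem logM_logM (t t' : ℂ) : CoeffComm (W.logM t) (W.logM t') :=
  coeffComm_kkLogM W.T_rel W.T'_rel W.T_T' t t'

variable {W}

theorem commute_logP {x : Module.End ℂ W.V} (h : ∀ y ∈ W.ops.T.gens, Commute x y)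
    (h' : ∀ y ∈ W.ops.T'.gens, Commute x y) (t : ℂ) (k : ℕ) :
    Commute x (PowerSeries.coeff k (W.logP t)) := commute_kkLogP h h' t k

theorem commute_logM {x : Module.End ℂ W.V} (h : ∀ y ∈ W.ops.T.gens, Commute x y)
    (h' : ∀ y ∈ W.ops.T'.gens, Commute x y) (t : ℂ) (k : ℕ) :
    Commute x (PowerSeries.coeff k (W.logM t)) := commute_kkLogM h h' t k

/-- An operator that commutes with the toroidal algebras commutes with the currents
`k_0^±(z) ǩ_0^±(q_1 z)`. -/
theorem commute_invM {x : Module.End ℂ W.V} (h : ∀ y ∈ W.ops.T.gens, Commute x y)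
    (h' : ∀ y ∈ W.ops.T'.gens, Commute x y) (hK : Commute x W.KK) (n : ℤ) :
    Commute x (W.invM n) :=
  (commute_expM hK.symm.units_inv_left
    (fun k => by rw [map_neg]; exact (commute_logM h h' _ k).symm.neg_left) n).symm

theorem commute_invP {x : Module.End ℂ W.V} (h : ∀ y ∈ W.ops.T.gens, Commute x y)
    (h' : ∀ y ∈ W.ops.T'.gens, Commute x y) (hK : Commute x W.KK) (n : ℤ) :
    Commute x (W.invP n) :=
  (commute_expP hK.symm.units_inv_left
    (fun k => by rw [map_neg]; exact (commute_logP h h' _ k).symm.neg_left) n).symm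

variable (W)

theorem C_KK : Commute (W.ops.T.C : Module.End ℂ W.V) W.KK :=
  (W.KK_T _ W.C_mem).symm

theorem psi0_KK : Commute (W.ops.T.psi0 : Module.End ℂ W.V) W.KK :=
  (W.KK_T _ W.psi0_mem).symm

theorem C_psi0 : Commute (W.ops.T.C : Module.End ℂ W.V) W.ops.T.psi0 :=
  W.C_T _ W.psi0_mem

variable {W}

theorem commute_C_zpow {x : Module.End ℂ W.V} (h : Commute (W.ops.T.C : Module.End ℂ W.V) x)
    (n : ℤ) : Commute ((W.ops.T.C ^ n : (Module.End ℂ W.V)ˣ) : Module.End ℂ W.V) x :=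
  h.units_zpow_left n

theorem commute_scaleC {x : Module.End ℂ W.V} (h : Commute (W.ops.T.C : Module.End ℂ W.V) x)
    {X : ℤ → Module.End ℂ W.V} (hX : ∀ n, Commute x (X n)) (n : ℤ) : Commute x (W.scaleC X n) :=
  (commute_C_zpow h _).symm.mul_right (hX n)

theorem commutator_scaleC {X : ℤ → Module.End ℂ W.V} {x l : Module.End ℂ W.V} {r : ℤ}
    (hC : Commute (W.ops.T.C : Module.End ℂ W.V) x)
    (hl : Commute (W.ops.T.C : Module.End ℂ W.V) l)
    (h : ∀ n, x * X n = X n * x + l * X (n + r)) (n : ℤ) :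
    x * W.scaleC X n = W.scaleC X n * x +
      (l * ((W.ops.T.C ^ r : (Module.End ℂ W.V)ˣ) : Module.End ℂ W.V)) * W.scaleC X (n + r) := by
  have h1 : ((W.ops.T.C ^ (-n) : (Module.End ℂ W.V)ˣ) : Module.End ℂ W.V) =
      ((W.ops.T.C ^ r : (Module.End ℂ W.V)ˣ) : Module.End ℂ W.V) *
        ((W.ops.T.C ^ (-(n + r)) : (Module.End ℂ W.V)ˣ) : Module.End ℂ W.V) := by
    rw [← Units.val_mul, ← zpow_add]
    congr 2
    ring
  simp only [scaleC]
  rw [← mul_assoc, ← (commute_C_zpow hC (-n)).eq, mul_assoc, h, mul_add, mul_assoc, ← mul_assoc _ l,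
    (commute_C_zpow hl (-n)).eq]
  simp only [mul_assoc, h1]

variable (W)

theorem logP_Xp (t : ℂ) (i : ℤ) (r : ℕ) (n : ℤ) :
    PowerSeries.coeff r (W.logP t) * W.ops.Xp i n = W.ops.Xp i n * PowerSeries.coeff r (W.logP t) +
      (gammaP L r ((t⁻¹ * q L 0 ^ i) ^ r) •
        ((W.ops.T.C⁻¹ : (Module.End ℂ W.V)ˣ) : Module.End ℂ W.V) ^ r) * W.ops.Xp i (n + r) :=
  commutator_kkLogP_left W.T_rel W.T'_rel W.relations.C_eq (W.relations.left i)
    (W.relations.left' i) t r n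

theorem logP_Xm (t : ℂ) (i : ℤ) (r : ℕ) (n : ℤ) :
    PowerSeries.coeff r (W.logP t) * W.ops.Xm i n = W.ops.Xm i n * PowerSeries.coeff r (W.logP t) +
      (-gammaP L r ((t⁻¹ * q L 0 ^ (-i)) ^ r)) • W.ops.Xm i (n + r) :=
  commutator_kkLogP_right W.T_rel W.T'_rel (W.relations.right i) (W.relations.right' i) t r n

theorem logM_Xp (hL : Generic L) (t : ℂ) (i : ℤ) (r : ℕ) (n : ℤ) :
    PowerSeries.coeff r (W.logM t) * W.ops.Xp i n = W.ops.Xp i n * PowerSeries.coeff r (W.logM t) +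
      (-gammaP L r ((t * (q L 0 ^ i)⁻¹) ^ r)) • W.ops.Xp i (n - r) := by
  rw [← gammaM_eq hL.sum hL.gen]
  exact commutator_kkLogM_left W.T_rel W.T'_rel (W.relations.left i) (W.relations.left' i) t r n

theorem logM_Xm (hL : Generic L) (t : ℂ) (i : ℤ) (r : ℕ) (n : ℤ) :
    PowerSeries.coeff r (W.logM t) * W.ops.Xm i n = W.ops.Xm i n * PowerSeries.coeff r (W.logM t) +
      (gammaP L r ((t * (q L 0 ^ (-i))⁻¹) ^ r) • (W.ops.T.C : Module.End ℂ W.V) ^ r) *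
        W.ops.Xm i (n - r) := by
  have := commutator_kkLogM_right W.T_rel W.T'_rel W.relations.C_eq (W.relations.right i)
    (W.relations.right' i) t r n
  rwa [gammaM_eq hL.sum hL.gen, neg_neg] at this

theorem logP_logM (hL : Generic L) (t t' : ℂ) (r k : ℕ) :
    PowerSeries.coeff r (W.logP t) * PowerSeries.coeff k (W.logM t') =
      PowerSeries.coeff k (W.logM t') * PowerSeries.coeff r (W.logP t) +
        if k = r then -(gammaP L r ((t⁻¹ * t') ^ r) • ((W.ops.T.C : Module.End ℂ W.V) ^ r -
          ((W.ops.T.C⁻¹ : (Module.End ℂ W.V)ˣ) : Module.End ℂ W.V) ^ r)) else 0 :=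
  commutator_kkLog hL.sum hL.gen W.T_rel W.T'_rel W.T_T' W.relations.C_eq t t' r k

variable {W}

theorem commutator_psi0inv {B : ℤ → Module.End ℂ W.V} {x l : Module.End ℂ W.V} {r : ℤ}
    (hx : Commute (W.ops.T.psi0 : Module.End ℂ W.V) x)
    (hl : Commute (W.ops.T.psi0 : Module.End ℂ W.V) l)
    (h : ∀ n, x * B n = B n * x + l * B (n + r)) (n : ℤ) :
    x * (((W.ops.T.psi0⁻¹ : (Module.End ℂ W.V)ˣ) : Module.End ℂ W.V) * B n) =
      ((W.ops.T.psi0⁻¹ : (Module.End ℂ W.V)ˣ) : Module.End ℂ W.V) * B n * x +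
        l * (((W.ops.T.psi0⁻¹ : (Module.End ℂ W.V)ˣ) : Module.End ℂ W.V) * B (n + r)) := by
  rw [← mul_assoc, ← hx.units_inv_left.eq, mul_assoc, h, mul_add, ← mul_assoc _ l,
    hl.units_inv_left.eq]
  simp only [mul_assoc]

theorem commutator_psi0 {B : ℤ → Module.End ℂ W.V} {x l : Module.End ℂ W.V} {r : ℤ}
    (hx : Commute (W.ops.T.psi0 : Module.End ℂ W.V) x)
    (hl : Commute (W.ops.T.psi0 : Module.End ℂ W.V) l)
    (h : ∀ n, x * B n = B n * x + l * B (n + r)) (n : ℤ) :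
    x * (W.ops.T.psi0 * B n) = W.ops.T.psi0 * B n * x + l * (W.ops.T.psi0 * B (n + r)) := by
  rw [← mul_assoc, ← hx.eq, mul_assoc, h, mul_add, ← mul_assoc _ l, hl.eq]
  simp only [mul_assoc]

theorem psi0_logP (t : ℂ) (k : ℕ) :
    Commute (W.ops.T.psi0 : Module.End ℂ W.V) (PowerSeries.coeff k (W.logP t)) :=
  commute_logP W.psi0_T W.psi0_T' t k

theorem psi0_logM (t : ℂ) (k : ℕ) :
    Commute (W.ops.T.psi0 : Module.End ℂ W.V) (PowerSeries.coeff k (W.logM t)) :=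
  commute_logM W.psi0_T W.psi0_T' t k

theorem C_logP (t : ℂ) (k : ℕ) :
    Commute (W.ops.T.C : Module.End ℂ W.V) (PowerSeries.coeff k (W.logP t)) :=
  commute_logP W.C_T W.C_T' t k

theorem C_logM (t : ℂ) (k : ℕ) :
    Commute (W.ops.T.C : Module.End ℂ W.V) (PowerSeries.coeff k (W.logM t)) :=
  commute_logM W.C_T W.C_T' t k

theorem KK_logP (t : ℂ) (k : ℕ) :
    Commute (W.KK : Module.End ℂ W.V) (PowerSeries.coeff k (W.logP t)) :=
  commute_logP W.KK_T W.KK_T' t k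

theorem KK_logM (t : ℂ) (k : ℕ) :
    Commute (W.KK : Module.End ℂ W.V) (PowerSeries.coeff k (W.logM t)) :=
  commute_logM W.KK_T W.KK_T' t k

variable (W)

/-- `C^r - C^{-r}`. -/
def diffC (r : ℕ) : Module.End ℂ W.V := (W.ops.T.C : Module.End ℂ W.V) ^ r -
  ((W.ops.T.C⁻¹ : (Module.End ℂ W.V)ˣ) : Module.End ℂ W.V) ^ r

variable {W}

theorem commute_diffC {x : Module.End ℂ W.V} (h : Commute (W.ops.T.C : Module.End ℂ W.V) x)
    (r : ℕ) : Commute (W.diffC r) x :=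
  (h.pow_left r).sub_left (h.units_inv_left.pow_left r)

variable (W)

/-- The exponent of `invM` is `-logM`, so its central commutator with `logP` has the sign opposite
to that in `logP_logM`. -/
theorem logP_invM (hL : Generic L) (t : ℂ) (r : ℕ) (n : ℤ) :
    PowerSeries.coeff r (W.logP t) * W.invM n = W.invM n * PowerSeries.coeff r (W.logP t) +
      (gammaP L r ((t⁻¹ * q L 0) ^ r) • W.diffC r) * W.invM (n + r) := by
  rcases eq_or_ne r 0 with rfl | hr
  · rw [coeff_zero_kkLogP, gammaP_zero]
    simp
  have hc : ∀ {x : Module.End ℂ W.V}, Commute (W.ops.T.C : Module.End ℂ W.V) x →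
      Commute (gammaP L r ((t⁻¹ * q L 0) ^ r) • W.diffC r) x := fun h =>
    (commute_diffC h r).smul_left _
  refine commutator_negCurrent_exp hr ?_ (fun k => hc ?_) ?_ (hc ?_) (fun k => ?_) n
  · rw [map_neg, coeff_zero_kkLogM, neg_zero]
  · rw [map_neg]
    exact (C_logM _ k).neg_right
  · simpa using (KK_logP t r).symm
  · simpa using W.C_KK
  · rw [map_neg, mul_neg, neg_mul, W.logP_logM hL, neg_add]
    congr 1
    split_ifs
    · rw [neg_neg]; rfl
    · rw [neg_zero]

theorem logM_invP (hL : Generic L) (t : ℂ) (r : ℕ) (n : ℤ) :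
    PowerSeries.coeff r (W.logM t) * W.invP n = W.invP n * PowerSeries.coeff r (W.logM t) +
      (-gammaP L r ((t * (q L 0)⁻¹) ^ r) • W.diffC r) * W.invP (n - r) := by
  rcases eq_or_ne r 0 with rfl | hr
  · rw [coeff_zero_kkLogM, gammaP_zero]
    simp
  have hc : ∀ {x : Module.End ℂ W.V}, Commute (W.ops.T.C : Module.End ℂ W.V) x →
      Commute (-gammaP L r ((t * (q L 0)⁻¹) ^ r) • W.diffC r) x := fun h =>
    (commute_diffC h r).smul_left _
  refine commutator_posCurrent_exp hr ?_ (fun k => hc ?_) ?_ (hc ?_) (fun k => ?_) n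
  · rw [map_neg, coeff_zero_kkLogP, neg_zero]
  · rw [map_neg]
    exact (C_logP _ k).neg_right
  · exact (KK_logM t r).symm.units_inv_right
  · exact W.C_KK.units_inv_right
  · rw [map_neg, mul_neg, neg_mul, W.logP_logM hL, neg_add, mul_comm t]
    split_ifs with h1 h2 h2
    · subst h1
      rw [neg_neg, neg_smul]; exact (add_neg_cancel_right _ _).symm
    · exact absurd h1.symm h2
    · exact absurd h2.symm h1
    · simp

theorem logM_invM (t : ℂ) (r : ℕ) (n : ℤ) :
    Commute (PowerSeries.coeff r (W.logM t)) (W.invM n) :=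
  (commute_expM (KK_logM t r).units_inv_left
    (fun k => by rw [map_neg]; exact (W.logM_logM _ _ _ _).neg_left) n).symm

theorem logP_invP (t : ℂ) (r : ℕ) (n : ℤ) :
    Commute (PowerSeries.coeff r (W.logP t)) (W.invP n) :=
  (commute_expP (KK_logP t r).units_inv_left
    (fun k => by rw [map_neg]; exact (W.logP_logP _ _ _ _).neg_left) n).symm

theorem isField_invP : IsField W.invP := by
  refine HomogeneousSeries.isField (HomogeneousSeries.mul (homogeneousSeries_C ?_)
    (HomogeneousSeries.exp ?_))
  · have h1 : W.Homogeneous 0 0 ((W.ops.K⁻¹ : (Module.End ℂ W.V)ˣ) : Module.End ℂ W.V) :=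
      W.homogeneous .Kinv
    have h2 : W.Homogeneous 0 0 ((W.ops.K'⁻¹ : (Module.End ℂ W.V)ˣ) : Module.End ℂ W.V) :=
      W.homogeneous .K'inv
    rw [KK, mul_inv_rev, Units.val_mul]
    exact h2.mul h1
  · intro k
    rw [map_neg, ← neg_one_smul ℂ]
    exact (homogeneousSeries_kkLogP _ k).smul _

/-- The order of the factors is essential: the series in `z` on the left bounds the summation index
from below, and the field on the right from above. -/
theorem locFinMul_curE : LocFinMul W.invM (W.scaleC (W.ops.Xm (-1))) :=
  (isField_scaleC (isField_Xm (-1))).locFinMul_neg _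

theorem invP_neg {n : ℤ} (hn : n < 0) : W.invP n = 0 := if_neg (not_le.2 hn)

theorem locFinMul_curF :
    LocFinMul (W.scaleC (W.ops.Xp 1)) (fun n => W.ops.T.psi0 * W.invP n) :=
  (W.isField_invP.mul_left _).locFinMul_pos (fun k hk => by rw [W.invP_neg hk, mul_zero]) _

theorem invC_pow (r : ℕ) : ((W.ops.T.C⁻¹ : (Module.End ℂ W.V)ˣ) : Module.End ℂ W.V) ^ r *
    ((W.ops.T.C ^ (r : ℤ) : (Module.End ℂ W.V)ˣ) : Module.End ℂ W.V) = 1 := by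
  rw [← units_zpow_neg_natCast, ← Units.val_mul, ← zpow_add, neg_add_cancel, zpow_zero,
    Units.val_one]

theorem C_zpow_natCast (r : ℕ) :
    ((W.ops.T.C ^ (r : ℤ) : (Module.End ℂ W.V)ˣ) : Module.End ℂ W.V) =
      (W.ops.T.C : Module.End ℂ W.V) ^ r := by
  rw [zpow_natCast, Units.val_pow_eq_pow_val]

/-- The dressing contributes `γ (C^r - C^{-r})`, and `X_{-1}^-(C z)` contributes `-γ C^r`, where the
power of `C` comes from the argument. The sum is `-γ C^{-r}`, the dependence on `C` required of an
`E`-current. -/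
theorem logP_curE (hL : Generic L) (t : ℂ) (r : ℕ) (n : ℤ) :
    PowerSeries.coeff r (W.logP t) * W.curE n = W.curE n * PowerSeries.coeff r (W.logP t) +
      (-gammaP L r ((t⁻¹ * q L 0) ^ r) •
        ((W.ops.T.C⁻¹ : (Module.End ℂ W.V)ˣ) : Module.End ℂ W.V) ^ r) * W.curE (n + r) := by
  have hC : ∀ a : ℂ, Commute (W.ops.T.C : Module.End ℂ W.V) (a • 1) := fun a =>
    (Commute.one_right _).smul_right a
  have h1 := commutator_scaleC (l := (-gammaP L r ((t⁻¹ * q L 0) ^ r)) • 1) (C_logP t r) (hC _)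
    (fun n => by simpa using W.logP_Xm t (-1) r n)
  have h2 := commutator_locMul W.locFinMul_curE (W.logP_invM hL t r) h1 fun n => by
    rw [smul_mul_assoc, one_mul]
    exact (commute_C_zpow (commute_invM W.C_T W.C_T' W.C_KK n) _).smul_left _
  refine commutator_psi0inv (psi0_logP t r) ?_ (fun n => ?_) n
  · exact ((W.C_psi0.symm.units_inv_right).pow_right r).smul_right _
  · rw [h2 n, smul_mul_assoc, one_mul, C_zpow_natCast, diffC]
    congr 2
    module

/-- The dressing commutes with `logM`, and the factor `C^r` from `X_{-1}^-` is cancelled by the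
rescaled argument `C z`. -/
theorem logM_curE (hL : Generic L) (t : ℂ) (r : ℕ) (n : ℤ) :
    PowerSeries.coeff r (W.logM t) * W.curE n = W.curE n * PowerSeries.coeff r (W.logM t) +
      (gammaP L r ((t * (q L 0)⁻¹) ^ r) • (1 : Module.End ℂ W.V)) * W.curE (n - r) := by
  have h1 := commutator_scaleC (r := -(r : ℤ))
    (l := gammaP L r ((t * (q L 0)⁻¹) ^ r) • (W.ops.T.C : Module.End ℂ W.V) ^ r) (C_logM t r)
    (((Commute.refl _).pow_right r).smul_right _)
    (fun n => by simpa [sub_eq_add_neg] using W.logM_Xm hL t (-1) r n)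
  have h2 := commutator_locMul (l := 0) W.locFinMul_curE
    (fun n => by rw [zero_mul, add_zero]; exact (W.logM_invM t r n).eq) h1 fun n => by
      rw [smul_mul_assoc]
      exact (((commute_invM W.C_T W.C_T' W.C_KK n).pow_left r).mul_left
        (commute_C_zpow (commute_invM W.C_T W.C_T' W.C_KK n) _)).smul_left _
  refine commutator_psi0inv (r := -(r : ℤ)) (psi0_logM t r)
    ((Commute.one_right _).smul_right _) (fun n => ?_) n
  rw [h2 n, zero_add, smul_mul_assoc, ← C_zpow_natCast, ← Units.val_mul, ← zpow_add,
    add_neg_cancel, zpow_zero, Units.val_one]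

/-- As for `logM_curE`: the dressing commutes, and `C^{-r}` from `X_1^+` cancels against the
argument `C z`. -/
theorem logP_curF (t : ℂ) (r : ℕ) (n : ℤ) :
    PowerSeries.coeff r (W.logP t) * W.curF n = W.curF n * PowerSeries.coeff r (W.logP t) +
      (gammaP L r ((t⁻¹ * q L 0) ^ r) • (1 : Module.End ℂ W.V)) * W.curF (n + r) := by
  have h1 := commutator_scaleC (r := (r : ℤ))
    (l := gammaP L r ((t⁻¹ * q L 0) ^ r) •
      ((W.ops.T.C⁻¹ : (Module.End ℂ W.V)ˣ) : Module.End ℂ W.V) ^ r) (C_logP t r)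
    ((((Commute.refl (W.ops.T.C : Module.End ℂ W.V)).units_inv_right).pow_right r).smul_right _)
    (fun n => by simpa using W.logP_Xp t 1 r n)
  have h2 := commutator_locMul (l' := 0) W.locFinMul_curF h1
    (fun n => by
      rw [zero_mul, add_zero]
      exact ((psi0_logP t r).symm.mul_right (W.logP_invP t r n)).eq)
    fun n => Commute.zero_left _
  rw [curF, h2 n, add_zero, smul_mul_assoc, invC_pow]

/-- `X_1^+(C z)` contributes `-γ C^{-r}` and the dressing `-γ (C^r - C^{-r})`; the total is `-γ
C^r`, as required of an `F`-current. -/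
theorem logM_curF (hL : Generic L) (t : ℂ) (r : ℕ) (n : ℤ) :
    PowerSeries.coeff r (W.logM t) * W.curF n = W.curF n * PowerSeries.coeff r (W.logM t) +
      (-gammaP L r ((t * (q L 0)⁻¹) ^ r) • (W.ops.T.C : Module.End ℂ W.V) ^ r) *
        W.curF (n - r) := by
  have hC : ∀ a : ℂ, Commute (W.ops.T.C : Module.End ℂ W.V) (a • 1) := fun a =>
    (Commute.one_right _).smul_right a
  have h1 := commutator_scaleC (r := -(r : ℤ)) (l := (-gammaP L r ((t * (q L 0)⁻¹) ^ r)) • 1)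
    (C_logM t r) (hC _) (fun n => by simpa [sub_eq_add_neg] using W.logM_Xp hL t 1 r n)
  have h2 := commutator_locMul (r := -(r : ℤ)) W.locFinMul_curF h1
    (commutator_psi0 (r := -(r : ℤ)) (psi0_logM t r)
      ((commute_diffC W.C_psi0 r).symm.smul_right _) (W.logM_invP hL t r)) fun n =>
      (commute_diffC (commute_scaleC (Commute.refl _) (W.C_Xp 1) n) r).smul_left _
  rw [curF, h2 n, smul_mul_assoc, one_mul, units_zpow_neg_natCast, diffC]
  congr 2
  module

end Commutators

end AdmRep

end

section

/-! ### The images of the generators and their exchange data -/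

namespace AdmRep

variable {L : Fin 3 → ℂ} (W : AdmRep L)

theorem commute_curE {x : Module.End ℂ W.V} (h : ∀ y ∈ W.ops.T.gens, Commute x y)
    (h' : ∀ y ∈ W.ops.T'.gens, Commute x y) (hK : Commute x W.KK)
    (hX : ∀ n, Commute x (W.ops.Xm (-1) n)) (n : ℤ) : Commute x (W.curE n) :=
  (h _ W.psi0_mem).units_inv_right.mul_right (commute_locMul W.locFinMul_curE
    (commute_invM h h' hK) (commute_scaleC (h _ W.C_mem).symm hX) n)

theorem commute_curF {x : Module.End ℂ W.V} (h : ∀ y ∈ W.ops.T.gens, Commute x y)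
    (h' : ∀ y ∈ W.ops.T'.gens, Commute x y) (hK : Commute x W.KK)
    (hX : ∀ n, Commute x (W.ops.Xp 1 n)) (n : ℤ) : Commute x (W.curF n) :=
  commute_locMul W.locFinMul_curF (commute_scaleC (h _ W.C_mem).symm hX)
    (fun n => (h _ W.psi0_mem).mul_right (commute_invP h h' hK n)) n

/-- The constant terms of the images of `Ψ_i⁺(z)`. -/
def κΨ : ZMod 2 → (Module.End ℂ W.V)ˣ := pair (W.ops.T.psi0 * W.KK⁻¹) W.KK

/-- The logarithms of the images of `Ψ_i⁺(z)`. -/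
def logPsiP : ZMod 2 → PowerSeries (Module.End ℂ W.V) :=
  pair (-scalePS (s L 0) (W.logP (q L 0))) (W.logP 1)

/-- The logarithms of the images of `Ψ_i⁻(z)`. -/
def logPsiM : ZMod 2 → PowerSeries (Module.End ℂ W.V) :=
  pair (-scalePS (s L 0)⁻¹ (W.logM (q L 0))) (W.logM 1)

/-- The images of `E_i(z)`. -/
def imE : ZMod 2 → ℤ → Module.End ℂ W.V := pair (fun n => s L 0 ^ n • W.curE n) (W.ops.Xp 0)

/-- The images of `F_i(z)`. -/
def imF : ZMod 2 → ℤ → Module.End ℂ W.V :=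
  pair (fun n => s L 0 ^ n • W.curF n) (fun n => -W.ops.Xm 0 n)

variable {W}

theorem commute_κΨ {x : Module.End ℂ W.V} (h : Commute (W.ops.T.psi0 : Module.End ℂ W.V) x)
    (hK : Commute (W.KK : Module.End ℂ W.V) x) : ∀ i, Commute (W.κΨ i : Module.End ℂ W.V) x := by
  refine forall_zmod_two ?_ ?_
  · rw [κΨ, pair_zero, Units.val_mul]
    exact h.mul_left hK.units_inv_left
  · rwa [κΨ, pair_one]

theorem coeff_logPsiP_zero (r : ℕ) : PowerSeries.coeff r (W.logPsiP 0) =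
    -(s L 0 ^ r • PowerSeries.coeff r (W.logP (q L 0))) := by
  rw [logPsiP, pair_zero, map_neg, scalePS, PowerSeries.coeff_mk]

theorem coeff_logPsiM_zero (r : ℕ) : PowerSeries.coeff r (W.logPsiM 0) =
    -((s L 0)⁻¹ ^ r • PowerSeries.coeff r (W.logM (q L 0))) := by
  rw [logPsiM, pair_zero, map_neg, scalePS, PowerSeries.coeff_mk]

theorem commute_logPsiP {x : Module.End ℂ W.V}
    (h : ∀ t k, Commute x (PowerSeries.coeff k (W.logP t))) :
    ∀ i k, Commute x (PowerSeries.coeff k (W.logPsiP i)) := by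
  refine forall_zmod_two (fun k => ?_) fun k => ?_
  · rw [coeff_logPsiP_zero]
    exact ((h _ _).smul_right _).neg_right
  · rw [logPsiP, pair_one]
    exact h _ _

theorem commute_logPsiM {x : Module.End ℂ W.V}
    (h : ∀ t k, Commute x (PowerSeries.coeff k (W.logM t))) :
    ∀ i k, Commute x (PowerSeries.coeff k (W.logPsiM i)) := by
  refine forall_zmod_two (fun k => ?_) fun k => ?_
  · rw [coeff_logPsiM_zero]
    exact ((h _ _).smul_right _).neg_right
  · rw [logPsiM, pair_one]
    exact h _ _

theorem commute_imE {x : Module.End ℂ W.V} (h₀ : ∀ n, Commute x (W.curE n))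
    (h₁ : ∀ n, Commute x (W.ops.Xp 0 n)) : ∀ i n, Commute x (W.imE i n) := by
  refine forall_zmod_two (fun n => ?_) fun n => ?_
  · rw [imE, pair_zero]
    exact (h₀ n).smul_right _
  · rw [imE, pair_one]
    exact h₁ n

theorem commute_imF {x : Module.End ℂ W.V} (h₀ : ∀ n, Commute x (W.curF n))
    (h₁ : ∀ n, Commute x (W.ops.Xm 0 n)) : ∀ i n, Commute x (W.imF i n) := by
  refine forall_zmod_two (fun n => ?_) fun n => ?_
  · rw [imF, pair_zero]
    exact (h₀ n).smul_right _
  · rw [imF, pair_one]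
    exact (h₁ n).neg_right

/-- Replacing `z` by `σ⁻¹ z` in a current multiplies the scalar in a shift commutator by a power of
`σ`. With `σ = q̄_1` this absorbs the factor left over in `gammaP_q` and `gammaP_q_inv`. -/
theorem commutator_smul_zpow {R : Type*} [Ring R] [Algebra ℂ R] {σ : ℂ} (hσ : σ ≠ 0) {x u : R}
    {B : ℤ → R} {g b : ℂ} {r : ℤ} (hg : g = σ ^ r * b)
    (h : ∀ n, x * B n = B n * x + (g • u) * B (n + r)) (n : ℤ) :
    x * (σ ^ n • B n) = (σ ^ n • B n) * x + (b • u) * (σ ^ (n + r) • B (n + r)) := by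
  rw [mul_smul_comm, h, smul_add, smul_mul_assoc, smul_mul_assoc, smul_mul_assoc, mul_smul_comm,
    smul_smul, smul_smul, hg, zpow_add₀ hσ]
  congr 2
  ring

theorem commutator_neg_smul {R : Type*} [Ring R] [Algebra ℂ R] {x u B B' : R} {g b a : ℂ}
    (hg : -(a * g) = b) (h : x * B = B * x + (g • u) * B') :
    -(a • x) * B = B * -(a • x) + (b • u) * B' := by
  rw [neg_mul, smul_mul_assoc, h, mul_neg, mul_smul_comm, ← hg, smul_add, neg_add, smul_mul_assoc,
    smul_mul_assoc, smul_smul, neg_smul]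

theorem commutator_neg_right {R : Type*} [Ring R] [Algebra ℂ R] {x u B B' : R}
    (h : x * B = B * x + u * B') : x * -B = -B * x + u * -B' := by
  rw [mul_neg, h, neg_mul, mul_neg, neg_add]

theorem smul_pow_mul_eq_zero {R : Type*} [Ring R] [Algebra ℂ R] {x B u B' : R} {g : ℂ}
    (hg : g = 0) (h : x * B = B * x + (g • u) * B') : x * B = B * x := by
  rw [h, hg, zero_smul, zero_mul, add_zero]

variable (W)

/-- Every scalar is a value of `γ_r`. Equal indices in `{0, 1}` give equal twists and hence zero;
different indices give `τ = q_1^{±r}`. In the latter case the factor `s_1^{±r}` disappears against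
the normalization `E_0(q̄_1 z)`, `F_0(q̄_1 z)`, `Ψ_0(q̄_1 z)`. -/
theorem exchangeData (hL : Generic L) : ExchangeData (s L 0) (s L 0 * q L 1) W.ops.T.C W.κΨ
    W.logPsiP W.logPsiM W.imE W.imF := by
  have hs := s_ne_zero (L := L)
  have hq := q_ne_zero L 0
  have hC1 : Commute (W.ops.T.C : Module.End ℂ W.V) W.KK := W.C_KK
  have γ1 := gammaP_one hL.sum hL.gen
  have γq := gammaP_q hL.sum hL.gen
  have γq' := gammaP_q_inv hL.sum hL.gen
  have e01 : exchangeLog (s L 0) (s L 0 * q L 1) 0 1 = barSeries (s L 0) (s L 0 * q L 1) := rfl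
  have e10 : exchangeLog (s L 0) (s L 0 * q L 1) 1 0 = -barSeries (s L 0) (s L 0 * q L 1) := rfl
  have n0 : W.imE 0 = fun n => s L 0 ^ n • W.curE n := rfl
  have n1 : W.imE 1 = W.ops.Xp 0 := rfl
  have m0 : W.imF 0 = fun n => s L 0 ^ n • W.curF n := rfl
  have m1 : W.imF 1 = fun n => -W.ops.Xm 0 n := rfl
  have a1 : W.logPsiP 1 = W.logP 1 := rfl
  have a1' : W.logPsiM 1 = W.logM 1 := rfl
  have KKE : ∀ n, Commute (W.KK : Module.End ℂ W.V) (W.curE n) :=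
    W.commute_curE W.KK_T W.KK_T' (Commute.refl _) (KK_Xm hL.ne_zero hL.sum (-1))
  have KKF : ∀ n, Commute (W.KK : Module.End ℂ W.V) (W.curF n) :=
    W.commute_curF W.KK_T W.KK_T' (Commute.refl _) (KK_Xp hL.ne_zero hL.sum 1)
  have pE : ∀ n, Commute (W.ops.T.psi0 : Module.End ℂ W.V) (W.curE n) :=
    W.commute_curE W.psi0_T W.psi0_T' W.psi0_KK (W.psi0_Xm (-1))
  have pF : ∀ n, Commute (W.ops.T.psi0 : Module.End ℂ W.V) (W.curF n) :=
    W.commute_curF W.psi0_T W.psi0_T' W.psi0_KK (W.psi0_Xp 1)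
  have cE : ∀ n, Commute (W.ops.T.C : Module.End ℂ W.V) (W.curE n) :=
    W.commute_curE W.C_T W.C_T' W.C_KK (W.C_Xm (-1))
  have cF : ∀ n, Commute (W.ops.T.C : Module.End ℂ W.V) (W.curF n) :=
    W.commute_curF W.C_T W.C_T' W.C_KK (W.C_Xp 1)
  have ss : ∀ (r : ℕ) (b : ℂ), s L 0 ^ r * ((s L 0)⁻¹ ^ r * b) = b := fun r b => by
    rw [← mul_assoc, ← mul_pow, mul_inv_cancel₀ hs, one_pow, one_mul]
  have ss' : ∀ (r : ℕ) (b : ℂ), (s L 0)⁻¹ ^ r * (s L 0 ^ r * b) = b := fun r b => by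
    rw [← mul_assoc, ← mul_pow, inv_mul_cancel₀ hs, one_pow, one_mul]
  -- The cases of matching twist: `t = q_1` against the currents with index `±1`, and, below, `t =
  -- 1` against those with index `0`.
  have z1 : ∀ r, gammaP L r (((q L 0)⁻¹ * q L 0) ^ r) = 0 := fun r => by
    rw [inv_mul_cancel₀ hq, one_pow, γ1]
  have z2 : ∀ r, gammaP L r ((q L 0 * (q L 0)⁻¹) ^ r) = 0 := fun r => by
    rw [mul_inv_cancel₀ hq, one_pow, γ1]
  have z3 : ∀ r, gammaP L r ((1⁻¹ * q L 0 ^ (0 : ℤ)) ^ r) = 0 := fun r => by simp [γ1]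
  have z4 : ∀ r, gammaP L r ((1⁻¹ * q L 0 ^ (-0 : ℤ)) ^ r) = 0 := fun r => by simp [γ1]
  have z5 : ∀ r, gammaP L r ((1 * (q L 0 ^ (0 : ℤ))⁻¹) ^ r) = 0 := fun r => by simp [γ1]
  have z6 : ∀ r, gammaP L r ((1 * (q L 0 ^ (-0 : ℤ))⁻¹) ^ r) = 0 := fun r => by simp [γ1]
  have diag : ∀ {x B : Module.End ℂ W.V} (a b : ℂ), x * B = B * x → -(a • x) * (b • B) = b • B * -(a • x) :=
    fun {x B} a b h => (((show Commute x B from h).smul_left a).smul_right b).neg_left.eq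
  constructor
  · refine forall_zmod_two ?_ (coeff_zero_kkLogP L _ _ _)
    rw [coeff_logPsiP_zero, coeff_zero_kkLogP, smul_zero, neg_zero]
  · refine forall_zmod_two ?_ (coeff_zero_kkLogM L _ _ _)
    rw [coeff_logPsiM_zero, coeff_zero_kkLogM, smul_zero, neg_zero]
  · exact fun i => (commute_κΨ W.C_psi0.symm hC1.symm i).symm
  · exact commute_logPsiP C_logP
  · exact commute_logPsiM C_logM
  · exact commute_imE cE (W.C_Xp 0)
  · exact commute_imF cF (W.C_Xm 0)
  · exact fun i j => commute_κΨ (commute_κΨ (Commute.refl _) W.psi0_KK.symm j).symm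
      (commute_κΨ W.psi0_KK (Commute.refl _) j).symm i
  · exact fun i j k => commute_κΨ (commute_logPsiP psi0_logP j k) (commute_logPsiP KK_logP j k) i
  · exact fun i j k => commute_κΨ (commute_logPsiM psi0_logM j k) (commute_logPsiM KK_logM j k) i
  · exact fun i j k => commute_κΨ (commute_imE pE (W.psi0_Xp 0) j k)
      (commute_imE KKE (KK_Xp hL.ne_zero hL.sum 0) j k) i
  · exact fun i j k => commute_κΨ (commute_imF pF (W.psi0_Xm 0) j k)
      (commute_imF KKF (KK_Xm hL.ne_zero hL.sum 0) j k) i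
  · exact fun i j k l => (commute_logPsiP (fun t k => (commute_logPsiP (fun t' k' =>
      W.logP_logP t t' k k') j l).symm) i k).symm
  · exact fun i j k l => (commute_logPsiM (fun t k => (commute_logPsiM (fun t' k' =>
      W.logM_logM t t' k k') j l).symm) i k).symm
  -- The brackets of the logarithms of `Ψ_i⁺` and `Ψ_j⁻`. The minus sign in the exponent of `Ψ_0`
  -- reverses one of the two mixed cases and produces `exchangeLog` with its two signs.
  · refine forall_zmod_two (forall_zmod_two (fun r k => ?_) fun r k => ?_)
      (forall_zmod_two (fun r k => ?_) fun r k => ?_)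
    · rw [coeff_logPsiP_zero, coeff_logPsiM_zero, exchangeLog_self, coeff_substMul_zero,
        coeff_substMul_zero, sub_self, ite_self, add_zero]
      simp only [neg_mul_neg, smul_mul_assoc, mul_smul_comm]
      rw [W.logP_logM hL, inv_mul_cancel₀ hq, one_pow, γ1, zero_smul, neg_zero, ite_self, add_zero,
        smul_comm]
    · rw [coeff_logPsiP_zero, a1', e01, coeff_substMul, coeff_substMul, neg_mul, smul_mul_assoc,
        W.logP_logM hL, mul_one, γq', smul_add, neg_add, mul_neg, mul_smul_comm]
      congr 1
      split_ifs
      · rw [smul_neg, neg_neg, smul_smul, ← smul_sub, ← neg_sub (_ ^ r) (_ ^ r), smul_neg, ← neg_smul]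
        rw [mul_neg, neg_neg, ss]
      · simp
    · rw [coeff_logPsiM_zero, a1, e10, coeff_substMul, coeff_substMul, mul_neg, mul_smul_comm,
        W.logP_logM hL, inv_one, one_mul, γq, smul_add, neg_add, neg_mul, smul_mul_assoc]
      congr 1
      split_ifs with h
      · subst h
        rw [smul_neg, neg_neg, smul_smul, ← smul_sub, ← neg_sub (_ ^ k) (_ ^ k), map_neg,
          neg_smul, smul_neg, ss']
      · simp
    · rw [a1, a1', exchangeLog_self, coeff_substMul_zero,
        coeff_substMul_zero, sub_self, ite_self, add_zero, W.logP_logM hL, inv_one, one_mul,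
        one_pow, γ1, zero_smul, neg_zero, ite_self, add_zero]
  · refine forall_zmod_two (forall_zmod_two (fun r n => ?_) fun r n => ?_)
      (forall_zmod_two (fun r n => ?_) fun r n => ?_)
    · rw [coeff_logPsiP_zero, n0, exchangeLog_self, coeff_substMul_zero, zero_mul, add_zero]
      exact diag _ _ (smul_pow_mul_eq_zero (by rw [z1, neg_zero]) (W.logP_curE hL _ r n))
    · rw [coeff_logPsiP_zero, n1, e01, coeff_substMul]
      refine commutator_neg_smul ?_ (W.logP_Xp _ 0 r n)
      rw [zpow_zero, mul_one, γq', mul_neg, neg_neg, ss]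
    · rw [a1, n0, e10, coeff_substMul]
      refine commutator_smul_zpow hs ?_ (fun n => W.logP_curE hL 1 r n) n
      rw [inv_one, one_mul, γq, zpow_natCast, map_neg, mul_neg]
    · rw [a1, n1, exchangeLog_self, coeff_substMul_zero, zero_mul, add_zero]
      exact smul_pow_mul_eq_zero (z3 r) (W.logP_Xp 1 0 r n)
  · refine forall_zmod_two (forall_zmod_two (fun r n => ?_) fun r n => ?_)
      (forall_zmod_two (fun r n => ?_) fun r n => ?_)
    · rw [coeff_logPsiM_zero, n0, exchangeLog_self, coeff_substMul_zero, zero_mul, add_zero]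
      exact diag _ _ (smul_pow_mul_eq_zero (z2 r) (W.logM_curE hL _ r n))
    · rw [coeff_logPsiM_zero, n1, e01, coeff_substMul, one_pow]
      -- There is no power of `C` in this commutator; the factor `1` is inserted to match the common
      -- shape of the lemma.
      refine commutator_neg_smul ?_ ((W.logM_Xp hL _ 0 r n).trans (by rw [← smul_one_mul]))
      rw [zpow_zero, inv_one, mul_one, γq, mul_neg, neg_neg, ss']
    · rw [a1', n0, e10, coeff_substMul, one_pow]
      refine commutator_smul_zpow hs (r := -(r : ℤ)) ?_ (fun n => W.logM_curE hL 1 r n) n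
      rw [one_mul, γq', zpow_neg, zpow_natCast, map_neg, mul_neg, inv_pow]
    · rw [a1', n1, exchangeLog_self, coeff_substMul_zero, zero_mul, add_zero, W.logM_Xp hL, z5,
        neg_zero, zero_smul, add_zero]
  · refine forall_zmod_two (forall_zmod_two (fun r n => ?_) fun r n => ?_)
      (forall_zmod_two (fun r n => ?_) fun r n => ?_)
    · rw [coeff_logPsiP_zero, m0, exchangeLog_self, coeff_substMul_zero, zero_mul, add_zero]
      exact diag _ _ (smul_pow_mul_eq_zero (z1 r) (W.logP_curF _ r n))
    · rw [coeff_logPsiP_zero, m1, e10, coeff_substMul, one_pow]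
      refine commutator_neg_right (commutator_neg_smul ?_ ((W.logP_Xm _ 0 r n).trans
        (by rw [← smul_one_mul])))
      rw [neg_zero, zpow_zero, mul_one, γq', neg_neg, ss, map_neg]
    · rw [a1, m0, e01, coeff_substMul, one_pow]
      refine commutator_smul_zpow hs ?_ (fun n => W.logP_curF 1 r n) n
      rw [inv_one, one_mul, γq, zpow_natCast]
    · rw [a1, m1, exchangeLog_self, coeff_substMul_zero, zero_mul, add_zero, mul_neg, W.logP_Xm, z4,
        neg_zero, zero_smul, add_zero, neg_mul]
  · refine forall_zmod_two (forall_zmod_two (fun r n => ?_) fun r n => ?_)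
      (forall_zmod_two (fun r n => ?_) fun r n => ?_)
    · rw [coeff_logPsiM_zero, m0, exchangeLog_self, coeff_substMul_zero, zero_mul, add_zero]
      exact diag _ _ (smul_pow_mul_eq_zero (by rw [z2, neg_zero]) (W.logM_curF hL _ r n))
    · rw [coeff_logPsiM_zero, m1, e10, coeff_substMul]
      refine commutator_neg_right (commutator_neg_smul ?_ (W.logM_Xm hL _ 0 r n))
      rw [neg_zero, zpow_zero, inv_one, mul_one, γq, ss', map_neg]
    · rw [a1', m0, e01, coeff_substMul]
      refine commutator_smul_zpow hs (r := -(r : ℤ)) ?_ (fun n => W.logM_curF hL 1 r n) n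
      rw [one_mul, γq', zpow_neg, zpow_natCast, neg_neg, inv_pow]
    · rw [a1', m1, exchangeLog_self, coeff_substMul_zero, zero_mul, add_zero, mul_neg,
        W.logM_Xm hL, z6, zero_smul, zero_mul, add_zero, neg_mul]

end AdmRep

end

section

/-! ### Anticommutators with products of currents, and interchange of sums -/

section LocallyFinite

variable {V : Type*} [AddCommGroup V] [Module ℂ V] {ι κ : Type*}

theorem anticommutator_locMul_right {a b : ℤ → Module.End ℂ V} (h : LocFinMul a b)
    {x : Module.End ℂ V} (ha : ∀ n, Commute x (a n)) (n : ℤ) :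
    x * locMul a b n + locMul a b n * x = locSum fun k => a (n - k) * (x * b k + b k * x) := by
  rw [locMul, mul_locSum (h n), locSum_mul (h n), ← locSum_add ((h n).mul_left x) ((h n).mul_right x)]
  congr 1
  funext k
  rw [← mul_assoc, (ha _).eq, mul_add, mul_assoc, mul_assoc]

theorem anticommutator_locMul_left {a b : ℤ → Module.End ℂ V} (h : LocFinMul a b)
    {x : Module.End ℂ V} (hb : ∀ n, Commute x (b n)) (n : ℤ) :
    x * locMul a b n + locMul a b n * x =
      locSum fun k => (x * a (n - k) + a (n - k) * x) * b k := by
  rw [locMul, mul_locSum (h n), locSum_mul (h n), ← locSum_add ((h n).mul_left x) ((h n).mul_right x)]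
  congr 1
  funext k
  rw [mul_assoc _ _ x, ← (hb _).eq, add_mul, mul_assoc, mul_assoc]

theorem LocFin.prod_right {b : κ → Module.End ℂ V} {S : κ → ι → Module.End ℂ V} (hb : LocFin b)
    (hS : ∀ k, LocFin (S k)) : LocFin fun p : κ × ι => S p.1 p.2 * b p.1 := by
  intro v
  refine ((hb v).biUnion (t := fun k => Prod.mk k '' (Function.support fun j => S k j (b k v)))
    fun k _ => (hS k (b k v)).image _).subset ?_
  rintro ⟨k, j⟩ h
  simp only [Set.mem_iUnion, Set.mem_image, Function.mem_support] at h ⊢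
  refine ⟨k, fun h0 => h ?_, j, h, rfl⟩
  rw [Module.End.mul_apply, h0, map_zero]

theorem locSum_comm {T : κ × ι → Module.End ℂ V} (h : LocFin T) :
    (locSum fun k => locSum fun j => T (k, j)) = locSum fun j => locSum fun k => T (k, j) := by
  rw [← locSum_prod h, ← locSum_comp_equiv h (Equiv.prodComm ι κ)]
  exact locSum_prod (T := fun r => T (Equiv.prodComm ι κ r)) (h.comp (Equiv.injective _))

theorem locSum_single {T : ι → Module.End ℂ V} (i : ι) (h : ∀ r, r ≠ i → T r = 0) :
    locSum T = T i := by
  rw [locSum_eq_sum (S := {i}) fun r hr => h r (by simpa using hr), sum_singleton]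

theorem IsField.locFin_mul {b A : ℤ → Module.End ℂ V} (h : IsField b) {m : ℤ}
    (hA : ∀ j < m, A j = 0) (c : ℤ) : LocFin fun j => A j * b (j + c) := fun v => by
  obtain ⟨N, hN⟩ := h v
  refine (Set.finite_Icc m (N - c)).subset fun j hj => ⟨?_, ?_⟩
  · by_contra h1
    exact hj (by simp only [hA j (by omega), zero_mul, LinearMap.zero_apply])
  · by_contra h1
    exact hj (by simp only [Module.End.mul_apply, hN (j + c) (by omega), map_zero])

theorem IsField.locFin {b : ℤ → Module.End ℂ V} (h : IsField b) (hb : ∀ k < 0, b k = 0) :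
    LocFin b := fun v => by
  obtain ⟨N, hN⟩ := h v
  refine (Set.finite_Icc 0 N).subset fun j hj => ⟨?_, ?_⟩
  · by_contra h1
    exact hj (by simp only [hb j (by omega), LinearMap.zero_apply])
  · by_contra h1
    exact hj (hN j (by omega))

theorem locMul_posCurrent (P Q : PowerSeries (Module.End ℂ V)) :
    locMul (posCurrent P) (posCurrent Q) = posCurrent (P * Q) := by
  funext n
  rw [locMul, posCurrent, locSum_eq_sum (S := (antidiagonal n.toNat).image fun p => (p.2 : ℤ))]
  · split_ifs with hn
    · rw [PowerSeries.coeff_mul, sum_image]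
      · refine sum_congr rfl fun p hp => ?_
        rw [HasAntidiagonal.mem_antidiagonal] at hp
        rw [posCurrent, posCurrent, if_pos (by omega), if_pos (by omega),
          show (n - p.2).toNat = p.1 by omega, Int.toNat_natCast]
      · rintro ⟨p, p'⟩ hp ⟨r, r'⟩ hr h
        rw [mem_coe, HasAntidiagonal.mem_antidiagonal] at hp hr
        dsimp only at h hp hr
        rw [Prod.mk.injEq]
        omega
    · refine sum_eq_zero fun k hk => ?_
      rw [posCurrent, posCurrent]
      split_ifs <;> first | omega | simp
  · intro k hk
    rw [posCurrent, posCurrent]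
    split_ifs with h1 h2
    · refine absurd (mem_image.2 ⟨((n - k).toNat, k.toNat), ?_, ?_⟩) hk
      · rw [HasAntidiagonal.mem_antidiagonal]
        dsimp only
        omega
      · dsimp only
        omega
    all_goals simp

theorem locFinMul_posCurrent (P Q : PowerSeries (Module.End ℂ V)) :
    LocFinMul (posCurrent P) (posCurrent Q) := fun n v => by
  refine (Set.finite_Icc 0 n).subset fun k hk => ?_
  by_contra h
  refine hk ?_
  dsimp only
  rw [posCurrent, posCurrent]
  rw [Set.mem_Icc, not_and_or] at h
  split_ifs <;> first | omega | simp

theorem locMul_negCurrent (P Q : PowerSeries (Module.End ℂ V)) :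
    locMul (negCurrent P) (negCurrent Q) = negCurrent (P * Q) := by
  funext n
  rw [negCurrent_eq, ← locMul_posCurrent, locMul, locMul,
    ← locSum_comp_equiv (locFinMul_posCurrent P Q (-n)) (Equiv.neg ℤ)]
  congr 1
  funext k
  rw [negCurrent_eq, negCurrent_eq]
  simp only [Equiv.neg_apply, sub_neg_eq_add, neg_sub]
  rw [add_comm, sub_eq_add_neg]

theorem posCurrent_one {R : Type*} [Ring R] (n : ℤ) :
    posCurrent (1 : PowerSeries R) n = if n = 0 then 1 else 0 := by
  rw [posCurrent]
  simp only [PowerSeries.coeff_one]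
  split_ifs <;> first | rfl | omega

theorem negCurrent_one {R : Type*} [Ring R] (n : ℤ) :
    negCurrent (1 : PowerSeries R) n = if n = 0 then 1 else 0 := by
  simp only [negCurrent_eq, posCurrent_one, neg_eq_zero]

theorem scale_posCurrent {R : Type*} [Ring R] [Algebra ℂ R] (t : ℂ) (P : PowerSeries R) :
    scale t (posCurrent P) = posCurrent (scalePS t⁻¹ P) := by
  funext n
  rw [scale, posCurrent, posCurrent, scalePS, PowerSeries.coeff_mk]
  split_ifs with h
  · obtain ⟨k, rfl⟩ := Int.eq_ofNat_of_zero_le h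
    rw [Int.toNat_natCast, zpow_neg, zpow_natCast, inv_pow]
  · rw [smul_zero]

theorem scale_negCurrent {R : Type*} [Ring R] [Algebra ℂ R] (t : ℂ) (P : PowerSeries R) :
    scale t (negCurrent P) = negCurrent (scalePS t P) := by
  funext n
  rw [scale, negCurrent, negCurrent, scalePS, PowerSeries.coeff_mk]
  split_ifs with h
  · obtain ⟨k, hk⟩ := Int.eq_ofNat_of_zero_le (show 0 ≤ -n by omega)
    rw [hk, Int.toNat_natCast, zpow_natCast]
  · rw [smul_zero]

/-- For `r = 0` the fused current is the empty product, so the convolution leaves `k_0⁺` unchanged.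
-/
theorem GL1Data.kP_zero (L : Fin 3 → ℂ) (T : GL1Data (Module.End ℂ V)) (K : (Module.End ℂ V)ˣ) :
    T.kP L K 0 = posCurrent (T.k0P L K) := by
  have h : (fun k => (-c1 L) ^ 0 • T.fusedF L 0 k) = posCurrent 1 := by
    funext k
    rw [posCurrent_one, pow_zero, one_smul, fusedF]
  rw [kP, h, locMul_posCurrent, one_mul]

theorem GL1Data.kM_zero (L : Fin 3 → ℂ) (T : GL1Data (Module.End ℂ V)) (K : (Module.End ℂ V)ˣ) :
    T.kM L K 0 = negCurrent (T.k0M L K) := by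
  have h : (fun k => c1 L ^ 0 • T.fusedE L 0 k) = negCurrent 1 := by
    funext k
    rw [negCurrent_one, pow_zero, one_smul, fusedE]
  rw [kM, h, locMul_negCurrent, mul_one]

theorem quadDist_locSum (T : ℂ) {D : ι → ℤ → ℤ → Module.End ℂ V}
    (h : ∀ m n, LocFin fun k => D k m n) (m n : ℤ) :
    quadDist T 1 1 (fun m n => locSum fun k => D k m n) m n =
      locSum fun k => quadDist T 1 1 (D k) m n := by
  simp only [quadDist, one_mul]
  have h2 := (h (m + 1) (n + 1)).smul (-T)
  have h3 := (h (m + 2) n).add h2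
  have h4 := locSum_add h3 (h m (n + 2))
  rw [locSum_add (h (m + 2) n) h2, locSum_smul (h (m + 1) (n + 1)), neg_smul,
    ← sub_eq_add_neg] at h4
  rw [← h4]
  congr 1
  funext k
  rw [neg_smul, sub_eq_add_neg]

end LocallyFinite

/-! ### (R3) at `i + j = 0`, and the inverses of `k_0^± ǩ_0^±` -/

namespace AdmRep

variable {L : Fin 3 → ℂ} (W : AdmRep L)

theorem scalePS_one_eq {R : Type*} [Ring R] [Algebra ℂ R] (P : PowerSeries R) : scalePS 1 P = P := by
  ext n
  rw [scalePS, PowerSeries.coeff_mk, one_pow, one_smul]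

/-- Only `r = ř = 0` remains, so no fused current occurs and the right hand side is a product of two
exponentials. -/
theorem crossP_of_add_eq_zero (i j m n : ℤ) (h : i + j = 0) : W.ops.crossP L i j m n =
    ((W.ops.T.psi0 ^ (-i) : (Module.End ℂ W.V)ˣ) : Module.End ℂ W.V) *
      (((W.ops.T.C ^ m : (Module.End ℂ W.V)ˣ) : Module.End ℂ W.V) *
        posCurrent (W.kkP (q L 0 ^ (-j))) (m + n)) := by
  rw [AData.crossP, h, if_pos le_rfl]
  simp only [Int.toNat_zero, Nat.antidiagonal_zero, sum_singleton, pow_zero, inv_one, one_zpow,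
    one_smul, one_mul]
  rw [GL1Data.kP_zero, GL1Data.kP_zero, scale_posCurrent, scale_posCurrent, locMul_posCurrent,
    inv_one, scalePS_one_eq, kkP]

theorem crossM_of_add_eq_zero (i j m n : ℤ) (h : i + j = 0) : W.ops.crossM L i j m n =
    ((W.ops.T.psi0 ^ (-j) : (Module.End ℂ W.V)ˣ) : Module.End ℂ W.V) *
      (((W.ops.T.C ^ n : (Module.End ℂ W.V)ˣ) : Module.End ℂ W.V) *
        negCurrent (W.kkM (q L 0 ^ i)) (m + n)) := by
  rw [AData.crossM, show -i - j = 0 by omega, if_pos le_rfl]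
  simp only [Int.toNat_zero, Nat.antidiagonal_zero, sum_singleton, pow_zero, inv_one, one_zpow,
    one_smul, one_mul]
  rw [GL1Data.kM_zero, GL1Data.kM_zero, scale_negCurrent, scale_negCurrent, locMul_negCurrent,
    scalePS_one_eq, kkM]

/-- The power series of `(k_0⁺(z) ǩ_0⁺(q_1 z))⁻¹`. -/
def serP : PowerSeries (Module.End ℂ W.V) :=
  PowerSeries.C ((W.KK⁻¹ : (Module.End ℂ W.V)ˣ) : Module.End ℂ W.V) *
    expSeries (-W.logP (q L 0))

/-- The power series of `(k_0⁻(z) ǩ_0⁻(q_1 z))⁻¹`. -/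
def serM : PowerSeries (Module.End ℂ W.V) :=
  PowerSeries.C (W.KK : Module.End ℂ W.V) * expSeries (-W.logM (q L 0))

theorem invP_eq : W.invP = posCurrent W.serP := rfl

theorem invM_eq : W.invM = negCurrent W.serM := by
  rw [invM, expM, inv_inv, serM]

/-- The constant factor commutes with the exponent, so the inverse is obtained by inverting the
constant and negating the exponent, in either order. -/
theorem C_mul_expSeries_mul_inv {R : Type*} [Ring R] [Algebra ℂ R] {u : Rˣ} {a : PowerSeries R}
    (ha0 : PowerSeries.coeff 0 a = 0) (ha : CoeffComm a a)
    (hu : ∀ k, Commute (u : R) (PowerSeries.coeff k a)) :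
    PowerSeries.C (u : R) * expSeries a * (PowerSeries.C ((u⁻¹ : Rˣ) : R) * expSeries (-a)) = 1 := by
  have h : expSeries a * PowerSeries.C ((u⁻¹ : Rˣ) : R) =
      PowerSeries.C ((u⁻¹ : Rˣ) : R) * expSeries a := by
    ext k
    rw [PowerSeries.coeff_mul_C, PowerSeries.coeff_C_mul]
    have := commute_expSeries (p := 1) (fun k => (hu k).symm.units_inv_right) (Commute.one_left _) k
    rwa [map_one, one_mul] at this
  rw [mul_assoc, ← mul_assoc (expSeries a), h, mul_assoc, expSeries_mul_neg ha0 ha, mul_one, ← map_mul,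
    Units.mul_inv, map_one]

theorem kkP_mul_serP : W.kkP (q L 0) * W.serP = 1 := by
  rw [kkP_eq, serP]
  exact C_mul_expSeries_mul_inv (coeff_zero_kkLogP L _ _ _) (W.logP_logP _ _) (KK_logP _)

theorem serP_mul_kkP : W.serP * W.kkP (q L 0) = 1 := by
  have h := C_mul_expSeries_mul_inv (u := W.KK⁻¹) (a := -W.logP (q L 0))
    (by rw [map_neg, coeff_zero_kkLogP, neg_zero]) (W.logP_logP _ _).neg_left.symm.neg_left
    (fun k => by rw [map_neg]; exact (KK_logP _ k).units_inv_left.neg_right)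
  rwa [inv_inv, neg_neg, ← kkP_eq] at h

theorem serM_mul_kkM : W.serM * W.kkM (q L 0) = 1 := by
  have h := C_mul_expSeries_mul_inv (u := W.KK) (a := -W.logM (q L 0))
    (by rw [map_neg, coeff_zero_kkLogM, neg_zero]) (W.logM_logM _ _).neg_left.symm.neg_left
    (fun k => by rw [map_neg]; exact (KK_logM _ k).neg_right)
  rwa [neg_neg, ← kkM_eq] at h

theorem kkM_mul_serM : W.kkM (q L 0) * W.serM = 1 := by
  have h := C_mul_expSeries_mul_inv (u := W.KK⁻¹) (coeff_zero_kkLogM L W.ops.T W.ops.T' (q L 0))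
    (W.logM_logM _ _) (fun k => (KK_logM _ k).units_inv_left)
  rwa [inv_inv, ← kkM_eq] at h

theorem isField_kkP (t : ℂ) : IsField (posCurrent (W.kkP t)) := by
  rw [kkP_eq]
  refine HomogeneousSeries.isField (HomogeneousSeries.mul (homogeneousSeries_C ?_)
    (homogeneousSeries_kkLogP t).exp)
  have h1 : W.Homogeneous 0 0 (W.ops.K : Module.End ℂ W.V) := W.homogeneous .K
  have h2 : W.Homogeneous 0 0 (W.ops.K' : Module.End ℂ W.V) := W.homogeneous .K'
  rw [KK, Units.val_mul]
  exact h1.mul h2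

/-- `Ring.inverse` would be zero on a non-unit; a two-sided inverse identifies it with the explicit
series used for the dressing. -/
theorem inverse_kkP : Ring.inverse (W.kkP (q L 0)) = W.serP := by
  have := Ring.inverse_unit (⟨_, _, W.kkP_mul_serP, W.serP_mul_kkP⟩ : (PowerSeries (Module.End ℂ W.V))ˣ)
  exact this

theorem inverse_kkM : Ring.inverse (W.kkM (q L 0)) = W.serM := by
  have := Ring.inverse_unit (⟨_, _, W.kkM_mul_serM, W.serM_mul_kkM⟩ : (PowerSeries (Module.End ℂ W.V))ˣ)
  exact this

end AdmRep

end

section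

/-! ### Relations inside the pair `E_0`, `F_0` -/

namespace AdmRep

variable {L : Fin 3 → ℂ} (W : AdmRep L)

theorem invM_commute {x : Module.End ℂ W.V} (hK : Commute (W.KK : Module.End ℂ W.V) x)
    (h : ∀ k, Commute (PowerSeries.coeff k (W.logM (q L 0))) x) (n : ℤ) : Commute (W.invM n) x :=
  commute_expM hK.units_inv_left (fun k => by rw [map_neg]; exact (h k).neg_left) n

theorem invP_commute {x : Module.End ℂ W.V} (hK : Commute (W.KK : Module.End ℂ W.V) x)
    (h : ∀ k, Commute (PowerSeries.coeff k (W.logP (q L 0))) x) (n : ℤ) : Commute (W.invP n) x :=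
  commute_expP hK.units_inv_left (fun k => by rw [map_neg]; exact (h k).neg_left) n

theorem C_invM (n : ℤ) : Commute (W.ops.T.C : Module.End ℂ W.V) (W.invM n) :=
  commute_invM W.C_T W.C_T' W.C_KK n

theorem C_invP (n : ℤ) : Commute (W.ops.T.C : Module.End ℂ W.V) (W.invP n) :=
  commute_invP W.C_T W.C_T' W.C_KK n

theorem psi0_invM (n : ℤ) : Commute (W.ops.T.psi0 : Module.End ℂ W.V) (W.invM n) :=
  commute_invM W.psi0_T W.psi0_T' W.psi0_KK n

theorem psi0_invP (n : ℤ) : Commute (W.ops.T.psi0 : Module.End ℂ W.V) (W.invP n) :=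
  commute_invP W.psi0_T W.psi0_T' W.psi0_KK n

/-- The current `X⁻_{-1}(C z)`. -/
abbrev curY : ℤ → Module.End ℂ W.V := W.scaleC (W.ops.Xm (-1))

/-- The current `X⁺_1(C z)`. -/
abbrev curZ : ℤ → Module.End ℂ W.V := W.scaleC (W.ops.Xp 1)

/-- The dressing has `t = q_1`, which is the twist of `X_{-1}^-` and also of `X_1^+`; so
`gammaP_one` makes the dressing factors commute with both currents, here and in the next three
lemmas. -/
theorem invM_curY (hL : Generic L) (m n : ℤ) : Commute (W.invM m) (W.curY n) :=
  commute_scaleC (W.C_invM m) (fun n => W.invM_commute (KK_Xm hL.ne_zero hL.sum _ n) (fun k => by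
    rw [commute_iff_eq, W.logM_Xm hL, neg_neg, zpow_one, mul_inv_cancel₀ (q_ne_zero L 0), one_pow,
      gammaP_one hL.sum hL.gen, zero_smul, zero_mul, add_zero]) m) n

theorem invM_curZ (hL : Generic L) (m n : ℤ) : Commute (W.invM m) (W.curZ n) :=
  commute_scaleC (W.C_invM m) (fun n => W.invM_commute (KK_Xp hL.ne_zero hL.sum _ n) (fun k => by
    rw [commute_iff_eq, W.logM_Xp hL, zpow_one, mul_inv_cancel₀ (q_ne_zero L 0), one_pow,
      gammaP_one hL.sum hL.gen, neg_zero, zero_smul, add_zero]) m) n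

theorem invP_curY (hL : Generic L) (m n : ℤ) : Commute (W.invP m) (W.curY n) :=
  commute_scaleC (W.C_invP m) (fun n => W.invP_commute (KK_Xm hL.ne_zero hL.sum _ n) (fun k => by
    rw [commute_iff_eq, W.logP_Xm, neg_neg, zpow_one, inv_mul_cancel₀ (q_ne_zero L 0), one_pow,
      gammaP_one hL.sum hL.gen, neg_zero, zero_smul, add_zero]) m) n

theorem invP_curZ (hL : Generic L) (m n : ℤ) : Commute (W.invP m) (W.curZ n) :=
  commute_scaleC (W.C_invP m) (fun n => W.invP_commute (KK_Xp hL.ne_zero hL.sum _ n) (fun k => by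
    rw [commute_iff_eq, W.logP_Xp, zpow_one, inv_mul_cancel₀ (q_ne_zero L 0), one_pow,
      gammaP_one hL.sum hL.gen, zero_smul, zero_mul, add_zero]) m) n

theorem invM_invM (m n : ℤ) : Commute (W.invM m) (W.invM n) :=
  W.invM_commute (commute_invM W.KK_T W.KK_T' (Commute.refl _) n)
    (fun k => W.logM_invM _ k n) m

theorem invP_invP (m n : ℤ) : Commute (W.invP m) (W.invP n) :=
  W.invP_commute (commute_invP W.KK_T W.KK_T' (Commute.refl _) n)
    (fun k => W.logP_invP _ k n) m

/-- Both factors have the same `t`, so their Heisenberg commutator contains `γ_r(1) = 0`, although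
`C` need not be trivial. -/
theorem invP_invM (hL : Generic L) (m n : ℤ) : Commute (W.invP m) (W.invM n) :=
  W.invP_commute (commute_invM W.KK_T W.KK_T' (Commute.refl _) n) (fun k => by
    rw [commute_iff_eq, W.logP_invM hL, inv_mul_cancel₀ (q_ne_zero L 0), one_pow,
      gammaP_one hL.sum hL.gen, zero_smul, zero_mul, add_zero]) m

theorem invP_curE (hL : Generic L) (m n : ℤ) : Commute (W.invP m) (W.curE n) :=
  (W.psi0_invP m).symm.units_inv_right.mul_right
    (commute_locMul W.locFinMul_curE (W.invP_invM hL m) (W.invP_curY hL m) n)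

theorem scaleC_mul_scaleC {X X' : ℤ → Module.End ℂ W.V}
    (hX : ∀ n, Commute (W.ops.T.C : Module.End ℂ W.V) (X n)) (m n : ℤ) :
    W.scaleC X m * W.scaleC X' n =
      ((W.ops.T.C ^ (-m - n) : (Module.End ℂ W.V)ˣ) : Module.End ℂ W.V) * (X m * X' n) := by
  rw [scaleC, scaleC, mul_assoc, ← mul_assoc (X m), ← (commute_C_zpow (hX m) (-n)).eq, mul_assoc,
    ← mul_assoc, ← Units.val_mul, ← zpow_add, ← sub_eq_add_neg]

theorem curY_curY (m n : ℤ) : W.curY m * W.curY n + W.curY n * W.curY m = 0 := by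
  rw [scaleC_mul_scaleC _ (W.C_Xm (-1)), scaleC_mul_scaleC _ (W.C_Xm (-1)), W.relations.quadM.diag,
    show -m - n = -n - m by ring, mul_neg, neg_add_cancel]

theorem curZ_curZ (m n : ℤ) : W.curZ m * W.curZ n + W.curZ n * W.curZ m = 0 := by
  rw [scaleC_mul_scaleC _ (W.C_Xp 1), scaleC_mul_scaleC _ (W.C_Xp 1), W.relations.quadP.diag,
    show -m - n = -n - m by ring, mul_neg, neg_add_cancel]

theorem anticommutator_curE {x : Module.End ℂ W.V}
    (hψ : Commute (W.ops.T.psi0 : Module.End ℂ W.V) x) (hx : ∀ n, Commute x (W.invM n)) (n : ℤ) :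
    x * W.curE n + W.curE n * x = ((W.ops.T.psi0⁻¹ : (Module.End ℂ W.V)ˣ) : Module.End ℂ W.V) *
      locSum fun k => W.invM (n - k) * (x * W.curY k + W.curY k * x) := by
  rw [← anticommutator_locMul_right W.locFinMul_curE hx, mul_add, curE, ← mul_assoc,
    ← hψ.units_inv_left.eq, mul_assoc, mul_assoc]

theorem anticommutator_curF {x : Module.End ℂ W.V}
    (hψ : Commute (W.ops.T.psi0 : Module.End ℂ W.V) x) (hx : ∀ n, Commute x (W.invP n)) (n : ℤ) :
    x * W.curF n + W.curF n * x =
      locSum fun k => (x * W.curZ (n - k) + W.curZ (n - k) * x) *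
        ((W.ops.T.psi0 : Module.End ℂ W.V) * W.invP k) :=
  anticommutator_locMul_left W.locFinMul_curF (fun n => hψ.symm.mul_right (hx n)) n

theorem psi0_curY (n : ℤ) : Commute (W.ops.T.psi0 : Module.End ℂ W.V) (W.curY n) :=
  commute_scaleC W.C_psi0 (W.psi0_Xm (-1)) n

theorem psi0_curZ (n : ℤ) : Commute (W.ops.T.psi0 : Module.End ℂ W.V) (W.curZ n) :=
  commute_scaleC W.C_psi0 (W.psi0_Xp 1) n

theorem psi0_curE (n : ℤ) : Commute (W.ops.T.psi0 : Module.End ℂ W.V) (W.curE n) :=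
  W.commute_curE W.psi0_T W.psi0_T' W.psi0_KK (W.psi0_Xm (-1)) n

theorem psi0_curF (n : ℤ) : Commute (W.ops.T.psi0 : Module.End ℂ W.V) (W.curF n) :=
  W.commute_curF W.psi0_T W.psi0_T' W.psi0_KK (W.psi0_Xp 1) n

/-- The dressing commutes with `X_{-1}^-` and with itself, so the vanishing anticommutators of
`X_{-1}^-(C z)` pass to the dressed current, one factor at a time. -/
theorem curE_curE (hL : Generic L) (m n : ℤ) : W.curE m * W.curE n + W.curE n * W.curE m = 0 := by
  have h1 : ∀ k n, W.curY k * W.curE n + W.curE n * W.curY k = 0 := fun k n => by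
    rw [W.anticommutator_curE (W.psi0_curY k) fun n => (W.invM_curY hL n k).symm]
    simp only [W.curY_curY, mul_zero, locSum_zero]
  have h2 : ∀ j, Commute (W.curE m) (W.invM j) := fun j =>
    ((W.psi0_invM j).units_inv_left).mul_left (commute_locMul W.locFinMul_curE
      (W.invM_invM j) (W.invM_curY hL j) m).symm
  rw [W.anticommutator_curE (W.psi0_curE m) h2]
  simp only [add_comm (W.curE m * _), h1, mul_zero, locSum_zero]

theorem curF_curF (hL : Generic L) (m n : ℤ) : W.curF m * W.curF n + W.curF n * W.curF m = 0 := by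
  have h1 : ∀ k n, W.curZ k * W.curF n + W.curF n * W.curZ k = 0 := fun k n => by
    rw [W.anticommutator_curF (W.psi0_curZ k) fun n => (W.invP_curZ hL n k).symm]
    simp only [W.curZ_curZ, zero_mul, locSum_zero]
  have h2 : ∀ j, Commute (W.curF m) (W.invP j) := fun j =>
    (commute_locMul W.locFinMul_curF (W.invP_curZ hL j)
      (fun n => (W.psi0_invP j).symm.mul_right (W.invP_invP j n)) m).symm
  rw [W.anticommutator_curF (W.psi0_curF m) h2]
  simp only [add_comm (W.curF m * _), h1, zero_mul, locSum_zero]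

/-- (R3) at `(i, j) = (1, -1)`. The arguments `C z`, `C w` of both currents multiply it by
`C^{-l-j}`, which turns the powers of `C` in the two delta functions into `C^{-j}` and `C^{-l}`. -/
theorem curY_curZ (j l : ℤ) : W.curZ l * W.curY j + W.curY j * W.curZ l =
    ((W.ops.T.psi0⁻¹ : (Module.End ℂ W.V)ˣ) : Module.End ℂ W.V) *
        (((W.ops.T.C ^ (-j) : (Module.End ℂ W.V)ˣ) : Module.End ℂ W.V) *
          posCurrent (W.kkP (q L 0)) (l + j)) -
      W.ops.T.psi0 * (((W.ops.T.C ^ (-l) : (Module.End ℂ W.V)ˣ) : Module.End ℂ W.V) *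
        negCurrent (W.kkM (q L 0)) (l + j)) := by
  have h1 : ∀ (a b : ℤ) (u : (Module.End ℂ W.V)ˣ) (P : Module.End ℂ W.V),
      Commute (W.ops.T.C : Module.End ℂ W.V) u →
      ((W.ops.T.C ^ a : (Module.End ℂ W.V)ˣ) : Module.End ℂ W.V) * (u *
        (((W.ops.T.C ^ b : (Module.End ℂ W.V)ˣ) : Module.End ℂ W.V) * P)) = u *
        (((W.ops.T.C ^ (a + b) : (Module.End ℂ W.V)ˣ) : Module.End ℂ W.V) * P) := fun a b u P h => by
    rw [← mul_assoc, (commute_C_zpow h a).eq, mul_assoc, ← mul_assoc (_ ^ a : (Module.End ℂ W.V)ˣ).val,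
      ← Units.val_mul, ← zpow_add]
  rw [scaleC_mul_scaleC _ (W.C_Xp 1), scaleC_mul_scaleC _ (W.C_Xm (-1)),
    show -j - l = -l - j by ring, ← mul_add, W.relations.cross,
    W.crossP_of_add_eq_zero _ _ _ _ (by norm_num), W.crossM_of_add_eq_zero _ _ _ _ (by norm_num),
    mul_sub, zpow_neg_one, neg_neg, zpow_one, zpow_one, h1 _ _ _ _ W.C_psi0.units_inv_right,
    h1 _ _ _ _ W.C_psi0, show -l - j + l = -j by ring, show -l - j + j = -l by ring]

theorem Xp_Xm_zero (m n : ℤ) : W.ops.Xp 0 m * W.ops.Xm 0 n + W.ops.Xm 0 n * W.ops.Xp 0 m =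
    ((W.ops.T.C ^ m : (Module.End ℂ W.V)ˣ) : Module.End ℂ W.V) * posCurrent (W.kkP 1) (m + n) -
      ((W.ops.T.C ^ n : (Module.End ℂ W.V)ˣ) : Module.End ℂ W.V) * negCurrent (W.kkM 1) (m + n) := by
  rw [W.relations.cross, W.crossP_of_add_eq_zero _ _ _ _ (by norm_num),
    W.crossM_of_add_eq_zero _ _ _ _ (by norm_num)]
  simp only [neg_zero, zpow_zero, Units.val_one, one_mul]

theorem psi0_kkP (t : ℂ) (n : ℤ) :
    Commute (W.ops.T.psi0 : Module.End ℂ W.V) (posCurrent (W.kkP t) n) := by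
  rw [kkP_eq]
  exact (commute_posCurrent (commute_expSeries (fun r => (psi0_logP t r).symm)
    W.psi0_KK.symm) n).symm

theorem invM_pos {n : ℤ} (hn : 0 < n) : W.invM n = 0 := if_neg (not_le.2 hn)

theorem locFin_invM_kkM (m l : ℤ) :
    LocFin fun j => W.invM (m - j) * negCurrent (W.kkM (q L 0)) (l + j) := fun v => by
  refine (Set.finite_Icc m (-l)).subset fun j hj => ⟨?_, ?_⟩
  · by_contra h1
    exact hj (by dsimp only; rw [W.invM_pos (by omega), zero_mul, LinearMap.zero_apply])
  · by_contra h1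
    exact hj (by dsimp only; rw [negCurrent, if_neg (by omega), mul_zero, LinearMap.zero_apply])

/-- The convolution of a series with its inverse; the shift by `l` only changes where the unit
coefficient sits. -/
theorem locSum_invM_kkM (m l : ℤ) :
    (locSum fun j => W.invM (m - j) * negCurrent (W.kkM (q L 0)) (l + j)) =
      if m + l = 0 then 1 else 0 := by
  rw [← negCurrent_one, ← serM_mul_kkM, ← locMul_negCurrent, locMul, ← invM_eq,
    ← locSum_comp_equiv (W.locFin_invM_kkM m l) (Equiv.subRight l)]
  congr 1
  funext k
  rw [Equiv.subRight_apply]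
  congr 2 <;> ring

theorem locSum_kkP_invP (n : ℤ) :
    (locSum fun k => posCurrent (W.kkP (q L 0)) (n - k) * W.invP k) =
      if n = 0 then 1 else 0 := by
  rw [← posCurrent_one, ← kkP_mul_serP, ← locMul_posCurrent]
  rfl

/-- Dressing on one side: `invM` is inverse to `k_0⁻ ǩ_0⁻`, so the second term of (R3) collapses to
a delta function, while the first keeps `invM` as a factor. -/
theorem curE_curZ (hL : Generic L) (m l : ℤ) : W.curE m * W.curZ l + W.curZ l * W.curE m =
    ((W.ops.T.psi0⁻¹ : (Module.End ℂ W.V)ˣ) : Module.End ℂ W.V) *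
      ((locSum fun j => ((W.ops.T.psi0⁻¹ : (Module.End ℂ W.V)ˣ) : Module.End ℂ W.V) *
        ((W.ops.T.C ^ (-j) : (Module.End ℂ W.V)ˣ) : Module.End ℂ W.V) * W.invM (m - j) *
          posCurrent (W.kkP (q L 0)) (l + j)) -
      W.ops.T.psi0 * ((W.ops.T.C ^ m : (Module.End ℂ W.V)ˣ) : Module.End ℂ W.V) *
        if m + l = 0 then 1 else 0) := by
  have hf : LocFin fun j => ((W.ops.T.psi0⁻¹ : (Module.End ℂ W.V)ˣ) : Module.End ℂ W.V) *
        ((W.ops.T.C ^ (-j) : (Module.End ℂ W.V)ˣ) : Module.End ℂ W.V) * W.invM (m - j) *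
          posCurrent (W.kkP (q L 0)) (l + j) := by
    simp only [add_comm l]
    exact (W.isField_kkP _).locFin_mul (m := m)
      (fun j hj => by rw [W.invM_pos (by omega), mul_zero]) l
  rw [add_comm, W.anticommutator_curE (W.psi0_curZ l) fun n => (W.invM_curZ hL n l).symm]
  congr 1
  have h1 : (fun k => W.invM (m - k) * (W.curZ l * W.curY k + W.curY k * W.curZ l)) = fun j =>
      ((W.ops.T.psi0⁻¹ : (Module.End ℂ W.V)ˣ) : Module.End ℂ W.V) *
        ((W.ops.T.C ^ (-j) : (Module.End ℂ W.V)ˣ) : Module.End ℂ W.V) * W.invM (m - j) *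
          posCurrent (W.kkP (q L 0)) (l + j) +
      -(W.ops.T.psi0 * ((W.ops.T.C ^ (-l) : (Module.End ℂ W.V)ˣ) : Module.End ℂ W.V)) *
        (W.invM (m - j) * negCurrent (W.kkM (q L 0)) (l + j)) := by
    funext k
    rw [curY_curZ, mul_sub, neg_mul, ← sub_eq_add_neg]
    congr 1
    · rw [← mul_assoc, ← mul_assoc, ← (W.psi0_invM _).units_inv_left.eq,
        mul_assoc _ (W.invM _), ← (commute_C_zpow (W.C_invM _) _).eq, ← mul_assoc]
    · rw [← mul_assoc, ← mul_assoc, ← (W.psi0_invM _).eq,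
        mul_assoc _ (W.invM _), ← (commute_C_zpow (W.C_invM _) _).eq, ← mul_assoc, mul_assoc]
  rw [h1, locSum_add hf ((W.locFin_invM_kkM m l).mul_left _),
    ← mul_locSum (W.locFin_invM_kkM m l), locSum_invM_kkM, neg_mul, ← sub_eq_add_neg]
  congr 1
  split_ifs with h
  · rw [show -l = m by omega]
  · rw [mul_zero, mul_zero]

/-- Dressing on the other side: `invP` cancels `k_0⁺ ǩ_0⁺` in the first term. Each term has lost its
original factor and carries the dressing that met the other one, and `ψ_0 invP`, `ψ_0⁻¹ invM` are
the currents `Ψ_0^±` up to scaling. -/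
theorem curE_curF (hL : Generic L) (m n : ℤ) : W.curE m * W.curF n + W.curF n * W.curE m =
    -(((W.ops.T.C ^ m : (Module.End ℂ W.V)ˣ) : Module.End ℂ W.V) *
        (W.ops.T.psi0 * W.invP (m + n)) -
      ((W.ops.T.C ^ n : (Module.End ℂ W.V)ˣ) : Module.End ℂ W.V) *
        (((W.ops.T.psi0⁻¹ : (Module.End ℂ W.V)ˣ) : Module.End ℂ W.V) * W.invM (m + n))) := by
  have hb := W.isField_invP.locFin (fun k => W.invP_neg)
  set ψ := W.ops.T.psi0 with hψ
  set A : ℤ → Module.End ℂ W.V := fun j => ((ψ⁻¹ : (Module.End ℂ W.V)ˣ) : Module.End ℂ W.V) *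
    ((W.ops.T.C ^ (-j) : (Module.End ℂ W.V)ˣ) : Module.End ℂ W.V) * W.invM (m - j) with hA
  have hA0 : ∀ j < m, A j = 0 := fun j hj => by
    simp only [hA]
    rw [W.invM_pos (by omega), mul_zero]
  have hS : ∀ l, LocFin fun j => A j * posCurrent (W.kkP (q L 0)) (l + j) := fun l => by
    simp only [add_comm l]
    exact (W.isField_kkP _).locFin_mul hA0 l
  rw [W.anticommutator_curF (W.psi0_curE m) fun n => (W.invP_curE hL n m).symm]
  have h1 : (fun k => (W.curE m * W.curZ (n - k) + W.curZ (n - k) * W.curE m) * (ψ * W.invP k)) =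
      fun k => (locSum fun j => A j * posCurrent (W.kkP (q L 0)) (n - k + j)) * W.invP k +
        (if m + (n - k) = 0 then -(((W.ops.T.C ^ m : (Module.End ℂ W.V)ˣ) : Module.End ℂ W.V) *
          (ψ * W.invP k)) else 0) := by
    funext k
    rw [W.curE_curZ hL, mul_sub, sub_mul, sub_eq_add_neg]
    congr 1
    · have h2 : Commute (ψ : Module.End ℂ W.V)
          (locSum fun j => A j * posCurrent (W.kkP (q L 0)) (n - k + j)) := by
        rw [commute_iff_eq, mul_locSum (hS _), locSum_mul (hS _)]
        congr 1
        funext j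
        exact (((((Commute.refl _).units_inv_right).mul_right
          (commute_C_zpow W.C_psi0 _).symm).mul_right (W.psi0_invM _)).mul_right
            (W.psi0_kkP _ _)).eq
      rw [← h2.units_inv_left.symm.eq, mul_assoc, Units.inv_mul_cancel_left]
    · split_ifs
      · rw [mul_one, Units.inv_mul_cancel_left]
      · rw [mul_zero, mul_zero, zero_mul, neg_zero]
  -- Joint local finiteness in both indices, which justifies summing over `k` first so that `k_0⁺
  -- ǩ_0⁺` meets its inverse.
  have h3 : LocFin fun p : ℤ × ℤ =>
      A p.2 * posCurrent (W.kkP (q L 0)) (n - p.1 + p.2) * W.invP p.1 :=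
    hb.prod_right (S := fun k j => A j * posCurrent (W.kkP (q L 0)) (n - k + j))
      fun k => hS (n - k)
  have h6 : (fun k => (locSum fun j => A j * posCurrent (W.kkP (q L 0)) (n - k + j)) *
        W.invP k) = fun k => locSum fun j =>
          A j * posCurrent (W.kkP (q L 0)) (n - k + j) * W.invP k :=
      funext fun k => locSum_mul (hS _) _
  have h4 : LocFin fun k => (locSum fun j => A j * posCurrent (W.kkP (q L 0)) (n - k + j)) *
      W.invP k := by
    rw [h6]
    exact h3.locSum_snd
  have h5 : LocFin fun k => if m + (n - k) = 0 then
      -(((W.ops.T.C ^ m : (Module.End ℂ W.V)ˣ) : Module.End ℂ W.V) *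
        ((ψ : Module.End ℂ W.V) * W.invP k)) else 0 :=
    fun v => (Set.finite_singleton (m + n)).subset fun k hk => by
      by_contra h
      refine hk ?_
      dsimp only
      rw [if_neg fun h' => h (show k = m + n by omega), LinearMap.zero_apply]
  rw [h1, locSum_add h4 h5, neg_sub, sub_eq_add_neg]
  congr 1
  · rw [h6, locSum_comm h3]
    -- For fixed `j` the sum over `k` is a coefficient of the product of inverse series, so only `j
    -- = -n` survives.
    have h7 : ∀ j, (locSum fun k => A j * posCurrent (W.kkP (q L 0)) (n - k + j) * W.invP k) =
        A j * if n + j = 0 then 1 else 0 := fun j => by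
      rw [← locSum_kkP_invP, mul_locSum (T := fun k => posCurrent (W.kkP (q L 0)) (n + j - k) * W.invP k)
        (locFinMul_posCurrent (W.kkP (q L 0)) W.serP (n + j))]
      congr 1
      funext k
      rw [mul_assoc, show n - k + j = n + j - k by ring]
    simp only [h7]
    rw [locSum_single (-n) fun j hj => by rw [if_neg (by omega), mul_zero],
      if_pos (add_neg_cancel n), mul_one]
    simp only [hA]
    rw [neg_neg, sub_neg_eq_add, ← (commute_C_zpow W.C_psi0.units_inv_right n).eq, mul_assoc]
  · rw [locSum_single (m + n) fun k hk => if_neg (by omega), if_pos (by ring)]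

end AdmRep

end

section

/-! ### The exchange ratio of (R2) for neighbouring indices -/

section Ratios

variable {L : Fin 3 → ℂ}

/-- The logarithm of `rhoP L 1`. -/
def rhoLogP (L : Fin 3 → ℂ) : PowerSeries ℂ :=
  (negLog 1 + negLog (q L 0)⁻¹) + (-negLog (q L 1) + -negLog (q L 2))

/-- The logarithm of `rhoM L 1`. -/
def rhoLogM (L : Fin 3 → ℂ) : PowerSeries ℂ :=
  (negLog 1 + negLog (q L 0)) + (-negLog (q L 1)⁻¹ + -negLog (q L 2)⁻¹)

theorem coeff_zero_rhoLogP : PowerSeries.coeff 0 (rhoLogP L) = 0 := by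
  simp only [rhoLogP, map_add, map_neg, coeff_zero_negLog, neg_zero, add_zero]

theorem coeff_zero_rhoLogM : PowerSeries.coeff 0 (rhoLogM L) = 0 := by
  simp only [rhoLogM, map_add, map_neg, coeff_zero_negLog, neg_zero, add_zero]

theorem rhoP_one : rhoP L 1 = expSeries (rhoLogP L) := by
  rw [rhoP, eq_comm, PowerSeries.eq_mul_inv_iff_mul_eq (by simp [prod_range_succ])]
  have h := exp_sum_negLog 1 (q L 0)⁻¹ (q L 1) (q L 2)
  simp only [prod_range_succ, prod_range_zero, pow_zero, pow_one, mul_one, one_mul]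
  exact h

theorem rhoM_one (hsum : L 0 + L 1 + L 2 = 0) : rhoM L 1 = expSeries (rhoLogM L) := by
  have h0 := q_ne_zero L 0
  have h1 := q_ne_zero L 1
  have h2 := q_ne_zero L 2
  rw [rhoM, eq_comm, PowerSeries.eq_mul_inv_iff_mul_eq (by simp [prod_range_succ, h0])]
  have h := exp_sum_negLog 1 (q L 0) (q L 1)⁻¹ (q L 2)⁻¹
  change expSeries (rhoLogM L) * _ = _ at h
  simp only [prod_range_succ, prod_range_zero, pow_zero, pow_one, mul_one, one_mul]
  have e0 : PowerSeries.C (q L 0) * PowerSeries.C (q L 0)⁻¹ = 1 := by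
    rw [← map_mul, mul_inv_cancel₀ h0, map_one]
  have e1 : PowerSeries.C (q L 1) * PowerSeries.C (q L 1)⁻¹ = 1 := by
    rw [← map_mul, mul_inv_cancel₀ h1, map_one]
  have e2 : PowerSeries.C (q L 2) * PowerSeries.C (q L 2)⁻¹ = 1 := by
    rw [← map_mul, mul_inv_cancel₀ h2, map_one]
  have e3 : PowerSeries.C (q L 0) * PowerSeries.C (q L 1) * PowerSeries.C (q L 2) = 1 := by
    rw [← map_mul, ← map_mul, q_prod hsum, map_one]
  rw [map_one] at h ⊢
  set A := PowerSeries.C (q L 1)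
  set B := PowerSeries.C (q L 2)
  set D := PowerSeries.C (q L 0)
  set A' := PowerSeries.C (q L 1)⁻¹
  set B' := PowerSeries.C (q L 2)⁻¹
  set D' := PowerSeries.C (q L 0)⁻¹
  set X : PowerSeries ℂ := PowerSeries.X
  have k1 : X - A = -A * (1 - A' * X) := by linear_combination (-X) * e1
  have k2 : X - B = -B * (1 - B' * X) := by linear_combination (-X) * e2
  have k3 : X - D' = -D' * (1 - D * X) := by linear_combination (-X) * e0
  have k4 : A * B = D' := by linear_combination D' * e3 - A * B * e0
  rw [k1, k2, k3]
  linear_combination (A * B) * h - (expSeries (rhoLogM L) * (1 - X) * (1 - D * X)) * k4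

/-- The right hand side is the scalar in the commutator of `-logP (q_1)`, the exponent of the
dressing `invP`, with `X_0^+`. Thus the ratio of (R2) and the exchange with the dressing coincide.
-/
theorem coeff_rhoLogP (hsum : L 0 + L 1 + L 2 = 0)
    (hgen : ∀ a b : ℤ, q L 0 ^ a * q L 1 ^ b = 1 → a = 0 ∧ b = 0) (r : ℕ) :
    PowerSeries.coeff r (rhoLogP L) = -gammaP L r ((q L 0)⁻¹ ^ r) := by
  have h : q L 2 = (s L 0)⁻¹ * (s L 0 * q L 1)⁻¹ := by
    have := q_prod hsum
    rw [← s_sq] at this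
    have h0 := s_ne_zero (L := L)
    have h1 := q_ne_zero L 1
    field_simp
    linear_combination this
  rw [gammaP_q_inv hsum hgen, neg_neg, coeff_barSeries]
  simp only [rhoLogP, negLog, map_add, map_neg, PowerSeries.coeff_mk, smul_eq_mul]
  rw [h, ← s_sq]
  have h1 : (s L 0)⁻¹ ^ r * s L 0 ^ r = 1 := by
    rw [← mul_pow, inv_mul_cancel₀ s_ne_zero, one_pow]
  have h2 : (s L 0)⁻¹ ^ r * (s L 0 * q L 1) ^ r = q L 1 ^ r := by
    rw [← mul_pow, inv_mul_cancel_left₀ s_ne_zero]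
  rw [mul_pow, ← inv_pow, ← pow_mul, one_pow, mul_comm 2 r, pow_mul]
  linear_combination (-(r : ℂ)⁻¹) * h1 + (r : ℂ)⁻¹ * h2

/-- The same comparison for `invM` and `X_0^-`. The exponent `-logM (q_1)` contributes the opposite
sign, and so `X_0^-` is moved to the right past `invM` with this ratio. -/
theorem coeff_rhoLogM (hsum : L 0 + L 1 + L 2 = 0)
    (hgen : ∀ a b : ℤ, q L 0 ^ a * q L 1 ^ b = 1 → a = 0 ∧ b = 0) (r : ℕ) :
    PowerSeries.coeff r (rhoLogM L) = gammaP L r (q L 0 ^ r) := by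
  have h : (q L 2)⁻¹ = s L 0 * (s L 0 * q L 1) := by
    have := q_prod hsum
    rw [← s_sq] at this
    refine inv_eq_of_mul_eq_one_left ?_
    linear_combination this
  rw [gammaP_q hsum hgen, coeff_barSeries]
  simp only [rhoLogM, negLog, map_add, map_neg, PowerSeries.coeff_mk, smul_eq_mul]
  rw [h, ← s_sq]
  have h1 : s L 0 ^ r * (s L 0)⁻¹ ^ r = 1 := by
    rw [← mul_pow, mul_inv_cancel₀ s_ne_zero, one_pow]
  have h2 : s L 0 ^ r * (s L 0 * q L 1)⁻¹ ^ r = (q L 1)⁻¹ ^ r := by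
    rw [← mul_pow, mul_inv, mul_inv_cancel_left₀ s_ne_zero]
  rw [mul_pow (s L 0) (s L 0 * q L 1), ← pow_mul, one_pow, mul_comm 2 r, pow_mul]
  linear_combination (-(r : ℂ)⁻¹) * h1 + (r : ℂ)⁻¹ * h2

end Ratios

section LocallyFinite

variable {V : Type*} [AddCommGroup V] [Module ℂ V]

theorem locSum_shift {T : ℤ × ℕ → Module.End ℂ V} (h : LocFin T) :
    (locSum fun k : ℤ => locSum fun t : ℕ => T (k - t, t)) =
      locSum fun k : ℤ => locSum fun t : ℕ => T (k, t) := by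
  let e : ℤ × ℕ ≃ ℤ × ℕ :=
    { toFun := fun p => (p.1 - p.2, p.2)
      invFun := fun p => (p.1 + p.2, p.2)
      left_inv := fun p => by simp
      right_inv := fun p => by simp }
  rw [← locSum_prod h, ← locSum_comp_equiv h e]
  exact (locSum_prod (T := fun r => T (e r)) (h.comp e.injective)).symm

theorem LocFin.smul_fun {ι : Type*} {T : ι → Module.End ℂ V} (h : LocFin T) (c : ι → ℂ) :
    LocFin fun r => c r • T r := fun v => (h v).subset fun r hr h0 => hr (by
      simp only [LinearMap.smul_apply, h0, smul_zero])

theorem LocFin.mul_left_fun {ι : Type*} {T : ι → Module.End ℂ V} (h : LocFin T)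
    (a : ι → Module.End ℂ V) : LocFin fun r => a r * T r := fun v => (h v).subset fun r hr h0 =>
  hr (by simp only [Module.End.mul_apply, h0, map_zero])

theorem IsField.locFin_nat {b : ℤ → Module.End ℂ V} (h : IsField b) (c : ℤ) :
    LocFin fun t : ℕ => b (c + t) := fun v => by
  obtain ⟨N, hN⟩ := h v
  refine (Set.finite_Iic (N - c).toNat).subset fun t ht => ?_
  by_contra h1
  rw [Set.mem_Iic] at h1
  exact ht (hN _ (by omega))

end LocallyFinite

/-! ### Anticommutation of `E_0` with `F_1` and of `E_1` with `F_0` -/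

namespace AdmRep

variable {L : Fin 3 → ℂ} (W : AdmRep L)

theorem scaleC_apply (X : ℤ → Module.End ℂ W.V) (n : ℤ) : W.scaleC X n =
    ((W.ops.T.C ^ (-n) : (Module.End ℂ W.V)ˣ) : Module.End ℂ W.V) * X n := rfl

/-- (R2) for the indices `-1`, `0`, where `γ_1` is an empty product and the constant is `-1`. The
argument `C z` converts the shift by `t` into the factor `C^t`. -/
theorem curY_Xm (k n : ℤ) : W.curY k * W.ops.Xm 0 n = -locSum fun t : ℕ =>
    PowerSeries.coeff t (rhoM L 1) • ((W.ops.T.C : Module.End ℂ W.V) ^ t *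
      (W.ops.Xm 0 (n - t) * W.curY (k + t))) := by
  have h1 := W.relations.quadM.offDiag (-1) 1 le_rfl k n
  simp only [gammaForms, gammaConst, swapForms, Nat.sub_self, List.range_zero,
    List.map_nil, mulForms, List.foldr_nil, prodZW, Nat.cast_one, neg_add_cancel, mul_zero,
    Nat.zero_div, pow_zero, mul_neg, mul_one, add_sub_cancel_right, neg_smul] at h1
  have hf : LocFin fun t : ℕ => PowerSeries.coeff t (rhoM L 1) •
      (W.ops.Xm 0 (n - t) * W.ops.Xm (-1) (k + t)) :=
    (((isField_Xm (-1)).locFin_nat k).mul_left_fun _).smul_fun _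
  rw [curY, scaleC_apply, mul_assoc, h1]
  rw [show ((-1 : ℂ)) ^ (1 + 1) = 1 by norm_num, one_smul, mul_neg, mul_locSum hf,
    neg_inj]
  congr 1
  funext t
  rw [mul_smul_comm, scaleC_apply, ← mul_assoc (W.ops.Xm 0 _), ← (commute_C_zpow (W.C_Xm 0 _) _).eq,
    ← C_zpow_natCast, ← mul_assoc, ← mul_assoc, ← mul_assoc, ← Units.val_mul, ← zpow_add]
  congr 5
  ring

theorem Xp_curZ (m n : ℤ) : W.ops.Xp 0 m * W.curZ n = -locSum fun t : ℕ =>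
    PowerSeries.coeff t (rhoP L 1) • (((W.ops.T.C⁻¹ : (Module.End ℂ W.V)ˣ) : Module.End ℂ W.V) ^ t *
      (W.curZ (n - t) * W.ops.Xp 0 (m + t))) := by
  have h1 := W.relations.quadP.offDiag 0 1 le_rfl m n
  simp only [gammaForms, gammaConst, Nat.sub_self, List.range_zero,
    List.map_nil, mulForms, List.foldr_nil, prodZW, Nat.cast_one, zero_add, mul_zero,
    Nat.zero_div, pow_zero, mul_neg, mul_one, add_sub_cancel_right, neg_smul] at h1
  have hf : LocFin fun t : ℕ => PowerSeries.coeff t (rhoP L 1) •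
      (W.ops.Xp 1 (n - t) * W.ops.Xp 0 (m + t)) :=
    (((isField_Xp 0).locFin_nat m).mul_left_fun _).smul_fun _
  rw [curZ, scaleC_apply, ← mul_assoc, ← (commute_C_zpow (W.C_Xp 0 _) _).eq, mul_assoc, h1]
  rw [show ((-1 : ℂ)) ^ (1 + 1) = 1 by norm_num, one_smul, mul_neg, mul_locSum hf,
    neg_inj]
  congr 1
  funext t
  rw [mul_smul_comm, scaleC_apply, ← units_zpow_neg_natCast, ← mul_assoc, ← mul_assoc, ← mul_assoc,
    ← Units.val_mul, ← zpow_add]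
  congr 5
  ring

theorem Xm_invM (hL : Generic L) (j n : ℤ) : W.ops.Xm 0 n * W.invM j = locSum fun t : ℕ =>
    PowerSeries.coeff t (rhoM L 1) • ((W.ops.T.C : Module.End ℂ W.V) ^ t *
      (W.invM (j + t) * W.ops.Xm 0 (n - t))) := by
  have h0 : PowerSeries.coeff 0 (-W.logM (q L 0)) = 0 := by
    rw [map_neg, coeff_zero_kkLogM, neg_zero]
  have hC : ∀ (l : PowerSeries ℂ) (k : ℕ), Commute (W.KK : Module.End ℂ W.V)
      (PowerSeries.coeff k (substMul (W.ops.T.C : Module.End ℂ W.V) l)) :=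
    commute_substMul W.C_KK.symm
  have h1 : seriesCur (expSeries (-W.logM (q L 0))) (fun n => W.ops.Xm 0 (-n)) =
      QTor.act (expSeries (substMul (W.ops.T.C : Module.End ℂ W.V) (-rhoLogM L)))
        (curSeries (fun n => W.ops.Xm 0 (-n)) (expSeries (-W.logM (q L 0)))) := by
    refine expSeries_conj h0 (W.logM_logM _ _).neg_left.symm.neg_left ?_
      (coeffComm_substMul (Commute.refl _) _ _) (coeffComm_substMul_right (fun n => ?_) _)
      fun r n => ?_
    · rw [coeff_substMul, map_neg, coeff_zero_rhoLogM, neg_zero, zero_smul]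
    · rw [map_neg]
      exact (C_logM _ n).symm.neg_left
    · rw [map_neg, neg_mul, W.logM_Xm hL, neg_zero, zpow_zero, inv_one, mul_one, coeff_substMul,
        map_neg, coeff_rhoLogM hL.sum hL.gen, neg_add, mul_neg, neg_smul, neg_mul,
        show -n - (r : ℤ) = -(n + r) by ring]
  have h2 := conj_C_mul (fun n => KK_Xm hL.ne_zero hL.sum 0 (-n))
    (fun n => by rw [← substMul_expSeries]; exact hC _ n) h1
  rw [← substMul_expSeries] at h2
  -- The conjugation formula has `X_0^-` on the right; inverting the exponential gives the expansion
  -- of `X_0^-` times the dressing.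
  have h3 := act_inverse (by rw [map_neg, coeff_zero_rhoLogM, neg_zero]) h2
  rw [neg_neg, ← rhoM_one hL.sum] at h3
  rw [invM_eq, negCurrent_eq, posCurrent]
  split_ifs with hj
  · have h4 := congrFun (congrFun h3 (-j).toNat) (-n)
    simp only [curSeries, neg_neg, QTor.act, seriesCur, coeff_substMul] at h4
    rw [serM, h4, locSum_nat (k := (-j).toNat)]
    · refine sum_congr rfl fun p hp => ?_
      rw [HasAntidiagonal.mem_antidiagonal] at hp
      rw [negCurrent, if_pos (by omega), smul_mul_assoc, show (-(j + p.1)).toNat = p.2 by omega,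
        show -(-n + (p.1 : ℤ)) = n - p.1 by ring]
    · intro t ht
      rw [negCurrent, if_neg (by omega), zero_mul, mul_zero, smul_zero]
  · rw [mul_zero, eq_comm]
    have h5 : ∀ t : ℕ, PowerSeries.coeff t (rhoM L 1) • ((W.ops.T.C : Module.End ℂ W.V) ^ t *
        (negCurrent W.serM (j + t) * W.ops.Xm 0 (n - t))) = 0 := fun t => by
      rw [negCurrent, if_neg (by omega), zero_mul, mul_zero, smul_zero]
    simp only [h5, locSum_zero]

theorem invP_Xp (hL : Generic L) (j m : ℤ) : W.invP j * W.ops.Xp 0 m = locSum fun t : ℕ =>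
    PowerSeries.coeff t (rhoP L 1) • (((W.ops.T.C⁻¹ : (Module.End ℂ W.V)ˣ) : Module.End ℂ W.V) ^ t *
      (W.ops.Xp 0 (m + t) * W.invP (j - t))) := by
  have h0 : PowerSeries.coeff 0 (-W.logP (q L 0)) = 0 := by
    rw [map_neg, coeff_zero_kkLogP, neg_zero]
  have hC : ∀ (l : PowerSeries ℂ) (k : ℕ), Commute
      ((W.KK⁻¹ : (Module.End ℂ W.V)ˣ) : Module.End ℂ W.V)
      (PowerSeries.coeff k (substMul ((W.ops.T.C⁻¹ : (Module.End ℂ W.V)ˣ) : Module.End ℂ W.V) l)) :=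
    commute_substMul W.C_KK.symm.units_inv_left.units_inv_right
  have h1 : seriesCur (expSeries (-W.logP (q L 0))) (W.ops.Xp 0) =
      QTor.act (expSeries (substMul ((W.ops.T.C⁻¹ : (Module.End ℂ W.V)ˣ) : Module.End ℂ W.V)
        (rhoLogP L))) (curSeries (W.ops.Xp 0) (expSeries (-W.logP (q L 0)))) := by
    refine expSeries_conj h0 (W.logP_logP _ _).neg_left.symm.neg_left ?_
      (coeffComm_substMul (Commute.refl _) _ _) (coeffComm_substMul_right (fun n => ?_) _)
      fun r n => ?_
    · rw [coeff_substMul, coeff_zero_rhoLogP, zero_smul]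
    · rw [map_neg]
      exact (C_logP _ n).units_inv_left.symm.neg_left
    · rw [map_neg, neg_mul, W.logP_Xp, zpow_zero, mul_one, coeff_substMul,
        coeff_rhoLogP hL.sum hL.gen, neg_add, mul_neg, neg_smul, neg_mul]
  have h2 := conj_C_mul (fun n => (KK_Xp hL.ne_zero hL.sum 0 n).units_inv_left)
    (fun n => by rw [← substMul_expSeries]; exact hC _ n) h1
  rw [← substMul_expSeries, ← rhoP_one] at h2
  rw [invP_eq, posCurrent]
  split_ifs with hj
  · have h4 := congrFun (congrFun h2 j.toNat) m
    simp only [curSeries, QTor.act, seriesCur, coeff_substMul] at h4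
    rw [serP, h4, locSum_nat (k := j.toNat)]
    · refine sum_congr rfl fun p hp => ?_
      rw [HasAntidiagonal.mem_antidiagonal] at hp
      rw [posCurrent, if_pos (by omega), smul_mul_assoc, show (j - p.1).toNat = p.2 by omega]
    · intro t ht
      rw [posCurrent, if_neg (by omega), mul_zero, mul_zero, smul_zero]
  · rw [zero_mul, eq_comm]
    have h5 : ∀ t : ℕ, PowerSeries.coeff t (rhoP L 1) •
        (((W.ops.T.C⁻¹ : (Module.End ℂ W.V)ˣ) : Module.End ℂ W.V) ^ t *
        (W.ops.Xp 0 (m + t) * posCurrent W.serP (j - t))) = 0 := fun t => by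
      rw [posCurrent, if_neg (by omega), mul_zero, mul_zero, smul_zero]
    simp only [h5, locSum_zero]

/-- In one order `X_0^-` is exchanged with `invM`, in the other with `X_{-1}^-`. Both produce the
coefficients of `rhoM L 1` times `C^t`, once with a minus sign, so the two double sums agree up to
sign and a shift of indices. -/
theorem curE_Xm (hL : Generic L) (m n : ℤ) :
    W.curE m * W.ops.Xm 0 n + W.ops.Xm 0 n * W.curE m = 0 := by
  set T : ℤ × ℕ → Module.End ℂ W.V := fun p => PowerSeries.coeff p.2 (rhoM L 1) •
    ((W.ops.T.C : Module.End ℂ W.V) ^ p.2 *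
      (W.invM (m - p.1) * (W.ops.Xm 0 (n - p.2) * W.curY (p.1 + p.2)))) with hT
  have hYf : IsField W.curY := isField_scaleC (isField_Xm (-1))
  have hTf : LocFin T := fun v => by
    obtain ⟨N, hN⟩ := hYf v
    refine ((Set.finite_Icc m N).prod (Set.finite_Iic (N - m).toNat)).subset ?_
    rintro ⟨k, t⟩ hkt
    have h1 : m ≤ k := by
      by_contra h
      refine hkt ?_
      simp only [hT]
      rw [W.invM_pos (by omega), zero_mul, mul_zero, smul_zero, LinearMap.zero_apply]
    have h2 : k + t ≤ N := by
      by_contra h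
      refine hkt ?_
      simp only [hT, LinearMap.smul_apply, Module.End.mul_apply]
      rw [hN _ (by omega), map_zero, map_zero, map_zero, smul_zero]
    simp only [Set.mem_prod, Set.mem_Icc, Set.mem_Iic]
    omega
  -- Here the summand is `T` at `(k - t, t)`, and in `hX'` at `(k, t)`; `locSum_shift` identifies
  -- the two double sums.
  have hX : ∀ k, W.ops.Xm 0 n * (W.invM (m - k) * W.curY k) =
      locSum fun t : ℕ => T (k - t, t) := fun k => by
    rw [← mul_assoc, W.Xm_invM hL, locSum_mul]
    · congr 1
      funext t
      simp only [hT]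
      rw [smul_mul_assoc, sub_add_cancel, show m - k + t = m - (k - t) by ring]
      simp only [mul_assoc]
    · refine LocFin.smul_fun (LocFin.mul_left_fun (fun v => ?_) _) _
      refine (Set.finite_Iic (k - m).toNat).subset fun t ht => ?_
      by_contra h
      rw [Set.mem_Iic] at h
      refine ht ?_
      dsimp only
      rw [W.invM_pos (by omega), zero_mul, LinearMap.zero_apply]
  have hX' : ∀ k, W.invM (m - k) * W.curY k * W.ops.Xm 0 n =
      (-1 : ℂ) • locSum fun t : ℕ => T (k, t) := fun k => by
    have hf : LocFin fun t : ℕ => PowerSeries.coeff t (rhoM L 1) •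
        ((W.ops.T.C : Module.End ℂ W.V) ^ t * (W.ops.Xm 0 (n - t) * W.curY (k + t))) :=
      (((hYf.locFin_nat k).mul_left_fun _).mul_left_fun _).smul_fun _
    rw [mul_assoc, curY_Xm, mul_neg, mul_locSum hf, neg_one_smul]
    congr 2
    funext t
    simp only [hT]
    rw [mul_smul_comm, ← mul_assoc (W.invM _), ← ((W.C_invM _).pow_left t).eq, mul_assoc]
  have h1 : W.ops.Xm 0 n * locMul W.invM W.curY m = locSum fun k : ℤ => locSum fun t : ℕ =>
      T (k, t) := by
    rw [← locSum_shift hTf, locMul, mul_locSum (W.locFinMul_curE m)]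
    congr 1
    funext k
    exact hX k
  have h2 : locMul W.invM W.curY m * W.ops.Xm 0 n = -locSum fun k : ℤ => locSum fun t : ℕ =>
      T (k, t) := by
    refine Eq.trans ?_ (neg_one_smul ℂ _)
    rw [locMul, locSum_mul (W.locFinMul_curE m), ← locSum_smul hTf.locSum_snd]
    congr 1
    funext k
    exact hX' k
  rw [curE, ← mul_assoc, ← (W.psi0_Xm 0 n).units_inv_left.eq, mul_assoc, mul_assoc, h1, h2, mul_neg,
    neg_add_cancel]

/-- The mirror image of `curE_Xm`: the dressing is on the right of `X_1^+`, and the common ratio is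
`rhoP L 1`. -/
theorem Xp_curF (hL : Generic L) (m n : ℤ) :
    W.ops.Xp 0 m * W.curF n + W.curF n * W.ops.Xp 0 m = 0 := by
  set T : ℤ × ℕ → Module.End ℂ W.V := fun p => PowerSeries.coeff p.2 (rhoP L 1) •
    (((W.ops.T.C⁻¹ : (Module.End ℂ W.V)ˣ) : Module.End ℂ W.V) ^ p.2 *
      (W.curZ (n - p.1 - p.2) * W.ops.Xp 0 (m + p.2))) *
        ((W.ops.T.psi0 : Module.End ℂ W.V) * W.invP p.1) with hT
  have hb := (W.isField_invP.locFin fun k => W.invP_neg).mul_left (W.ops.T.psi0 : Module.End ℂ W.V)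
  have hS : ∀ k, LocFin fun t : ℕ => PowerSeries.coeff t (rhoP L 1) •
    (((W.ops.T.C⁻¹ : (Module.End ℂ W.V)ˣ) : Module.End ℂ W.V) ^ t *
      (W.curZ (k - t) * W.ops.Xp 0 (m + t))) := fun k =>
    ((((isField_Xp 0).locFin_nat m).mul_left_fun _).mul_left_fun _).smul_fun _
  have hTf : LocFin T := hb.prod_right fun k => hS (n - k)
  have hX : ∀ k, W.curZ (n - k) * ((W.ops.T.psi0 : Module.End ℂ W.V) * W.invP k) * W.ops.Xp 0 m =
      locSum fun t : ℕ => T (k - t, t) := fun k => by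
    rw [mul_assoc, mul_assoc (W.ops.T.psi0 : Module.End ℂ W.V), W.invP_Xp hL, ← mul_assoc,
      mul_locSum]
    · congr 1
      funext t
      simp only [hT]
      rw [mul_smul_comm, smul_mul_assoc, show n - (k - t) - t = n - k by ring]
      congr 1
      have c1 := (W.psi0_Xp 0 (m + t)).eq
      have c2 : Commute (((W.ops.T.C⁻¹ : (Module.End ℂ W.V)ˣ) : Module.End ℂ W.V) ^ t)
          (W.curZ (n - k) * W.ops.T.psi0) :=
        ((commute_scaleC (Commute.refl _) (W.C_Xp 1) (n - k)).mul_right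
          W.C_psi0).units_inv_left.pow_left t
      rw [← mul_assoc, ← c2.eq, mul_assoc, mul_assoc, mul_assoc, ← mul_assoc _ (W.ops.Xp 0 _), c1]
      simp only [mul_assoc]
    · refine LocFin.smul_fun (LocFin.mul_left_fun (fun v => ?_) _) _
      refine (Set.finite_Iic k.toNat).subset fun t ht => ?_
      by_contra h
      rw [Set.mem_Iic] at h
      refine ht ?_
      dsimp only
      rw [W.invP_neg (by omega), mul_zero, LinearMap.zero_apply]
  have hX' : ∀ k, W.ops.Xp 0 m * (W.curZ (n - k) * ((W.ops.T.psi0 : Module.End ℂ W.V) *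
      W.invP k)) = (-1 : ℂ) • locSum fun t : ℕ => T (k, t) := fun k => by
    rw [← mul_assoc, Xp_curZ, neg_mul, locSum_mul (hS (n - k)), neg_one_smul]
  have h1 : W.curF n * W.ops.Xp 0 m = locSum fun k : ℤ => locSum fun t : ℕ => T (k, t) := by
    rw [← locSum_shift hTf, curF, locMul, locSum_mul (W.locFinMul_curF n)]
    congr 1
    funext k
    exact hX k
  have h2 : W.ops.Xp 0 m * W.curF n = -locSum fun k : ℤ => locSum fun t : ℕ => T (k, t) := by
    refine Eq.trans ?_ (neg_one_smul ℂ _)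
    rw [curF, locMul, mul_locSum (W.locFinMul_curF n), ← locSum_smul hTf.locSum_snd]
    congr 1
    funext k
    exact hX' k
  rw [h1, h2, neg_add_cancel]

end AdmRep

end

section

/-! ### Quadratic forms applied to delta functions and to convolutions -/

section QuadraticForms

variable {V : Type*} [AddCommGroup V] [Module ℂ V]

theorem quadDist_sub {R : Type*} [Ring R] [Algebra ℂ R] (T : ℂ) (D D' : ℤ → ℤ → R) (m n : ℤ) :
    quadDist T 1 1 (fun m n => D m n - D' m n) m n = quadDist T 1 1 D m n - quadDist T 1 1 D' m n := by
  simp only [quadDist, one_mul, smul_sub]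
  abel

/-- The coefficients `σ^k A (k + n)` describe a delta function at `z = σ w` times a current, and
`σ⁻¹^k B (k + n)` one at `z = σ⁻¹ w`. The form `(z - σ w)(z - σ⁻¹ w)` kills both. -/
theorem quadDist_geometric {R : Type*} [Ring R] [Algebra ℂ R] {σ : ℂ} (hσ : σ ≠ 0) (A B : ℤ → R)
    (m n : ℤ) :
    quadDist (σ + σ⁻¹) 1 1 (fun k n => σ ^ k • A (k + n) + σ⁻¹ ^ k • B (k + n)) m n = 0 := by
  simp only [quadDist, one_mul]
  rw [show m + 2 + n = m + n + 2 by ring, show m + 1 + (n + 1) = m + n + 2 by ring,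
    ← add_assoc m n 2]
  have hσ' := inv_ne_zero hσ
  rw [zpow_add₀ hσ, zpow_add₀ hσ, zpow_add₀ hσ', zpow_add₀ hσ', zpow_one, zpow_one]
  have h1 : σ ^ m * σ ^ (2 : ℤ) - (σ + σ⁻¹) * (σ ^ m * σ) + σ ^ m = 0 := by
    have : σ⁻¹ * σ = 1 := inv_mul_cancel₀ hσ
    rw [show σ ^ (2 : ℤ) = σ * σ by rw [← sq]; rfl]
    linear_combination (-σ ^ m) * this
  have h2 : σ⁻¹ ^ m * σ⁻¹ ^ (2 : ℤ) - (σ + σ⁻¹) * (σ⁻¹ ^ m * σ⁻¹) + σ⁻¹ ^ m = 0 := by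
    have : σ⁻¹ * σ = 1 := inv_mul_cancel₀ hσ
    rw [show σ⁻¹ ^ (2 : ℤ) = σ⁻¹ * σ⁻¹ by rw [← sq]; rfl]
    linear_combination (-σ⁻¹ ^ m) * this
  calc _ = (σ ^ m * σ ^ (2 : ℤ) - (σ + σ⁻¹) * (σ ^ m * σ) + σ ^ m) • A (m + n + 2) +
      (σ⁻¹ ^ m * σ⁻¹ ^ (2 : ℤ) - (σ + σ⁻¹) * (σ⁻¹ ^ m * σ⁻¹) + σ⁻¹ ^ m) • B (m + n + 2) := by module
    _ = 0 := by rw [h1, h2, zero_smul, zero_smul, add_zero]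

theorem quadDist_comp_sub {R : Type*} [Ring R] [Algebra ℂ R] (T : ℂ) (D : ℤ → ℤ → R) (k m n : ℤ) :
    quadDist T 1 1 (fun m n => D (m - k) n) m n = quadDist T 1 1 D (m - k) n := by
  simp only [quadDist]
  rw [show m + 2 - k = m - k + 2 by ring, show m + 1 - k = m - k + 1 by ring]

theorem quadDist_mul_right {R : Type*} [Ring R] [Algebra ℂ R] (T : ℂ) (D : ℤ → ℤ → R) (x : R)
    (m n : ℤ) : quadDist T 1 1 (fun m n => D m n * x) m n = quadDist T 1 1 D m n * x := by
  simp only [quadDist, one_mul, add_mul, sub_mul, smul_mul_assoc]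

theorem quadDist_mul_left {R : Type*} [Ring R] [Algebra ℂ R] (T : ℂ) (D : ℤ → ℤ → R) (x : R)
    (m n : ℤ) : quadDist T 1 1 (fun m n => x * D m n) m n = x * quadDist T 1 1 D m n := by
  simp only [quadDist, one_mul, mul_add, mul_sub, mul_smul_comm]

/-- The convolution in the first variable may be taken before or after `quadDist`. -/
theorem quadDist_locSum_right (T : ℂ) {D : ℤ → ℤ → Module.End ℂ V} {Y : ℤ → Module.End ℂ V}
    (h : ∀ m n, LocFin fun k => D (m - k) n * Y k) (m n : ℤ) :
    quadDist T 1 1 (fun m n => locSum fun k => D (m - k) n * Y k) m n =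
      locSum fun k => quadDist T 1 1 D (m - k) n * Y k := by
  rw [quadDist_locSum T h]
  congr 1
  funext k
  rw [quadDist_mul_right T (fun m n => D (m - k) n), quadDist_comp_sub]

theorem quadDist_locSum_left (T : ℂ) {D : ℤ → ℤ → Module.End ℂ V} {Y : ℤ → Module.End ℂ V}
    (h : ∀ m n, LocFin fun k => Y (m - k) * D k n) (m n : ℤ) :
    quadDist T 1 1 (fun m n => locSum fun k => Y (m - k) * D k n) m n =
      locSum fun k => Y (m - k) * quadDist T 1 1 D k n := by
  have e : ∀ m n, (locSum fun k => Y (m - k) * D k n) = locSum fun k => Y k * D (m - k) n :=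
    fun m n => by
      rw [← locSum_comp_equiv (h m n) (Equiv.subLeft m)]
      congr 1
      funext k
      rw [Equiv.subLeft_apply, sub_sub_cancel]
  have h' : ∀ m n, LocFin fun k => Y k * D (m - k) n := fun m n => by
    have := (h m n).comp (Equiv.subLeft m).injective
    simpa only [Equiv.subLeft_apply, sub_sub_cancel] using this
  have h2 : ∀ m n, LocFin fun k => Y k * quadDist T 1 1 D (m - k) n := fun m n => by
    have h3 := (((h' (m + 2) n).add ((h' (m + 1) (n + 1)).smul (-T))).add (h' m (n + 2)))
    refine (funext fun k => ?_ : (fun k => Y k * quadDist T 1 1 D (m - k) n) = _) ▸ h3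
    simp only [quadDist, one_mul]
    rw [show m + 2 - k = m - k + 2 by ring, show m + 1 - k = m - k + 1 by ring, mul_add, mul_sub,
      mul_smul_comm, neg_smul, sub_eq_add_neg]
  simp only [e]
  have e' : (fun k => quadDist T 1 1 (fun m n => Y k * D (m - k) n) m n) =
      fun k => Y k * quadDist T 1 1 D (m - k) n := funext fun k => by
    rw [quadDist_mul_left T (fun m n => D (m - k) n), quadDist_comp_sub]
  rw [quadDist_locSum T h', e', ← locSum_comp_equiv (h2 m n) (Equiv.subLeft m)]
  simp only [Equiv.subLeft_apply, sub_sub_cancel]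

/-- The exchange relation of the current `P(z) Y(z)` with `X(w)`, given that of `P(z)`. -/
theorem quadDist_locMul_right {P Y X : ℤ → Module.End ℂ V} {T T' : ℂ} (h : LocFinMul P Y)
    (hX : ∀ m n, LocFin fun k => P (m - k) * X n * Y k)
    (hPX : ∀ m n, quadDist T 1 1 (prodZW P X) m n = quadDist T' 1 1 (prodWZ X P) m n)
    (hYX : ∀ m n, quadDist T 1 1 (fun k n => Y k * X n + X n * Y k) m n = 0) (m n : ℤ) :
    quadDist T 1 1 (prodZW (locMul P Y) X) m n +
      quadDist T' 1 1 (prodWZ X (locMul P Y)) m n = 0 := by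
  have h1 : ∀ m n, LocFin fun k => P (m - k) * (Y k * X n + X n * Y k) := fun m n => by
    refine (funext fun k => ?_ : (fun k => P (m - k) * (Y k * X n + X n * Y k)) = _) ▸
      ((h m).mul_right (X n)).add (hX m n)
    rw [mul_add, mul_assoc, mul_assoc]
  have h2 : prodZW (locMul P Y) X = fun m n => (locSum fun k => P (m - k) *
      (Y k * X n + X n * Y k)) - locSum fun k => P (m - k) * X n * Y k := by
    funext m n
    rw [prodZW, locMul, locSum_mul (h m), eq_sub_iff_add_eq,
      ← locSum_add ((h m).mul_right (X n)) (hX m n)]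
    congr 1
    funext k
    rw [mul_add, mul_assoc, mul_assoc]
  have h3 : prodWZ X (locMul P Y) = fun m n => locSum fun k => X n * P (m - k) * Y k := by
    funext m n
    rw [prodWZ, locMul, mul_locSum (h m)]
    simp only [mul_assoc]
  have h4 : ∀ m n, LocFin fun k => X n * P (m - k) * Y k := fun m n => by
    simpa only [mul_assoc] using (h m).mul_left (X n)
  have e1 := quadDist_locSum_left T (D := fun k n => Y k * X n + X n * Y k) h1 m n
  have e2 := quadDist_locSum_right T (D := prodZW P X) hX m n
  have e3 := quadDist_locSum_right T' (D := prodWZ X P) h4 m n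
  simp only [hYX, mul_zero, locSum_zero] at e1
  simp only [prodZW, prodWZ] at e2 e3 hPX
  rw [h2, h3, quadDist_sub, e1, e2, e3, zero_sub, neg_add_eq_zero]
  simp only [hPX]

/-- The exchange relation of the current `Z(z) P(z)` with `X(w)`, given that of `P(z)`. -/
theorem quadDist_locMul_left {P Z X : ℤ → Module.End ℂ V} {T T' : ℂ} (h : LocFinMul Z P)
    (hX : ∀ m n, LocFin fun k => Z (m - k) * X n * P k)
    (hPX : ∀ m n, quadDist T 1 1 (prodZW P X) m n = quadDist T' 1 1 (prodWZ X P) m n)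
    (hZX : ∀ m n, quadDist T' 1 1 (fun k n => Z k * X n + X n * Z k) m n = 0) (m n : ℤ) :
    quadDist T 1 1 (prodZW (locMul Z P) X) m n +
      quadDist T' 1 1 (prodWZ X (locMul Z P)) m n = 0 := by
  have h1 : ∀ m n, LocFin fun k => (Z (m - k) * X n + X n * Z (m - k)) * P k := fun m n => by
    refine (funext fun k => ?_ : (fun k => (Z (m - k) * X n + X n * Z (m - k)) * P k) = _) ▸
      (hX m n).add ((h m).mul_left (X n))
    rw [add_mul, mul_assoc (X n)]
  have h2 : prodWZ X (locMul Z P) = fun m n => (locSum fun k =>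
      (Z (m - k) * X n + X n * Z (m - k)) * P k) - locSum fun k => Z (m - k) * (X n * P k) := by
    funext m n
    have h3 : LocFin fun k => Z (m - k) * (X n * P k) := by simpa only [mul_assoc] using hX m n
    rw [prodWZ, locMul, mul_locSum (h m), eq_sub_iff_add_eq',
      ← locSum_add h3 ((h m).mul_left (X n))]
    simp only [add_mul, mul_assoc]
  have h3 : prodZW (locMul Z P) X = fun m n => locSum fun k => Z (m - k) * (P k * X n) := by
    funext m n
    rw [prodZW, locMul, locSum_mul (h m)]
    simp only [mul_assoc]
  have h4 : ∀ m n, LocFin fun k => Z (m - k) * (P k * X n) := fun m n => by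
    simpa only [mul_assoc] using (h m).mul_right (X n)
  have e1 := quadDist_locSum_right T' (D := fun k n => Z k * X n + X n * Z k) h1 m n
  have e2 := quadDist_locSum_left T' (D := prodWZ X P) (Y := Z)
    (by simpa only [prodWZ, mul_assoc] using hX) m n
  have e3 := quadDist_locSum_left T (D := prodZW P X) h4 m n
  simp only [hZX, zero_mul, locSum_zero] at e1
  simp only [prodZW, prodWZ] at e2 e3 hPX
  rw [h2, h3, quadDist_sub, e1, e2, e3, zero_sub, ← sub_eq_add_neg, sub_eq_zero]
  simp only [hPX]

end QuadraticForms

/-! ### Quadratic relations between `E_0`, `E_1` and between `F_0`, `F_1`; relations with `K` -/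

namespace AdmRep

variable {L : Fin 3 → ℂ} (W : AdmRep L)

theorem posCurrent_C_mul {R : Type*} [Ring R] (x : R) (P : PowerSeries R) (n : ℤ) :
    posCurrent (PowerSeries.C x * P) n = x * posCurrent P n := by
  rw [posCurrent, posCurrent]
  split_ifs
  · rw [PowerSeries.coeff_C_mul]
  · rw [mul_zero]

theorem negCurrent_C_mul {R : Type*} [Ring R] (x : R) (P : PowerSeries R) (n : ℤ) :
    negCurrent (PowerSeries.C x * P) n = x * negCurrent P n := by
  rw [negCurrent_eq, posCurrent_C_mul, ← negCurrent_eq]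

theorem scalePS_neg {R : Type*} [Ring R] [Algebra ℂ R] (t : ℂ) (P : PowerSeries R) :
    scalePS t (-P) = -scalePS t P := by
  ext n
  rw [scalePS, PowerSeries.coeff_mk, map_neg, map_neg, smul_neg, scalePS, PowerSeries.coeff_mk]

theorem expP_κΨ_zero (n : ℤ) : expP (W.κΨ 0) (W.logPsiP 0) n =
    s L 0 ^ n • ((W.ops.T.psi0 : Module.End ℂ W.V) * W.invP n) := by
  have h : PowerSeries.C (W.κΨ 0 : Module.End ℂ W.V) * expSeries (W.logPsiP 0) =
      scalePS (s L 0) (PowerSeries.C (W.ops.T.psi0 : Module.End ℂ W.V) * W.serP) := by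
    rw [κΨ, pair_zero, logPsiP, pair_zero, ← scalePS_neg, serP, scalePS_mul, scalePS_mul, scalePS_C,
      scalePS_C, scalePS_expSeries, Units.val_mul, map_mul, mul_assoc]
  rw [expP, h, ← inv_inv (s L 0), ← scale_posCurrent, scale, posCurrent_C_mul, inv_zpow', neg_neg,
    inv_inv, invP_eq]

theorem expM_κΨ_zero (n : ℤ) : expM (W.κΨ 0) (W.logPsiM 0) n =
    s L 0 ^ n • (((W.ops.T.psi0⁻¹ : (Module.End ℂ W.V)ˣ) : Module.End ℂ W.V) * W.invM n) := by
  have h : PowerSeries.C (((W.κΨ 0)⁻¹ : (Module.End ℂ W.V)ˣ) : Module.End ℂ W.V) *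
      expSeries (W.logPsiM 0) = scalePS (s L 0)⁻¹ (PowerSeries.C
        ((W.ops.T.psi0⁻¹ : (Module.End ℂ W.V)ˣ) : Module.End ℂ W.V) * W.serM) := by
    rw [κΨ, pair_zero, logPsiM, pair_zero, ← scalePS_neg, serM, scalePS_mul, scalePS_mul, scalePS_C,
      scalePS_C, scalePS_expSeries, mul_inv_rev, inv_inv, Units.val_mul,
      ← W.psi0_KK.units_inv_left.eq, map_mul, mul_assoc]
  rw [expM, h, ← scale_negCurrent, scale, negCurrent_C_mul, inv_zpow', neg_neg, invM_eq]

/-- Only `(r, ř) = (0, 1)` and `(1, 0)` occur, and `A`, `B` are the corresponding products of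
currents. Of the fused currents nothing but the supports of the two delta functions is needed. -/
theorem exists_crossM {i j : ℤ} (h : i + j = -1) :
    ∃ A B : ℤ → Module.End ℂ W.V, ∀ m n, W.ops.crossM L i j m n =
      ((W.ops.T.C ^ n : (Module.End ℂ W.V)ˣ) : Module.End ℂ W.V) *
        (A (m + n) + (q L 0)⁻¹ ^ n • B (m + n)) := by
  have hc : Commute (W.ops.T.C : Module.End ℂ W.V) ((W.ops.T.psi0 ^ (-j) : (Module.End ℂ W.V)ˣ) :
      Module.End ℂ W.V) := W.C_psi0.units_zpow_right _
  refine ⟨fun k => ((W.ops.T.psi0 ^ (-j) : (Module.End ℂ W.V)ˣ) : Module.End ℂ W.V) *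
      locMul (scale 1 (W.ops.T.kM L W.ops.K 0))
        (scale ((q (check L) 0)⁻¹ * q L 0 ^ i) (W.ops.T'.kM (check L) W.ops.K' 1)) k,
    fun k => ((W.ops.T.psi0 ^ (-j) : (Module.End ℂ W.V)ˣ) : Module.End ℂ W.V) *
      locMul (scale (q L 0)⁻¹ (W.ops.T.kM L W.ops.K 1))
        (scale (1 * q L 0 ^ i) (W.ops.T'.kM (check L) W.ops.K' 0)) k,
    fun m n => ?_⟩
  rw [AData.crossM, show -i - j = 1 by omega, if_pos zero_le_one, Int.toNat_one,
    Nat.sum_antidiagonal_eq_sum_range_succ_mk, sum_range_succ, sum_range_one]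
  simp only [pow_zero, pow_one, inv_one, one_zpow, one_smul, tsub_zero, tsub_self]
  rw [← mul_smul_comm, ← mul_add, ← mul_assoc, ← (hc.units_zpow_left n).eq, mul_assoc, mul_add,
    mul_smul_comm]

theorem exists_crossP {i j : ℤ} (h : i + j = 1) :
    ∃ A B : ℤ → Module.End ℂ W.V, ∀ m n, W.ops.crossP L i j m n =
      ((W.ops.T.C ^ m : (Module.End ℂ W.V)ˣ) : Module.End ℂ W.V) *
        (A (m + n) + (q L 0)⁻¹ ^ m • B (m + n)) := by
  have hc : Commute (W.ops.T.C : Module.End ℂ W.V) ((W.ops.T.psi0 ^ (-i) : (Module.End ℂ W.V)ˣ) :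
      Module.End ℂ W.V) := W.C_psi0.units_zpow_right _
  refine ⟨fun k => ((W.ops.T.psi0 ^ (-i) : (Module.End ℂ W.V)ˣ) : Module.End ℂ W.V) *
      locMul (scale 1 (W.ops.T.kP L W.ops.K 0))
        (scale ((q (check L) 0)⁻¹ * q L 0 ^ (-j)) (W.ops.T'.kP (check L) W.ops.K' 1)) k,
    fun k => ((W.ops.T.psi0 ^ (-i) : (Module.End ℂ W.V)ˣ) : Module.End ℂ W.V) *
      locMul (scale (q L 0)⁻¹ (W.ops.T.kP L W.ops.K 1))
        (scale (1 * q L 0 ^ (-j)) (W.ops.T'.kP (check L) W.ops.K' 0)) k,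
    fun m n => ?_⟩
  rw [AData.crossP, h, if_pos zero_le_one, Int.toNat_one,
    Nat.sum_antidiagonal_eq_sum_range_succ_mk, sum_range_succ, sum_range_one]
  simp only [pow_zero, pow_one, inv_one, one_zpow, one_smul, tsub_zero, tsub_self]
  rw [← mul_smul_comm, ← mul_add, ← mul_assoc, ← (hc.units_zpow_left m).eq, mul_assoc, mul_add,
    mul_smul_comm]

/-- After rescaling by `q̄_1` the supports `1` and `q_1⁻¹` of the delta functions become `q̄_1` and
`q̄_1⁻¹`. -/
theorem s_zpow_mul (k : ℤ) : s L 0 ^ k * (q L 0)⁻¹ ^ k = (s L 0)⁻¹ ^ k := by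
  rw [← mul_zpow, ← s_sq]
  congr 1
  have := s_ne_zero (L := L)
  field_simp

/-- The relation between `E_0(z)` and `E_1(w)`. -/
theorem imE_imE (hL : Generic L) (m n : ℤ) :
    quadDist (gTrace (s L 0) (s L 0 * q L 1) 0) 1 1 (prodZW (W.imE 0) (W.imE 1)) m n +
      quadDist (gTrace (s L 0) (s L 0 * q L 1) 1) 1 1 (prodWZ (W.imE 1) (W.imE 0)) m n = 0 := by
  set P : ℤ → Module.End ℂ W.V := expM (W.κΨ 0) (W.logPsiM 0) with hP
  set Y : ℤ → Module.End ℂ W.V := fun k => s L 0 ^ k • W.curY k with hY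
  have hYf : IsField Y := fun v => by
    obtain ⟨N, hN⟩ := isField_scaleC (isField_Xm (-1)) v
    exact ⟨N, fun k hk => by simp only [hY, LinearMap.smul_apply]; rw [hN k hk, smul_zero]⟩
  have hPY : LocFinMul P Y := hYf.locFinMul_neg _
  -- Up to scaling, `E_0` is `Ψ_0⁻` times `X_{-1}^-(C z)`, so the exchange of the first factor with
  -- `E_1` is already known from `exchangeData`.
  have h0 : W.imE 0 = locMul P Y := by
    funext n
    rw [imE, pair_zero, curE, locMul, mul_locSum (W.locFinMul_curE n),
      ← locSum_smul ((W.locFinMul_curE n).mul_left _), locMul]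
    congr 1
    funext k
    rw [hP, expM_κΨ_zero]
    simp only [hY]
    rw [smul_mul_smul_comm, ← zpow_add₀ s_ne_zero, sub_add_cancel, mul_assoc]
  rw [h0]
  obtain ⟨A, B, hAB⟩ := W.exists_crossM (show (0 : ℤ) + -1 = -1 by norm_num)
  refine quadDist_locMul_right hPY (fun m n => ?_) (fun m n => ?_) (fun m n => ?_) m n
  · have := hYf.locFin_mul (A := fun k => P (m - k) * W.imE 1 n) (m := m) (fun k hk => by
      rw [hP, expM_κΨ_zero, W.invM_pos (by omega), mul_zero, smul_zero, zero_mul]) 0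
    simpa only [add_zero] using this
  · have h1 := (W.exchangeData hL).psiM_E s_ne_zero (mul_ne_zero s_ne_zero (q_ne_zero L 1)) 0 1
    rw [mulForms_gBar s_ne_zero (mul_ne_zero s_ne_zero (q_ne_zero L 1)) (by decide)
      (Commute.one_left _), mulForms_swap_gBar s_ne_zero (mul_ne_zero s_ne_zero (q_ne_zero L 1))
      (by decide) (Commute.one_left _)] at h1
    exact congrFun (congrFun h1 m) n
  -- The first sum of (R3) is empty because `i + j < 0`. The argument `C z` cancels the power of `C`
  -- in the second, which leaves two pure delta functions.
  · have h2 : (fun k n => Y k * W.imE 1 n + W.imE 1 n * Y k) = fun k n =>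
        s L 0 ^ k • (-A (k + n)) + (s L 0)⁻¹ ^ k • (-B (k + n)) := by
      funext k n
      have h3 := W.relations.cross 0 (-1) n k
      rw [hAB, AData.crossP, if_neg (by norm_num), zero_sub] at h3
      simp only [hY]
      rw [imE, pair_one, smul_mul_assoc, mul_smul_comm, ← smul_add, curY, scaleC_apply, mul_assoc,
        ← mul_assoc (W.ops.Xp 0 n), ← (commute_C_zpow (W.C_Xp 0 n) _).eq, mul_assoc, ← mul_add,
        add_comm, h3, mul_neg, ← mul_assoc, ← Units.val_mul, ← zpow_add, neg_add_cancel, zpow_zero,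
        Units.val_one, one_mul, neg_add, smul_add, add_comm n, smul_neg _ (_ • _), smul_smul,
        s_zpow_mul, smul_neg _ (B _)]
    rw [h2, gTrace, if_pos rfl]
    exact quadDist_geometric s_ne_zero (fun n => -A n) (fun n => -B n) m n

/-- The relation between `F_0(z)` and `F_1(w)`. -/
theorem imF_imF (hL : Generic L) (m n : ℤ) :
    quadDist (gTrace (s L 0) (s L 0 * q L 1) 1) 1 1 (prodZW (W.imF 0) (W.imF 1)) m n +
      quadDist (gTrace (s L 0) (s L 0 * q L 1) 0) 1 1 (prodWZ (W.imF 1) (W.imF 0)) m n = 0 := by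
  set P : ℤ → Module.End ℂ W.V := expP (W.κΨ 0) (W.logPsiP 0) with hP
  set Z : ℤ → Module.End ℂ W.V := fun k => s L 0 ^ k • W.curZ k with hZ
  have hPf : IsField P := fun v => by
    obtain ⟨N, hN⟩ := W.isField_invP v
    refine ⟨N, fun k hk => ?_⟩
    rw [hP, expP_κΨ_zero, LinearMap.smul_apply, Module.End.mul_apply, hN k hk, map_zero, smul_zero]
  have hP0 : ∀ k < 0, P k = 0 := fun k hk => by
    rw [hP, expP_κΨ_zero, W.invP_neg hk, mul_zero, smul_zero]
  have hZP : LocFinMul Z P := hPf.locFinMul_pos hP0 _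
  -- For `F_0` the factor `Ψ_0⁺` stands on the right, which is why the left-handed version of the
  -- convolution lemma is applied.
  have h0 : W.imF 0 = locMul Z P := by
    funext n
    rw [imF, pair_zero, curF, locMul, ← locSum_smul (W.locFinMul_curF n), locMul]
    congr 1
    funext k
    rw [hP, expP_κΨ_zero]
    simp only [hZ]
    rw [smul_mul_smul_comm, ← zpow_add₀ s_ne_zero, sub_add_cancel]
  rw [h0]
  obtain ⟨A, B, hAB⟩ := W.exists_crossP (show (1 : ℤ) + 0 = 1 by norm_num)
  refine quadDist_locMul_left hZP (fun m n => ?_) (fun m n => ?_) (fun m n => ?_) m n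
  · exact (hPf.locFin hP0).mul_left_fun _
  · have h1 := (W.exchangeData hL).psiP_F s_ne_zero (mul_ne_zero s_ne_zero (q_ne_zero L 1)) 0 1
    rw [mulForms_gBar s_ne_zero (mul_ne_zero s_ne_zero (q_ne_zero L 1)) (by decide)
      (Commute.one_left _), mulForms_swap_gBar s_ne_zero (mul_ne_zero s_ne_zero (q_ne_zero L 1))
      (by decide) (Commute.one_left _)] at h1
    exact congrFun (congrFun h1 m) n
  · have h2 : (fun k n => Z k * W.imF 1 n + W.imF 1 n * Z k) = fun k n =>
        s L 0 ^ k • (-A (k + n)) + (s L 0)⁻¹ ^ k • (-B (k + n)) := by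
      funext k n
      have h3 := W.relations.cross 1 0 k n
      rw [hAB, AData.crossM, if_neg (by norm_num), sub_zero] at h3
      simp only [hZ]
      rw [imF, pair_one, smul_mul_assoc, mul_smul_comm, ← smul_add, curZ, scaleC_apply, mul_assoc,
        ← mul_assoc (-W.ops.Xm 0 n), ← (commute_C_zpow (W.C_Xm 0 n).neg_right _).eq, mul_assoc,
        ← mul_add, mul_neg, neg_mul, ← neg_add,
        h3, mul_neg, ← mul_assoc, ← Units.val_mul, ← zpow_add, neg_add_cancel, zpow_zero,
        Units.val_one, one_mul, neg_add, smul_add, smul_neg _ (_ • _), smul_smul,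
        s_zpow_mul, smul_neg _ (B _)]
    rw [h2, gTrace, if_pos rfl]
    exact quadDist_geometric s_ne_zero (fun n => -A n) (fun n => -B n) m n

theorem conj_locMul {a b : ℤ → Module.End ℂ W.V} (h : LocFinMul a b) {x : Module.End ℂ W.V} {c : ℂ}
    (hab : ∀ m n, x * (a m * b n) = c • (a m * b n * x)) (n : ℤ) :
    x * locMul a b n = c • (locMul a b n * x) := by
  rw [locMul, mul_locSum (h n), locSum_mul (h n), ← locSum_smul ((h n).mul_right x)]
  simp only [hab]

theorem K_scaleC {X : ℤ → Module.End ℂ W.V} {c : ℂ}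
    (h : ∀ n, (W.ops.K : Module.End ℂ W.V) * X n = c • (X n * W.ops.K)) (n : ℤ) :
    (W.ops.K : Module.End ℂ W.V) * W.scaleC X n = c • (W.scaleC X n * W.ops.K) := by
  have hC : Commute (W.ops.T.C : Module.End ℂ W.V) W.ops.K :=
    (W.relations.K_central _ W.C_mem).symm
  rw [scaleC_apply, ← mul_assoc, ← (commute_C_zpow hC (-n)).eq, mul_assoc, h, mul_smul_comm,
    mul_assoc]

theorem K_curE (k : ℤ) : (W.ops.K : Module.End ℂ W.V) * W.curE k =
    (q2HalfBeta L)⁻¹ • (W.curE k * W.ops.K) := by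
  have hψ : Commute (W.ops.K : Module.End ℂ W.V) W.ops.T.psi0 := W.relations.K_central _ W.psi0_mem
  rw [curE, ← mul_assoc, hψ.units_inv_right.eq, mul_assoc, W.conj_locMul W.locFinMul_curE
    (c := (q2HalfBeta L)⁻¹) fun m n => ?_, mul_smul_comm, mul_assoc]
  rw [← mul_assoc, (commute_invM W.relations.K_central W.K_T' W.K_KK m).eq, mul_assoc,
    W.K_scaleC (W.relations.K_Xm _), mul_smul_comm, mul_assoc]

theorem K_curF (k : ℤ) : (W.ops.K : Module.End ℂ W.V) * W.curF k =
    q2HalfBeta L • (W.curF k * W.ops.K) := by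
  have hψ : Commute (W.ops.K : Module.End ℂ W.V) W.ops.T.psi0 := W.relations.K_central _ W.psi0_mem
  refine W.conj_locMul W.locFinMul_curF (fun m n => ?_) k
  rw [← mul_assoc, W.K_scaleC (W.relations.K_Xp _), smul_mul_assoc, mul_assoc, mul_assoc,
    (hψ.mul_right (commute_invP W.relations.K_central W.K_T' W.K_KK n)).eq]

/-- The relations of `E_{1|1}[K]` hold for the images of the generators. -/
theorem eq_of_ERel (hL : Generic L) {s2 : ℂ} (hs2 : s2 - s2⁻¹ ≠ 0) {x y : Module.End ℂ W.V}
    (h : ERel (s L 0) (s L 0 * q L 1) s2 (q2HalfBeta L) (genMap s2 W.ops.T.C W.ops.K W.κΨ W.logPsiP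
      W.logPsiM W.imE W.imF) x y) : x = y := by
  have hs := s_ne_zero (L := L)
  have n0 : W.imE 0 = fun n => s L 0 ^ n • W.curE n := rfl
  have n1 : W.imE 1 = W.ops.Xp 0 := rfl
  have m0 : W.imF 0 = fun n => s L 0 ^ n • W.curF n := rfl
  have m1 : W.imF 1 = fun n => -W.ops.Xm 0 n := rfl
  have anti : ∀ {A B : Module.End ℂ W.V} (a b : ℂ), A * B + B * A = 0 →
      (a • A) * (b • B) + (b • B) * (a • A) = 0 := fun {A B} a b h => by
    rw [smul_mul_smul_comm, smul_mul_smul_comm, mul_comm b, ← smul_add, h, smul_zero]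
  have hE01 : ∀ m n, W.imE 0 m * W.imF 1 n + W.imF 1 n * W.imE 0 m = 0 := fun m n => by
    have := anti (s L 0 ^ m) (-1) (W.curE_Xm hL m n)
    rwa [neg_one_smul] at this
  have hE10 : ∀ m n, W.imE 1 m * W.imF 0 n + W.imF 0 n * W.imE 1 m = 0 := fun m n => by
    have := anti 1 (s L 0 ^ n) (W.Xp_curF hL m n)
    rwa [one_smul] at this
  refine QTor.eq_of_ERel hs (mul_ne_zero hs (q_ne_zero L 1)) hs2 (W.exchangeData hL)
    (W.relations.K_central _ W.C_mem).symm
    (fun i => (commute_κΨ (W.relations.K_central _ W.psi0_mem).symm W.K_KK.symm i).symm)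
    (commute_logPsiP (commute_logP W.relations.K_central W.K_T'))
    (commute_logPsiM (commute_logM W.relations.K_central W.K_T'))
    (forall_zmod_two (fun m n => anti _ _ (W.curE_curE hL m n)) fun m n => ?_)
    (forall_zmod_two (fun m n => anti _ _ (W.curF_curF hL m n)) fun m n => ?_)
    (W.imE_imE hL) (W.imF_imF hL) (forall_zmod_two (fun m n => ?_) fun m n => ?_)
    (forall_zmod_two (forall_zmod_two (fun _ _ h => absurd rfl h) fun m n _ => hE01 m n)
      (forall_zmod_two (fun m n _ => hE10 m n) fun _ _ h => absurd rfl h))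
    (fun k => ?_) (fun k => ?_) (W.relations.K_Xp 0) (fun k => ?_) h
  · rw [n1, W.relations.quadP.diag, neg_add_cancel]
  · rw [m1, neg_mul_neg, neg_mul_neg, W.relations.quadM.diag, neg_add_cancel]
  -- The total power `s_1^{m+n}` is the one by which `Ψ_0^±` at index `m + n` differs from the
  -- dressing currents.
  · rw [n0, m0, smul_mul_smul_comm, smul_mul_smul_comm, mul_comm (s L 0 ^ n), ← smul_add,
      W.curE_curF hL, expP_κΨ_zero, expM_κΨ_zero, ← zpow_add₀ hs, mul_smul_comm, mul_smul_comm,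
      ← smul_sub, smul_neg]
  · have h1 := W.Xp_Xm_zero m n
    rw [kkP_eq, kkM_eq] at h1
    rw [n1, m1, mul_neg, neg_mul, ← neg_add, h1]
    rfl
  · rw [n0, mul_smul_comm, K_curE, smul_comm, smul_mul_assoc]
  · rw [m0, mul_smul_comm, K_curF, smul_comm, smul_mul_assoc]
  · rw [m1, mul_neg, W.relations.K_Xm, neg_mul, smul_neg]

end AdmRep

end

/-! ### Membership in the completion, and the homomorphism -/

section

variable {L : Fin 3 → ℂ}

theorem op_mem_Ahat (a : AGen) : (fun W : AdmRep L => W.ops.op a) ∈ Ahat L := fun _ =>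
  ⟨_, Algebra.subset_adjoin ⟨a, rfl⟩, fun _ _ => rfl⟩

/-- A locally finite sum of elements of `Â_{0,0}` belongs to `Â_{0,0}`. -/
theorem locSum_mem_Ahat {ι : Type*} {T : ι → OpFamily L} (hT : ∀ r, T r ∈ Ahat L)
    (h : ∀ W, LocFin fun r => T r W) : (fun W => locSum fun r => T r W) ∈ Ahat L := fun S => by
  classical
  -- For finitely many test vectors only the indices in the union of the supports matter, so a
  -- finite partial sum gives the same values, and it already belongs to the algebra.
  let J : Finset ι := S.biUnion fun p => (h p.1 p.2).toFinset
  obtain ⟨x, hx, hx'⟩ := sum_mem (fun r (_ : r ∈ J) => hT r) S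
  refine ⟨x, hx, fun p hp => ?_⟩
  rw [← hx' p hp, locSum_apply (h p.1), Finset.sum_apply, LinearMap.sum_apply]
  refine finsum_eq_sum_of_support_subset _ fun r hr => ?_
  exact mem_coe.2 (mem_biUnion.2 ⟨p, hp, (Set.Finite.mem_toFinset _).2 hr⟩)

theorem zpow_mem_Ahat {u : ∀ W : AdmRep L, (Module.End ℂ W.V)ˣ}
    (h : (fun W : AdmRep L => (u W : Module.End ℂ W.V)) ∈ Ahat L)
    (h' : (fun W : AdmRep L => (((u W)⁻¹ : (Module.End ℂ W.V)ˣ) : Module.End ℂ W.V)) ∈ Ahat L) :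
    ∀ k : ℤ, (fun W : AdmRep L => ((u W ^ k : (Module.End ℂ W.V)ˣ) : Module.End ℂ W.V)) ∈ Ahat L
  | .ofNat n => by
    convert pow_mem h n using 1
    funext W
    simp
  | .negSucc n => by
    convert pow_mem h' (n + 1) using 1
    funext W
    rw [zpow_negSucc, ← inv_pow, Units.val_pow_eq_pow_val, Pi.pow_apply]

/-- Power series of operators on all admissible representations, with coefficients in
`Â_{0,0}`. -/
def CoeffsIn (P : ∀ W : AdmRep L, PowerSeries (Module.End ℂ W.V)) : Prop :=
  ∀ k, (fun W => PowerSeries.coeff k (P W)) ∈ Ahat L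

namespace CoeffsIn

variable {P Q : ∀ W : AdmRep L, PowerSeries (Module.End ℂ W.V)}

theorem neg (hP : CoeffsIn P) : CoeffsIn fun W => -P W := fun k => by
  simp only [map_neg]
  exact neg_mem (hP k)

theorem mul (hP : CoeffsIn P) (hQ : CoeffsIn Q) : CoeffsIn fun W => P W * Q W := fun k => by
  convert sum_mem fun (x : ℕ × ℕ) (_ : x ∈ antidiagonal k) => mul_mem (hP x.1) (hQ x.2) using 1
  funext W
  rw [PowerSeries.coeff_mul, Finset.sum_apply]
  rfl

theorem const {a : OpFamily L} (ha : a ∈ Ahat L) : CoeffsIn fun W => PowerSeries.C (a W) :=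
  fun k => by
    simp only [PowerSeries.coeff_C]
    split_ifs
    · exact ha
    · exact zero_mem _

theorem pow (hP : CoeffsIn P) : ∀ n : ℕ, CoeffsIn fun W => P W ^ n
  | 0 => by simpa only [pow_zero, Pi.one_apply, map_one] using const (one_mem (Ahat L))
  | n + 1 => by simpa only [pow_succ] using (hP.pow n).mul hP

theorem scalePS (hP : CoeffsIn P) (t : ℂ) : CoeffsIn fun W => QTor.scalePS t (P W) := fun k => by
  simp only [QTor.scalePS, PowerSeries.coeff_mk]
  exact (Ahat L).smul_mem (hP k) _

theorem expSeries (hP : CoeffsIn P) : CoeffsIn fun W => QTor.expSeries (P W) := fun k => by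
  convert sum_mem fun (n : ℕ) (_ : n ∈ range (k + 1)) =>
    (Ahat L).smul_mem (hP.pow n k) ((n.factorial : ℂ)⁻¹) using 1
  funext W
  change PowerSeries.coeff k (PowerSeries.mk _) = _
  rw [PowerSeries.coeff_mk, Finset.sum_apply]
  rfl

theorem posCurrent (hP : CoeffsIn P) (k : ℤ) : (fun W => QTor.posCurrent (P W) k) ∈ Ahat L := by
  simp only [QTor.posCurrent]
  split_ifs
  · exact hP _
  · exact zero_mem _

theorem negCurrent (hP : CoeffsIn P) (k : ℤ) : (fun W => QTor.negCurrent (P W) k) ∈ Ahat L := by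
  simp only [QTor.negCurrent]
  split_ifs
  · exact hP _
  · exact zero_mem _

end CoeffsIn

namespace AdmRep

theorem KK_mem : (fun W : AdmRep L => (W.KK : Module.End ℂ W.V)) ∈ Ahat L :=
  mul_mem (op_mem_Ahat .K) (op_mem_Ahat .K')

theorem KK_inv_mem :
    (fun W : AdmRep L => ((W.KK⁻¹ : (Module.End ℂ W.V)ˣ) : Module.End ℂ W.V)) ∈ Ahat L := by
  simp only [KK, mul_inv_rev]
  exact mul_mem (op_mem_Ahat .K'inv) (op_mem_Ahat .Kinv)

theorem coeffsIn_logP (t : ℂ) : CoeffsIn fun W : AdmRep L => W.logP t := fun k => by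
  simp only [logP, kkLogP, GL1Data.psiLogP, PowerSeries.coeff_mk]
  refine add_mem ((Ahat L).smul_mem ?_ _) ((Ahat L).smul_mem ?_ _) <;> split_ifs
  exacts [zero_mem _, (Ahat L).smul_mem (op_mem_Ahat (.h k)) _, zero_mem _,
    (Ahat L).smul_mem (op_mem_Ahat (.h' k)) _]

theorem coeffsIn_logM (t : ℂ) : CoeffsIn fun W : AdmRep L => W.logM t := fun k => by
  simp only [logM, kkLogM, GL1Data.psiLogM, PowerSeries.coeff_mk]
  refine add_mem ((Ahat L).smul_mem ?_ _) ((Ahat L).smul_mem ?_ _) <;> split_ifs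
  exacts [zero_mem _, (Ahat L).smul_mem (op_mem_Ahat (.h (-k))) _, zero_mem _,
    (Ahat L).smul_mem (op_mem_Ahat (.h' (-k))) _]

theorem coeffsIn_logPsiP : ∀ i, CoeffsIn fun W : AdmRep L => W.logPsiP i :=
  forall_zmod_two ((coeffsIn_logP _).scalePS _).neg (coeffsIn_logP 1)

theorem coeffsIn_logPsiM : ∀ i, CoeffsIn fun W : AdmRep L => W.logPsiM i :=
  forall_zmod_two ((coeffsIn_logM _).scalePS _).neg (coeffsIn_logM 1)

theorem invP_mem (n : ℤ) : (fun W : AdmRep L => W.invP n) ∈ Ahat L := by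
  simp only [invP_eq, serP]
  exact ((CoeffsIn.const KK_inv_mem).mul (coeffsIn_logP _).neg.expSeries).posCurrent n

theorem invM_mem (n : ℤ) : (fun W : AdmRep L => W.invM n) ∈ Ahat L := by
  simp only [invM_eq, serM]
  exact ((CoeffsIn.const KK_mem).mul (coeffsIn_logM _).neg.expSeries).negCurrent n

theorem curE_mem (n : ℤ) : (fun W : AdmRep L => W.curE n) ∈ Ahat L :=
  mul_mem (op_mem_Ahat .psi0inv) (locSum_mem_Ahat
    (T := fun (k : ℤ) (W : AdmRep L) => W.invM (n - k) * W.scaleC (W.ops.Xm (-1)) k)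
    (fun k => mul_mem (invM_mem _) (mul_mem
      (zpow_mem_Ahat (op_mem_Ahat .C) (op_mem_Ahat .Cinv) _) (op_mem_Ahat (.Xm (-1) k))))
    fun W => W.locFinMul_curE n)

theorem curF_mem (n : ℤ) : (fun W : AdmRep L => W.curF n) ∈ Ahat L :=
  locSum_mem_Ahat
    (T := fun (k : ℤ) (W : AdmRep L) => W.scaleC (W.ops.Xp 1) (n - k) *
      (W.ops.T.psi0 * W.invP k))
    (fun k => mul_mem (mul_mem (zpow_mem_Ahat (op_mem_Ahat .C) (op_mem_Ahat .Cinv) _)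
      (op_mem_Ahat (.Xp 1 (n - k)))) (mul_mem (op_mem_Ahat .psi0) (invP_mem k)))
    fun W => W.locFinMul_curF n

/-- The operators by which the generators of `E_{1|1}[K]` act. -/
def genImage (W : AdmRep L) (s2 : ℂ) : EGen → Module.End ℂ W.V :=
  genMap s2 W.ops.T.C W.ops.K W.κΨ W.logPsiP W.logPsiM W.imE W.imF

theorem genImage_mem (s2 : ℂ) : ∀ a, (fun W : AdmRep L => W.genImage s2 a) ∈ Ahat L
  | .E i k => forall_zmod_two (P := fun i => (fun W : AdmRep L => W.imE i k) ∈ Ahat L)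
      ((Ahat L).smul_mem (curE_mem k) _) (op_mem_Ahat (.Xp 0 k)) i
  | .F i k => forall_zmod_two (P := fun i => (fun W : AdmRep L => W.imF i k) ∈ Ahat L)
      ((Ahat L).smul_mem (curF_mem k) _) (neg_mem (op_mem_Ahat (.Xm 0 k))) i
  | .H i r _ => by
    simp only [genImage, genMap]
    refine (Ahat L).smul_mem ?_ _
    split_ifs
    · exact coeffsIn_logPsiP i _
    · exact neg_mem (coeffsIn_logPsiM i _)
  | .psi0 i => forall_zmod_two
      (P := fun i => (fun W : AdmRep L => (W.κΨ i : Module.End ℂ W.V)) ∈ Ahat L)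
      (mul_mem (op_mem_Ahat .psi0) KK_inv_mem) KK_mem i
  | .psi0inv i => forall_zmod_two
      (P := fun i => (fun W : AdmRep L =>
        (((W.κΨ i)⁻¹ : (Module.End ℂ W.V)ˣ) : Module.End ℂ W.V)) ∈ Ahat L)
      (by
        simp only [κΨ, pair_zero, mul_inv_rev, inv_inv, Units.val_mul]
        exact mul_mem KK_mem (op_mem_Ahat .psi0inv)) KK_inv_mem i
  | .C => op_mem_Ahat .C
  | .Cinv => op_mem_Ahat .Cinv
  | .K => op_mem_Ahat .K
  | .Kinv => op_mem_Ahat .Kinv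

end AdmRep

/-- The homomorphism `E_{1|1}[K] → Â_{0,0}`. -/
def toAhat (hL : Generic L) {s2 : ℂ} (hs2 : s2 - s2⁻¹ ≠ 0) :
    E11K (s L 0) (s L 0 * q L 1) s2 (q2HalfBeta L) →ₐ[ℂ] Ahat L :=
  RingQuot.liftAlgHom ℂ ⟨FreeAlgebra.lift ℂ fun a => ⟨_, AdmRep.genImage_mem s2 a⟩,
    fun {x y} h => Subtype.ext <| funext fun W => by
      -- An element of `Ahat` is determined by its action on all representations. The relation is
      -- therefore pushed to the operators on `W`, where `AdmRep.eq_of_ERel` applies.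
      have h1 := h.map (W.act.comp (FreeAlgebra.lift ℂ fun a => (⟨_, AdmRep.genImage_mem s2 a⟩ : Ahat L)))
      refine W.eq_of_ERel hL hs2 ?_
      simp only [AlgHom.comp_apply, FreeAlgebra.lift_ι_apply] at h1
      exact h1⟩

theorem act_toAhat_gen (hL : Generic L) {s2 : ℂ} (hs2 : s2 - s2⁻¹ ≠ 0) (W : AdmRep L) (a : EGen) :
    W.act (toAhat hL hs2 (E11K.gen _ _ _ _ a)) = W.genImage s2 a := by
  rw [toAhat, E11K.gen, RingQuot.liftAlgHom_mkAlgHom_apply, FreeAlgebra.lift_ι_apply]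
  rfl

end

end

end QTor

theorem mainTheorem7 (L : Fin 3 → ℂ) (hsum : L 0 + L 1 + L 2 = 0)
    (hgen : ∀ a b : ℤ, QTor.q L 0 ^ a * QTor.q L 1 ^ b = 1 → a = 0 ∧ b = 0)
    (p1 p2 s2 : ℂ) (hp1 : p1 = QTor.s L 0) (hp2 : p2 = QTor.s L 0 * QTor.q L 1)
    (hs2 : s2 ^ 2 = p2) :
    ∃ φ : QTor.E11K p1 p2 s2 (QTor.q2HalfBeta L) →ₐ[ℂ] QTor.Ahat L,
      ∀ (G : QTor.EGen → QTor.E11K p1 p2 s2 (QTor.q2HalfBeta L)),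
        G = QTor.E11K.gen p1 p2 s2 (QTor.q2HalfBeta L) → ∀ W : QTor.AdmRep L,
        W.act (φ (G .C)) = W.ops.T.C ∧
        W.act (φ (G .K)) = W.ops.K ∧
        ∀ k : ℤ,
          W.act (φ (QTor.PsiP s2 G 1 k)) = QTor.posCurrent (W.kkP 1) k ∧
          W.act (φ (QTor.PsiM s2 G 1 k)) = QTor.negCurrent (W.kkM 1) k ∧
          W.act (φ (QTor.scale p1 (QTor.PsiP s2 G 0) k)) =
            W.ops.T.psi0 * QTor.posCurrent (Ring.inverse (W.kkP (QTor.q L 0))) k ∧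
          W.act (φ (QTor.scale p1 (QTor.PsiM s2 G 0) k)) =
            (W.ops.T.psi0⁻¹ : (Module.End ℂ W.V)ˣ) *
              QTor.negCurrent (Ring.inverse (W.kkM (QTor.q L 0))) k ∧
          W.act (φ (QTor.Ecur G 1 k)) = W.ops.Xp 0 k ∧
          W.act (φ (QTor.scale p1 (QTor.Ecur G 0) k)) =
            (W.ops.T.psi0⁻¹ : (Module.End ℂ W.V)ˣ) *
              QTor.locMul (QTor.negCurrent (Ring.inverse (W.kkM (QTor.q L 0))))
                (W.scaleC (W.ops.Xm (-1))) k ∧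
          W.act (φ (QTor.Fcur G 1 k)) = -W.ops.Xm 0 k ∧
          W.act (φ (QTor.scale p1 (QTor.Fcur G 0) k)) =
            QTor.locMul (W.scaleC (W.ops.Xp 1))
              (fun n => W.ops.T.psi0 *
                QTor.posCurrent (Ring.inverse (W.kkP (QTor.q L 0))) n) k := by
  have hL : QTor.Generic L := ⟨hsum, hgen⟩
  subst hp1 hp2
  -- Otherwise `q̄_2 = s2 ^ 2 = 1`, and squaring gives `q_1 q_2² = 1`, against genericity. The
  -- argument does not depend on the choice of the root `s2`.
  have hs2' : s2 - s2⁻¹ ≠ 0 := fun h => by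
    have hp : QTor.s L 0 * QTor.q L 1 ≠ 0 :=
      mul_ne_zero QTor.s_ne_zero (QTor.q_ne_zero L 1)
    have h0 : s2 ≠ 0 := fun h0 => hp (by rw [← hs2, h0, zero_pow two_ne_zero])
    have h1 : s2 ^ 2 = 1 := by
      rw [sq]
      nth_rewrite 2 [sub_eq_zero.1 h]
      exact mul_inv_cancel₀ h0
    have h2 := hgen 1 2 (by
      rw [zpow_one, ← QTor.s_sq, zpow_ofNat, ← mul_pow, ← hs2, h1, one_pow])
    exact one_ne_zero h2.1
  refine ⟨QTor.toAhat hL hs2', ?_⟩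
  rintro G rfl W
  set f : QTor.E11K (QTor.s L 0) (QTor.s L 0 * QTor.q L 1) s2 (QTor.q2HalfBeta L) →ₐ[ℂ]
    Module.End ℂ W.V := W.act.comp (QTor.toAhat hL hs2') with hf
  have hgen : (fun a => f (QTor.E11K.gen _ _ _ _ a)) = W.genImage s2 :=
    funext fun a => QTor.act_toAhat_gen hL hs2' W a
  have hP : ∀ i k, f (QTor.PsiP s2 (QTor.E11K.gen _ _ _ _) i k) =
      QTor.expP (W.κΨ i) (W.logPsiP i) k := fun i k => by
    rw [QTor.map_PsiP, hgen, QTor.AdmRep.genImage, QTor.PsiP_genMap hs2' ((W.exchangeData hL).A_zero i)]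
  have hM : ∀ i k, f (QTor.PsiM s2 (QTor.E11K.gen _ _ _ _) i k) =
      QTor.expM (W.κΨ i) (W.logPsiM i) k := fun i k => by
    rw [QTor.map_PsiM, hgen, QTor.AdmRep.genImage, QTor.PsiM_genMap hs2' ((W.exchangeData hL).A'_zero i)]
  have hs : ∀ (k : ℤ) (x : Module.End ℂ W.V),
      QTor.s L 0 ^ (-k) • QTor.s L 0 ^ k • x = x := fun k x => by
    rw [smul_smul, ← zpow_add₀ QTor.s_ne_zero, neg_add_cancel, zpow_zero, one_smul]
  have hE : ∀ i k, f (QTor.Ecur (QTor.E11K.gen _ _ _ _) i k) = W.imE i k := fun i k =>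
    congrFun hgen (.E i k)
  have hF : ∀ i k, f (QTor.Fcur (QTor.E11K.gen _ _ _ _) i k) = W.imF i k := fun i k =>
    congrFun hgen (.F i k)
  refine ⟨congrFun hgen .C, congrFun hgen .K, fun k => ⟨?_, ?_, ?_, ?_, ?_, ?_, ?_, ?_⟩⟩
  · exact (hP 1 k).trans (by rw [W.kkP_eq]; rfl)
  · exact (hM 1 k).trans (by rw [W.kkM_eq]; rfl)
  -- The rescaling `z ↦ q̄_1 z` undoes the power `s_1^k` built into the images with index `0`, here
  -- and in the other three scaled components.
  · refine (map_smul f _ _).trans ?_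
    rw [hP, W.expP_κΨ_zero, hs, W.inverse_kkP, W.invP_eq]
  · refine (map_smul f _ _).trans ?_
    rw [hM, W.expM_κΨ_zero, hs, W.inverse_kkM, W.invM_eq]
  · exact hE 1 k
  · refine (map_smul f _ _).trans ?_
    rw [hE, W.inverse_kkM, ← W.invM_eq]
    exact hs k _
  · exact hF 1 k
  · refine (map_smul f _ _).trans ?_
    rw [hF, W.inverse_kkP, ← W.invP_eq]
    exact hs k _
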